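/- Let $H$ be a separable infinite-dimensional real Hilbert space (for instance $L^2[0,1]$), let $X$ be an $H$-valued random element with $\mathbb E\|X\|^2<\infty$ and $Y$ a random variable with values in $\{1,\dots,G\}$, $\pi_g=\mathbb P(Y=g)>0$, and let $(X_1,Y_1),(X_2,Y_2),\dots$ be i.i.d. copies of $(X,Y)$. For each group $g$ let $\mu_g$ and $\Sigma_g$ be the mean and the covariance operator of $X$ given $Y=g$, and let $(\xi_{g,j})_{j\ge1}$ be an orthonormal basis of $H$ with $\Sigma_g\xi_{g,j}=\lambda_{g,j}\xi_{g,j}$ and $\lambda_{g,1}\ge\lambda_{g,2}\ge\cdots$. Write $\theta_{g,j}(x)=\langle x-\mu_g,\xi_{g,j}\rangle$. Assume for every $g$: (i) for every $d$, the law of $(\theta_{g,1}(X),\dots,\theta_{g,d}(X))$ given $Y=g$ has a strictly positive, twice continuously differentiable density $f_{g,d}$ on $\mathbb R^d$; write $f_d(x|g)=f_{g,d}(\theta_{g,1}(x),\dots,\theta_{g,d}(x))$; (ii) for almost every $x$ with respect to the law of $X$ given $Y=g$ there are $C>0$ and $\rho>0$ such that for all $d$, all $i,j\le d$ and all $\vartheta\in\mathbb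 R^d$ with $\sum_{k\le d}(\vartheta_k-\theta_{g,k}(x))^2\le\rho^2$, $$\frac{\sqrt{\lambda_{g,i}\lambda_{g,j}}}{|f_{g,d}(\vartheta)|}\left|\frac{\partial^2 f_{g,d}(\vartheta)}{\partial\vartheta_i\,\partial\vartheta_j}\right|\le C;$$ (iii) there is $C>0$ such that $\lambda_{g,d}^{-1}\sum_{j\ge d+1}\lambda_{g,j}<C$ for all $d\ge1$. Let $\gamma(x,d)=\arg\max_{g}\pi_g f_d(x|g)$ (the set of maximizers), and assume (iv) there is $d^*\ge1$ such that, for almost every $x$ with respect to the law of $X$, $\gamma(x,d)=\gamma(x,d^*)$ for all $d\ge d^*$. Fix $d\ge d^*$ with $\lambda_{g,d}>\lambda_{g,d+1}$ for every $g$. Let $K:[0,\infty)\to[0,\infty)$ be Lipschitz, vanish outside $[0,1]$ and satisfy $\int_0^1K>0$. Let $H_g=h_{g,n}I$ ($d\times d$) with $h_{g,n}>0$, $h_{g,n}\to0$ and $n\,\det(H_g)^{1/2}=n\,h_{g,n}^{d/2}\to\infty$ as $n\to\infty$, and put $K_{H_g}(u)=\det(H_g)^{-1/2}K(u/\sqrt{h_{g,n}})$.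 With $n_g=\#\{i\le n:Y_i=g\}$, $\widehat\pi_g=n_g/n$, and $\widehat\Pi_{g,d}$ the orthogonal projection onto the span of a choice of the first $d$ eigenvectors of the sample covariance operator of the observations of group $g$, let $$\widehat\gamma_n(x,d)\in\arg\max_{g}\ \frac{\widehat\pi_g}{n_g}\sum_{i=1}^n\mathbb I_{\{Y_i=g\}}\,K_{H_g}\big(\|\widehat\Pi_{g,d}(X_i-x)\|\big)$$ (a score with $n_g=0$ is $0$), the choice being jointly measurable in $x$ and the sample. Let $L_n=\mathbb P(\widehat\gamma_n(X,d)\ne Y\mid(X_1,Y_1),\dots,(X_n,Y_n))$, with $(X,Y)$ independent of the sample, and $L^\star=\min_\gamma\mathbb P(\gamma(X)\ne Y)$ over all measurable $\gamma:H\to\{1,\dots,G\}$. Then $L_n\to L^\star$ in probability as $n\to\infty$. -/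

import Mathlib

open MeasureTheory ProbabilityTheory Filter Topology

noncomputable section

namespace KernelClassifier

variable {H : Type*} [NormedAddCommGroup H] [InnerProductSpace ℝ H]

/-! ### Population objects -/

/-- The set of indices at which a score attains its maximum. -/
def argmaxSet {G : ℕ} (s : Fin G → ℝ) : Set (Fin G) :=
  {g | ∀ g', s g' ≤ s g}

/-- The law of `X` given `Y = g`. -/
def groupLaw {Ω : Type*} [MeasurableSpace Ω] [MeasurableSpace H] {G : ℕ}
    (P : Measure Ω) (X : Ω → H) (Y : Ω → Fin G) (g : Fin G) : Measure H :=
  (P[|Y ⁻¹' {g}]).map X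

/-- Mean of a law on `H`. -/
def meanVec [MeasurableSpace H] (ν : Measure H) : H :=
  ∫ x, x ∂ν

/-- Covariance operator of a law on `H`: `v ↦ E[⟨X - μ, v⟩ (X - μ)]`. -/
def covOp [MeasurableSpace H] (ν : Measure H) (v : H) : H :=
  ∫ x, inner ℝ (x - meanVec ν) v • (x - meanVec ν) ∂ν

/-- The first `d` principal components of the point `x` for the law `ν`, relative to the
orthonormal basis `ξ`: the numbers `⟨x - μ, ξ j⟩`, `j < d`. -/
def pcs [MeasurableSpace H] (ν : Measure H) (ξ : HilbertBasis ℕ ℝ H) (d : ℕ) (x : H) :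
    Fin d → ℝ :=
  fun j => inner ℝ (x - meanVec ν) (ξ j)

/-- The second partial derivative `∂² f / ∂ϑ_i ∂ϑ_j` at `ϑ`. -/
def secondPartial {d : ℕ} (f : (Fin d → ℝ) → ℝ) (i j : Fin d) (ϑ : Fin d → ℝ) : ℝ :=
  fderiv ℝ (fun y => fderiv ℝ f y (Pi.single j 1)) ϑ (Pi.single i 1)

/-- `ξ` is a Karhunen-Loève basis of the law `ν`: an orthonormal basis of eigenvectors of its
covariance operator, the eigenvalues `lam` being listed in decreasing order. -/
structure IsKLBasis [MeasurableSpace H] (ν : Measure H) (ξ : HilbertBasis ℕ ℝ H)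
    (lam : ℕ → ℝ) : Prop where
  antitone : Antitone lam
  eigen : ∀ j, covOp ν (ξ j) = lam j • ξ j

/-- The regularity conditions on one group law `ν`, with Karhunen-Loève basis `ξ`, eigenvalues
`lam`, and `f d` the joint density of the first `d` principal components. -/
structure IsRegularLaw [MeasurableSpace H] (ν : Measure H) (ξ : HilbertBasis ℕ ℝ H)
    (lam : ℕ → ℝ) (f : (d : ℕ) → (Fin d → ℝ) → ℝ) : Prop where
  /-- `f d` is the joint density of the first `d` principal components -/
  density : ∀ d, ν.map (pcs ν ξ d) = volume.withDensity (fun t => ENNReal.ofReal (f d t))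
  pos : ∀ d t, 0 < f d t
  smooth : ∀ d, ContDiff ℝ 2 (f d)
  /-- relative second derivatives are bounded near the point, uniformly in the dimension -/
  secondDeriv : ∀ᵐ x ∂ν, ∃ C > 0, ∃ ρ > 0, ∀ (d : ℕ) (i j : Fin d) (ϑ : Fin d → ℝ),
    ∑ k, (ϑ k - pcs ν ξ d x k) ^ 2 ≤ ρ ^ 2 →
      √(lam i * lam j) / |f d ϑ| * |secondPartial (f d) i j ϑ| ≤ C
  /-- exponential decay of the spectrum -/
  decay : ∃ C > 0, ∀ d, (lam d)⁻¹ * ∑' j, lam (d + 1 + j) < C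

/-- The set of maximizers of `g ↦ π_g f_d(x | g)`; `ν g` is the law of group `g`. -/
def surrogateBayes [MeasurableSpace H] {G : ℕ} (w : Fin G → ℝ) (ν : Fin G → Measure H)
    (ξ : Fin G → HilbertBasis ℕ ℝ H) (f : Fin G → (d : ℕ) → (Fin d → ℝ) → ℝ)
    (d : ℕ) (x : H) : Set (Fin G) :=
  argmaxSet fun g => w g * f g d (pcs (ν g) (ξ g) d x)

/-- The Bayes probability of error `L* = min_γ P(γ(X) ≠ Y)`, over all measurable rules. -/
def bayesError {Ω : Type*} [MeasurableSpace Ω] [MeasurableSpace H] {G : ℕ}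
    (P : Measure Ω) (X : Ω → H) (Y : Ω → Fin G) : ℝ :=
  ⨅ γ : {γ : H → Fin G // Measurable γ}, P.real {ω | γ.1 (X ω) ≠ Y ω}

/-! ### Sample objects; a sample of size `n` is `s : Fin n → H × Fin G` -/

/-- Number of observations in group `g`. -/
def groupCount {G n : ℕ} (s : Fin n → H × Fin G) (g : Fin G) : ℝ :=
  ∑ i, if (s i).2 = g then 1 else 0

/-- Sample mean of group `g`. -/
def groupMean {G n : ℕ} (s : Fin n → H × Fin G) (g : Fin G) : H :=
  (groupCount s g)⁻¹ • ∑ i, if (s i).2 = g then (s i).1 else 0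

/-- Sample covariance operator of group `g`. -/
def groupCov {G n : ℕ} (s : Fin n → H × Fin G) (g : Fin G) (v : H) : H :=
  (groupCount s g)⁻¹ • ∑ i, if (s i).2 = g then
    inner ℝ ((s i).1 - groupMean s g) v • ((s i).1 - groupMean s g) else 0

/-- `e` is a choice of the first `d` eigenvectors of the operator `A`: orthonormal, with
decreasing eigenvalues, and every further eigenvalue is at most each of those. -/
def IsLeadingEigensystem {d : ℕ} (A : H → H) (e : Fin d → H) : Prop :=
  Orthonormal ℝ e ∧ ∃ l : Fin d → ℝ, Antitone l ∧ (∀ j, A (e j) = l j • e j) ∧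
    ∀ (v : H) (c : ℝ), v ≠ 0 → (∀ j, inner ℝ (e j) v = 0) → A v = c • v → ∀ j, c ≤ l j

/-- The orthogonal projection `v ↦ ∑ j, ⟨e j, v⟩ e j` onto the span of an orthonormal family. -/
def proj {d : ℕ} (e : Fin d → H) (v : H) : H :=
  ∑ j, inner ℝ (e j) v • e j

/-- `K_H(u) = det(H)^{-1/2} K(H^{-1/2} u)` for the `d × d` bandwidth matrix `H = h I`. -/
def scaledKernel (K : ℝ → ℝ) (d : ℕ) (h : ℝ) (u : ℝ) : ℝ :=
  (√(h ^ d))⁻¹ * K (u / √h)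

/-- A kernel on `[0, ∞)`: a nonnegative Lipschitz function supported in `[0, 1]` with positive
integral. -/
structure IsKernel (K : ℝ → ℝ) : Prop where
  nonneg : ∀ u, 0 ≤ K u
  lipschitz : ∃ L, LipschitzOnWith L K (Set.Ici 0)
  support : ∀ u, 1 < u → K u = 0
  pos : 0 < ∫ u in Set.Icc (0 : ℝ) 1, K u

/-- The score of group `g` at `x`: `(π̂_g / n_g) ∑_i 1{Y_i = g} K_{h I}(‖Π̂ (X_i - x)‖)`, where
`Π̂` projects onto the span of `e`. -/
def groupScore {G n d : ℕ} (K : ℝ → ℝ) (h : ℝ) (e : Fin d → H) (s : Fin n → H × Fin G)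
    (g : Fin G) (x : H) : ℝ :=
  (groupCount s g / n) / groupCount s g *
    ∑ i, (if (s i).2 = g then 1 else 0) * scaledKernel K d h ‖proj e ((s i).1 - x)‖

/-- The probability that the rule `c` misclassifies an independent copy of `(X, Y)`. -/
def errorProb {Ω : Type*} [MeasurableSpace Ω] {G : ℕ}
    (P : Measure Ω) (X : Ω → H) (Y : Ω → Fin G) (c : H → Fin G) : ℝ :=
  P.real {ω | c (X ω) ≠ Y ω}

end KernelClassifier

end

open MeasureTheory ProbabilityTheory Filter Topology

noncomputable section

namespace KernelClassifier

variable {H : Type*} [NormedAddCommGroup H] [InnerProductSpace ℝ H]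

/-! ### Coordinates with respect to a finite orthonormal family -/

/-! Two facts are combined: every measurable selection from the surrogate Bayes set in dimension `d`
is Bayes optimal, and the plug-in rule selects from this set with probability tending to one. The
excess risk is at most the probability of leaving the set (`errorProb_le_bayesError_add`), so it is
enough that the mean of that probability over the samples vanishes.

Both facts rest on local quasi-invariance. By a one-dimensional Harnack argument, the relative bound
on the second derivatives bounds each partial derivative of `log f_D` near almost every point, with
a constant that depends on the direction but not on the dimension `D`. Hence near almost every point
the group law is distorted by at most `exp (L * ‖v‖)` under translations `v` along finitely many
basis vectors (`mem_tamePts_of_secondDeriv`). Averaging over such translations shows that the images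
of the law, cut to a compact set of tame points, under a surjection onto a finite-dimensional space
have bounded densities, uniformly over nearby surjections (`exists_density_bound`). Conversely, near
a tame point of the support such an image charges every set that Lebesgue measure charges there
(`measure_preimage_inter_ball_pos`).

Optimality. The functions `f_D(x|g)` of two groups are densities of projections onto different
subspaces, so their ratio is not a likelihood ratio. The singular value decomposition of the cross
Gram operator provides an isometry between the two coordinate spaces, realized by a linear map `T D`
of `H` that tends to the identity uniformly on compact sets (`exists_coord_isometry`). The density
inequality, used at `T D x`, is integrated and transported by the isometry; letting `D` tend to
infinity compares the measures themselves (`measure_le_of_density_le`). The inequality is known only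
almost everywhere, and quasi-invariance together with continuity of the densities carries it to the
points `T D x`. On the set where `g` maximizes the surrogate this gives `π_g' ν_g' ≤ π_g ν_g`, which
is Bayes optimality.

Convergence of the scores. The estimated projection depends on all the observations. By a
Davis-Kahan bound it is a Lipschitz function of the empirical mean of `(1, x, x ⊗ x)` over the group
(`exists_projL_lipschitz`), so deleting one or two observations moves it by `O(1/n)`. This is
negligible with respect to `δ n`, the square root of the bandwidth parameter, because `n * δ n`
tends to infinity. Once the projection is replaced by that of the remaining sample, it is
independent of the deleted observations, and the first two moments of the scores become kernel
averages of the group law for projections near the limit. These averages vary little with the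
projection, uniformly in `δ`: quasi-invariance allows the kernel to be smoothed at a fixed scale
(`exists_localAvg_le_add`). Mean square convergence follows on compact sets of tame points, the
remaining mass is controlled by anti-concentration, and the bias vanishes because the density is
continuous.

The limits of the scores are `π_g f_d(x|g)` times one positive constant common to all groups. A
maximizer of the scores therefore maximizes the limits, except near a tie that is not exact or when
some score is far from its limit, and both events have small probability. -/

/-- The coordinates `⟨e j, x⟩`, as a continuous linear map into Euclidean space. -/
def coordMap {d : ℕ} (e : Fin d → H) : H →L[ℝ] EuclideanSpace ℝ (Fin d) :=
  (EuclideanSpace.equiv (Fin d) ℝ).symm.toContinuousLinearMap ∘L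
    ContinuousLinearMap.pi fun j => innerSL ℝ (e j)

@[simp] lemma coordMap_apply {d : ℕ} (e : Fin d → H) (x : H) (j : Fin d) :
    coordMap e x j = inner ℝ (e j) x := rfl

/-- The linear combination `∑ j, w j • e j`. -/
def synth {d : ℕ} (e : Fin d → H) : EuclideanSpace ℝ (Fin d) →L[ℝ] H :=
  ∑ j, (EuclideanSpace.proj j : EuclideanSpace ℝ (Fin d) →L[ℝ] ℝ).smulRight (e j)

lemma synth_apply {d : ℕ} (e : Fin d → H) (w : EuclideanSpace ℝ (Fin d)) :
    synth e w = ∑ j, w j • e j := by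
  simp [synth]

/-- The orthogonal projection onto the span of an orthonormal family, as an operator. -/
def projL {d : ℕ} (e : Fin d → H) : H →L[ℝ] H := synth e ∘L coordMap e

lemma projL_apply {d : ℕ} (e : Fin d → H) (x : H) : projL e x = proj e x := by
  simp [projL, synth_apply, proj]

lemma inner_synth {d : ℕ} {e : Fin d → H} (he : Orthonormal ℝ e)
    (w w' : EuclideanSpace ℝ (Fin d)) : inner ℝ (synth e w) (synth e w') = inner ℝ w w' := by
  rw [synth_apply, synth_apply, he.inner_sum]
  simp [PiLp.inner_apply, mul_comm]

lemma inner_synth_left {d : ℕ} (e : Fin d → H) (w : EuclideanSpace ℝ (Fin d)) (x : H) :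
    inner ℝ (synth e w) x = inner ℝ w (coordMap e x) := by
  rw [synth_apply, sum_inner]
  simp [PiLp.inner_apply, inner_smul_left, mul_comm]

lemma inner_coordMap_left {d : ℕ} (e : Fin d → H) (w : EuclideanSpace ℝ (Fin d)) (x : H) :
    inner ℝ (coordMap e x) w = inner ℝ x (synth e w) := by
  rw [real_inner_comm, ← inner_synth_left, real_inner_comm]

lemma norm_synth {d : ℕ} {e : Fin d → H} (he : Orthonormal ℝ e)
    (w : EuclideanSpace ℝ (Fin d)) : ‖synth e w‖ = ‖w‖ := by
  rw [norm_eq_sqrt_real_inner, inner_synth he, ← norm_eq_sqrt_real_inner]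

lemma coordMap_synth {d : ℕ} {e : Fin d → H} (he : Orthonormal ℝ e)
    (w : EuclideanSpace ℝ (Fin d)) : coordMap e (synth e w) = w := by
  refine ext_inner_right ℝ fun w' => ?_
  rw [inner_coordMap_left, inner_synth he]

lemma norm_projL {d : ℕ} {e : Fin d → H} (he : Orthonormal ℝ e) (x : H) :
    ‖projL e x‖ = ‖coordMap e x‖ := norm_synth he _

lemma norm_proj {d : ℕ} {e : Fin d → H} (he : Orthonormal ℝ e) (x : H) :
    ‖proj e x‖ = ‖coordMap e x‖ := by rw [← projL_apply, norm_projL he]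

lemma norm_coordMap_le {d : ℕ} {e : Fin d → H} (he : Orthonormal ℝ e) (x : H) :
    ‖coordMap e x‖ ≤ ‖x‖ := by
  have h1 : ‖coordMap e x‖ * ‖coordMap e x‖ ≤ ‖x‖ * ‖coordMap e x‖ := by
    calc ‖coordMap e x‖ * ‖coordMap e x‖ = inner ℝ x (synth e (coordMap e x)) := by
          rw [← inner_coordMap_left, real_inner_self_eq_norm_mul_norm]
      _ ≤ ‖x‖ * ‖synth e (coordMap e x)‖ := real_inner_le_norm _ _
      _ = _ := by rw [norm_synth he]
  rcases (norm_nonneg (coordMap e x)).eq_or_lt with h | h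
  · rw [← h]; exact norm_nonneg _
  · exact le_of_mul_le_mul_right h1 h

lemma norm_projL_le {d : ℕ} {e : Fin d → H} (he : Orthonormal ℝ e) (x : H) :
    ‖projL e x‖ ≤ ‖x‖ := (norm_projL he x).trans_le (norm_coordMap_le he x)

lemma coordMap_projL {d : ℕ} {e : Fin d → H} (he : Orthonormal ℝ e) (x : H) :
    coordMap e (projL e x) = coordMap e x := coordMap_synth he _

lemma projL_projL {d : ℕ} {e : Fin d → H} (he : Orthonormal ℝ e) (x : H) :
    projL e (projL e x) = projL e x := by
  simp only [projL, ContinuousLinearMap.comp_apply, coordMap_synth he]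

lemma inner_projL_left {d : ℕ} (e : Fin d → H) (x y : H) :
    inner ℝ (projL e x) y = inner ℝ x (projL e y) := by
  simp only [projL, ContinuousLinearMap.comp_apply, inner_synth_left, inner_coordMap_left]

/-! ### Principal angles -/

lemma norm_sq_sum_smul_of_orthogonal {d : ℕ} {w : Fin d → H} {q : Fin d → ℝ}
    (hw : ∀ i j, inner ℝ (w i) (w j) = if i = j then q i else 0) (s : Fin d → ℝ) :
    ‖∑ i, s i • w i‖ ^ 2 = ∑ i, s i ^ 2 * q i := by
  rw [← real_inner_self_eq_norm_sq, sum_inner]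
  refine Finset.sum_congr rfl fun i _ => ?_
  rw [inner_sum, Finset.sum_eq_single i]
  · rw [inner_smul_left, inner_smul_right, hw]; simp; ring
  · intro j _ hj
    rw [inner_smul_left, inner_smul_right, hw, if_neg hj.symm]; simp
  · simp

/-- Singular value decomposition of an endomorphism of Euclidean space. -/
lemma exists_svd {d : ℕ} (M : EuclideanSpace ℝ (Fin d) →ₗ[ℝ] EuclideanSpace ℝ (Fin d)) :
    ∃ (u v : OrthonormalBasis (Fin d) ℝ (EuclideanSpace ℝ (Fin d))) (c : Fin d → ℝ),
      (∀ i, 0 ≤ c i) ∧ ∀ i, M (u i) = c i • v i := by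
  have hn : Module.finrank ℝ (EuclideanSpace ℝ (Fin d)) = d := by simp
  have hpos := LinearMap.isPositive_adjoint_comp_self M
  set T := M.adjoint ∘ₗ M with hT
  set u := hpos.isSymmetric.eigenvectorBasis hn
  set σ := hpos.isSymmetric.eigenvalues hn
  have hu : ∀ i, T (u i) = σ i • u i := fun i =>
    hpos.isSymmetric.apply_eigenvectorBasis hn i
  have hσ : ∀ i, 0 ≤ σ i := fun i => hpos.nonneg_eigenvalues hn i
  have hMM : ∀ i j, inner ℝ (M (u i)) (M (u j)) = if i = j then σ i else 0 := by
    intro i j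
    rw [← LinearMap.adjoint_inner_left, ← LinearMap.comp_apply, ← hT, hu, inner_smul_left,
      OrthonormalBasis.inner_eq_ite]
    split_ifs <;> simp
  -- The normalized images of the singular vectors with nonzero singular value are orthonormal. On
  -- the other indices `M (u i) = 0`, so any orthonormal completion serves as `v`.
  have hon : Orthonormal ℝ (({i | σ i ≠ 0} : Set (Fin d)).domRestrict
      fun i => (√(σ i))⁻¹ • M (u i)) := by
    rw [orthonormal_iff_ite]
    rintro ⟨i, hi⟩ ⟨j, hj⟩
    simp only [Set.domRestrict_apply, inner_smul_left, inner_smul_right, hMM, Subtype.mk.injEq]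
    split_ifs with hij
    · subst hij
      have : √(σ i) ≠ 0 := (Real.sqrt_ne_zero (hσ i)).2 hi
      simp only [conj_trivial]
      field_simp
      exact (Real.sq_sqrt (hσ i)).symm
    · simp
  obtain ⟨v, hv⟩ := hon.exists_orthonormalBasis_extension_of_card_eq (by simp)
  refine ⟨u, v, fun i => √(σ i), fun i => Real.sqrt_nonneg _, fun i => ?_⟩
  by_cases hi : σ i = 0
  · have : M (u i) = 0 := by
      rw [← inner_self_eq_zero (𝕜 := ℝ), hMM, if_pos rfl, hi]
    simp [this, hi]
  · rw [hv i hi, smul_smul, mul_inv_cancel₀ ((Real.sqrt_ne_zero (hσ i)).2 hi), one_smul]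

/-- Two orthonormal families of the same size are related by an isometry `R` of coordinates,
realized by a linear map `S` that moves a point no more than the projection does. -/
lemma exists_coord_isometry {d : ℕ} {a b : Fin d → H} (ha : Orthonormal ℝ a)
    (hb : Orthonormal ℝ b) :
    ∃ (R : EuclideanSpace ℝ (Fin d) ≃ₗᵢ[ℝ] EuclideanSpace ℝ (Fin d)) (S : H →L[ℝ] H),
      (∀ x, coordMap a (S x) = coordMap a x) ∧ (∀ x, coordMap b (S x) = R (coordMap a x)) ∧
      ∀ x, ‖S x - projL a x‖ ≤ ‖projL a x - projL b (projL a x)‖ := by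
  -- The singular vectors of the cross Gram operator are the principal vectors of the two subspaces:
  -- `a' i` and `b' i` below are orthonormal families, orthogonal to each other except that `⟨a' i,
  -- b' i⟩ = c i`, the cosine of a principal angle.
  obtain ⟨u, v, c, hc, hM⟩ := exists_svd (coordMap b ∘L synth a).toLinearMap
  simp only [ContinuousLinearMap.coe_coe, ContinuousLinearMap.comp_apply] at hM
  have hM' : ∀ i, coordMap a (synth b (v i)) = c i • u i := by
    intro i
    refine u.repr.injective (PiLp.ext fun j => ?_)
    rw [u.repr_apply_apply, u.repr_apply_apply, real_inner_comm, inner_coordMap_left,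
      inner_synth_left, hM, inner_smul_right, inner_smul_right, OrthonormalBasis.inner_eq_ite,
      OrthonormalBasis.inner_eq_ite]
    by_cases h : i = j
    · simp [h]
    · simp [h, Ne.symm h]
  set a' : Fin d → H := fun i => synth a (u i) with ha'
  set b' : Fin d → H := fun i => synth b (v i) with hb'
  have haa : ∀ i j, inner ℝ (a' i) (a' j) = if i = j then (1 : ℝ) else 0 := fun i j => by
    rw [ha', inner_synth ha, OrthonormalBasis.inner_eq_ite]
  have hbb : ∀ i j, inner ℝ (b' i) (b' j) = if i = j then (1 : ℝ) else 0 := fun i j => by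
    rw [hb', inner_synth hb, OrthonormalBasis.inner_eq_ite]
  have hba : ∀ i j, inner ℝ (b' i) (a' j) = if i = j then c i else 0 := fun i j => by
    rw [ha', hb', inner_synth_left, hM, inner_smul_right, OrthonormalBasis.inner_eq_ite]
    split_ifs with h <;> simp [h]
  have hab : ∀ i j, inner ℝ (a' i) (b' j) = if i = j then c i else 0 := fun i j => by
    rw [real_inner_comm, hba]
    by_cases h : i = j
    · simp [h]
    · simp [h, Ne.symm h]
  have hc1 : ∀ i, 1 + c i ≠ 0 := fun i => by have := hc i; positivity
  have hq1 : ∀ i j, inner ℝ (b' i - c i • a' i) (b' j - c j • a' j) =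
      if i = j then 1 - c i ^ 2 else 0 := fun i j => by
    simp only [inner_sub_left, inner_sub_right, inner_smul_left, inner_smul_right, haa, hbb, hab,
      hba, conj_trivial]
    split_ifs with h
    · subst h; ring
    · ring
  have hq2 : ∀ i j, inner ℝ (a' i - c i • b' i) (a' j - c j • b' j) =
      if i = j then 1 - c i ^ 2 else 0 := fun i j => by
    simp only [inner_sub_left, inner_sub_right, inner_smul_left, inner_smul_right, haa, hbb, hab,
      hba, conj_trivial]
    split_ifs with h
    · subst h; ring
    · ring
  have hcoord : ∀ x, coordMap a x = ∑ i, inner ℝ (u i) (coordMap a x) • u i := fun x =>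
    (u.sum_repr' _).symm
  have hproj : ∀ x, projL a x = ∑ i, inner ℝ (u i) (coordMap a x) • a' i := fun x => by
    rw [projL, ContinuousLinearMap.comp_apply]
    conv_lhs => rw [hcoord x]
    simp [ha']
  have hpb : ∀ i, projL b (a' i) = c i • b' i := fun i => by
    rw [projL, ContinuousLinearMap.comp_apply, ha', hM, map_smul]
  let R := u.equiv v (Equiv.refl _)
  have hR : ∀ i, R (u i) = v i := fun i => by simp [R]
  -- On the principal vector `a' i` the map gives the multiple of the bisector `a' i + b' i` whose
  -- projections onto the two subspaces are `a' i` and `b' i`; the factor is `(1 + c i)⁻¹`.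
  let S : H →L[ℝ] H :=
    ∑ i, ((innerSL ℝ (u i)) ∘L coordMap a).smulRight ((1 + c i)⁻¹ • (a' i + b' i))
  have hS : ∀ x, S x = ∑ i, inner ℝ (u i) (coordMap a x) • ((1 + c i)⁻¹ • (a' i + b' i)) := by
    intro x; simp [S, innerSL_apply_apply]
  refine ⟨R, S, fun x => ?_, fun x => ?_, fun x => ?_⟩
  · rw [hS, map_sum]
    conv_rhs => rw [hcoord x]
    refine Finset.sum_congr rfl fun i _ => ?_
    simp only [map_smul, map_add, ha', hb', coordMap_synth ha, hM']
    rw [show u i + c i • u i = (1 + c i) • u i by rw [add_smul, one_smul],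
      inv_smul_smul₀ (hc1 i)]
  · rw [hS, map_sum]
    conv_rhs => rw [hcoord x]
    rw [map_sum]
    refine Finset.sum_congr rfl fun i _ => ?_
    simp only [map_smul, map_add, ha', hb', coordMap_synth hb, hM, hR]
    rw [show c i • v i + v i = (1 + c i) • v i by rw [add_smul, one_smul, add_comm],
      inv_smul_smul₀ (hc1 i)]
  -- Both displacements are expanded in orthogonal vectors of the same squared lengths `1 - c i ^
  -- 2`; that of `S` carries the extra factor `(1 + c i)⁻¹ ≤ 1`.
  · have e1 : S x - projL a x =
        ∑ i, (inner ℝ (u i) (coordMap a x) * (1 + c i)⁻¹) • (b' i - c i • a' i) := by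
      rw [hS, hproj, ← Finset.sum_sub_distrib]
      refine Finset.sum_congr rfl fun i _ => ?_
      have h3 : (1 + c i)⁻¹ • (a' i + b' i) - a' i = (1 + c i)⁻¹ • (b' i - c i • a' i) := by
        refine smul_right_injective H (hc1 i) ?_
        change (1 + c i) • _ = (1 + c i) • _
        rw [smul_sub, smul_inv_smul₀ (hc1 i), smul_inv_smul₀ (hc1 i), add_smul, one_smul]
        abel
      rw [← smul_sub, h3, smul_smul]
    have e2 : projL a x - projL b (projL a x) =
        ∑ i, inner ℝ (u i) (coordMap a x) • (a' i - c i • b' i) := by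
      rw [hproj, map_sum, ← Finset.sum_sub_distrib]
      refine Finset.sum_congr rfl fun i _ => ?_
      rw [map_smul, hpb, ← smul_sub]
    refine le_of_sq_le_sq ?_ (norm_nonneg _)
    rw [e1, e2, norm_sq_sum_smul_of_orthogonal hq1, norm_sq_sum_smul_of_orthogonal hq2]
    refine Finset.sum_le_sum fun i _ => ?_
    have hnn : 0 ≤ 1 - c i ^ 2 := by
      have := hq1 i i
      rw [if_pos rfl] at this
      rw [← this]; exact real_inner_self_nonneg
    refine mul_le_mul_of_nonneg_right ?_ hnn
    rw [mul_pow]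
    refine mul_le_of_le_one_right (sq_nonneg _) ?_
    refine pow_le_one₀ (by have := hc i; positivity) ?_
    exact inv_le_one_of_one_le₀ (by linarith [hc i])

/-! ### Initial segments of a Hilbert basis -/

/-- The first `d` vectors of a Hilbert basis. -/
def initSeg (ξ : HilbertBasis ℕ ℝ H) (d : ℕ) : Fin d → H := fun j => ξ j

lemma orthonormal_initSeg (ξ : HilbertBasis ℕ ℝ H) (d : ℕ) : Orthonormal ℝ (initSeg ξ d) :=
  ξ.orthonormal.comp _ Fin.val_injective

lemma projL_initSeg (ξ : HilbertBasis ℕ ℝ H) (d : ℕ) (x : H) :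
    projL (initSeg ξ d) x = ∑ j ∈ Finset.range d, inner ℝ (ξ j) x • ξ j := by
  rw [projL_apply, proj, ← Fin.sum_univ_eq_sum_range (fun j => inner ℝ (ξ j) x • ξ j)]
  rfl

lemma tendsto_projL_initSeg (ξ : HilbertBasis ℕ ℝ H) (x : H) :
    Tendsto (fun d => projL (initSeg ξ d) x) atTop (𝓝 x) := by
  simp_rw [projL_initSeg]
  have := (ξ.hasSum_repr x).tendsto_sum_nat
  simpa only [ξ.repr_apply_apply] using this

/-- On a compact set the partial projections of a Hilbert basis converge uniformly. -/
lemma eventually_norm_sub_projL_lt (ξ : HilbertBasis ℕ ℝ H) {A : Set H} (hA : IsCompact A)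
    {ε : ℝ} (hε : 0 < ε) : ∀ᶠ d in atTop, ∀ x ∈ A, ‖x - projL (initSeg ξ d) x‖ < ε := by
  -- Pointwise convergence becomes locally uniform because the projections are contractions;
  -- compactness makes it uniform on `A`.
  have h1 : ∀ x ∈ A, ∀ᶠ p : ℕ × H in atTop ×ˢ 𝓝 x, ‖p.2 - projL (initSeg ξ p.1) p.2‖ < ε := by
    intro x _
    have h2 : ∀ᶠ d in atTop, ‖x - projL (initSeg ξ d) x‖ < ε / 2 := by
      have := (tendsto_const_nhds (x := x)).sub (tendsto_projL_initSeg ξ x)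
      rw [sub_self] at this
      have h := this.norm
      rw [norm_zero] at h
      exact h.eventually_lt_const (half_pos hε)
    have h3 : ∀ᶠ y in 𝓝 x, ‖y - x‖ < ε / 4 := by
      filter_upwards [Metric.ball_mem_nhds x (show 0 < ε / 4 by positivity)] with y hy
      simpa [dist_eq_norm] using hy
    filter_upwards [h2.prod_mk h3] with p hp
    have e : p.2 - projL (initSeg ξ p.1) p.2 = (p.2 - x) - projL (initSeg ξ p.1) (p.2 - x) +
        (x - projL (initSeg ξ p.1) x) := by rw [map_sub]; abel
    rw [e]
    have := norm_projL_le (orthonormal_initSeg ξ p.1) (p.2 - x)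
    have := norm_add_le ((p.2 - x) - projL (initSeg ξ p.1) (p.2 - x))
      (x - projL (initSeg ξ p.1) x)
    have := norm_sub_le (p.2 - x) (projL (initSeg ξ p.1) (p.2 - x))
    linarith [hp.1, hp.2]
  obtain ⟨t, ht, u, hu, htu⟩ := Filter.mem_prod_iff.1 (hA.mem_prod_nhdsSet_of_forall h1)
  filter_upwards [ht] with d hd x hx
  exact htu (Set.mk_mem_prod hd (subset_of_mem_nhdsSet hu hx))

/-! ### A Harnack inequality -/

/-- A positive function whose second derivative is relatively bounded cannot decrease too fast. -/
lemma neg_deriv_le_of_second_deriv_le {φ φ' φ'' : ℝ → ℝ} {h M : ℝ} (hh : 0 < h) (hM : 0 ≤ M)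
    (hhM : h ^ 2 * M ≤ 1 / 2) (h1 : ∀ t, HasDerivAt φ (φ' t) t)
    (h2 : ∀ t, HasDerivAt φ' (φ'' t) t) (hpos : ∀ t, 0 < φ t)
    (hb : ∀ t ∈ Set.Icc 0 h, φ'' t ≤ M * φ t) : -φ' 0 ≤ 2 / h * φ 0 := by
  by_cases hp : 0 ≤ φ' 0
  · have := hpos 0
    have : 0 ≤ 2 / h * φ 0 := by positivity
    linarith
  push Not at hp
  have hc : Continuous φ := continuous_iff_continuousAt.2 fun t => (h1 t).continuousAt
  have hc' : Continuous φ' := continuous_iff_continuousAt.2 fun t => (h2 t).continuousAt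
  obtain ⟨t₀, ht₀, hmax⟩ := isCompact_Icc.exists_isMaxOn (Set.nonempty_Icc.2 hh.le) hc.continuousOn
  set S := φ t₀ with hS
  have hSpos : 0 < S := hpos _
  have hd1 : ∀ t ∈ Set.Icc 0 h, φ' t ≤ φ' 0 + M * S * h := by
    intro t ht
    have := (convex_Icc 0 h).image_sub_le_mul_sub_of_deriv_le (f := φ') (C := M * S)
      hc'.continuousOn (fun x _ => (h2 x).differentiableAt.differentiableWithinAt)
      (fun x hx => by
        have hx := interior_subset hx
        rw [(h2 x).deriv]
        exact (hb x hx).trans (mul_le_mul_of_nonneg_left (hmax hx) hM))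
      0 (Set.left_mem_Icc.2 hh.le) t ht ht.1
    have h3 : M * S * (t - 0) ≤ M * S * h :=
      mul_le_mul_of_nonneg_left (by linarith [ht.2]) (by positivity)
    linarith
  have hd2 : ∀ t ∈ Set.Icc 0 h, φ t ≤ φ 0 + (φ' 0 + M * S * h) * t := by
    intro t ht
    have := (convex_Icc 0 h).image_sub_le_mul_sub_of_deriv_le (f := φ) (C := φ' 0 + M * S * h)
      hc.continuousOn (fun x _ => (h1 x).differentiableAt.differentiableWithinAt)
      (fun x hx => by rw [(h1 x).deriv]; exact hd1 x (interior_subset hx))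
      0 (Set.left_mem_Icc.2 hh.le) t ht ht.1
    linarith
  -- With `S` the maximum of `φ` on `[0, h]`, the estimate `hd2` at the maximum point gives `S ≤ φ 0
  -- + S / 2`. At `h` it gives `0 < φ h ≤ φ 0 + φ' 0 * h + S / 2 ≤ 2 * φ 0 + φ' 0 * h`.
  have hMS : M * S * h * h ≤ S / 2 := by nlinarith
  have e1 : S ≤ 2 * φ 0 := by
    have h3 := hd2 t₀ ht₀
    have h4 : M * S * h * t₀ ≤ M * S * h * h :=
      mul_le_mul_of_nonneg_left ht₀.2 (by positivity)
    have h5 : φ' 0 * t₀ ≤ 0 := mul_nonpos_of_nonpos_of_nonneg hp.le ht₀.1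
    nlinarith
  have e2 := hd2 h (Set.right_mem_Icc.2 hh.le)
  have e3 := hpos h
  rw [div_mul_eq_mul_div, le_div_iff₀ hh]
  nlinarith

lemma abs_deriv_le_of_second_deriv_le {φ φ' φ'' : ℝ → ℝ} {h M : ℝ} (hh : 0 < h) (hM : 0 ≤ M)
    (hhM : h ^ 2 * M ≤ 1 / 2) (h1 : ∀ t, HasDerivAt φ (φ' t) t)
    (h2 : ∀ t, HasDerivAt φ' (φ'' t) t) (hpos : ∀ t, 0 < φ t)
    (hb : ∀ t, |t| ≤ h → φ'' t ≤ M * φ t) : |φ' 0| ≤ 2 / h * φ 0 := by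
  rw [abs_le']
  constructor
  · have h3 := neg_deriv_le_of_second_deriv_le (φ := fun t => φ (-t)) (φ' := fun t => -φ' (-t))
      (φ'' := fun t => φ'' (-t)) hh hM hhM
      (fun t => by simpa using! (h1 (-t)).scomp t (hasDerivAt_neg t))
      (fun t => by simpa using! ((h2 (-t)).scomp t (hasDerivAt_neg t)).neg)
      (fun t => hpos _) (fun t ht => hb _ (by rw [abs_neg, abs_of_nonneg ht.1]; exact ht.2))
    simpa using h3
  · exact neg_deriv_le_of_second_deriv_le hh hM hhM h1 h2 hpos
      (fun t ht => hb _ (by rw [abs_of_nonneg ht.1]; exact ht.2))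

/-- The one-dimensional estimate is applied on the line in direction `i`, so only the pure second
derivative in that direction enters; this keeps the constant free of the dimension. -/
lemma abs_partial_le {d : ℕ} {f : (Fin d → ℝ) → ℝ} (hf : ContDiff ℝ 2 f) (hpos : ∀ t, 0 < f t)
    {ϑ : Fin d → ℝ} {i : Fin d} {h M : ℝ} (hh : 0 < h) (hM : 0 ≤ M) (hhM : h ^ 2 * M ≤ 1 / 2)
    (hb : ∀ t : ℝ, |t| ≤ h → |secondPartial f i i (ϑ + t • Pi.single i 1)| ≤
      M * f (ϑ + t • Pi.single i 1)) :
    |fderiv ℝ f ϑ (Pi.single i 1)| ≤ 2 / h * f ϑ := by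
  have hline : ∀ t : ℝ, HasDerivAt (fun t : ℝ => ϑ + t • (Pi.single i 1 : Fin d → ℝ))
      (Pi.single i 1) t := fun t => by
    simpa using ((hasDerivAt_id t).smul_const (Pi.single i 1 : Fin d → ℝ)).const_add ϑ
  have hdf : Differentiable ℝ f := hf.differentiable (by norm_num)
  have hdf' : Differentiable ℝ (fun y => fderiv ℝ f y (Pi.single i 1)) :=
    ((hf.fderiv_right (m := 1) (by norm_num)).clm_apply contDiff_const).differentiable (by norm_num)
  have h3 := abs_deriv_le_of_second_deriv_le
    (φ := fun t => f (ϑ + t • Pi.single i 1))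
    (φ' := fun t => fderiv ℝ f (ϑ + t • Pi.single i 1) (Pi.single i 1))
    (φ'' := fun t => secondPartial f i i (ϑ + t • Pi.single i 1)) hh hM hhM
    (fun t => (hdf _).hasFDerivAt.comp_hasDerivAt t (hline t))
    (fun t => (hdf' _).hasFDerivAt.comp_hasDerivAt t (hline t))
    (fun t => hpos _) (fun t ht => (le_abs_self _).trans (hb t ht))
  simpa using h3

/-- The mean value inequality for `log f` along the segment. -/
lemma le_exp_mul_of_deriv_le {d : ℕ} {f : (Fin d → ℝ) → ℝ} (hf : Differentiable ℝ f)
    (hpos : ∀ t, 0 < f t) {ϑ v : Fin d → ℝ} {Λ : ℝ}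
    (hb : ∀ t ∈ Set.Icc (0 : ℝ) 1, |fderiv ℝ f (ϑ + t • v) v| ≤ Λ * f (ϑ + t • v)) :
    f (ϑ + v) ≤ Real.exp Λ * f ϑ := by
  have hd : ∀ t : ℝ, HasDerivAt (fun t : ℝ => Real.log (f (ϑ + t • v)))
      (fderiv ℝ f (ϑ + t • v) v / f (ϑ + t • v)) t := fun t => by
    have h1 : HasDerivAt (fun t : ℝ => ϑ + t • v) v t := by
      simpa using ((hasDerivAt_id t).smul_const v).const_add ϑ
    exact ((hf _).hasFDerivAt.comp_hasDerivAt t h1).log (hpos _).ne'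
  have := (convex_Icc (0 : ℝ) 1).image_sub_le_mul_sub_of_deriv_le
    (f := fun t : ℝ => Real.log (f (ϑ + t • v))) (C := Λ)
    (fun t _ => (hd t).continuousAt.continuousWithinAt)
    (fun t _ => (hd t).differentiableAt.differentiableWithinAt)
    (fun t ht => by
      rw [(hd t).deriv, div_le_iff₀ (hpos _)]
      exact (le_abs_self _).trans (hb t (interior_subset ht)))
    0 (by simp) 1 (by simp) (by simp)
  simp only [one_smul, zero_smul, add_zero, sub_zero, mul_one] at this
  rw [← Real.exp_log (hpos (ϑ + v)), ← Real.exp_log (hpos ϑ), ← Real.exp_add]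
  exact Real.exp_le_exp.2 (by linarith)

/-- Under a relative bound on the pure second derivatives near `θ`, the density is comparable at
points that differ in the first `m` coordinates only, uniformly in the dimension. -/
lemma density_translate_le {f : (d : ℕ) → (Fin d → ℝ) → ℝ} (hf : ∀ d, ContDiff ℝ 2 (f d))
    (hpos : ∀ d t, 0 < f d t) {lam : ℕ → ℝ} (hlam : ∀ i, lam i ≠ 0)
    {θ : (d : ℕ) → Fin d → ℝ} {C ρ : ℝ} (hC : 0 < C) (hρ : 0 < ρ)
    (hb : ∀ (d : ℕ) (i j : Fin d) (ϑ : Fin d → ℝ), ∑ k, (ϑ k - θ d k) ^ 2 ≤ ρ ^ 2 →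
      √(lam i * lam j) / |f d ϑ| * |secondPartial (f d) i j ϑ| ≤ C) (m : ℕ) :
    ∃ L, 0 ≤ L ∧ ∀ (d : ℕ) (ϑ v : EuclideanSpace ℝ (Fin d)),
      (∀ j : Fin d, m ≤ (j : ℕ) → v j = 0) →
      (∀ t ∈ Set.Icc (0 : ℝ) 1, ‖ϑ + t • v - WithLp.toLp 2 (θ d)‖ ≤ ρ / 2) →
      f d (ϑ + v).ofLp ≤ Real.exp (L * ‖v‖) * f d ϑ.ofLp := by
  -- The case `i = j` of the hypothesis, where `√(lam i * lam i) = |lam i|`.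
  set M : ℕ → ℝ := fun i => C / |lam i|
  have hM : ∀ i, 0 < M i := fun i => div_pos hC (abs_pos.2 (hlam i))
  -- The first entry keeps a segment issued from the ball of radius `ρ / 2` inside the ball of
  -- radius `ρ`; the second is the smallness required by the Harnack estimate.
  set h : ℕ → ℝ := fun i => min (ρ / 2) (√(1 / (2 * M i)))
  have hh : ∀ i, 0 < h i := fun i => lt_min (by positivity)
    (Real.sqrt_pos.2 (by have := hM i; positivity))
  have hhM : ∀ i, h i ^ 2 * M i ≤ 1 / 2 := fun i => by
    have h1 : h i ^ 2 ≤ 1 / (2 * M i) := by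
      rw [← Real.sq_sqrt (show 0 ≤ 1 / (2 * M i) by have := hM i; positivity)]
      exact pow_le_pow_left₀ (hh i).le (min_le_right _ _) 2
    calc h i ^ 2 * M i ≤ 1 / (2 * M i) * M i := mul_le_mul_of_nonneg_right h1 (hM i).le
      _ = 1 / 2 := by have := (hM i).ne'; field_simp
  -- Only the first `m` directions contribute to a derivative along `v`, so the constant involves
  -- `m` eigenvalues and not the dimension `d`.
  refine ⟨∑ i ∈ Finset.range m, 2 / h i,
    Finset.sum_nonneg fun i _ => by have := hh i; positivity, fun d ϑ v hv hseg => ?_⟩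
  set L := ∑ i ∈ Finset.range m, 2 / h i
  have key : f d (ϑ.ofLp + v.ofLp) ≤ Real.exp (L * ‖v‖) * f d ϑ.ofLp := by
    refine le_exp_mul_of_deriv_le ((hf d).differentiable (by norm_num)) (hpos d) fun t ht => ?_
    set x : EuclideanSpace ℝ (Fin d) := ϑ + t • v with hx
    change |fderiv ℝ (f d) x.ofLp v.ofLp| ≤ L * ‖v‖ * f d x.ofLp
    have hpart : ∀ i : Fin d, |fderiv ℝ (f d) x.ofLp (Pi.single i 1)| ≤ 2 / h i * f d x.ofLp := by
      intro i
      refine abs_partial_le (hf d) (hpos d) (hh i) (hM i).le (hhM i) fun s hs => ?_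
      have hball : ∑ k, ((x.ofLp + s • (Pi.single i 1 : Fin d → ℝ)) k - θ d k) ^ 2 ≤ ρ ^ 2 := by
        have e1 : ∑ k, ((x.ofLp + s • (Pi.single i 1 : Fin d → ℝ)) k - θ d k) ^ 2 =
            ‖(x - WithLp.toLp 2 (θ d)) + s • EuclideanSpace.single i (1 : ℝ)‖ ^ 2 := by
          rw [EuclideanSpace.real_norm_sq_eq]
          refine Finset.sum_congr rfl fun k _ => ?_
          simp [Pi.single_apply]
          ring
        rw [e1]
        refine pow_le_pow_left₀ (norm_nonneg _) ((norm_add_le _ _).trans ?_) 2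
        have e2 : ‖s • EuclideanSpace.single i (1 : ℝ)‖ ≤ ρ / 2 := by
          rw [norm_smul, PiLp.norm_single, norm_one, mul_one, Real.norm_eq_abs]
          exact hs.trans (min_le_left _ _)
        linarith [hseg t ht]
      have h3 := hb d i i _ hball
      set y := x.ofLp + s • (Pi.single i 1 : Fin d → ℝ)
      rw [Real.sqrt_mul_self_eq_abs, abs_of_pos (hpos d y)] at h3
      change _ ≤ C / |lam i| * f d y
      have h4 := abs_pos.2 (hlam i)
      have h5 := hpos d y
      rw [div_mul_eq_mul_div, div_le_iff₀ h5] at h3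
      rw [div_mul_eq_mul_div, le_div_iff₀ h4]
      linarith
    have hsum : fderiv ℝ (f d) x.ofLp v.ofLp =
        ∑ i, v i * fderiv ℝ (f d) x.ofLp (Pi.single i 1) := by
      conv_lhs => rw [pi_eq_sum_univ' v.ofLp]
      simp [map_sum]
    rw [hsum]
    calc |∑ i, v i * fderiv ℝ (f d) x.ofLp (Pi.single i 1)|
        ≤ ∑ i : Fin d, |v i * fderiv ℝ (f d) x.ofLp (Pi.single i 1)| :=
          Finset.abs_sum_le_sum_abs _ _
      _ ≤ ∑ i : Fin d, if (i : ℕ) < m then ‖v‖ * (2 / h i * f d x.ofLp) else 0 := by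
          refine Finset.sum_le_sum fun i _ => ?_
          split_ifs with him
          · rw [abs_mul]
            refine mul_le_mul ?_ (hpart i) (abs_nonneg _) (norm_nonneg _)
            rw [← Real.norm_eq_abs]; exact PiLp.norm_apply_le v i
          · simp [hv i (not_lt.1 him)]
      _ = ∑ i ∈ Finset.range d, if i < m then ‖v‖ * (2 / h i * f d x.ofLp) else 0 :=
          Fin.sum_univ_eq_sum_range (fun i => if i < m then ‖v‖ * (2 / h i * f d x.ofLp) else 0) d
      _ = ∑ i ∈ (Finset.range d).filter (· < m), ‖v‖ * (2 / h i * f d x.ofLp) :=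
          (Finset.sum_filter _ _).symm
      _ ≤ ∑ i ∈ Finset.range m, ‖v‖ * (2 / h i * f d x.ofLp) := by
          refine Finset.sum_le_sum_of_subset_of_nonneg (fun i hi => ?_) fun i _ _ => ?_
          · simp at hi ⊢; exact hi.2
          · have := hh i; have := hpos d x.ofLp; positivity
      _ = L * ‖v‖ * f d x.ofLp := by
          rw [← Finset.mul_sum, ← Finset.sum_mul]; ring
  exact key

/-! ### Local quasi-invariance under finite translations -/

/-- On `A`, translations of size at most `r` along finitely many basis vectors change the measure
`ν` by a controlled factor. -/
def TameOn [MeasurableSpace H] (ν : Measure H) (ξ : HilbertBasis ℕ ℝ H) (A : Set H) (r : ℝ) :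
    Prop :=
  ∀ m : ℕ, ∃ L : ℝ, 0 ≤ L ∧ ∀ v : H, (∀ j, m ≤ j → inner ℝ (ξ j) v = 0) → ‖v‖ ≤ r →
    ∀ N, MeasurableSet N → N ⊆ A →
      ν ((fun x => x + v) ⁻¹' N) ≤ ENNReal.ofReal (Real.exp (L * ‖v‖)) * ν N

lemma TameOn.mono [MeasurableSpace H] {ν : Measure H} {ξ : HilbertBasis ℕ ℝ H} {A B : Set H}
    {r s : ℝ} (h : TameOn ν ξ A r) (hBA : B ⊆ A) (hsr : s ≤ r) : TameOn ν ξ B s := fun m => by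
  obtain ⟨L, hL, h⟩ := h m
  exact ⟨L, hL, fun v hv hvs N hN hNB => h v hv (hvs.trans hsr) N hN (hNB.trans hBA)⟩

lemma TameOn.union [MeasurableSpace H] {ν : Measure H} {ξ : HilbertBasis ℕ ℝ H} {A B : Set H}
    {r : ℝ} (hA : TameOn ν ξ A r) (hB : TameOn ν ξ B r) (hAm : MeasurableSet A) :
    TameOn ν ξ (A ∪ B) r := fun m => by
  obtain ⟨L, hL, hA⟩ := hA m
  obtain ⟨L', hL', hB⟩ := hB m
  refine ⟨L + L', add_nonneg hL hL', fun v hv hvs N hN hNB => ?_⟩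
  have h1 := hA v hv hvs (N ∩ A) (hN.inter hAm) Set.inter_subset_right
  have h2 := hB v hv hvs (N \ A) (hN.diff hAm) fun x hx => (hNB hx.1).resolve_left hx.2
  have e1 : ENNReal.ofReal (Real.exp (L * ‖v‖)) ≤ ENNReal.ofReal (Real.exp ((L + L') * ‖v‖)) :=
    ENNReal.ofReal_le_ofReal (Real.exp_le_exp.2
      (mul_le_mul_of_nonneg_right (by linarith) (norm_nonneg _)))
  have e2 : ENNReal.ofReal (Real.exp (L' * ‖v‖)) ≤ ENNReal.ofReal (Real.exp ((L + L') * ‖v‖)) :=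
    ENNReal.ofReal_le_ofReal (Real.exp_le_exp.2
      (mul_le_mul_of_nonneg_right (by linarith) (norm_nonneg _)))
  calc ν ((fun x => x + v) ⁻¹' N)
      = ν ((fun x => x + v) ⁻¹' (N ∩ A) ∪ (fun x => x + v) ⁻¹' (N \ A)) := by
        rw [← Set.preimage_union, Set.inter_union_sdiff]
    _ ≤ _ := measure_union_le _ _
    _ ≤ ENNReal.ofReal (Real.exp ((L + L') * ‖v‖)) * ν (N ∩ A) +
        ENNReal.ofReal (Real.exp ((L + L') * ‖v‖)) * ν (N \ A) :=
      add_le_add (h1.trans (mul_le_mul_left e1 _)) (h2.trans (mul_le_mul_left e2 _))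
    _ = _ := by rw [← mul_add, measure_inter_add_sdiff _ hAm]

/-- The points near which `ν` is quasi-invariant. -/
def tamePts [MeasurableSpace H] (ν : Measure H) (ξ : HilbertBasis ℕ ℝ H) : Set H :=
  {x | ∃ r > 0, TameOn ν ξ (Metric.ball x r) r}

lemma isOpen_tamePts [MeasurableSpace H] (ν : Measure H) (ξ : HilbertBasis ℕ ℝ H) :
    IsOpen (tamePts ν ξ) := by
  refine Metric.isOpen_iff.2 fun x ⟨r, hr, h⟩ => ⟨r / 2, half_pos hr, fun y hy => ?_⟩
  refine ⟨r / 2, half_pos hr, h.mono (Metric.ball_subset_ball' ?_) (by linarith)⟩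
  have := Metric.mem_ball.1 hy
  linarith

/-- Compactness: tameness is local and passes to finite unions, since the constants of two sets can
be added and the smaller radius kept. The thickening leaves room for the translates of points of
`A`. -/
lemma exists_tameOn_thickening [MeasurableSpace H] [BorelSpace H] {ν : Measure H}
    {ξ : HilbertBasis ℕ ℝ H} {A : Set H} (hA : IsCompact A) (hAt : A ⊆ tamePts ν ξ) :
    ∃ r > 0, TameOn ν ξ (Metric.thickening r A) r := by
  refine hA.induction_on (p := fun s => ∃ r > 0, TameOn ν ξ (Metric.thickening r s) r)
    ⟨1, one_pos, fun m => ⟨0, le_rfl, fun v _ _ N _ hN => ?_⟩⟩ ?_ ?_ ?_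
  · rw [Metric.thickening_empty, Set.subset_empty_iff] at hN
    simp [hN]
  · rintro s t hst ⟨r, hr, h⟩
    exact ⟨r, hr, h.mono (Metric.thickening_subset_of_subset _ hst) le_rfl⟩
  · rintro s t ⟨r, hr, h⟩ ⟨r', hr', h'⟩
    refine ⟨min r r', lt_min hr hr', ?_⟩
    rw [Metric.thickening_union]
    exact (h.mono (Metric.thickening_mono (min_le_left _ _) _) (min_le_left _ _)).union
      (h'.mono (Metric.thickening_mono (min_le_right _ _) _) (min_le_right _ _))
      Metric.isOpen_thickening.measurableSet
  · intro x hx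
    obtain ⟨r, hr, h⟩ := hAt hx
    refine ⟨Metric.ball x (r / 2), mem_nhdsWithin_of_mem_nhds (Metric.ball_mem_nhds _ (half_pos hr)),
      r / 2, half_pos hr, h.mono (fun y hy => ?_) (by linarith)⟩
    obtain ⟨z, hz, hyz⟩ := Metric.mem_thickening_iff.1 hy
    have := Metric.mem_ball.1 hz
    have := dist_triangle y z x
    exact Metric.mem_ball.2 (by linarith)

/-- Fatou's lemma for the superior limit of sets in a finite measure space. -/
lemma le_measure_of_frequently {α : Type*} [MeasurableSpace α] {ν : Measure α} [IsFiniteMeasure ν]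
    {A : ℕ → Set α} (hA : ∀ n, MeasurableSet (A n)) {E : Set α}
    (hE : ∀ x, (∃ᶠ n in atTop, x ∈ A n) → x ∈ E) {c : ENNReal}
    (hc : ∀ᶠ n in atTop, c ≤ ν (A n)) : c ≤ ν E := by
  have hanti : Antitone fun k => ⋃ n ≥ k, A n := fun k l hkl =>
    Set.biUnion_subset_biUnion_left fun n hn => le_trans hkl hn
  have ht := tendsto_measure_iInter_atTop (μ := ν)
    (fun k => (MeasurableSet.biUnion (Set.to_countable {n | n ≥ k})
      fun n _ => hA n).nullMeasurableSet) hanti ⟨0, measure_ne_top _ _⟩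
  refine (ge_of_tendsto ht ?_).trans (measure_mono fun x hx => hE x ?_)
  · filter_upwards [hc] with k hk
    exact hk.trans (measure_mono (Set.subset_biUnion_of_mem (u := A) (le_refl k)))
  · refine Filter.frequently_atTop.2 fun k => ?_
    have := Set.mem_iInter.1 hx k
    simpa using this

/-- The measure of a compact set is recovered from its finite-dimensional projections, even when
the set is slightly deformed. -/
lemma le_measure_of_projected [MeasurableSpace H] [BorelSpace H] {ν : Measure H}
    [IsFiniteMeasure ν] (ξ : HilbertBasis ℕ ℝ H) {K : Set H} (hK : IsCompact K) {T : ℕ → H → H}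
    (hTc : ∀ D, Continuous (T D))
    (hT : ∀ ε > 0, ∀ᶠ D in atTop, ∀ x ∈ K, ‖T D x - x‖ < ε) {c : ENNReal}
    (hc : ∀ᶠ D in atTop, c ≤ ν (coordMap (initSeg ξ D) ⁻¹'
      (coordMap (initSeg ξ D) '' (T D '' K)))) : c ≤ ν K := by
  refine le_measure_of_frequently (fun D => ?_) (fun x hx => ?_) hc
  · exact (((hK.image (hTc D)).image
      (coordMap (initSeg ξ D)).continuous).isClosed.preimage
      (coordMap (initSeg ξ D)).continuous).measurableSet
  · rw [← hK.isClosed.closure_eq]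
    refine Metric.mem_closure_iff.2 fun ε hε => ?_
    have h3 : 0 < ε / 3 := by positivity
    -- A point in infinitely many of the cylinders has, for some large `D`, the same first `D`
    -- coordinates as `T D k` with `k ∈ K`. It is then close to `k`, because `T D k` is close to `k`
    -- and both `x` and `k` are close to their projections.
    obtain ⟨D, ⟨_, ⟨k, hk, rfl⟩, hkx⟩, h1, h2, h4⟩ := (hx.and_eventually ((hT _ h3).and
      ((eventually_norm_sub_projL_lt ξ hK h3).and
        (eventually_norm_sub_projL_lt ξ (isCompact_singleton (x := x)) h3)))).exists
    refine ⟨k, hk, ?_⟩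
    have h1 := h1 k hk
    have h2 := h2 k hk
    have h4 := h4 x rfl
    have e : projL (initSeg ξ D) x = projL (initSeg ξ D) (T D k) := by
      simp only [projL, ContinuousLinearMap.comp_apply, hkx]
    have h5 := norm_projL_le (orthonormal_initSeg ξ D) (T D k - k)
    rw [map_sub, ← e] at h5
    rw [dist_eq_norm]
    have h6 := norm_add₃_le (a := x - projL (initSeg ξ D) x)
      (b := projL (initSeg ξ D) x - projL (initSeg ξ D) k) (c := projL (initSeg ξ D) k - k)
    rw [norm_sub_rev (projL (initSeg ξ D) k) k] at h6
    rw [show x - k = x - projL (initSeg ξ D) x + (projL (initSeg ξ D) x - projL (initSeg ξ D) k) +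
      (projL (initSeg ξ D) k - k) by abel]
    linarith

/-- A point with a uniform relative bound on the second derivatives of the densities is tame. -/
lemma mem_tamePts_of_secondDeriv [CompleteSpace H] [SecondCountableTopology H] [MeasurableSpace H]
    [BorelSpace H] {ν : Measure H} [IsFiniteMeasure ν] {ξ : HilbertBasis ℕ ℝ H}
    {f : (d : ℕ) → (Fin d → ℝ) → ℝ} (hf : ∀ d, ContDiff ℝ 2 (f d))
    (hpos : ∀ d t, 0 < f d t) {c : H}
    (hdens : ∀ D, ν.map (coordMap (initSeg ξ D)) = volume.withDensity
      fun y => ENNReal.ofReal (f D (y - coordMap (initSeg ξ D) c).ofLp))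
    {lam : ℕ → ℝ} (hlam : ∀ i, lam i ≠ 0) {x₀ : H} {C ρ : ℝ} (hC : 0 < C) (hρ : 0 < ρ)
    (hb : ∀ (d : ℕ) (i j : Fin d) (ϑ : Fin d → ℝ),
      ∑ k, (ϑ k - (coordMap (initSeg ξ d) x₀ - coordMap (initSeg ξ d) c).ofLp k) ^ 2 ≤ ρ ^ 2 →
      √(lam i * lam j) / |f d ϑ| * |secondPartial (f d) i j ϑ| ≤ C) :
    x₀ ∈ tamePts ν ξ := by
  -- One quarter for the distance to `x₀` and one for the translation: the whole segment stays
  -- within `ρ / 2`, as the density estimate demands.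
  refine ⟨ρ / 4, by positivity, fun m => ?_⟩
  obtain ⟨L, hL, h⟩ := density_translate_le hf hpos hlam hC hρ hb m
  refine ⟨L, hL, fun v hv hvr N hN hNB => ?_⟩
  have hmeas : Measurable fun x : H => x + v := measurable_add_const v
  have : IsFiniteMeasure (ν.map fun x => x + v) := Measure.isFiniteMeasure_map ν _
  -- By inner regularity a compact set suffices, and its measure is recovered from the cylinders
  -- over its finite-dimensional images, where the density estimate holds with a constant
  -- independent of the dimension.
  rw [← Measure.map_apply hmeas hN, hN.measure_eq_iSup_isCompact]
  refine iSup₂_le fun K hKN => iSup_le fun hK => ?_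
  refine le_trans ?_ (mul_le_mul_right (measure_mono hKN) _)
  rw [Measure.map_apply hmeas hK.measurableSet]
  set c₀ := ENNReal.ofReal (Real.exp (L * ‖v‖)) with hc₀
  have hc₀pos : c₀ ≠ 0 := by simp [c₀, Real.exp_pos]
  have hc₀top : c₀ ≠ ⊤ := ENNReal.ofReal_ne_top
  rw [mul_comm, ← ENNReal.div_le_iff hc₀pos hc₀top]
  refine le_measure_of_projected ξ hK (T := fun _ => id) (fun _ => continuous_id)
    (fun ε hε => Eventually.of_forall fun _ _ _ => by simpa using hε) ?_
  refine Eventually.of_forall fun D => ?_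
  rw [Set.image_id, ENNReal.div_le_iff hc₀pos hc₀top]
  set p := coordMap (initSeg ξ D)
  have hQ : IsCompact (p '' K) := hK.image p.continuous
  have hG : Measurable fun y => ENNReal.ofReal (f D (y - p c).ofLp) := by
    refine ENNReal.measurable_ofReal.comp ((hf D).continuous.measurable.comp ?_)
    exact (Continuous.measurable (by fun_prop))
  calc ν ((fun x => x + v) ⁻¹' K) ≤ ν (p ⁻¹' ((fun y => y + p v) ⁻¹' (p '' K))) :=
        measure_mono fun x hx => ⟨x + v, hx, map_add p x v⟩
    _ = ∫⁻ y in (fun y => y + p v) ⁻¹' (p '' K), ENNReal.ofReal (f D (y - p c).ofLp) := by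
        rw [← Measure.map_apply p.measurable ((measurable_add_const _) hQ.measurableSet), hdens,
          withDensity_apply _ ((measurable_add_const _) hQ.measurableSet)]
    _ = ∫⁻ y in (fun y => y + p v) ⁻¹' (p '' K),
          ENNReal.ofReal (f D ((y + p v) - p v - p c).ofLp) := by simp
    _ = ∫⁻ z in p '' K, ENNReal.ofReal (f D (z - p v - p c).ofLp) :=
        (measurePreserving_add_right volume (p v)).setLIntegral_comp_preimage hQ.measurableSet
          (f := fun z => ENNReal.ofReal (f D (z - p v - p c).ofLp))
          (hG.comp (measurable_sub_const (p v)))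
    _ ≤ ∫⁻ z in p '' K, c₀ * ENNReal.ofReal (f D (z - p c).ofLp) := by
        refine setLIntegral_mono' hQ.measurableSet ?_
        rintro _ ⟨k, hk, rfl⟩
        rw [hc₀, ← ENNReal.ofReal_mul (Real.exp_pos _).le]
        refine ENNReal.ofReal_le_ofReal ?_
        have hpv : ‖p v‖ ≤ ‖v‖ := norm_coordMap_le (orthonormal_initSeg ξ D) v
        have h1 := h D (p k - p c) (-p v) (fun j hj => by
          have := hv j hj
          simp only [PiLp.neg_apply, neg_eq_zero]
          exact this) (fun t ht => by
          have e : p k - p c + t • -p v - WithLp.toLp 2 (p x₀ - p c).ofLp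
              = p (k - x₀) - t • p v := by
            rw [map_sub, WithLp.toLp_ofLp, smul_neg]; abel
          rw [e]
          have h2 := norm_sub_le (p (k - x₀)) (t • p v)
          have h3 := norm_coordMap_le (orthonormal_initSeg ξ D) (k - x₀)
          have h4 : ‖k - x₀‖ < ρ / 4 := by
            rw [← dist_eq_norm]; exact hNB (hKN hk)
          have h5 : ‖t • p v‖ ≤ ρ / 4 := by
            rw [norm_smul, Real.norm_eq_abs, abs_of_nonneg ht.1]
            calc t * ‖p v‖ ≤ 1 * ‖p v‖ := mul_le_mul_of_nonneg_right ht.2 (norm_nonneg _)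
              _ ≤ ρ / 4 := by linarith
          change ‖p (k - x₀)‖ ≤ _ at h3
          linarith)
        rw [norm_neg] at h1
        have e : p k - p v - p c = p k - p c + -p v := by abel
        rw [e]
        refine h1.trans (mul_le_mul_of_nonneg_right (Real.exp_le_exp.2 ?_) (hpos _ _).le)
        exact mul_le_mul_of_nonneg_left hpv hL
    _ = c₀ * ∫⁻ z in p '' K, ENNReal.ofReal (f D (z - p c).ofLp) :=
        lintegral_const_mul _ hG
    _ = ν (p ⁻¹' (p '' K)) * c₀ := by
        rw [mul_comm, ← withDensity_apply _ hQ.measurableSet, ← hdens,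
          Measure.map_apply p.measurable hQ.measurableSet]

/-! ### Right inverses along finitely many basis vectors -/

lemma exists_forall_inner_eq_zero_of_mem_span (ξ : HilbertBasis ℕ ℝ H) {x : H}
    (hx : x ∈ Submodule.span ℝ (Set.range ξ)) : ∃ m, ∀ j, m ≤ j → inner ℝ (ξ j) x = 0 := by
  induction hx using Submodule.span_induction with
  | mem x hx =>
    obtain ⟨i, rfl⟩ := hx
    refine ⟨i + 1, fun j hj => ξ.orthonormal.2 (by omega)⟩
  | zero => exact ⟨0, fun j _ => inner_zero_right _⟩
  | add x y _ _ hx hy =>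
    obtain ⟨m, hm⟩ := hx
    obtain ⟨n, hn⟩ := hy
    refine ⟨max m n, fun j hj => ?_⟩
    rw [inner_add_right, hm j (le_of_max_le_left hj), hn j (le_of_max_le_right hj), add_zero]
  | smul c x _ hx =>
    obtain ⟨m, hm⟩ := hx
    exact ⟨m, fun j hj => by rw [inner_smul_right, hm j hj, mul_zero]⟩

/-- The finite linear combinations of basis vectors are dense, so their image under `A` is a dense
subspace of a finite-dimensional space, hence everything. Translations along such a right inverse
are those that tameness controls, and they move the image by a prescribed vector. -/
lemma exists_rightInverse {E : Type*} [NormedAddCommGroup E] [NormedSpace ℝ E]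
    [FiniteDimensional ℝ E] (ξ : HilbertBasis ℕ ℝ H) (A : H →L[ℝ] E)
    (hA : Function.Surjective A) :
    ∃ (m : ℕ) (J : E →L[ℝ] H), (∀ w j, m ≤ j → inner ℝ (ξ j) (J w) = 0) ∧ ∀ w, A (J w) = w := by
  set V := Submodule.span ℝ (Set.range ξ)
  have hV : Dense (V : Set H) := Submodule.dense_iff_topologicalClosure_eq_top.2 ξ.dense_span
  have hmap : V.map A.toLinearMap = ⊤ := by
    have h1 : Dense ((V.map A.toLinearMap : Submodule ℝ E) : Set E) := by
      rw [Submodule.map_coe]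
      exact hA.denseRange.dense_image A.continuous hV
    have h2 : IsClosed ((V.map A.toLinearMap : Submodule ℝ E) : Set E) :=
      Submodule.closed_of_finiteDimensional _
    refine SetLike.coe_injective ?_
    rw [← h2.closure_eq, h1.closure_eq, Submodule.top_coe]
  let b := Module.finBasis ℝ E
  have h1 : ∀ i, ∃ x ∈ V, A x = b i := fun i => by
    have : b i ∈ V.map A.toLinearMap := hmap ▸ Submodule.mem_top
    simpa using this
  choose x hxV hx using h1
  choose m hm using fun i => exists_forall_inner_eq_zero_of_mem_span ξ (hxV i)
  refine ⟨Finset.univ.sup m, (b.constr ℝ x).toContinuousLinearMap, fun w j hj => ?_, fun w => ?_⟩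
  · rw [LinearMap.coe_toContinuousLinearMap', Module.Basis.constr_apply_fintype, inner_sum]
    refine Finset.sum_eq_zero fun i _ => ?_
    rw [inner_smul_right, hm i j ((Finset.le_sup (Finset.mem_univ i)).trans hj), mul_zero]
  · rw [LinearMap.coe_toContinuousLinearMap', Module.Basis.constr_apply_fintype, map_sum]
    simp only [map_smul, hx]
    exact b.sum_equivFun w

/-- An operator whose composition with `J` is close to the identity has a right inverse with the
same range as `J`. -/
lemma exists_rightInverse_of_near {E : Type*} [NormedAddCommGroup E] [NormedSpace ℝ E]
    [FiniteDimensional ℝ E] {J : E →L[ℝ] H} {A' : H →L[ℝ] E}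
    (h : ∀ w, ‖A' (J w) - w‖ ≤ 1 / 2 * ‖w‖) :
    ∃ J' : E →L[ℝ] H, (∀ w, A' (J' w) = w) ∧ (∀ w, ∃ w', J' w = J w') ∧
      ∀ w, ‖J' w‖ ≤ 2 * ‖J‖ * ‖w‖ := by
  have hM : ∀ w, ‖w‖ ≤ 2 * ‖A' (J w)‖ := fun w => by
    have h1 := h w
    have h2 := norm_sub_norm_le w (A' (J w))
    rw [norm_sub_rev] at h2
    linarith
  have hinj : Function.Injective (A' ∘L J).toLinearMap := by
    rw [← LinearMap.ker_eq_bot, LinearMap.ker_eq_bot']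
    intro w hw
    have h1 := hM w
    rw [show A' (J w) = 0 from hw, norm_zero, mul_zero] at h1
    exact norm_le_zero_iff.1 h1
  -- Correcting `J` on the side of `E` by the inverse of `A' ∘ J` leaves its range in the same
  -- finite span, so the index `m` that goes with `J` is preserved.
  let e := LinearEquiv.ofInjectiveEndo _ hinj
  have he : ∀ w, A' (J (e.symm w)) = w := fun w => e.apply_symm_apply w
  refine ⟨J ∘L e.symm.toLinearMap.toContinuousLinearMap, fun w => he w,
    fun w => ⟨e.symm w, rfl⟩, fun w => ?_⟩
  change ‖J (e.symm w)‖ ≤ _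
  have h1 := hM (e.symm w)
  rw [he] at h1
  calc ‖J (e.symm w)‖ ≤ ‖J‖ * ‖e.symm w‖ := J.le_opNorm _
    _ ≤ ‖J‖ * (2 * ‖w‖) := mul_le_mul_of_nonneg_left h1 (norm_nonneg _)
    _ = _ := by ring

/-! ### Finite-dimensional images of a tame measure -/

section Images

variable [MeasurableSpace H] [BorelSpace H] [SecondCountableTopology H]
  {E : Type*} [NormedAddCommGroup E] [NormedSpace ℝ E] [FiniteDimensional ℝ E] [MeasurableSpace E]
  [BorelSpace E]

/-- The images of a tame measure under linear maps with controlled right inverses have uniformly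
bounded densities. -/
lemma exists_density_bound (l : Measure E) [l.IsAddHaarMeasure] {ν : Measure H} [IsFiniteMeasure ν]
    {ξ : HilbertBasis ℕ ℝ H} {A₀ : Set H} (hA₀ : MeasurableSet A₀) {r : ℝ} (hr : 0 < r)
    (ht : TameOn ν ξ (Metric.thickening r A₀) r) (m : ℕ) (c : ℝ) :
    ∃ C : ENNReal, C ≠ ⊤ ∧ ∀ (A' : H →L[ℝ] E) (J : E →L[ℝ] H), (∀ w, A' (J w) = w) →
      (∀ w j, m ≤ j → inner ℝ (ξ j) (J w) = 0) → (∀ w, ‖J w‖ ≤ c * ‖w‖) →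
      ∀ S, MeasurableSet S → ν (A₀ ∩ A' ⁻¹' S) ≤ C * l S := by
  obtain ⟨L, hL, h⟩ := ht m
  -- Small enough that `‖J w‖ ≤ r / 2` on the ball, for every `J` admitted below.
  set s := r / (2 * (|c| + 1)) with hs
  have hc1 : 0 < |c| + 1 := by positivity
  have hspos : 0 < s := by positivity
  set B : Set E := Metric.ball 0 s
  have hBpos : l B ≠ 0 := (Metric.measure_ball_pos l 0 hspos).ne'
  have hBtop : l B ≠ ⊤ := measure_ball_lt_top.ne
  set c₀ := ENNReal.ofReal (Real.exp (L * r))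
  refine ⟨c₀ * ν Set.univ / l B, ENNReal.div_ne_top
    (ENNReal.mul_ne_top ENNReal.ofReal_ne_top (measure_ne_top _ _)) hBpos,
    fun A' J hAJ hJ hJc S hS => ?_⟩
  have hN : MeasurableSet (A₀ ∩ A' ⁻¹' S) := hA₀.inter (A'.measurable hS)
  set N := A₀ ∩ A' ⁻¹' S
  -- Translating by `J w` shifts the image by `w`. Averaging over `w` in a ball and exchanging the
  -- integrals replaces the image measure of `S` by its Lebesgue measure.
  have key : ∀ w ∈ B, ν N ≤ c₀ * ν ((fun x => A' x - w) ⁻¹' S) := by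
    intro w hw
    have hJw : ‖J w‖ ≤ r / 2 := by
      have h1 : ‖w‖ < s := by simpa [B] using hw
      calc ‖J w‖ ≤ c * ‖w‖ := hJc w
        _ ≤ (|c| + 1) * s := mul_le_mul (by linarith [le_abs_self c]) h1.le (norm_nonneg _) hc1.le
        _ = r / 2 := by rw [hs]; field_simp
    have h1 := h (J w) (hJ w) (by linarith) ((fun x => x - J w) ⁻¹' N)
      (measurable_sub_const _ hN) (fun x hx => Metric.mem_thickening_iff.2
        ⟨x - J w, hx.1, by rw [dist_eq_norm, sub_sub_cancel]; linarith⟩)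
    have e : (fun x => x + J w) ⁻¹' ((fun x => x - J w) ⁻¹' N) = N := by
      ext x; simp
    rw [e] at h1
    refine h1.trans (mul_le_mul' (ENNReal.ofReal_le_ofReal (Real.exp_le_exp.2
      (mul_le_mul_of_nonneg_left (by linarith) hL))) (measure_mono fun x hx => ?_))
    have := hx.2
    simp only [Set.mem_preimage, map_sub, hAJ] at this
    exact this
  have hmeas : MeasurableSet {q : E × H | A' q.2 - q.1 ∈ S} :=
    ((A'.measurable.comp measurable_snd).sub measurable_fst) hS
  have h2 : l B * ν N ≤ c₀ * (ν Set.univ * l S) := by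
    calc l B * ν N = ∫⁻ _ in B, ν N ∂l := by rw [setLIntegral_const, mul_comm]
      _ ≤ ∫⁻ w in B, c₀ * ν ((fun x => A' x - w) ⁻¹' S) ∂l :=
          setLIntegral_mono' Metric.isOpen_ball.measurableSet key
      _ ≤ ∫⁻ w, c₀ * ν ((fun x => A' x - w) ⁻¹' S) ∂l := setLIntegral_le_lintegral _ _
      _ = c₀ * ∫⁻ w, ν ((fun x => A' x - w) ⁻¹' S) ∂l :=
          lintegral_const_mul _ (measurable_measure_prodMk_left hmeas)
      _ = c₀ * (l.prod ν) {q : E × H | A' q.2 - q.1 ∈ S} := by rw [Measure.prod_apply hmeas]; rfl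
      _ = c₀ * ∫⁻ x, l ((fun w => A' x - w) ⁻¹' S) ∂ν := by
          rw [Measure.prod_apply_symm hmeas]; rfl
      _ = c₀ * (ν Set.univ * l S) := by
          have : ∀ x, l ((fun w => A' x - w) ⁻¹' S) = l S := fun x =>
            (Measure.measurePreserving_sub_left l (A' x)).measure_preimage hS.nullMeasurableSet
          simp_rw [this]
          rw [lintegral_const, mul_comm (l S)]
  rw [ENNReal.mul_comm_div, ← mul_div_assoc, mul_assoc, ENNReal.le_div_iff_mul_le (Or.inl hBpos)
    (Or.inl hBtop), mul_comm]
  calc l B * ν N ≤ _ := h2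
    _ = _ := by ring

/-- The support fills a neighbourhood of a tame support point: a small ball around `x₀` is carried
into the ball around `x` by a finite-dimensional approximation `v` of `x - x₀`. If the target were
null, quasi-invariance would make the small ball null. -/
lemma measure_ball_pos_of_near_support [CompleteSpace H] {ν : Measure H} {ξ : HilbertBasis ℕ ℝ H}
    {x₀ : H} {r : ℝ} (hr : 0 < r) (ht : TameOn ν ξ (Metric.ball x₀ r) r)
    (hx₀ : ∀ ε > 0, 0 < ν (Metric.ball x₀ ε)) {x : H} (hx : x ∈ Metric.ball x₀ (r / 2))
    {ε : ℝ} (hε : 0 < ε) : 0 < ν (Metric.ball x ε) := by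
  have hx' : ‖x - x₀‖ < r / 2 := by rwa [← dist_eq_norm]
  obtain ⟨m, hm⟩ := (eventually_norm_sub_projL_lt ξ (isCompact_singleton (x := x - x₀))
    (half_pos hε)).exists
  have hm := hm _ rfl
  set v := projL (initSeg ξ m) (x - x₀) with hv
  have hvn : ‖v‖ ≤ ‖x - x₀‖ := norm_projL_le (orthonormal_initSeg ξ m) _
  have hvj : ∀ j, m ≤ j → inner ℝ (ξ j) v = 0 := fun j hj => by
    rw [hv, projL_initSeg, inner_sum]
    refine Finset.sum_eq_zero fun i hi => ?_
    have := Finset.mem_range.1 hi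
    rw [inner_smul_right, ξ.orthonormal.2 (by omega), mul_zero]
  obtain ⟨L, -, h⟩ := ht m
  set e := min (ε / 2) (r / 2) with he
  have hepos : 0 < e := lt_min (half_pos hε) (half_pos hr)
  have h1 := h v hvj (by linarith) (Metric.ball x ε ∩ Metric.ball x₀ r)
    (Metric.isOpen_ball.inter Metric.isOpen_ball).measurableSet Set.inter_subset_right
  have h2 : Metric.ball x₀ e ⊆ (fun y => y + v) ⁻¹' (Metric.ball x ε ∩ Metric.ball x₀ r) := by
    intro y hy
    rw [Metric.mem_ball, dist_eq_norm] at hy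
    simp only [Set.mem_preimage, Set.mem_inter_iff, Metric.mem_ball, dist_eq_norm]
    constructor
    · rw [show y + v - x = (y - x₀) - (x - x₀ - v) by abel]
      have := norm_sub_le (y - x₀) (x - x₀ - v)
      have := min_le_left (ε / 2) (r / 2)
      linarith
    · rw [show y + v - x₀ = (y - x₀) + v by abel]
      have := norm_add_le (y - x₀) v
      have := min_le_right (ε / 2) (r / 2)
      linarith
  by_contra h0
  have h0 : ν (Metric.ball x ε) = 0 := by simpa using h0
  have h3 := (measure_mono h2).trans h1
  rw [measure_mono_null Set.inter_subset_left h0, mul_zero] at h3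
  exact absurd h3 (not_le.2 (hx₀ e hepos))

/-- Near a tame point of the support, the image of the measure charges every set that Lebesgue
measure charges. -/
lemma measure_preimage_inter_ball_pos (l : Measure E) [l.IsAddHaarMeasure] {ν : Measure H}
    [IsFiniteMeasure ν] {ξ : HilbertBasis ℕ ℝ H} {x₀ : H} {r : ℝ} (hr : 0 < r)
    (ht : TameOn ν ξ (Metric.ball x₀ r) r) (hx₀ : ∀ ε > 0, 0 < ν (Metric.ball x₀ ε))
    {A : H →L[ℝ] E} (hA : Function.Surjective A) {M : Set E} (hM : MeasurableSet M)
    (hMpos : ∀ ε > 0, 0 < l (M ∩ Metric.ball (A x₀) ε)) {ε : ℝ} (hε : 0 < ε) :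
    0 < ν (A ⁻¹' M ∩ Metric.ball x₀ ε) := by
  obtain ⟨m, J, hJ, hAJ⟩ := exists_rightInverse ξ A hA
  obtain ⟨L, -, h⟩ := ht m
  by_contra h0
  have h0 : ν (A ⁻¹' M ∩ Metric.ball x₀ ε) = 0 := by simpa using h0
  set e := min ε r with he
  have hepos : 0 < e := lt_min hε hr
  set s := e / (4 * (‖J‖ + 1)) with hs
  have hJ1 : 0 < ‖J‖ + 1 := by positivity
  have hspos : 0 < s := by positivity
  have hJw : ∀ w ∈ Metric.ball (0 : E) s, ‖J w‖ ≤ e / 4 := fun w hw => by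
    have h1 : ‖w‖ < s := by simpa using hw
    calc ‖J w‖ ≤ ‖J‖ * ‖w‖ := J.le_opNorm w
      _ ≤ (‖J‖ + 1) * s := mul_le_mul (by linarith) h1.le (norm_nonneg _) hJ1.le
      _ = e / 4 := by rw [hs]; field_simp
  -- Argument by contradiction: a null preimage of `M` stays null, on a smaller ball, after `M` is
  -- shifted by any small `w`.
  have hnull : ∀ w ∈ Metric.ball (0 : E) s,
      ν (Metric.ball x₀ (e / 4) ∩ (fun x => A x + w) ⁻¹' M) = 0 := by
    intro w hw
    have h1 := h (J w) (hJ w) ((hJw w hw).trans (by linarith [min_le_right ε r]))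
      (A ⁻¹' M ∩ Metric.ball x₀ e) ((A.measurable hM).inter Metric.isOpen_ball.measurableSet)
      (Set.inter_subset_right.trans (Metric.ball_subset_ball (min_le_right _ _)))
    rw [measure_mono_null (Set.inter_subset_inter_right _
      (Metric.ball_subset_ball (min_le_left _ _))) h0, mul_zero, nonpos_iff_eq_zero] at h1
    refine measure_mono_null (fun x hx => ?_) h1
    refine ⟨?_, ?_⟩
    · simpa [hAJ] using hx.2
    · have h2 := Metric.mem_ball.1 hx.1
      rw [dist_eq_norm] at h2
      rw [Metric.mem_ball, dist_eq_norm, show x + J w - x₀ = (x - x₀) + J w by abel]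
      have := norm_add_le (x - x₀) (J w)
      have := hJw w hw
      linarith
  have hmeas : MeasurableSet {q : E × H | A q.2 + q.1 ∈ M} :=
    ((A.measurable.comp measurable_snd).add measurable_fst) hM
  have hprod : ((l.restrict (Metric.ball 0 s)).prod (ν.restrict (Metric.ball x₀ (e / 4))))
      {q : E × H | A q.2 + q.1 ∈ M} = 0 := by
    rw [Measure.prod_apply hmeas, setLIntegral_eq_zero_iff Metric.isOpen_ball.measurableSet
      (measurable_measure_prodMk_left hmeas)]
    refine Eventually.of_forall fun w hw => ?_
    rw [Measure.restrict_apply (measurable_prodMk_left hmeas), Set.inter_comm]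
    exact hnull w hw
  rw [Measure.prod_apply_symm hmeas, lintegral_eq_zero_iff
    (measurable_measure_prodMk_right hmeas)] at hprod
  rw [Filter.EventuallyEq, ae_restrict_iff' Metric.isOpen_ball.measurableSet] at hprod
  set t := min (e / 4) (s / (2 * (‖A‖ + 1))) with htdef
  have hA1 : 0 < ‖A‖ + 1 := by positivity
  have htpos : 0 < t := lt_min (by positivity) (by positivity)
  -- After the integrals are exchanged, almost every `x` near `x₀` has `A x + w ∉ M` for almost all
  -- small `w`. One such `x` exists since the balls around `x₀` have positive mass, and it
  -- contradicts the density of `M` near `A x₀`.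
  obtain ⟨x, hxball, hx⟩ : ∃ x ∈ Metric.ball x₀ t, x ∈ Metric.ball x₀ (e / 4) →
      (l.restrict (Metric.ball 0 s)) ((fun w => (w, x)) ⁻¹' {q : E × H | A q.2 + q.1 ∈ M}) = 0 := by
    by_contra hcon
    push Not at hcon
    refine (hx₀ t htpos).ne' (measure_mono_null (fun x hx => ?_) hprod)
    intro hx'
    exact (hcon x hx).2 (hx' (hcon x hx).1)
  have hx := hx (Metric.ball_subset_ball (min_le_left _ _) hxball)
  rw [Measure.restrict_apply (measurable_prodMk_right hmeas)] at hx
  have h4 : M ∩ Metric.ball (A x₀) (s / 2) ⊆ (fun z => z - A x) ⁻¹'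
      ((fun w => (w, x)) ⁻¹' {q : E × H | A q.2 + q.1 ∈ M} ∩ Metric.ball 0 s) := by
    rintro z ⟨hzM, hz⟩
    refine ⟨by simpa using hzM, ?_⟩
    rw [Metric.mem_ball, dist_eq_norm] at hz hxball
    rw [mem_ball_zero_iff]
    change ‖z - A x‖ < s
    rw [show z - A x = (z - A x₀) - A (x - x₀) by rw [map_sub]; abel]
    have h5 := norm_sub_le (z - A x₀) (A (x - x₀))
    have h6 : ‖A (x - x₀)‖ ≤ s / 2 := by
      calc ‖A (x - x₀)‖ ≤ ‖A‖ * ‖x - x₀‖ := A.le_opNorm _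
        _ ≤ (‖A‖ + 1) * (s / (2 * (‖A‖ + 1))) :=
          mul_le_mul (by linarith) (hxball.le.trans (min_le_right _ _)) (norm_nonneg _) hA1.le
        _ = s / 2 := by field_simp
    linarith
  refine (hMpos (s / 2) (half_pos hspos)).ne' (measure_mono_null h4 ?_)
  rw [(measurePreserving_sub_right l (A x)).measure_preimage
    ((measurable_prodMk_right hmeas).inter Metric.isOpen_ball.measurableSet).nullMeasurableSet]
  exact hx

end Images

/-! ### From the densities of the projections to the measures -/

/-- Expresses the displacement by the truncation errors of the two bases separately, each of which
is uniformly small on compact sets. -/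
lemma norm_sub_le_of_coord_isometry {d : ℕ} {a b : Fin d → H} (hb : Orthonormal ℝ b) {x y : H}
    (h : ‖y - projL a x‖ ≤ ‖projL a x - projL b (projL a x)‖) :
    ‖y - x‖ ≤ 3 * ‖x - projL a x‖ + ‖x - projL b x‖ := by
  have h1 : projL a x - projL b (projL a x) =
      -(x - projL a x) + (x - projL b x) + projL b (x - projL a x) := by rw [map_sub]; abel
  have h2 := norm_projL_le hb (x - projL a x)
  have h3 := norm_add₃_le (a := -(x - projL a x)) (b := x - projL b x)
    (c := projL b (x - projL a x))
  rw [← h1, norm_neg] at h3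
  have h4 := norm_add_le (y - projL a x) (projL a x - x)
  rw [sub_add_sub_cancel, norm_sub_rev (projL a x) x] at h4
  linarith

/-- If, on a cylinder, the density of the projection of `ν'` is dominated by the density of the
projection of `ν` in every large dimension, then `ν'` is dominated by `ν` on the cylinder, although
the projections are onto different subspaces. -/
theorem measure_le_of_density_le [CompleteSpace H] [SecondCountableTopology H] [MeasurableSpace H]
    [BorelSpace H] {E : Type*} [NormedAddCommGroup E] [NormedSpace ℝ E] [FiniteDimensional ℝ E]
    [MeasurableSpace E] [BorelSpace E] (l : Measure E) [l.IsAddHaarMeasure]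
    {ν ν' : Measure H} [IsFiniteMeasure ν] [IsFiniteMeasure ν'] {ξ ξ' : HilbertBasis ℕ ℝ H}
    {F F' : (D : ℕ) → EuclideanSpace ℝ (Fin D) → ℝ} (hF : ∀ D, Continuous (F D))
    (hF' : ∀ D, Continuous (F' D))
    (hν : ∀ D, ν.map (coordMap (initSeg ξ D)) = volume.withDensity fun y => ENNReal.ofReal (F D y))
    (hν' : ∀ D, ν'.map (coordMap (initSeg ξ' D)) =
      volume.withDensity fun y => ENNReal.ofReal (F' D y))
    (htame : ∀ᵐ x ∂ν', x ∈ tamePts ν' ξ') {A : H →L[ℝ] E} (hA : Function.Surjective A)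
    {M : Set E} (hM : MeasurableSet M) {w w' : ℝ} (hw : 0 ≤ w) (hw' : 0 ≤ w') {D₀ : ℕ}
    (hle : ∀ᵐ x ∂ν', A x ∈ M → ∀ D ≥ D₀,
      w' * F' D (coordMap (initSeg ξ' D) x) ≤ w * F D (coordMap (initSeg ξ D) x))
    {S : Set H} (hS : MeasurableSet S) (hSM : S ⊆ A ⁻¹' M) :
    ENNReal.ofReal w' * ν' S ≤ ENNReal.ofReal w * ν S := by
  obtain ⟨m, J, hJ, hAJ⟩ := exists_rightInverse ξ' A hA
  -- The measurable set `M` is replaced by the closed support of Lebesgue measure on it. The two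
  -- differ negligibly, and every neighbourhood of a point of `V` meets `M` in positive measure,
  -- which is what extending an almost everywhere inequality by continuity needs.
  set V : Set E := (l.restrict M).support with hV
  have hVc : IsClosed V := Measure.isClosed_support
  have hVpos : ∀ u ∈ V, ∀ ε > 0, 0 < l (M ∩ Metric.ball u ε) := fun u hu ε hε => by
    have := Measure.mem_support_iff_forall _ |>.1 hu _ (Metric.ball_mem_nhds u hε)
    rwa [Measure.restrict_apply Metric.isOpen_ball.measurableSet, Set.inter_comm] at this
  have hMV : l (M \ V) = 0 := by
    have : (l.restrict M) Vᶜ = 0 := Measure.measure_compl_support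
    rwa [Measure.restrict_apply hVc.measurableSet.compl, Set.inter_comm, ← Set.sdiff_eq] at this
  -- On compact sets of tame points the image under `A` has a density, so Lebesgue null sets are not
  -- charged.
  have hnull : ν' (A ⁻¹' (M \ V) ∩ tamePts ν' ξ') = 0 := by
    have hms : MeasurableSet (A ⁻¹' (M \ V) ∩ tamePts ν' ξ') :=
      (A.measurable (hM.diff hVc.measurableSet)).inter (isOpen_tamePts _ _).measurableSet
    rw [hms.measure_eq_iSup_isCompact]
    simp only [ENNReal.iSup_eq_zero]
    intro K hK hKc
    obtain ⟨r, hr, ht⟩ := exists_tameOn_thickening hKc (hK.trans Set.inter_subset_right)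
    obtain ⟨C, -, hC⟩ := exists_density_bound l hKc.measurableSet hr ht m ‖J‖
    have := hC A J hAJ hJ J.le_opNorm (M \ V) (hM.diff hVc.measurableSet)
    rw [hMV, mul_zero, nonpos_iff_eq_zero] at this
    exact measure_mono_null (fun x hx => Set.mem_inter hx (hK hx).1) this
  set S' := S ∩ (tamePts ν' ξ' ∩ (ν'.support ∩ A ⁻¹' V)) with hS'
  have hS'm : MeasurableSet S' := hS.inter ((isOpen_tamePts _ _).measurableSet.inter
    (Measure.isClosed_support.measurableSet.inter (A.measurable hVc.measurableSet)))
  have hSS' : ν' S ≤ ν' S' := by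
    refine measure_mono_ae ?_
    have h1 : ∀ᵐ x ∂ν', x ∉ A ⁻¹' (M \ V) ∩ tamePts ν' ξ' := measure_eq_zero_iff_ae_notMem.1 hnull
    filter_upwards [h1, htame, Measure.support_mem_ae (μ := ν')] with x h1 h2 h3 hxS
    refine ⟨hxS, h2, h3, ?_⟩
    by_contra hxV
    exact h1 ⟨⟨hSM hxS, hxV⟩, h2⟩
  refine (mul_le_mul_right hSS' _).trans ?_
  rw [hS'm.measure_eq_iSup_isCompact, ENNReal.mul_iSup]
  refine iSup_le fun K => ?_
  rw [ENNReal.mul_iSup]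
  refine iSup_le fun hKS => ?_
  rw [ENNReal.mul_iSup]
  refine iSup_le fun hK => ?_
  refine le_trans ?_ (mul_le_mul_right (measure_mono (hKS.trans Set.inter_subset_left)) _)
  obtain ⟨r, hr, ht⟩ := exists_tameOn_thickening hK fun x hx => (hKS hx).2.1
  obtain ⟨C, hCtop, hC⟩ := exists_density_bound l hK.measurableSet hr ht m (2 * ‖J‖)
  -- `T D x` has the coordinates of `x` in the first basis and their image under the isometry `R D`
  -- in the second.
  choose R T hTa hTb hTn using fun D =>
    exists_coord_isometry (orthonormal_initSeg ξ' D) (orthonormal_initSeg ξ D)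
  have hTunif : ∀ {K : Set H}, IsCompact K → ∀ ε > 0, ∀ᶠ D in atTop, ∀ x ∈ K, ‖T D x - x‖ < ε := by
    intro K hK ε hε
    filter_upwards [eventually_norm_sub_projL_lt ξ' hK (show 0 < ε / 6 by positivity),
      eventually_norm_sub_projL_lt ξ hK (half_pos hε)] with D h1 h2 x hx
    have := norm_sub_le_of_coord_isometry (orthonormal_initSeg ξ D) (hTn D x)
    linarith [h1 x hx, h2 x hx]
  -- the deformed points stay in `A ⁻¹' V`, up to a set of small measure
  have hnear : ∀ᶠ D in atTop, ∀ u, ‖(A ∘L T D) (J u) - u‖ ≤ 1 / 2 * ‖u‖ := by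
    have hA1 : 0 < 2 * (‖A‖ + 1) := by positivity
    filter_upwards [hTunif ((isCompact_closedBall (0 : E) 1).image J.continuous)
      (1 / (2 * (‖A‖ + 1))) (by positivity)] with D hD u
    have h1 : ∀ u ∈ Metric.closedBall (0 : E) 1, ‖(A ∘L T D) (J u) - u‖ ≤ 1 / 2 := by
      intro u hu
      have h2 := hD _ ⟨u, hu, rfl⟩
      have e : (A ∘L T D) (J u) - u = A (T D (J u) - J u) := by
        rw [map_sub, hAJ]; rfl
      rw [e]
      calc ‖A (T D (J u) - J u)‖ ≤ ‖A‖ * ‖T D (J u) - J u‖ := A.le_opNorm _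
        _ ≤ (‖A‖ + 1) * (1 / (2 * (‖A‖ + 1))) :=
          mul_le_mul (by linarith) h2.le (norm_nonneg _) (by positivity)
        _ = 1 / 2 := by field_simp
    rcases eq_or_ne u 0 with rfl | hu
    · simp
    have hu' : 0 < ‖u‖ := norm_pos_iff.2 hu
    have h2 := h1 (‖u‖⁻¹ • u) (by
      rw [mem_closedBall_zero_iff, norm_smul, norm_inv, norm_norm, inv_mul_cancel₀ hu'.ne'])
    rw [map_smul, map_smul, ← smul_sub, norm_smul, norm_inv, norm_norm, inv_mul_le_iff₀ hu'] at h2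
    linarith
  obtain ⟨R₀, hR₀⟩ := (hK.image A.continuous).isBounded.subset_ball (0 : E)
  have hsmall : ∀ η > 0, ∀ᶠ D in atTop, ν' (K \ (T D) ⁻¹' (A ⁻¹' V)) ≤ η := by
    intro η hη
    -- Since `V` is closed, its thin bounded outer layers have small Lebesgue measure. For large `D`
    -- the map `A ∘ T D` still has a right inverse into the same finite span, so a single constant
    -- `C` turns this into small `ν'` measure of the points pushed out of `V`.
    have h1 : Tendsto (fun k : ℕ => l ((Metric.thickening (1 / ((k : ℝ) + 1)) V \ V) ∩
        Metric.ball 0 (R₀ + 1))) atTop (𝓝 0) := by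
      have hanti : Antitone fun k : ℕ => (Metric.thickening (1 / ((k : ℝ) + 1)) V \ V) ∩
          Metric.ball (0 : E) (R₀ + 1) := fun i j hij =>
        Set.inter_subset_inter_left _ (Set.sdiff_subset_sdiff_left (Metric.thickening_mono
          (Nat.one_div_le_one_div hij) _))
      have h2 := tendsto_measure_iInter_atTop (μ := l)
        (fun k => ((Metric.isOpen_thickening.measurableSet.diff hVc.measurableSet).inter
          Metric.isOpen_ball.measurableSet).nullMeasurableSet) hanti
        ⟨0, ((measure_mono Set.inter_subset_right).trans_lt measure_ball_lt_top).ne⟩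
      suffices hempty : ⋂ k : ℕ, (Metric.thickening (1 / ((k : ℝ) + 1)) V \ V) ∩
          Metric.ball (0 : E) (R₀ + 1) = ∅ by
        rw [hempty, measure_empty] at h2
        exact h2
      refine Set.eq_empty_of_forall_notMem fun u hu => ?_
      rw [Set.mem_iInter] at hu
      refine (hu 0).1.2 ?_
      rw [← hVc.closure_eq, Metric.closure_eq_iInter_thickening]
      refine Set.mem_iInter₂.2 fun δ hδ => ?_
      obtain ⟨k, hk⟩ := exists_nat_one_div_lt hδ
      exact Metric.thickening_mono hk.le _ (hu k).1.1
    have h2 := ENNReal.Tendsto.const_mul (a := C) h1 (Or.inr hCtop)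
    rw [mul_zero] at h2
    obtain ⟨k, hk⟩ := (h2.eventually_lt_const hη).exists
    set δ : ℝ := 1 / ((k : ℝ) + 1) with hδ
    have hδpos : 0 < δ := Nat.one_div_pos_of_nat
    have hA1 : 0 < ‖A‖ + 1 := by positivity
    filter_upwards [hnear, hTunif hK (min δ 1 / (‖A‖ + 1)) (by positivity)] with D h3 h4
    obtain ⟨J', hAJ', hJ'J, hJ'n⟩ := exists_rightInverse_of_near h3
    have h5 := hC (A ∘L T D) J' hAJ' (fun u j hj => by
      obtain ⟨u', hu'⟩ := hJ'J u
      rw [hu']; exact hJ u' j hj) hJ'n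
      ((Metric.thickening δ V \ V) ∩ Metric.ball 0 (R₀ + 1))
      ((Metric.isOpen_thickening.measurableSet.diff hVc.measurableSet).inter
          Metric.isOpen_ball.measurableSet)
    refine (measure_mono fun x hx => ?_).trans (h5.trans hk.le)
    have h6 : ‖A (T D x) - A x‖ < min δ 1 := by
      rw [← map_sub]
      have := h4 x hx.1
      rw [lt_div_iff₀ hA1] at this
      calc ‖A (T D x - x)‖ ≤ ‖A‖ * ‖T D x - x‖ := A.le_opNorm _
        _ ≤ ‖T D x - x‖ * (‖A‖ + 1) := by
          rw [mul_comm]; exact mul_le_mul_of_nonneg_left (by linarith) (norm_nonneg _)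
        _ < _ := this
    refine ⟨hx.1, ⟨Metric.mem_thickening_iff.2 ⟨A x, (hKS hx.1).2.2.2, ?_⟩, hx.2⟩, ?_⟩
    · rw [dist_eq_norm]; exact h6.trans_le (min_le_left _ _)
    · have h7 : ‖A x‖ < R₀ := mem_ball_zero_iff.1 (hR₀ ⟨x, hx.1, rfl⟩)
      have h8 := norm_add_le (A (T D x) - A x) (A x)
      rw [sub_add_cancel] at h8
      have := min_le_right δ 1
      rw [mem_ball_zero_iff]
      change ‖A (T D x)‖ < _
      linarith
  -- pointwise inequality at the deformed points
  have hpt : ∀ᶠ D in atTop, ∀ x ∈ K, A (T D x) ∈ V →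
      w' * F' D (coordMap (initSeg ξ' D) x) ≤ w * F D (R D (coordMap (initSeg ξ' D) x)) := by
    filter_upwards [hTunif hK (r / 2) (half_pos hr), eventually_ge_atTop D₀] with D h1 hD x hx hxV
    -- Both sides become densities evaluated at the single point `T D x`, where the hypothesis can
    -- be used in its limiting form.
    rw [← hTb, ← hTa]
    have hball : Metric.ball x r ⊆ Metric.thickening r K := Metric.ball_subset_thickening hx r
    have hTx : T D x ∈ Metric.ball x (r / 2) := by
      rw [Metric.mem_ball, dist_eq_norm]; exact h1 x hx
    have hsuppx : ∀ ε > 0, 0 < ν' (Metric.ball x ε) := fun ε hε =>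
      (Measure.mem_support_iff_forall _).1 (hKS hx).2.2.1 _ (Metric.ball_mem_nhds x hε)
    have hsupp : ∀ ε > 0, 0 < ν' (Metric.ball (T D x) ε) := fun ε hε =>
      measure_ball_pos_of_near_support hr (ht.mono hball le_rfl) hsuppx hTx hε
    have hclosed : IsClosed {y | w' * F' D (coordMap (initSeg ξ' D) y) ≤
        w * F D (coordMap (initSeg ξ D) y)} :=
      isClosed_le (continuous_const.mul ((hF' D).comp (coordMap (initSeg ξ' D)).continuous))
        (continuous_const.mul ((hF D).comp (coordMap (initSeg ξ D)).continuous))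
    change T D x ∈ {y | w' * F' D (coordMap (initSeg ξ' D) y) ≤
        w * F D (coordMap (initSeg ξ D) y)}
    rw [← hclosed.closure_eq]
    refine Metric.mem_closure_iff.2 fun ε hε => ?_
    have h2 := measure_preimage_inter_ball_pos l (half_pos hr)
      (ht.mono ((Metric.ball_subset_ball' (by
        have := Metric.mem_ball.1 hTx; linarith)).trans hball) (by linarith)) hsupp hA hM
      (hVpos _ hxV) hε
    by_contra hcon
    push Not at hcon
    refine h2.ne' (measure_mono_null (fun y hy => ?_) hle)
    intro hy'
    have := hcon y (hy' hy.1 D hD)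
    rw [dist_comm] at this
    exact absurd (Metric.mem_ball.1 hy.2) (not_lt.2 this)
  -- integrate
  have : IsFiniteMeasure (ENNReal.ofReal w • ν) := Measure.smul_finite _ ENNReal.ofReal_ne_top
  change _ ≤ (ENNReal.ofReal w • ν) K
  -- The points pushed out of `A ⁻¹' V` cost at most `η`; the rest of `K` is compared in each large
  -- dimension, and `K` is then recovered from its deformed cylinders.
  have hint : ∀ η > 0, ENNReal.ofReal w' * ν' K - ENNReal.ofReal w' * η ≤
      (ENNReal.ofReal w • ν) K := by
    intro η hη
    refine le_measure_of_projected ξ hK (T := fun D => T D) (fun D => (T D).continuous)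
      (hTunif hK) ?_
    filter_upwards [hpt, hsmall η hη] with D h1 h2
    rw [tsub_le_iff_right]
    set p := coordMap (initSeg ξ D)
    set p' := coordMap (initSeg ξ' D)
    set K' := K ∩ (T D) ⁻¹' (A ⁻¹' V)
    have hK' : IsCompact K' :=
      hK.inter_right ((hVc.preimage A.continuous).preimage (T D).continuous)
    have hQ : IsCompact (p' '' K') := hK'.image p'.continuous
    have hRQ : IsCompact (R D '' (p' '' K')) := hQ.image (R D).continuous
    have h3 : ENNReal.ofReal w' * ν' K' ≤
        (ENNReal.ofReal w • ν) (p ⁻¹' (p '' (T D '' K))) := by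
      calc ENNReal.ofReal w' * ν' K' ≤ ENNReal.ofReal w' * ν' (p' ⁻¹' (p' '' K')) :=
            mul_le_mul_right (measure_mono (Set.subset_preimage_image _ _)) _
        _ = ENNReal.ofReal w' * ∫⁻ y in p' '' K', ENNReal.ofReal (F' D y) := by
            rw [← withDensity_apply _ hQ.measurableSet, ← hν',
              Measure.map_apply p'.measurable hQ.measurableSet]
        _ = ∫⁻ y in p' '' K', ENNReal.ofReal (w' * F' D y) := by
            rw [← lintegral_const_mul _ (hF' D).measurable.ennreal_ofReal]
            simp_rw [ENNReal.ofReal_mul hw']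
        _ ≤ ∫⁻ y in p' '' K', ENNReal.ofReal (w * F D (R D y)) := by
            refine setLIntegral_mono' hQ.measurableSet ?_
            rintro _ ⟨x, hx, rfl⟩
            exact ENNReal.ofReal_le_ofReal (h1 x hx.1 hx.2)
        -- Change of variables by `R D`, which preserves Lebesgue measure. This is why the two
        -- families of coordinates have to be related by an isometry.
        _ = ∫⁻ y in (R D) ⁻¹' (R D '' (p' '' K')), ENNReal.ofReal (w * F D (R D y)) := by
            rw [(R D).injective.preimage_image]
        _ = ∫⁻ z in R D '' (p' '' K'), ENNReal.ofReal (w * F D z) :=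
            (R D).measurePreserving.setLIntegral_comp_preimage hRQ.measurableSet
              (f := fun z => ENNReal.ofReal (w * F D z))
              ((hF D).measurable.const_mul w).ennreal_ofReal
        _ = ENNReal.ofReal w * ∫⁻ z in R D '' (p' '' K'), ENNReal.ofReal (F D z) := by
            rw [← lintegral_const_mul _ (hF D).measurable.ennreal_ofReal]
            simp_rw [ENNReal.ofReal_mul hw]
        _ = (ENNReal.ofReal w • ν) (p ⁻¹' (R D '' (p' '' K'))) := by
            rw [← withDensity_apply _ hRQ.measurableSet, ← hν,
              Measure.map_apply p.measurable hRQ.measurableSet, Measure.smul_apply, smul_eq_mul]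
        _ ≤ _ := by
            refine measure_mono (Set.preimage_mono ?_)
            rintro _ ⟨_, ⟨x, hx, rfl⟩, rfl⟩
            exact ⟨T D x, ⟨x, hx.1, rfl⟩, hTb D x⟩
    calc ENNReal.ofReal w' * ν' K
        ≤ ENNReal.ofReal w' * (ν' K' + ν' (K \ (T D) ⁻¹' (A ⁻¹' V))) := by
          refine mul_le_mul_right ?_ _
          rw [← Set.inter_union_sdiff K ((T D) ⁻¹' (A ⁻¹' V))]
          refine (measure_union_le _ _).trans_eq ?_
          rw [Set.inter_union_sdiff]
      _ ≤ _ := by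
          rw [mul_add]
          exact add_le_add h3 (mul_le_mul_right h2 _)
  refine ENNReal.le_of_forall_pos_le_add fun ε hε _ => ?_
  have h1 := hint (ε / (ENNReal.ofReal w' + 1)) (ENNReal.div_pos (by simpa using hε.ne')
    (by simp))
  rw [tsub_le_iff_right] at h1
  refine h1.trans (add_le_add le_rfl ?_)
  calc ENNReal.ofReal w' * (ε / (ENNReal.ofReal w' + 1))
      ≤ (ENNReal.ofReal w' + 1) * (ε / (ENNReal.ofReal w' + 1)) :=
        mul_le_mul_left le_self_add _
    _ = ε := ENNReal.mul_div_cancel (by simp) (by simp)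

/-! ### Regular laws -/

section Law

variable [MeasurableSpace H] [BorelSpace H]

lemma pcs_eq (ν : Measure H) (ξ : HilbertBasis ℕ ℝ H) (d : ℕ) (x : H) :
    pcs ν ξ d x =
      (coordMap (initSeg ξ d) x - coordMap (initSeg ξ d) (meanVec ν)).ofLp := by
  funext j
  simp [pcs, inner_sub_left, initSeg, real_inner_comm]

/-- The density of the first `D` uncentered coordinates. -/
def coordDensity (ν : Measure H) (ξ : HilbertBasis ℕ ℝ H) (f : (d : ℕ) → (Fin d → ℝ) → ℝ)
    (D : ℕ) (y : EuclideanSpace ℝ (Fin D)) : ℝ :=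
  f D (y - coordMap (initSeg ξ D) (meanVec ν)).ofLp

lemma coordDensity_coordMap (ν : Measure H) (ξ : HilbertBasis ℕ ℝ H)
    (f : (d : ℕ) → (Fin d → ℝ) → ℝ) (D : ℕ) (x : H) :
    coordDensity ν ξ f D (coordMap (initSeg ξ D) x) = f D (pcs ν ξ D x) := by
  rw [pcs_eq]; rfl

lemma IsRegularLaw.continuous_coordDensity {ν : Measure H} {ξ : HilbertBasis ℕ ℝ H} {lam : ℕ → ℝ}
    {f : (d : ℕ) → (Fin d → ℝ) → ℝ} (h : IsRegularLaw ν ξ lam f) (D : ℕ) :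
    Continuous (coordDensity ν ξ f D) :=
  (h.smooth D).continuous.comp (by fun_prop)

lemma measurable_pcs (ν : Measure H) (ξ : HilbertBasis ℕ ℝ H) (d : ℕ) :
    Measurable (pcs ν ξ d) := by
  have : pcs ν ξ d = fun x =>
      (coordMap (initSeg ξ d) x - coordMap (initSeg ξ d) (meanVec ν)).ofLp :=
    funext (pcs_eq ν ξ d)
  rw [this]
  exact Continuous.measurable (by fun_prop)

/-- Removing the centering is a translation of the coordinates. Uncentered coordinates are linear in
the point, so laws with different means are treated by the same maps. -/
lemma IsRegularLaw.map_coordMap {ν : Measure H} {ξ : HilbertBasis ℕ ℝ H} {lam : ℕ → ℝ}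
    {f : (d : ℕ) → (Fin d → ℝ) → ℝ} (h : IsRegularLaw ν ξ lam f) (D : ℕ) :
    ν.map (coordMap (initSeg ξ D)) =
      volume.withDensity fun y => ENNReal.ofReal (coordDensity ν ξ f D y) := by
  set c := coordMap (initSeg ξ D) (meanVec ν)
  let T : (Fin D → ℝ) → EuclideanSpace ℝ (Fin D) := fun t => WithLp.toLp 2 t + c
  have hT : MeasurePreserving T volume volume :=
    (measurePreserving_add_right volume c).comp (PiLp.volume_preserving_toLp (Fin D))
  have e : (coordMap (initSeg ξ D) : H → _) = T ∘ pcs ν ξ D := by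
    funext x
    simp only [Function.comp_apply, T, pcs_eq, WithLp.toLp_ofLp, c]
    abel
  rw [e, ← Measure.map_map hT.measurable (measurable_pcs ν ξ D), h.density]
  ext s hs
  rw [Measure.map_apply hT.measurable hs, withDensity_apply _ (hT.measurable hs),
    withDensity_apply _ hs, ← hT.setLIntegral_comp_preimage hs
      (f := fun y => ENNReal.ofReal (coordDensity ν ξ f D y))
      (h.continuous_coordDensity D).measurable.ennreal_ofReal]
  have : ∀ t, coordDensity ν ξ f D (T t) = f D t := fun t => by
    simp [coordDensity, T, c]
  simp_rw [this]

variable [CompleteSpace H] [SecondCountableTopology H]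

lemma integrable_inner_smul {ν : Measure H} [IsFiniteMeasure ν] (h2 : MemLp (fun x : H => x) 2 ν)
    (c v : H) : Integrable (fun x : H => inner ℝ (x - c) v • (x - c)) ν := by
  have h : MemLp (fun x : H => x - c) 2 ν := h2.sub (memLp_const c)
  refine (h.norm.integrable_sq.const_mul ‖v‖).mono'
    (Continuous.aestronglyMeasurable (by fun_prop)) (Eventually.of_forall fun x => ?_)
  rw [norm_smul]
  have := norm_inner_le_norm (𝕜 := ℝ) (x - c) v
  calc ‖inner ℝ (x - c) v‖ * ‖x - c‖ ≤ ‖x - c‖ * ‖v‖ * ‖x - c‖ :=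
        mul_le_mul_of_nonneg_right this (norm_nonneg _)
    _ = ‖v‖ * ‖x - c‖ ^ 2 := by ring

/-- A vanishing eigenvalue would confine a principal component to `0` almost surely, hence its joint
law with the preceding ones to a hyperplane, although that law has a density. Without it the second
derivative condition would say nothing in that direction. -/
lemma IsRegularLaw.eigenvalue_ne_zero {ν : Measure H} [IsProbabilityMeasure ν]
    {ξ : HilbertBasis ℕ ℝ H} {lam : ℕ → ℝ} {f : (d : ℕ) → (Fin d → ℝ) → ℝ}
    (h : IsRegularLaw ν ξ lam f) (hξ : IsKLBasis ν ξ lam) (h2 : MemLp (fun x : H => x) 2 ν)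
    (i : ℕ) : lam i ≠ 0 := by
  intro h0
  have h1 : covOp ν (ξ i) = 0 := by rw [hξ.eigen, h0, zero_smul]
  have hint := integrable_inner_smul h2 (meanVec ν) (ξ i)
  have h3 : ∫ x, inner ℝ (x - meanVec ν) (ξ i) * inner ℝ (x - meanVec ν) (ξ i) ∂ν = (0 : ℝ) := by
    have h4 : inner ℝ (ξ i) (covOp ν (ξ i)) = (0 : ℝ) := by rw [h1, inner_zero_right]
    rw [covOp, ← integral_inner hint] at h4
    simpa [inner_smul_right, real_inner_comm] using h4
  have hint' : Integrable
      (fun x => inner ℝ (x - meanVec ν) (ξ i) * inner ℝ (x - meanVec ν) (ξ i)) ν := by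
    have := hint.const_inner (𝕜 := ℝ) (ξ i)
    simpa [inner_smul_right, real_inner_comm] using this
  rw [integral_eq_zero_iff_of_nonneg (fun x => mul_self_nonneg _) hint'] at h3
  have hset : MeasurableSet {t : Fin (i + 1) → ℝ | t (Fin.last i) = 0} :=
    measurableSet_eq_fun (measurable_pi_apply _) measurable_const
  have h5 : ν.map (pcs ν ξ (i + 1)) {t | t (Fin.last i) = 0}ᶜ = 0 := by
    rw [Measure.map_apply (measurable_pcs _ _ _) hset.compl]
    refine measure_mono_null (fun x hx => ?_) h3
    intro hx'
    exact hx (by simpa [pcs] using hx')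
  have h6 : ν.map (pcs ν ξ (i + 1)) {t | t (Fin.last i) = 0} = 0 := by
    rw [h.density]
    refine withDensity_absolutelyContinuous _ _ ?_
    have := Measure.addHaar_affineSubspace (volume : Measure (Fin (i + 1) → ℝ))
      (LinearMap.ker (LinearMap.proj (R := ℝ) (φ := fun _ : Fin (i + 1) => ℝ)
        (Fin.last i))).toAffineSubspace (fun htop => by
          have h7 : (Pi.single (Fin.last i) 1 : Fin (i + 1) → ℝ) ∈
            (LinearMap.ker (LinearMap.proj (R := ℝ) (φ := fun _ : Fin (i + 1) => ℝ)
              (Fin.last i))).toAffineSubspace := htop ▸ AffineSubspace.mem_top ℝ _ _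
          simp at h7)
    exact this
  have h8 : IsProbabilityMeasure (ν.map (pcs ν ξ (i + 1))) :=
    Measure.isProbabilityMeasure_map (measurable_pcs _ _ _).aemeasurable
  have h9 := measure_univ (μ := ν.map (pcs ν ξ (i + 1)))
  rw [← Set.union_compl_self {t : Fin (i + 1) → ℝ | t (Fin.last i) = 0}] at h9
  have := (measure_union_le (μ := ν.map (pcs ν ξ (i + 1)))
    {t : Fin (i + 1) → ℝ | t (Fin.last i) = 0} {t | t (Fin.last i) = 0}ᶜ)
  rw [h9, h5, h6] at this
  simp at this

lemma IsRegularLaw.ae_mem_tamePts {ν : Measure H} [IsProbabilityMeasure ν]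
    {ξ : HilbertBasis ℕ ℝ H} {lam : ℕ → ℝ} {f : (d : ℕ) → (Fin d → ℝ) → ℝ}
    (h : IsRegularLaw ν ξ lam f) (hξ : IsKLBasis ν ξ lam) (h2 : MemLp (fun x : H => x) 2 ν) :
    ∀ᵐ x ∂ν, x ∈ tamePts ν ξ := by
  filter_upwards [h.secondDeriv] with x ⟨C, hC, ρ, hρ, hb⟩
  refine mem_tamePts_of_secondDeriv h.smooth h.pos (c := meanVec ν) h.map_coordMap
    (h.eigenvalue_ne_zero hξ h2) hC hρ fun d i j ϑ hϑ => hb d i j ϑ ?_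
  rwa [pcs_eq]

end Law

/-! ### Group laws -/

section Group

variable {Ω : Type*} [MeasurableSpace Ω] [MeasurableSpace H] {G : ℕ} {P : Measure Ω}
  [IsProbabilityMeasure P] {X : Ω → H} {Y : Ω → Fin G}

lemma ofReal_mul_groupLaw (hX : Measurable X) (hY : Measurable Y)
    {g : Fin G} (hg : 0 < P.real (Y ⁻¹' {g})) {S : Set H} (hS : MeasurableSet S) :
    ENNReal.ofReal (P.real (Y ⁻¹' {g})) * groupLaw P X Y g S = P (Y ⁻¹' {g} ∩ X ⁻¹' S) := by
  rw [groupLaw, Measure.map_apply hX hS, cond_apply (hY (measurableSet_singleton g)),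
    ofReal_measureReal, ← mul_assoc, ENNReal.mul_inv_cancel, one_mul]
  · intro h0; simp [measureReal_def, h0] at hg
  · exact measure_ne_top _ _

lemma isProbabilityMeasure_groupLaw (hX : Measurable X) {g : Fin G}
    (hg : 0 < P.real (Y ⁻¹' {g})) : IsProbabilityMeasure (groupLaw P X Y g) := by
  have : IsProbabilityMeasure (P[|Y ⁻¹' {g}]) :=
    cond_isProbabilityMeasure fun h0 => by simp [measureReal_def, h0] at hg
  exact Measure.isProbabilityMeasure_map hX.aemeasurable

lemma groupLaw_absolutelyContinuous (hX : Measurable X) (g : Fin G) :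
    groupLaw P X Y g ≪ P.map X :=
  cond_absolutelyContinuous.map hX

lemma memLp_groupLaw [BorelSpace H] [SecondCountableTopology H] (hX : Measurable X)
    (hX2 : MemLp X 2 P) (g : Fin G) : MemLp (fun x : H => x) 2 (groupLaw P X Y g) := by
  refine (memLp_map_measure_iff (g := fun x : H => x) aestronglyMeasurable_id hX.aemeasurable).2 ?_
  change MemLp X 2 (ProbabilityTheory.cond P (Y ⁻¹' {g}))
  rw [ProbabilityTheory.cond]
  by_cases h0 : P (Y ⁻¹' {g}) = 0
  · rw [Measure.restrict_eq_zero.2 h0, smul_zero]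
    exact memLp_measure_zero
  · exact (hX2.restrict _).smul_measure (ENNReal.inv_ne_top.2 h0)

end Group

/-! ### Optimality of the surrogate Bayes rule -/

/-- Applied to the leading vectors of all the groups at once: the surrogate rule in dimension `d`
then depends on `x` only through one surjective linear map into a finite-dimensional space. -/
lemma exists_orthonormal_projL_eq {ι : Type*} [Finite ι] (v : ι → H) :
    ∃ (k : ℕ) (e : Fin k → H), Orthonormal ℝ e ∧ ∀ i, projL e (v i) = v i := by
  have : FiniteDimensional ℝ (Submodule.span ℝ (Set.range v)) :=
    FiniteDimensional.span_of_finite ℝ (Set.finite_range v)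
  set U := Submodule.span ℝ (Set.range v)
  let b := stdOrthonormalBasis ℝ U
  refine ⟨_, fun i => (b i : H), b.orthonormal.comp_linearIsometry U.subtypeₗᵢ, fun i => ?_⟩
  have h := congrArg (Subtype.val) (b.sum_repr' ⟨v i, Submodule.subset_span ⟨i, rfl⟩⟩)
  simpa [projL_apply, proj] using h

section Bayes

variable [MeasurableSpace H] {G : ℕ}

lemma argmaxSet_nonempty (hG : 0 < G) (s : Fin G → ℝ) : (argmaxSet s).Nonempty := by
  have : Nonempty (Fin G) := ⟨⟨0, hG⟩⟩
  obtain ⟨g, hg⟩ := Finite.exists_max s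
  exact ⟨g, hg⟩

lemma pcs_projL {k D : ℕ} {e : Fin k → H} {ξ : HilbertBasis ℕ ℝ H} (ν : Measure H)
    (h : ∀ j : Fin D, projL e (ξ j) = ξ j) (x : H) : pcs ν ξ D (projL e x) = pcs ν ξ D x := by
  funext j
  simp only [pcs, inner_sub_left, inner_projL_left, h]

variable [BorelSpace H]

lemma measurableSet_mem_surrogateBayes {w : Fin G → ℝ} {ν : Fin G → Measure H}
    {ξ : Fin G → HilbertBasis ℕ ℝ H} {lam : Fin G → ℕ → ℝ}
    {f : Fin G → (d : ℕ) → (Fin d → ℝ) → ℝ} (hreg : ∀ g, IsRegularLaw (ν g) (ξ g) (lam g) (f g))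
    (d : ℕ) (g : Fin G) : MeasurableSet {x | g ∈ surrogateBayes w ν ξ f d x} := by
  have he : {x | g ∈ surrogateBayes w ν ξ f d x} = ⋂ g', {x | w g' * f g' d (pcs (ν g') (ξ g') d x) ≤
      w g * f g d (pcs (ν g) (ξ g) d x)} := by
    ext x; simp [surrogateBayes, argmaxSet]
  rw [he]
  have hm : ∀ g, Measurable fun x => w g * f g d (pcs (ν g) (ξ g) d x) := fun g =>
    (((hreg g).smooth d).continuous.measurable.comp (measurable_pcs _ _ _)).const_mul _
  exact MeasurableSet.iInter fun g' => measurableSet_le (hm g') (hm g)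

variable [CompleteSpace H] [SecondCountableTopology H]

/-- Stability in the dimension turns maximality of `g` in dimension `d` into an inequality between
the weighted densities in every larger dimension, and `measure_le_of_density_le` converts it into
one between the weighted laws. -/
lemma mul_measure_le_of_subset_surrogateBayes {w : Fin G → ℝ} (hw : ∀ g, 0 ≤ w g)
    {ν : Fin G → Measure H} [∀ g, IsProbabilityMeasure (ν g)]
    {ξ : Fin G → HilbertBasis ℕ ℝ H} {lam : Fin G → ℕ → ℝ}
    {f : Fin G → (d : ℕ) → (Fin d → ℝ) → ℝ} (h2 : ∀ g, MemLp (fun x : H => x) 2 (ν g))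
    (hξ : ∀ g, IsKLBasis (ν g) (ξ g) (lam g))
    (hreg : ∀ g, IsRegularLaw (ν g) (ξ g) (lam g) (f g)) {d : ℕ}
    (hstab : ∀ g, ∀ᵐ x ∂(ν g), ∀ d' ≥ d,
      surrogateBayes w ν ξ f d' x = surrogateBayes w ν ξ f d x)
    {g g' : Fin G} {S : Set H} (hS : MeasurableSet S)
    (hSg : S ⊆ {x | g ∈ surrogateBayes w ν ξ f d x}) :
    ENNReal.ofReal (w g') * ν g' S ≤ ENNReal.ofReal (w g) * ν g S := by
  obtain ⟨k, e, he, hfix⟩ := exists_orthonormal_projL_eq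
    (fun p : Fin G × Fin d => ξ p.1 p.2)
  have hsur : ∀ x, surrogateBayes w ν ξ f d (projL e x) = surrogateBayes w ν ξ f d x := fun x => by
    have hp : ∀ g, pcs (ν g) (ξ g) d (projL e x) = pcs (ν g) (ξ g) d x := fun g =>
      pcs_projL (ν g) (ξ := ξ g) (fun j => hfix (g, j)) x
    simp only [surrogateBayes, hp]
  obtain ⟨M, hMdef⟩ : ∃ M : Set (EuclideanSpace ℝ (Fin k)),
      M = {t | g ∈ surrogateBayes w ν ξ f d (synth e t)} := ⟨_, rfl⟩
  have hM : MeasurableSet M := by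
    rw [hMdef]
    exact (synth e).measurable (measurableSet_mem_surrogateBayes hreg d g)
  have hmem : ∀ x, coordMap e x ∈ M ↔ g ∈ surrogateBayes w ν ξ f d x := fun x => by
    rw [hMdef, ← hsur x]; rfl
  have hsurj : Function.Surjective (coordMap e) := fun t => ⟨synth e t, coordMap_synth he t⟩
  have hle : ∀ᵐ x ∂(ν g'), coordMap e x ∈ M → ∀ D ≥ d,
      w g' * coordDensity (ν g') (ξ g') (f g') D (coordMap (initSeg (ξ g') D) x) ≤
        w g * coordDensity (ν g) (ξ g) (f g) D (coordMap (initSeg (ξ g) D) x) := by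
    filter_upwards [hstab g'] with x hx hxM D hD
    rw [coordDensity_coordMap, coordDensity_coordMap]
    rw [hmem, ← hx D hD] at hxM
    exact hxM g'
  exact measure_le_of_density_le volume (hreg g).continuous_coordDensity
    (hreg g').continuous_coordDensity (hreg g).map_coordMap (hreg g').map_coordMap
    ((hreg g').ae_mem_tamePts (hξ g') (h2 g')) hsurj hM (hw g) (hw g') hle hS
    fun x hx => (hmem x).2 (hSg hx)

end Bayes

/-! ### Error probabilities and the excess risk -/

section Error

variable {Ω : Type*} [MeasurableSpace Ω] [MeasurableSpace H] {G : ℕ} {P : Measure Ω}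
  [IsProbabilityMeasure P] {X : Ω → H} {Y : Ω → Fin G}

lemma errorProb_eq (hX : Measurable X) (hY : Measurable Y) {c : H → Fin G} (hc : Measurable c) :
    errorProb P X Y c = 1 - ∑ g, P.real (Y ⁻¹' {g} ∩ X ⁻¹' (c ⁻¹' {g})) := by
  have hm : MeasurableSet {ω | c (X ω) = Y ω} := measurableSet_eq_fun (hc.comp hX) hY
  have h1 : {ω | c (X ω) ≠ Y ω} = {ω | c (X ω) = Y ω}ᶜ := rfl
  have h2 : {ω | c (X ω) = Y ω} = ⋃ g, (Y ⁻¹' {g} ∩ X ⁻¹' (c ⁻¹' {g})) := by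
    ext ω; simp
  have hms : ∀ g, MeasurableSet (Y ⁻¹' {g} ∩ X ⁻¹' (c ⁻¹' {g})) := fun g =>
    (hY (measurableSet_singleton g)).inter (hX (hc (measurableSet_singleton g)))
  rw [errorProb, h1, probReal_compl_eq_one_sub hm, h2, measureReal_iUnion_fintype _ hms]
  intro g g' hgg'
  exact Set.disjoint_left.2 fun ω h h' => hgg' (h.1.symm.trans h'.1)

lemma bddBelow_errorProb :
    BddBelow (Set.range fun γ : {γ : H → Fin G // Measurable γ} =>
      P.real {ω | γ.1 (X ω) ≠ Y ω}) :=
  ⟨0, by rintro _ ⟨γ, rfl⟩; exact measureReal_nonneg⟩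

lemma bayesError_le {c : H → Fin G} (hc : Measurable c) :
    bayesError P X Y ≤ errorProb P X Y c :=
  ciInf_le bddBelow_errorProb (⟨c, hc⟩ : {γ : H → Fin G // Measurable γ})

variable [BorelSpace H] [CompleteSpace H] [SecondCountableTopology H]
  {ξ : Fin G → HilbertBasis ℕ ℝ H} {lam : Fin G → ℕ → ℝ} {f : Fin G → (d : ℕ) → (Fin d → ℝ) → ℝ}

/-- The probabilities of a correct decision of `c` and of a competitor `γ` are split over the cells
`c = g, γ = g'`. There they are the weighted laws of groups `g` and `g'`, and `g` is in the
surrogate Bayes set. -/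
lemma errorProb_eq_bayesError (hX : Measurable X) (hY : Measurable Y) (hX2 : MemLp X 2 P)
    (hYpos : ∀ g, 0 < P.real (Y ⁻¹' {g}))
    (hξ : ∀ g, IsKLBasis (groupLaw P X Y g) (ξ g) (lam g))
    (hreg : ∀ g, IsRegularLaw (groupLaw P X Y g) (ξ g) (lam g) (f g)) {d : ℕ}
    (hstab : ∀ᵐ x ∂(P.map X), ∀ d' ≥ d,
      surrogateBayes (fun g => P.real (Y ⁻¹' {g})) (groupLaw P X Y) ξ f d' x =
        surrogateBayes (fun g => P.real (Y ⁻¹' {g})) (groupLaw P X Y) ξ f d x)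
    {c : H → Fin G} (hc : Measurable c)
    (hcs : ∀ x, c x ∈ surrogateBayes (fun g => P.real (Y ⁻¹' {g})) (groupLaw P X Y) ξ f d x) :
    errorProb P X Y c = bayesError P X Y := by
  have := fun g => isProbabilityMeasure_groupLaw hX (hYpos g)
  have hne : Nonempty {γ : H → Fin G // Measurable γ} := ⟨⟨c, hc⟩⟩
  refine le_antisymm (le_ciInf fun γ => ?_) (bayesError_le hc)
  change _ ≤ errorProb P X Y γ.1
  rw [errorProb_eq hX hY hc, errorProb_eq hX hY γ.2]
  have hsplit : ∀ (a b : H → Fin G), Measurable b → ∀ g, P.real (Y ⁻¹' {g} ∩ X ⁻¹' (a ⁻¹' {g})) =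
      ∑ g', P.real (Y ⁻¹' {g} ∩ X ⁻¹' (a ⁻¹' {g} ∩ b ⁻¹' {g'})) := fun a b hb g => by
    have h := sum_measureReal_preimage_singleton (μ := P.restrict (Y ⁻¹' {g} ∩ X ⁻¹' (a ⁻¹' {g})))
      (f := b ∘ X) (Finset.univ) (fun g' _ => (hb.comp hX) (measurableSet_singleton g'))
    simp only [Finset.coe_univ, Set.preimage_univ, measureReal_restrict_apply_univ] at h
    rw [← h]
    refine Finset.sum_congr rfl fun g' _ => ?_
    rw [measureReal_restrict_apply ((hb.comp hX) (measurableSet_singleton g'))]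
    congr 1
    ext ω; simp; tauto
  rw [sub_le_sub_iff_left, Finset.sum_congr rfl fun g _ => hsplit γ.1 c hc g,
    Finset.sum_congr rfl fun g _ => hsplit c γ.1 γ.2 g, Finset.sum_comm]
  refine Finset.sum_le_sum fun g _ => Finset.sum_le_sum fun g' _ => ?_
  have hS : MeasurableSet (c ⁻¹' {g} ∩ γ.1 ⁻¹' {g'}) :=
    (hc (measurableSet_singleton g)).inter (γ.2 (measurableSet_singleton g'))
  have key := mul_measure_le_of_subset_surrogateBayes (w := fun g => P.real (Y ⁻¹' {g}))
    (fun g => measureReal_nonneg) (memLp_groupLaw hX hX2) hξ hreg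
    (fun g => (groupLaw_absolutelyContinuous hX g).ae_le hstab) (g := g) (g' := g') hS
    (fun x hx => by have := hcs x; rwa [hx.1] at this)
  rw [ofReal_mul_groupLaw hX hY (hYpos g) hS, ofReal_mul_groupLaw hX hY (hYpos g') hS] at key
  rw [Set.inter_comm (γ.1 ⁻¹' {g'})]
  exact ENNReal.toReal_mono (measure_ne_top _ _) key

/-- The excess risk of a rule is at most the probability of leaving the surrogate Bayes set. -/
theorem errorProb_le_bayesError_add (hX : Measurable X) (hY : Measurable Y) (hX2 : MemLp X 2 P)
    (hYpos : ∀ g, 0 < P.real (Y ⁻¹' {g}))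
    (hξ : ∀ g, IsKLBasis (groupLaw P X Y g) (ξ g) (lam g))
    (hreg : ∀ g, IsRegularLaw (groupLaw P X Y g) (ξ g) (lam g) (f g)) {d : ℕ}
    (hstab : ∀ᵐ x ∂(P.map X), ∀ d' ≥ d,
      surrogateBayes (fun g => P.real (Y ⁻¹' {g})) (groupLaw P X Y) ξ f d' x =
        surrogateBayes (fun g => P.real (Y ⁻¹' {g})) (groupLaw P X Y) ξ f d x)
    {c : H → Fin G} (hc : Measurable c) :
    errorProb P X Y c ≤ bayesError P X Y + (P.map X).real
      {x | c x ∉ surrogateBayes (fun g => P.real (Y ⁻¹' {g})) (groupLaw P X Y) ξ f d x} := by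
  classical
  set s := surrogateBayes (fun g => P.real (Y ⁻¹' {g})) (groupLaw P X Y) ξ f d with hs
  have hmem : ∀ g, MeasurableSet {x | g ∈ s x} := measurableSet_mem_surrogateBayes hreg d
  have hex : ∀ x, ∃ k : ℕ, ∃ hk : k < G, (⟨k, hk⟩ : Fin G) ∈ s x := fun x => by
    obtain ⟨g, hg⟩ := argmaxSet_nonempty (c x).pos _
    exact ⟨g, g.2, hg⟩
  -- The smallest index in the surrogate set, chosen to have a measurable selection.
  let b : H → Fin G := fun x => ⟨Nat.find (hex x), (Nat.find_spec (hex x)).1⟩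
  have hb : Measurable b := by
    refine measurable_to_countable' fun g => ?_
    have : b ⁻¹' {g} = (fun x => Nat.find (hex x)) ⁻¹' {(g : ℕ)} := by
      ext x; simp [b, Fin.ext_iff]
    rw [this]
    refine measurable_find hex (fun k => ?_) (measurableSet_singleton _)
    by_cases hk : k < G
    · simpa [hk] using hmem ⟨k, hk⟩
    · simp [hk]
  have hbs : ∀ x, b x ∈ s x := fun x => (Nat.find_spec (hex x)).2
  have hgood : MeasurableSet {x | c x ∈ s x} := by
    have : {x | c x ∈ s x} = ⋃ g, (c ⁻¹' {g} ∩ {x | g ∈ s x}) := by ext x; simp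
    rw [this]
    exact MeasurableSet.iUnion fun g => (hc (measurableSet_singleton g)).inter (hmem g)
  -- The rule is corrected where it leaves the surrogate set. The corrected rule is optimal, and the
  -- two rules disagree only where the correction took place.
  let c' : H → Fin G := fun x => if c x ∈ s x then c x else b x
  have hc' : Measurable c' := Measurable.ite hgood hc hb
  have hc's : ∀ x, c' x ∈ s x := fun x => by
    by_cases h : c x ∈ s x
    · simp only [c', h, if_true]
    · simpa [c', h] using hbs x
  rw [← errorProb_eq_bayesError hX hY hX2 hYpos hξ hreg hstab hc' hc's]
  change _ ≤ _ + (P.map X).real {x | c x ∈ s x}ᶜ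
  rw [map_measureReal_apply hX hgood.compl]
  refine (measureReal_mono ?_).trans (measureReal_union_le _ _)
  intro ω hω
  by_cases h : c (X ω) ∈ s (X ω)
  · left
    simpa [c', h] using hω
  · exact Or.inr h

end Error

/-! ### Perturbation of spectral projections -/

/-- `e` spans an eigenspace of `A` on which `A ≥ α`, while `A ≤ β` on its orthogonal complement. -/
structure SpectralSplit {d : ℕ} (A : H →L[ℝ] H) (e : Fin d → H) (α β : ℝ) : Prop where
  orthonormal : Orthonormal ℝ e
  eigen : ∃ l : Fin d → ℝ, (∀ j, A (e j) = l j • e j) ∧ ∀ j, α ≤ l j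
  rayleigh : ∀ v, (∀ j, inner ℝ (e j) v = 0) → inner ℝ (A v) v ≤ β * ‖v‖ ^ 2

lemma SpectralSplit.mono {d : ℕ} {A : H →L[ℝ] H} {e : Fin d → H} {α β α' β' : ℝ}
    (h : SpectralSplit A e α β) (hα : α' ≤ α) (hβ : β ≤ β') : SpectralSplit A e α' β' where
  orthonormal := h.orthonormal
  eigen := by
    obtain ⟨l, hl, hl'⟩ := h.eigen
    exact ⟨l, hl, fun j => hα.trans (hl' j)⟩
  rayleigh v hv := (h.rayleigh v hv).trans (mul_le_mul_of_nonneg_right hβ (sq_nonneg _))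

lemma inner_sub_projL {d : ℕ} {e : Fin d → H} (he : Orthonormal ℝ e) (x : H) (j : Fin d) :
    inner ℝ (e j) (x - projL e x) = (0 : ℝ) := by
  rw [inner_sub_right, ← coordMap_apply, ← coordMap_apply, coordMap_projL he, sub_self]

/-- The residual `w = e j - projL e' (e j)` lies in the complement of the span of `e'`, where `A' ≤
β`, and that span is invariant under `A'`. Hence `⟨(A - A') (e j), w⟩ = l j * ‖w‖ ^ 2 - ⟨A' w, w⟩ ≥
(α - β) * ‖w‖ ^ 2`. Summing over the `d` vectors gives the factor `d`. -/
lemma SpectralSplit.norm_sub_projL_le {d : ℕ} {A A' : H →L[ℝ] H} {e e' : Fin d → H} {α β : ℝ}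
    (hαβ : β < α) (h : SpectralSplit A e α β) (h' : SpectralSplit A' e' α β) (v : H) :
    ‖projL e v - projL e' (projL e v)‖ ≤ d * (‖A - A'‖ / (α - β)) * ‖v‖ := by
  obtain ⟨l, hl, hlα⟩ := h.eigen
  obtain ⟨l', hl', -⟩ := h'.eigen
  have hw : ∀ j, ‖e j - projL e' (e j)‖ ≤ ‖A - A'‖ / (α - β) := fun j => by
    set w := e j - projL e' (e j) with hwdef
    have hw0 : ∀ i, inner ℝ (e' i) w = (0 : ℝ) := inner_sub_projL h'.orthonormal (e j)
    have h1 : inner ℝ (A' (projL e' (e j))) w = (0 : ℝ) := by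
      rw [projL_apply, proj, map_sum, sum_inner]
      refine Finset.sum_eq_zero fun i _ => ?_
      rw [map_smul, hl', inner_smul_left, inner_smul_left, hw0, mul_zero, mul_zero]
    have h2 : inner ℝ (projL e' (e j)) w = (0 : ℝ) := by
      rw [projL_apply, proj, sum_inner]
      exact Finset.sum_eq_zero fun i _ => by rw [inner_smul_left, hw0, mul_zero]
    have h3 : inner ℝ ((A - A') (e j)) w = l j * ‖w‖ ^ 2 - inner ℝ (A' w) w := by
      have e1 : e j = w + projL e' (e j) := by rw [hwdef]; abel
      have e2 : A' (e j) = A' w + A' (projL e' (e j)) := by rw [← map_add, ← e1]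
      rw [sub_apply, hl, e2, inner_sub_left, inner_add_left, h1, inner_smul_left]
      nth_rewrite 1 [e1]
      rw [inner_add_left, h2, real_inner_self_eq_norm_sq]
      simp
    have h4 := h'.rayleigh w hw0
    have h5 : inner ℝ ((A - A') (e j)) w ≤ ‖A - A'‖ * ‖w‖ := by
      refine (real_inner_le_norm _ _).trans (mul_le_mul_of_nonneg_right ?_ (norm_nonneg _))
      simpa [h.orthonormal.1 j] using (A - A').le_opNorm (e j)
    rw [le_div_iff₀ (sub_pos.2 hαβ)]
    rcases (norm_nonneg w).eq_or_lt with h0 | h0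
    · rw [← h0]; simp
    · refine le_of_mul_le_mul_right ?_ h0
      nlinarith [mul_le_mul_of_nonneg_right (hlα j) (sq_nonneg ‖w‖)]
  have h6 : projL e v - projL e' (projL e v) =
      ∑ j, inner ℝ (e j) v • (e j - projL e' (e j)) := by
    have : projL e v = ∑ j, (inner ℝ (e j) v : ℝ) • e j := projL_apply e v
    rw [this, map_sum, ← Finset.sum_sub_distrib]
    simp only [map_smul, smul_sub]
  rw [h6]
  refine (norm_sum_le _ _).trans ?_
  have h7 : ∀ j ∈ Finset.univ, ‖(inner ℝ (e j) v : ℝ) • (e j - projL e' (e j))‖ ≤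
      ‖v‖ * (‖A - A'‖ / (α - β)) := fun j _ => by
    rw [norm_smul]
    refine mul_le_mul ?_ (hw j) (norm_nonneg _) (norm_nonneg _)
    simpa [h.orthonormal.1 j] using norm_inner_le_norm (𝕜 := ℝ) (e j) v
  refine (Finset.sum_le_sum h7).trans (le_of_eq ?_)
  simp; ring

/-- A Davis-Kahan bound. -/
theorem SpectralSplit.norm_projL_sub_le {d : ℕ} {A A' : H →L[ℝ] H} {e e' : Fin d → H} {α β : ℝ}
    (hαβ : β < α) (h : SpectralSplit A e α β) (h' : SpectralSplit A' e' α β) :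
    ‖projL e - projL e'‖ ≤ 2 * d / (α - β) * ‖A - A'‖ := by
  have hc : 0 ≤ d * (‖A - A'‖ / (α - β)) :=
    mul_nonneg (Nat.cast_nonneg _) (div_nonneg (norm_nonneg _) (sub_pos.2 hαβ).le)
  refine ContinuousLinearMap.opNorm_le_bound _
    (mul_nonneg (div_nonneg (by positivity) (sub_pos.2 hαβ).le) (norm_nonneg _)) fun v => ?_
  have h1 := h.norm_sub_projL_le hαβ h' v
  set y := projL e' v - projL e' (projL e v) with hy
  -- The remaining part `y = projL e' (v - projL e v)` is the adjoint of the one-sided estimate with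
  -- the roles exchanged: `‖y‖ ^ 2 = ⟨projL e' y - projL e (projL e' y), v⟩`.
  have h2 : ‖y‖ ≤ d * (‖A - A'‖ / (α - β)) * ‖v‖ := by
    have e1 : ‖y‖ ^ 2 = inner ℝ (projL e' y - projL e (projL e' y)) v := by
      rw [← real_inner_self_eq_norm_sq]
      nth_rewrite 2 [hy]
      rw [← map_sub, ← inner_projL_left, inner_sub_right, inner_sub_left, inner_projL_left e]
    have e2 := h'.norm_sub_projL_le hαβ h y
    rw [norm_sub_rev A' A] at e2
    have e3 := (real_inner_le_norm (projL e' y - projL e (projL e' y)) v).trans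
      (mul_le_mul_of_nonneg_right e2 (norm_nonneg v))
    rw [← e1] at e3
    rcases (norm_nonneg y).eq_or_lt with h0 | h0
    · rw [← h0]; exact mul_nonneg hc (norm_nonneg _)
    · refine le_of_mul_le_mul_right ?_ h0
      nlinarith
  have h3 : (projL e - projL e') v = (projL e v - projL e' (projL e v)) - y := by
    rw [hy, sub_apply]; abel
  rw [h3]
  refine (norm_sub_le _ _).trans ((add_le_add h1 h2).trans (le_of_eq ?_))
  ring

/-- The Rayleigh quotient of a finite rank nonnegative operator orthogonally to a leading
eigensystem is at most each of its eigenvalues. -/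
lemma IsLeadingEigensystem.exists_rayleigh_le {d : ℕ} {A : H →L[ℝ] H} {e : Fin d → H}
    (hA : ∀ x y, inner ℝ (A x) y = (inner ℝ x (A y) : ℝ)) (hpos : ∀ x, 0 ≤ (inner ℝ (A x) x : ℝ))
    (hfin : FiniteDimensional ℝ (LinearMap.range A.toLinearMap)) (h : IsLeadingEigensystem A e) :
    ∃ l : Fin d → ℝ, (∀ j, A (e j) = l j • e j) ∧
      ∀ v, (∀ j, inner ℝ (e j) v = 0) → ∀ j, inner ℝ (A v) v ≤ l j * ‖v‖ ^ 2 := by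
  obtain ⟨he, l, -, hl, hmax⟩ := h
  refine ⟨l, hl, fun v hv j => ?_⟩
  -- Nonnegativity is needed at the end, when the norm of the component in `W` is replaced by the
  -- norm of `v`.
  have hl0 : 0 ≤ l j := by
    have := hpos (e j)
    rw [hl, inner_smul_left, real_inner_self_eq_norm_sq, he.1 j] at this
    simpa using this
  -- restrict to the span of the range, orthogonally to `e`
  let W : Submodule ℝ H := LinearMap.range A.toLinearMap ⊓ LinearMap.ker (coordMap e).toLinearMap
  have hW : ∀ w, w ∈ W ↔ w ∈ LinearMap.range A.toLinearMap ∧ ∀ j, inner ℝ (e j) w = (0 : ℝ) := by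
    intro w
    simp only [W, Submodule.mem_inf, LinearMap.mem_ker]
    refine and_congr_right fun _ => ?_
    constructor
    · intro h0 j
      have h0' : coordMap e w = 0 := h0
      rw [← coordMap_apply, h0']; rfl
    · intro h0
      change coordMap e w = 0
      ext j; simpa using h0 j
  have hAe : ∀ w, (∀ j, inner ℝ (e j) w = (0 : ℝ)) → ∀ j, inner ℝ (e j) (A w) = (0 : ℝ) :=
    fun w hw j => by rw [← hA, hl, inner_smul_left, hw, mul_zero]
  have hinv : ∀ w ∈ W, A.toLinearMap w ∈ W := fun w hw =>
    (hW _).2 ⟨⟨w, rfl⟩, hAe w ((hW w).1 hw).2⟩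
  have hWfin : FiniteDimensional ℝ W := Submodule.finiteDimensional_of_le inf_le_left
  let B := A.toLinearMap.restrict hinv
  have hB : B.IsSymmetric := LinearMap.IsSymmetric.restrict_invariant (fun x y => hA x y) hinv
  have hBle : ∀ w : W, inner ℝ (A w) w ≤ l j * ‖(w : H)‖ ^ 2 := fun w => by
    let b := hB.eigenvectorBasis rfl
    have hb : ∀ i, hB.eigenvalues rfl i ≤ l j := fun i => by
      refine hmax (b i) _ ?_ ((hW _).1 (b i).2).2 ?_ j
      · have := b.orthonormal.ne_zero i
        simpa using this
      · exact congrArg Subtype.val (hB.apply_eigenvectorBasis rfl i)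
    have h1 : (inner ℝ (A w) w : ℝ) = inner ℝ (B w) w := rfl
    rw [h1, ← b.sum_inner_mul_inner, ← Submodule.coe_norm, ← b.sum_sq_norm_inner_right w,
      Finset.mul_sum]
    refine Finset.sum_le_sum fun i _ => ?_
    rw [hB w (b i), hB.apply_eigenvectorBasis, inner_smul_right, real_inner_comm (b i) w,
      mul_assoc, Real.norm_eq_abs, sq_abs, pow_two]
    exact mul_le_mul_of_nonneg_right (hb i) (mul_self_nonneg _)
  have : W.HasOrthogonalProjection := inferInstance
  let p : H := W.starProjection v
  have hpW : p ∈ W := Submodule.starProjection_apply_mem W v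
  have hq : v - p ∈ Wᗮ := W.sub_starProjection_mem_orthogonal v
  have hqe : ∀ j, inner ℝ (e j) (v - p) = (0 : ℝ) := fun j => by
    rw [inner_sub_right, hv, ((hW p).1 hpW).2, sub_zero]
  -- The component orthogonal to `W` is killed: `A (A (v - p))` lies in `W`, so `‖A (v - p)‖ ^ 2 =
  -- ⟨A (A (v - p)), v - p⟩ = 0`.
  have hAq : A (v - p) = 0 := by
    have h1 : A (A (v - p)) ∈ W := hinv _ ((hW _).2 ⟨⟨_, rfl⟩, hAe _ hqe⟩)
    have h2 := (Submodule.mem_orthogonal W _).1 hq _ h1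
    rw [hA, real_inner_self_eq_norm_sq] at h2
    simpa using h2
  have hAv : A v = A p := by rw [← sub_eq_zero, ← map_sub, hAq]
  have h1 : (inner ℝ (A v) v : ℝ) = inner ℝ (A p) p := by
    have : (inner ℝ (A p) (v - p) : ℝ) = 0 := by rw [hA, hAq, inner_zero_right]
    rw [hAv, ← zero_add (inner ℝ (A p) p), ← this, ← inner_add_right, sub_add_cancel]
  rw [h1]
  refine (hBle ⟨p, hpW⟩).trans (mul_le_mul_of_nonneg_left ?_ hl0)
  gcongr
  exact W.norm_starProjection_apply_le v

/-- The dimension count of the min-max principle: with more parameters than orthogonality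
constraints there is a nonzero solution. -/
lemma exists_orthogonal_combination {V : Type*} [AddCommGroup V] [Module ℝ V]
    [FiniteDimensional ℝ V] {d : ℕ} (hV : d < Module.finrank ℝ V) (φ : V →ₗ[ℝ] H)
    (e : Fin d → H) : ∃ c, c ≠ 0 ∧ ∀ j, inner ℝ (e j) (φ c) = (0 : ℝ) := by
  have h := LinearMap.ker_ne_bot_of_finrank_lt (f := (coordMap e).toLinearMap ∘ₗ φ) (by simpa)
  obtain ⟨c, hc, hc0⟩ := Submodule.exists_mem_ne_zero_of_ne_bot h
  refine ⟨c, hc0, fun j => ?_⟩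
  have hc' : coordMap e (φ c) = 0 := hc
  rw [← coordMap_apply, hc']; rfl

lemma SpectralSplit.le_inner_synth {d : ℕ} {A : H →L[ℝ] H} {e : Fin d → H} {α β : ℝ}
    (h : SpectralSplit A e α β) (c : EuclideanSpace ℝ (Fin d)) :
    α * ‖synth e c‖ ^ 2 ≤ inner ℝ (A (synth e c)) (synth e c) := by
  obtain ⟨l, hl, hlα⟩ := h.eigen
  have h1 : A (synth e c) = synth e (WithLp.toLp 2 fun j => l j * c j) := by
    simp only [synth_apply, map_sum, map_smul, hl, smul_smul, mul_comm]
  rw [h1, inner_synth h.orthonormal, norm_synth h.orthonormal, EuclideanSpace.real_norm_sq_eq,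
    Finset.mul_sum, PiLp.inner_apply]
  refine Finset.sum_le_sum fun j _ => ?_
  simp only [RCLike.inner_apply, conj_trivial]
  nlinarith [mul_le_mul_of_nonneg_right (hlα j) (sq_nonneg (c j))]

lemma spectralSplit_initSeg {ξ : HilbertBasis ℕ ℝ H} {lam : ℕ → ℝ} (hlam : Antitone lam)
    {A : H →L[ℝ] H} (hA : ∀ x y, inner ℝ (A x) y = (inner ℝ x (A y) : ℝ))
    (hξ : ∀ j, A (ξ j) = lam j • ξ j) {d : ℕ} {α : ℝ} (hα : ∀ j < d, α ≤ lam j) :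
    SpectralSplit A (initSeg ξ d) α (lam d) where
  orthonormal := orthonormal_initSeg ξ d
  eigen := ⟨fun j => lam j, fun j => hξ j, fun j => hα j j.2⟩
  rayleigh v hv := by
    have h1 := ξ.hasSum_inner_mul_inner (A v) v
    have h2 := (ξ.hasSum_inner_mul_inner v v).mul_left (lam d)
    rw [real_inner_self_eq_norm_sq] at h2
    refine hasSum_le (fun i => ?_) h1 h2
    rw [hA, hξ, inner_smul_right, real_inner_comm v (ξ i), mul_assoc]
    by_cases hi : i < d
    · have : inner ℝ v (ξ i) = (0 : ℝ) := (real_inner_comm _ _).trans (hv ⟨i, hi⟩)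
      simp [this]
    · exact mul_le_mul_of_nonneg_right (hlam (not_lt.1 hi)) (mul_self_nonneg _)

lemma abs_inner_sub_le (A A' : H →L[ℝ] H) (v : H) :
    |inner ℝ (A v) v - inner ℝ (A' v) v| ≤ ‖A - A'‖ * ‖v‖ ^ 2 := by
  rw [← inner_sub_left, ← sub_apply, pow_two, ← mul_assoc]
  exact (abs_real_inner_le_norm _ _).trans
    (mul_le_mul_of_nonneg_right ((A - A').le_opNorm v) (norm_nonneg v))

/-- A leading eigensystem of an operator close to one with a spectral gap splits its spectrum. -/
lemma SpectralSplit.of_near {d : ℕ} {A S : H →L[ℝ] H} {e a : Fin d → H} {α β η : ℝ}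
    (hS : SpectralSplit S a α β)
    (hA : ∀ x y, inner ℝ (A x) y = (inner ℝ x (A y) : ℝ)) (hpos : ∀ x, 0 ≤ (inner ℝ (A x) x : ℝ))
    (hfin : FiniteDimensional ℝ (LinearMap.range A.toLinearMap)) (h : IsLeadingEigensystem A e)
    (hη : ‖A - S‖ ≤ η) : SpectralSplit A e (α - η) (β + η) := by
  obtain ⟨l, hl, hray⟩ := h.exists_rayleigh_le hA hpos hfin
  have he := h.1
  have hnear : ∀ v, |inner ℝ (A v) v - inner ℝ (S v) v| ≤ η * ‖v‖ ^ 2 := fun v =>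
    (abs_inner_sub_le A S v).trans (mul_le_mul_of_nonneg_right hη (sq_nonneg _))
  have hperp : ∀ u : EuclideanSpace ℝ (Fin d), ∀ v, (∀ j, inner ℝ (e j) v = (0 : ℝ)) →
      inner ℝ (synth e u) v = (0 : ℝ) := fun u v hv => by
    rw [inner_synth_left]
    have : coordMap e v = 0 := by ext j; simpa using hv j
    rw [this, inner_zero_right]
  have hAs : ∀ u : EuclideanSpace ℝ (Fin d),
      A (synth e u) = synth e (WithLp.toLp 2 fun j => l j * u j) := fun u => by
    simp only [synth_apply, map_sum, map_smul, hl, smul_smul, mul_comm]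
  have hquad : ∀ (u : EuclideanSpace ℝ (Fin d)) (v : H), (∀ j, inner ℝ (e j) v = (0 : ℝ)) →
      inner ℝ (A (synth e u + v)) (synth e u + v) =
        ∑ j, l j * u j ^ 2 + (inner ℝ (A v) v : ℝ) ∧
      ‖synth e u + v‖ ^ 2 = ∑ j, u j ^ 2 + ‖v‖ ^ 2 := fun u v hv => by
    have h1 : inner ℝ (A (synth e u)) v = (0 : ℝ) := by rw [hAs]; exact hperp _ v hv
    have h2 : inner ℝ (A v) (synth e u) = (0 : ℝ) := by rw [hA, real_inner_comm, h1]
    have h3 : inner ℝ (A (synth e u)) (synth e u) = ∑ j, l j * u j ^ 2 := by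
      rw [hAs, inner_synth he, PiLp.inner_apply]
      refine Finset.sum_congr rfl fun j _ => ?_
      simp only [RCLike.inner_apply, conj_trivial]; ring
    constructor
    · rw [map_add, inner_add_left, inner_add_right, inner_add_right, h1, h2, h3]; ring
    · rw [norm_add_sq_real, hperp u v hv, norm_synth he, EuclideanSpace.real_norm_sq_eq]; ring
  refine ⟨he, ⟨l, hl, fun j => ?_⟩, fun v hv => ?_⟩
  · -- a vector of the span of `a` orthogonal to all `e i` but `e j`
    obtain ⟨c, hc0, hc⟩ := exists_orthogonal_combination (d := d - 1) (V := EuclideanSpace ℝ (Fin d))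
      (by have := j.pos; simp; omega) (synth a).toLinearMap
      (fun i : Fin (d - 1) => e ((Fin.succAbove (n := d - 1) (Fin.cast (by have := j.pos; omega) j) i).cast
        (by have := j.pos; omega)))
    set v : H := synth a c with hvdef
    have hv0 : 0 < ‖v‖ ^ 2 := by
      have : 0 < ‖c‖ := norm_pos_iff.2 hc0
      rw [hvdef, norm_synth hS.orthonormal]; positivity
    have hvi : ∀ i, i ≠ j → inner ℝ (e i) v = (0 : ℝ) := fun i hij => by
      have hd : d - 1 + 1 = d := by have := j.pos; omega
      obtain ⟨k, hk⟩ := Fin.exists_succAbove_eq (n := d - 1) (x := Fin.cast hd.symm i)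
        (y := Fin.cast hd.symm j) (fun h => hij (by simpa [Fin.ext_iff] using h))
      have := hc k
      rw [hk] at this
      exact this
    obtain ⟨q1, q2⟩ := hquad (coordMap e v) (v - projL e v) (inner_sub_projL he v)
    have hvv : synth e (coordMap e v) + (v - projL e v) = v := by
      change projL e v + (v - projL e v) = v
      abel
    rw [hvv] at q1 q2
    have hs : ∀ m : Fin d → ℝ, ∑ i, m i * (coordMap e v) i ^ 2 = m j * (coordMap e v) j ^ 2 :=
      fun m => by
        refine Finset.sum_eq_single j (fun i _ hij => ?_) (by simp)
        rw [coordMap_apply, hvi i hij]; simp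
    have hs1 := hs fun _ => 1
    simp only [one_mul] at hs1
    rw [hs] at q1
    rw [hs1] at q2
    have h1 := hray _ (inner_sub_projL he v) j
    have h2 := hS.le_inner_synth c
    have h3 := abs_le.1 (hnear v)
    rw [← hvdef] at h2
    have h4 : (α - η) * ‖v‖ ^ 2 ≤ l j * ‖v‖ ^ 2 := by
      have h5 : l j * ‖v‖ ^ 2 = l j * (coordMap e v) j ^ 2 + l j * ‖v - projL e v‖ ^ 2 := by
        rw [q2]; ring
      linarith
    exact le_of_mul_le_mul_right h4 hv0
  · rcases eq_or_ne v 0 with rfl | hv0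
    · simp
    have hvn : 0 < ‖v‖ ^ 2 := by have := norm_pos_iff.2 hv0; positivity
    -- The span of the `e j` and `v` has dimension `d + 1`, so it contains a nonzero vector
    -- orthogonal to `a`, where the form of `A` is at most `β + η`. By `hray`, adding components
    -- along the `e j` cannot lower the Rayleigh quotient below that of `v`.
    obtain ⟨⟨u, t⟩, hc0, hc⟩ := exists_orthogonal_combination
      (V := EuclideanSpace ℝ (Fin d) × ℝ) (by simp)
      ((synth e).toLinearMap.coprod (LinearMap.toSpanSingleton ℝ H v)) a
    have hc' : ∀ j, inner ℝ (a j) (synth e u + t • v) = (0 : ℝ) := hc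
    have htv : ∀ j, inner ℝ (e j) (t • v) = (0 : ℝ) := fun j => by
      rw [inner_smul_right, hv, mul_zero]
    obtain ⟨q1, q2⟩ := hquad u (t • v) htv
    have h1 := hS.rayleigh _ hc'
    have h2 := abs_le.1 (hnear (synth e u + t • v))
    have h3 : inner ℝ (A (t • v)) (t • v) = t ^ 2 * (inner ℝ (A v) v : ℝ) := by
      rw [map_smul, inner_smul_left, inner_smul_right]; simp; ring
    have h4 : ‖t • v‖ ^ 2 = t ^ 2 * ‖v‖ ^ 2 := by rw [norm_smul, mul_pow, Real.norm_eq_abs, sq_abs]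
    rw [h3] at q1
    rw [h4] at q2
    have h5 : (inner ℝ (A v) v : ℝ) * ∑ j, u j ^ 2 ≤ ‖v‖ ^ 2 * ∑ j, l j * u j ^ 2 := by
      rw [Finset.mul_sum, Finset.mul_sum]
      refine Finset.sum_le_sum fun j _ => ?_
      nlinarith [mul_le_mul_of_nonneg_right (hray v hv j) (sq_nonneg (u j))]
    have h6 : 0 < ‖synth e u + t • v‖ ^ 2 := by
      rw [q2]
      by_contra hneg
      have hu : 0 ≤ ∑ j, u j ^ 2 := Finset.sum_nonneg fun j _ => sq_nonneg _
      have ht0 : 0 ≤ t ^ 2 * ‖v‖ ^ 2 := by positivity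
      have hu0 : ∑ j, u j ^ 2 = 0 := by linarith
      have ht : t ^ 2 * ‖v‖ ^ 2 = 0 := by linarith
      apply hc0
      ext j
      · have := (Finset.sum_eq_zero_iff_of_nonneg fun j _ => sq_nonneg (u j)).1 hu0 j (by simp)
        simpa using this
      · simpa [hvn.ne', hv0] using ht
    have h7 : (inner ℝ (A v) v : ℝ) * ‖synth e u + t • v‖ ^ 2 ≤
        (β + η) * ‖v‖ ^ 2 * ‖synth e u + t • v‖ ^ 2 := by
      have h8 : inner ℝ (A (synth e u + t • v)) (synth e u + t • v) ≤
        (β + η) * ‖synth e u + t • v‖ ^ 2 := by linarith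
      have h9 := mul_le_mul_of_nonneg_left h8 hvn.le
      rw [q1] at h9
      rw [q2] at h9 ⊢
      nlinarith
    exact le_of_mul_le_mul_right h7 h6

/-! ### Sample features determining the projections -/

/-- The rank one operator `v ↦ ⟨x, v⟩ x'`, as a bilinear map of `x'` and `x`. -/
def tensorL : H →L[ℝ] H →L[ℝ] (H →L[ℝ] H) :=
  LinearMap.mkContinuous₂ (LinearMap.mk₂ ℝ (fun x y : H => InnerProductSpace.rankOne ℝ x y)
    (fun x x' y => by ext; simp) (fun c x y => by ext v; exact smul_comm _ _ _)
    (fun x y y' => by ext; simp)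
    (fun c x y => by ext; simp [smul_smul])) 1
    fun x y => by simp

@[simp] lemma tensorL_apply (x y v : H) : tensorL x y v = (inner ℝ y v : ℝ) • x := rfl

lemma norm_tensorL (x y : H) : ‖tensorL x y‖ = ‖x‖ * ‖y‖ :=
  InnerProductSpace.norm_rankOne x y

/-- Count, sum and second moment of group `g` at one observation. -/
def feature {G : ℕ} (g : Fin G) (z : H × Fin G) : ℝ × H × (H →L[ℝ] H) :=
  if z.2 = g then (1, z.1, tensorL z.1 z.1) else 0

/-- The normalization is by the size of the whole sample and not by that of the group: this makes it
an average of i.i.d. variables, with the group frequency as first component. -/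
def featureMean {G n : ℕ} (g : Fin G) (s : Fin n → H × Fin G) : ℝ × H × (H →L[ℝ] H) :=
  (n : ℝ)⁻¹ • ∑ i, feature g (s i)

/-- The covariance operator as a function of the mean feature. -/
def featureCov (T : ℝ × H × (H →L[ℝ] H)) : H →L[ℝ] H :=
  T.1⁻¹ • T.2.2 - (T.1⁻¹ * T.1⁻¹) • tensorL T.2.1 T.2.1

lemma contDiffAt_featureCov {T : ℝ × H × (H →L[ℝ] H)} (hT : T.1 ≠ 0) :
    ContDiffAt ℝ 1 featureCov T := by
  have h1 : ContDiffAt ℝ 1 (fun T : ℝ × H × (H →L[ℝ] H) => T.1⁻¹) T := contDiffAt_fst.inv hT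
  have h2 : ContDiffAt ℝ 1 (fun T : ℝ × H × (H →L[ℝ] H) => tensorL T.2.1 T.2.1) T := by fun_prop
  exact (h1.smul (by fun_prop)).sub ((h1.mul h1).smul h2)

/-- Second moment minus the square of the mean: the sample covariance is a smooth function of an
empirical average, also across different sample sizes. -/
lemma groupCov_eq {G n : ℕ} (s : Fin n → H × Fin G) (g : Fin G)
    (h : (featureMean g s).1 ≠ 0) (v : H) : groupCov s g v = featureCov (featureMean g s) v := by
  have hn : (n : ℝ) ≠ 0 := by
    intro h0; apply h; simp [featureMean, h0]
  have e1 : (featureMean g s).1 = (n : ℝ)⁻¹ * groupCount s g := by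
    simp only [featureMean, feature, groupCount, Prod.smul_fst, Prod.fst_sum, smul_eq_mul]
    congr 1
    exact Finset.sum_congr rfl fun i _ => by split_ifs <;> rfl
  have e2 : (featureMean g s).2.1 = (n : ℝ)⁻¹ • ∑ i, if (s i).2 = g then (s i).1 else 0 := by
    simp only [featureMean, feature, Prod.smul_fst, Prod.smul_snd, Prod.fst_sum, Prod.snd_sum]
    congr 1
    exact Finset.sum_congr rfl fun i _ => by split_ifs <;> rfl
  have e3 : (featureMean g s).2.2 v =
      (n : ℝ)⁻¹ • ∑ i, if (s i).2 = g then (inner ℝ (s i).1 v : ℝ) • (s i).1 else 0 := by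
    simp only [featureMean, feature, Prod.smul_snd, Prod.snd_sum]
    rw [smul_apply, sum_apply]
    congr 1
    exact Finset.sum_congr rfl fun i _ => by split_ifs <;> rfl
  have hc : groupCount s g ≠ 0 := by
    intro h0; apply h; rw [e1, h0, mul_zero]
  set c := groupCount s g with hcdef
  set m := groupMean s g with hm
  set S1 := ∑ i, (if (s i).2 = g then (s i).1 else 0) with hS1
  have hmS : S1 = c • m := by rw [hm, groupMean, ← hS1, ← hcdef, smul_inv_smul₀ hc]
  set S2 := ∑ i, (if (s i).2 = g then (inner ℝ (s i).1 v : ℝ) • (s i).1 else 0) with hS2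
  have hexp : (∑ i, if (s i).2 = g then
      (inner ℝ ((s i).1 - m) v : ℝ) • ((s i).1 - m) else 0) = S2 - c • (inner ℝ m v : ℝ) • m := by
    have : ∀ i, (if (s i).2 = g then (inner ℝ ((s i).1 - m) v : ℝ) • ((s i).1 - m) else 0) =
        (if (s i).2 = g then (inner ℝ (s i).1 v : ℝ) • (s i).1 else 0)
        - (inner ℝ (if (s i).2 = g then (s i).1 else 0) v : ℝ) • m
        - (inner ℝ m v : ℝ) • (if (s i).2 = g then (s i).1 else 0)
        + (if (s i).2 = g then (1 : ℝ) else 0) • (inner ℝ m v : ℝ) • m := fun i => by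
      split_ifs
      · simp only [inner_sub_left, sub_smul, smul_sub, one_smul]; abel
      · simp
    simp only [this, Finset.sum_add_distrib, Finset.sum_sub_distrib, ← Finset.sum_smul,
      ← Finset.smul_sum, ← sum_inner]
    rw [← hS1, ← hS2, hmS]
    change _ + c • _ = _
    rw [inner_smul_left]
    simp only [smul_smul, conj_trivial]
    rw [mul_comm (inner ℝ m v)]
    abel
  rw [groupCov, ← hcdef, ← hm, hexp, featureCov, sub_apply, smul_apply,
    smul_apply, tensorL_apply, e1, e2, e3, hmS]
  simp only [inner_smul_left, smul_smul, smul_sub, conj_trivial]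
  congr 2 <;> field_simp

lemma inner_groupCov_left {G n : ℕ} (s : Fin n → H × Fin G) (g : Fin G) (v w : H) :
    (inner ℝ (groupCov s g v) w : ℝ) = (groupCount s g)⁻¹ * ∑ i, if (s i).2 = g then
      inner ℝ ((s i).1 - groupMean s g) v * inner ℝ ((s i).1 - groupMean s g) w else 0 := by
  rw [groupCov, inner_smul_left, sum_inner]
  congr 1
  refine Finset.sum_congr rfl fun i _ => ?_
  split_ifs
  · rw [inner_smul_left]; rfl
  · simp

lemma inner_groupCov_comm {G n : ℕ} (s : Fin n → H × Fin G) (g : Fin G) (v w : H) :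
    (inner ℝ (groupCov s g v) w : ℝ) = inner ℝ v (groupCov s g w) := by
  rw [real_inner_comm (groupCov s g w) v, inner_groupCov_left, inner_groupCov_left]
  simp only [mul_comm]

lemma inner_groupCov_self_nonneg {G n : ℕ} (s : Fin n → H × Fin G) (g : Fin G) (v : H) :
    (0 : ℝ) ≤ inner ℝ (groupCov s g v) v := by
  rw [inner_groupCov_left]
  refine mul_nonneg (inv_nonneg.2 (Finset.sum_nonneg fun i _ => ?_))
    (Finset.sum_nonneg fun i _ => ?_)
  · split_ifs <;> norm_num
  · split_ifs
    · exact mul_self_nonneg _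
    · rfl

lemma groupCov_mem_span {G n : ℕ} (s : Fin n → H × Fin G) (g : Fin G) (v : H) :
    groupCov s g v ∈ Submodule.span ℝ (Set.range fun i => (s i).1 - groupMean s g) := by
  refine Submodule.smul_mem _ _ (Submodule.sum_mem _ fun i _ => ?_)
  split_ifs
  · exact Submodule.smul_mem _ _ (Submodule.subset_span ⟨i, rfl⟩)
  · exact Submodule.zero_mem _

/-- In a neighbourhood of a population feature with a spectral gap, the estimated projections
depend on the mean feature in a Lipschitz way, also across sample sizes. -/
theorem exists_projL_lipschitz {G d : ℕ} {g : Fin G} {T : ℝ × H × (H →L[ℝ] H)} (hT : T.1 ≠ 0)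
    {a : Fin d → H} {α β : ℝ} (hαβ : β < α) (hsplit : SpectralSplit (featureCov T) a α β) :
    ∃ η > 0, ∃ C ≥ 0, ∀ (n : ℕ) (s : Fin n → H × Fin G) (e : Fin d → H),
      featureMean g s ∈ Metric.ball T η → IsLeadingEigensystem (groupCov s g) e →
        ‖projL e - projL a‖ ≤ C * ‖featureMean g s - T‖ ∧
        ∀ (m : ℕ) (s' : Fin m → H × Fin G) (e' : Fin d → H),
          featureMean g s' ∈ Metric.ball T η → IsLeadingEigensystem (groupCov s' g) e' →
            ‖projL e - projL e'‖ ≤ C * ‖featureMean g s - featureMean g s'‖ := by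
  obtain ⟨L, t, ht, hL⟩ := (contDiffAt_featureCov hT).exists_lipschitzOnWith
  have hne : {S : ℝ × H × (H →L[ℝ] H) | S.1 ≠ 0} ∈ 𝓝 T :=
    (isOpen_ne.preimage continuous_fst).mem_nhds hT
  -- A perturbation by a quarter of the gap on each side leaves half of it, so one Davis-Kahan
  -- constant serves all samples in the neighbourhood.
  have hnear : {S | ‖featureCov S - featureCov T‖ < (α - β) / 4} ∈ 𝓝 T := by
    have hc : ContinuousAt featureCov T := (contDiffAt_featureCov hT).continuousAt
    filter_upwards [Metric.tendsto_nhds.1 hc ((α - β) / 4) (by linarith)] with S hS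
    simpa [dist_eq_norm] using hS
  obtain ⟨η, hη, hball⟩ := Metric.mem_nhds_iff.1 (inter_mem ht (inter_mem hne hnear))
  have key : ∀ (n : ℕ) (s : Fin n → H × Fin G) (e : Fin d → H),
      featureMean g s ∈ Metric.ball T η → IsLeadingEigensystem (groupCov s g) e →
      SpectralSplit (featureCov (featureMean g s)) e (α - (α - β) / 4) (β + (α - β) / 4) := by
    intro n s e hs he
    have hb := hball hs
    have heq : (groupCov s g) = featureCov (featureMean g s) :=
      funext (groupCov_eq s g hb.2.1)
    refine hsplit.of_near (fun x y => ?_) (fun x => ?_) ?_ (heq ▸ he) (le_of_lt hb.2.2)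
    · rw [← heq]; exact inner_groupCov_comm s g x y
    · rw [← heq]; exact inner_groupCov_self_nonneg s g x
    · have : FiniteDimensional ℝ (Submodule.span ℝ (Set.range fun i => (s i).1 - groupMean s g)) :=
        FiniteDimensional.span_of_finite ℝ (Set.finite_range _)
      refine Submodule.finiteDimensional_of_le (S₂ := Submodule.span ℝ
        (Set.range fun i => (s i).1 - groupMean s g)) ?_
      rintro _ ⟨v, rfl⟩
      have := groupCov_mem_span s g v
      rwa [heq] at this
  have hαβ' : β + (α - β) / 4 < α - (α - β) / 4 := by linarith
  have hC : 0 ≤ 2 * d / (α - (α - β) / 4 - (β + (α - β) / 4)) :=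
    div_nonneg (by positivity) (by linarith)
  refine ⟨η, hη, 2 * d / (α - (α - β) / 4 - (β + (α - β) / 4)) * L, mul_nonneg hC L.2,
    fun n s e hs he => ⟨?_, fun m s' e' hs' he' => ?_⟩⟩
  · refine ((key n s e hs he).norm_projL_sub_le hαβ'
      (hsplit.mono (by linarith) (by linarith))).trans ?_
    rw [mul_assoc]
    refine mul_le_mul_of_nonneg_left ?_ hC
    simpa [dist_eq_norm] using hL.dist_le_mul _ (hball hs).1 _ (mem_of_mem_nhds ht)
  · refine ((key n s e hs he).norm_projL_sub_le hαβ' (key m s' e' hs' he')).trans ?_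
    rw [mul_assoc]
    refine mul_le_mul_of_nonneg_left ?_ hC
    simpa [dist_eq_norm] using hL.dist_le_mul _ (hball hs).1 _ (hball hs').1

/-! ### Rescaled kernels -/

/-- The rescaled radial kernel `δ^{-d} k(‖w‖ / δ)`. -/
def kern {d : ℕ} (k : ℝ → ENNReal) (δ : ℝ) (w : EuclideanSpace ℝ (Fin d)) : ENNReal :=
  ENNReal.ofReal (δ ^ d)⁻¹ * k (‖w‖ / δ)

lemma measurable_kern {d : ℕ} {k : ℝ → ENNReal} (hk : Measurable k) (δ : ℝ) :
    Measurable (kern (d := d) k δ) :=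
  (hk.comp (by fun_prop)).const_mul _

lemma kern_le {d : ℕ} {k : ℝ → ENNReal} {B : ENNReal} {c : ℝ} (hB : ∀ u, k u ≤ B)
    (hc : ∀ u, c < u → k u = 0) {δ : ℝ} (hδ : 0 < δ) (w : EuclideanSpace ℝ (Fin d)) :
    kern k δ w ≤ ENNReal.ofReal (δ ^ d)⁻¹ * B *
      (Metric.closedBall (0 : EuclideanSpace ℝ (Fin d)) (c * δ)).indicator 1 w := by
  rw [kern, mul_assoc]
  refine mul_le_mul_right ?_ _
  by_cases h : w ∈ Metric.closedBall (0 : EuclideanSpace ℝ (Fin d)) (c * δ)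
  · rw [Set.indicator_of_mem h]; simpa using hB _
  · rw [hc _ ((lt_div_iff₀ hδ).2 (by simpa using h))]; simp

lemma lintegral_kern_le {d : ℕ} {k : ℝ → ENNReal} {B : ENNReal} {c : ℝ} (hB : ∀ u, k u ≤ B)
    (hc : ∀ u, c < u → k u = 0) {δ : ℝ} (hδ : 0 < δ) {α : Type*} [MeasurableSpace α]
    {m : Measure α} {φ : α → EuclideanSpace ℝ (Fin d)} (hφ : Measurable φ) {C : ENNReal}
    (h : m (φ ⁻¹' Metric.closedBall 0 (c * δ)) ≤ C * ENNReal.ofReal (δ ^ d)) :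
    ∫⁻ x, kern k δ (φ x) ∂m ≤ B * C := by
  have hδd : 0 < δ ^ d := pow_pos hδ d
  calc ∫⁻ x, kern k δ (φ x) ∂m
      ≤ ∫⁻ x, ENNReal.ofReal (δ ^ d)⁻¹ * B *
          (φ ⁻¹' Metric.closedBall 0 (c * δ)).indicator 1 x ∂m :=
        lintegral_mono fun x => kern_le hB hc hδ (φ x)
    _ = ENNReal.ofReal (δ ^ d)⁻¹ * B * m (φ ⁻¹' Metric.closedBall 0 (c * δ)) := by
        rw [lintegral_const_mul _ (measurable_one.indicator
          (hφ Metric.isClosed_closedBall.measurableSet)),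
          lintegral_indicator_one (hφ Metric.isClosed_closedBall.measurableSet)]
    _ ≤ ENNReal.ofReal (δ ^ d)⁻¹ * B * (C * ENNReal.ofReal (δ ^ d)) := by gcongr
    _ = (ENNReal.ofReal (δ ^ d)⁻¹ * ENNReal.ofReal (δ ^ d)) * (B * C) := by ring
    _ = B * C := by
        rw [← ENNReal.ofReal_mul (inv_nonneg.2 hδd.le), inv_mul_cancel₀ hδd.ne',
          ENNReal.ofReal_one, one_mul]

lemma volume_closedBall_le {d : ℕ} (c : ℝ) (hc : 0 ≤ c) {δ : ℝ} (hδ : 0 < δ)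
    (u : EuclideanSpace ℝ (Fin d)) :
    volume (Metric.closedBall u (c * δ)) =
      ENNReal.ofReal (c ^ d) * volume (Metric.ball (0 : EuclideanSpace ℝ (Fin d)) 1) *
        ENNReal.ofReal (δ ^ d) := by
  rw [Measure.addHaar_closedBall _ _ (by positivity), finrank_euclideanSpace_fin, mul_pow,
    ENNReal.ofReal_mul (by positivity)]
  ring

/-- The right inverses of nearby maps are corrections of one `J` and keep its range, so a single
number `m` of basis vectors and a single norm bound serve the whole neighbourhood. -/
lemma exists_uniform_rightInverse {E : Type*} [NormedAddCommGroup E] [NormedSpace ℝ E]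
    [FiniteDimensional ℝ E] (ξ : HilbertBasis ℕ ℝ H) (A : H →L[ℝ] E)
    (hA : Function.Surjective A) :
    ∃ ε > 0, ∃ (m : ℕ) (c : ℝ), 0 ≤ c ∧ ∀ A' : H →L[ℝ] E, ‖A' - A‖ ≤ ε →
      ∃ J : E →L[ℝ] H, (∀ w, A' (J w) = w) ∧ (∀ w j, m ≤ j → inner ℝ (ξ j) (J w) = 0) ∧
        ∀ w, ‖J w‖ ≤ c * ‖w‖ := by
  obtain ⟨m, J, hJ, hAJ⟩ := exists_rightInverse ξ A hA
  have hpos : 0 < 2 * (‖J‖ + 1) := by positivity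
  refine ⟨1 / (2 * (‖J‖ + 1)), by positivity, m, 2 * ‖J‖, by positivity, fun A' hA' => ?_⟩
  have h : ∀ w, ‖A' (J w) - w‖ ≤ 1 / 2 * ‖w‖ := fun w => by
    have h1 : A' (J w) - w = (A' - A) (J w) := by rw [sub_apply, hAJ]
    rw [h1]
    refine ((A' - A).le_opNorm _).trans ?_
    calc ‖A' - A‖ * ‖J w‖ ≤ 1 / (2 * (‖J‖ + 1)) * (‖J‖ * ‖w‖) := by
          gcongr; exact J.le_opNorm w
      _ ≤ 1 / (2 * (‖J‖ + 1)) * ((‖J‖ + 1) * ‖w‖) := by gcongr; linarith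
      _ = 1 / 2 * ‖w‖ := by field_simp
  obtain ⟨J', h1, h2, h3⟩ := exists_rightInverse_of_near h
  refine ⟨J', h1, fun w j hj => ?_, h3⟩
  obtain ⟨w', hw'⟩ := h2 w
  rw [hw', hJ w' j hj]

/-! ### Anti-concentration and smoothed kernels -/

section Images

variable [MeasurableSpace H] [BorelSpace H] [SecondCountableTopology H] {d : ℕ}

/-- Anti-concentration: kernel averages of the images of a tame measure are bounded, uniformly over
nearby projections. -/
lemma exists_lintegral_kern_le {ν : Measure H} [IsFiniteMeasure ν] {ξ : HilbertBasis ℕ ℝ H}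
    {B₀ : Set H} (hB₀ : IsCompact B₀) (hB₀t : B₀ ⊆ tamePts ν ξ)
    {A : H →L[ℝ] EuclideanSpace ℝ (Fin d)} (hA : Function.Surjective A) :
    ∃ ε > 0, ∃ C : ENNReal, C ≠ ⊤ ∧ ∀ A' : H →L[ℝ] EuclideanSpace ℝ (Fin d), ‖A' - A‖ ≤ ε →
      ∀ (k : ℝ → ENNReal) (B : ENNReal) (c : ℝ), 0 ≤ c → (∀ u, k u ≤ B) →
        (∀ u, c < u → k u = 0) → ∀ δ > 0, ∀ u,
          ∫⁻ x in B₀, kern k δ (u - A' x) ∂ν ≤ B * (C * ENNReal.ofReal (c ^ d)) := by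
  obtain ⟨ε, hε, m, cJ, -, hJ⟩ := exists_uniform_rightInverse ξ A hA
  obtain ⟨r, hr, ht⟩ := exists_tameOn_thickening hB₀ hB₀t
  obtain ⟨C, hC, hb⟩ := exists_density_bound
    (volume : Measure (EuclideanSpace ℝ (Fin d))) hB₀.measurableSet hr ht m cJ
  refine ⟨ε, hε, C * volume (Metric.ball (0 : EuclideanSpace ℝ (Fin d)) 1),
    ENNReal.mul_ne_top hC measure_ball_lt_top.ne, fun A' hA' k B c hc hB hk δ hδ u => ?_⟩
  obtain ⟨J, hJ1, hJ2, hJ3⟩ := hJ A' hA'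
  refine lintegral_kern_le hB hk hδ (by fun_prop) ?_
  have hset : (fun x => u - A' x) ⁻¹' Metric.closedBall 0 (c * δ) =
      A' ⁻¹' Metric.closedBall u (c * δ) := by
    ext x; simp [dist_eq_norm, norm_sub_rev]
  rw [hset, Measure.restrict_apply (A'.measurable Metric.isClosed_closedBall.measurableSet),
    Set.inter_comm]
  refine (hb A' J hJ1 hJ2 hJ3 _ Metric.isClosed_closedBall.measurableSet).trans ?_
  rw [volume_closedBall_le c hc hδ]
  exact le_of_eq (by ring)

lemma TameOn.lintegral_translate_le {ν : Measure H} {ξ : HilbertBasis ℕ ℝ H} {A₀ : Set H} {r τ L : ℝ}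
    {m : ℕ} (hL : 0 ≤ L) (hτ : τ ≤ r)
    (h : ∀ v : H, (∀ j, m ≤ j → inner ℝ (ξ j) v = 0) → ‖v‖ ≤ r →
      ∀ N, MeasurableSet N → N ⊆ Metric.thickening r A₀ →
        ν ((fun x => x + v) ⁻¹' N) ≤ ENNReal.ofReal (Real.exp (L * ‖v‖)) * ν N)
    {v : H} (hv : ∀ j, m ≤ j → inner ℝ (ξ j) v = 0) (hvτ : ‖v‖ < τ) {φ : H → ENNReal}
    (hφ : Measurable φ) :
    ∫⁻ z in A₀, φ (z + v) ∂ν ≤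
      ENNReal.ofReal (Real.exp (L * τ)) * ∫⁻ z in Metric.thickening τ A₀, φ z ∂ν := by
  have hadd : Measurable fun x : H => x + v := measurable_add_const v
  have hle : (ν.restrict A₀).map (fun x => x + v) ≤
      ENNReal.ofReal (Real.exp (L * τ)) • ν.restrict (Metric.thickening τ A₀) := by
    refine Measure.le_iff.2 fun N hN => ?_
    rw [Measure.map_apply hadd hN, Measure.restrict_apply (hadd hN), Measure.smul_apply,
      Measure.restrict_apply hN, smul_eq_mul]
    have hN' : MeasurableSet (N ∩ Metric.thickening τ A₀) :=
      hN.inter Metric.isOpen_thickening.measurableSet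
    calc ν ((fun x => x + v) ⁻¹' N ∩ A₀)
        ≤ ν ((fun x => x + v) ⁻¹' (N ∩ Metric.thickening τ A₀)) := by
          refine measure_mono fun x hx => ⟨hx.1, Metric.mem_thickening_iff.2 ⟨x, hx.2, ?_⟩⟩
          simpa [dist_eq_norm] using hvτ
      _ ≤ ENNReal.ofReal (Real.exp (L * ‖v‖)) * ν (N ∩ Metric.thickening τ A₀) :=
          h v hv (hvτ.le.trans hτ) _ hN'
            (Set.inter_subset_right.trans (Metric.thickening_mono hτ A₀))
      _ ≤ _ := by gcongr
  calc ∫⁻ z in A₀, φ (z + v) ∂ν = ∫⁻ z, φ z ∂((ν.restrict A₀).map fun x => x + v) :=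
        (lintegral_map hφ hadd).symm
    _ ≤ ∫⁻ z, φ z ∂(ENNReal.ofReal (Real.exp (L * τ)) • ν.restrict (Metric.thickening τ A₀)) :=
        lintegral_mono' hle le_rfl
    _ = _ := lintegral_smul_measure _ _

/-- The kernel `k_δ` smoothed by the tent function of radius `σ`. -/
def smoothKern (k : ℝ → ENNReal) (δ σ : ℝ) (u : EuclideanSpace ℝ (Fin d)) : ENNReal :=
  ∫⁻ w, ENNReal.ofReal (σ - ‖w‖) * kern k δ (u + w)

/-- A change of variables moves the shift from the kernel to the tent function, which is
`1`-Lipschitz. What remains is the total mass of the rescaled kernel, so the Lipschitz constant does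
not deteriorate as `δ` tends to `0`. -/
lemma smoothKern_le_add {k : ℝ → ENNReal} {B : ENNReal} {c : ℝ} (hk : Measurable k)
    (hB : ∀ u, k u ≤ B) (hc0 : 0 ≤ c)
    (hc : ∀ u, c < u → k u = 0) {δ : ℝ} (hδ : 0 < δ) (σ : ℝ) (u u' : EuclideanSpace ℝ (Fin d)) :
    smoothKern k δ σ u ≤ smoothKern k δ σ u' + ENNReal.ofReal ‖u - u'‖ * (B *
      (ENNReal.ofReal (c ^ d) * volume (Metric.ball (0 : EuclideanSpace ℝ (Fin d)) 1))) := by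
  have hshift : ∀ u : EuclideanSpace ℝ (Fin d), smoothKern k δ σ u =
      ∫⁻ y, ENNReal.ofReal (σ - ‖y - u‖) * kern k δ y := fun u => by
    rw [smoothKern, ← lintegral_add_left_eq_self (fun y => ENNReal.ofReal (σ - ‖y - u‖) *
      kern k δ y) u]
    simp
  have hmass : ∫⁻ y : EuclideanSpace ℝ (Fin d), kern k δ y ≤ B *
      (ENNReal.ofReal (c ^ d) * volume (Metric.ball (0 : EuclideanSpace ℝ (Fin d)) 1)) :=
    lintegral_kern_le (φ := fun y => y) hB hc hδ measurable_id
      (volume_closedBall_le c hc0 hδ 0).le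
  have hm := measurable_kern (d := d) hk δ
  rw [hshift, hshift]
  calc ∫⁻ y, ENNReal.ofReal (σ - ‖y - u‖) * kern k δ y
      ≤ ∫⁻ y, (ENNReal.ofReal (σ - ‖y - u'‖) * kern k δ y +
          ENNReal.ofReal ‖u - u'‖ * kern k δ y) := by
        refine lintegral_mono fun y => ?_
        rw [← add_mul]
        refine mul_le_mul_left ?_ _
        refine le_trans (ENNReal.ofReal_le_ofReal ?_) ENNReal.ofReal_add_le
        have := norm_sub_le_norm_sub_add_norm_sub y u u'
        linarith
    _ = _ := by
        rw [lintegral_add_left (by fun_prop), lintegral_const_mul _ hm]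
    _ ≤ _ := by gcongr

lemma lintegral_tent_ne_zero {σ : ℝ} (hσ : 0 < σ) :
    ∫⁻ w : EuclideanSpace ℝ (Fin d), ENNReal.ofReal (σ - ‖w‖) ≠ 0 := by
  have hm : Measurable fun w : EuclideanSpace ℝ (Fin d) => ENNReal.ofReal (σ - ‖w‖) := by fun_prop
  rw [Ne, lintegral_eq_zero_iff hm]
  intro h
  have h1 : volume (Metric.ball (0 : EuclideanSpace ℝ (Fin d)) σ) = 0 := by
    refine measure_mono_null (fun w hw => ?_) h
    have : ‖w‖ < σ := by simpa using hw
    simpa using this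
  exact (Metric.measure_ball_pos volume (0 : EuclideanSpace ℝ (Fin d)) hσ).ne' h1

lemma lintegral_tent_ne_top (σ : ℝ) :
    ∫⁻ w : EuclideanSpace ℝ (Fin d), ENNReal.ofReal (σ - ‖w‖) ≠ ⊤ := by
  refine ne_top_of_le_ne_top (b := ENNReal.ofReal σ *
    volume (Metric.closedBall (0 : EuclideanSpace ℝ (Fin d)) σ))
    (ENNReal.mul_ne_top ENNReal.ofReal_ne_top measure_closedBall_lt_top.ne) ?_
  rw [← lintegral_indicator_const Metric.isClosed_closedBall.measurableSet]
  refine lintegral_mono fun w => ?_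
  by_cases h : w ∈ Metric.closedBall (0 : EuclideanSpace ℝ (Fin d)) σ
  · rw [Set.indicator_of_mem h]
    exact ENNReal.ofReal_le_ofReal (by linarith [norm_nonneg w])
  · rw [ENNReal.ofReal_of_nonpos]
    · exact zero_le
    · have : σ < ‖w‖ := by simpa using h
      linarith

lemma measurable_smoothKern {k : ℝ → ENNReal} (hk : Measurable k) (δ σ : ℝ) :
    Measurable (smoothKern (d := d) k δ σ) := by
  have hm := measurable_kern (d := d) hk δ
  refine Measurable.lintegral_prod_right' (f := fun p : EuclideanSpace ℝ (Fin d) ×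
    EuclideanSpace ℝ (Fin d) => ENNReal.ofReal (σ - ‖p.2‖) * kern k δ (p.1 + p.2)) ?_
  exact Measurable.mul (by fun_prop) (hm.comp (by fun_prop))

end Images

/-! ### Local averages and their continuity in the projection -/

section Local

variable [MeasurableSpace H] [BorelSpace H] [SecondCountableTopology H] {d : ℕ}

/-- The kernel average `∫_S k_δ(A (z - x)) dν(z)`. -/
def localAvg (ν : Measure H) (S : Set H) (k : ℝ → ENNReal) (δ : ℝ)
    (A : H →L[ℝ] EuclideanSpace ℝ (Fin d)) (x : H) : ENNReal :=
  ∫⁻ z in S, kern k δ (A (z - x)) ∂ν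

lemma measurable_localAvg (ν : Measure H) [SFinite ν] (S : Set H) {k : ℝ → ENNReal}
    (hk : Measurable k) (δ : ℝ) (A : H →L[ℝ] EuclideanSpace ℝ (Fin d)) :
    Measurable (localAvg ν S k δ A) := by
  refine Measurable.lintegral_prod_right' (f := fun p : H × H => kern k δ (A (p.2 - p.1))) ?_
  exact (measurable_kern hk δ).comp (by fun_prop)

/-- Smoothing over the translations `J w`. -/
lemma lintegral_tent_mul_localAvg (ν : Measure H) [SFinite ν] (S : Set H) {k : ℝ → ENNReal}
    (hk : Measurable k) (δ σ : ℝ) (A : H →L[ℝ] EuclideanSpace ℝ (Fin d)) (x : H) :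
    ∫⁻ w, ENNReal.ofReal (σ - ‖w‖) * ∫⁻ z in S, kern k δ (A (z - x) + w) ∂ν =
      ∫⁻ z in S, smoothKern k δ σ (A (z - x)) ∂ν := by
  have hm := measurable_kern (d := d) hk δ
  simp only [smoothKern]
  rw [lintegral_lintegral_swap]
  · refine lintegral_congr fun w => (lintegral_const_mul _ (hm.comp (by fun_prop))).symm
  · exact (Measurable.mul (by fun_prop) (hm.comp (by fun_prop))).aemeasurable

/-- Translating `z` by `J w` shifts `A z` by `w`, costs a factor `exp (L * τ)` and moves the domain
by less than `τ`. Averaging over `w` with tent weights smooths the kernel, the price being the layer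
between `A₀` and its thickening. The tent radius `τ / (cJ + 1)` ensures `‖J w‖ < τ`. -/
lemma localAvg_le_smooth {ν : Measure H} [IsFiniteMeasure ν] {ξ : HilbertBasis ℕ ℝ H} {A₀ : Set H}
    (hA₀ : MeasurableSet A₀) {r τ L cJ : ℝ} {m : ℕ} (hL : 0 ≤ L) (hcJ : 0 ≤ cJ) (hτ0 : 0 < τ)
    (hτ : τ ≤ r)
    (h : ∀ v : H, (∀ j, m ≤ j → inner ℝ (ξ j) v = 0) → ‖v‖ ≤ r →
      ∀ N, MeasurableSet N → N ⊆ Metric.thickening r A₀ →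
        ν ((fun x => x + v) ⁻¹' N) ≤ ENNReal.ofReal (Real.exp (L * ‖v‖)) * ν N)
    {A : H →L[ℝ] EuclideanSpace ℝ (Fin d)} {J : EuclideanSpace ℝ (Fin d) →L[ℝ] H}
    (hAJ : ∀ w, A (J w) = w) (hJ : ∀ w j, m ≤ j → inner ℝ (ξ j) (J w) = 0)
    (hJc : ∀ w, ‖J w‖ ≤ cJ * ‖w‖) {k : ℝ → ENNReal} (hk : Measurable k) (δ : ℝ) (x : H) :
    (∫⁻ w : EuclideanSpace ℝ (Fin d), ENNReal.ofReal (τ / (cJ + 1) - ‖w‖)) *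
        localAvg ν A₀ k δ A x ≤ ENNReal.ofReal (Real.exp (L * τ)) *
      (∫⁻ z in A₀, smoothKern k δ (τ / (cJ + 1)) (A (z - x)) ∂ν +
        ∫⁻ z in Metric.thickening τ A₀ \ A₀, smoothKern k δ (τ / (cJ + 1)) (A (z - x)) ∂ν) ∧
    ∫⁻ z in A₀, smoothKern k δ (τ / (cJ + 1)) (A (z - x)) ∂ν ≤
      ENNReal.ofReal (Real.exp (L * τ)) *
        (∫⁻ w : EuclideanSpace ℝ (Fin d), ENNReal.ofReal (τ / (cJ + 1) - ‖w‖)) *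
        (localAvg ν A₀ k δ A x + localAvg ν (Metric.thickening τ A₀ \ A₀) k δ A x) := by
  set σ := τ / (cJ + 1) with hσ
  have hm := measurable_kern (d := d) hk δ
  have hsub : A₀ ⊆ Metric.thickening τ A₀ := Metric.self_subset_thickening hτ0 A₀
  have hsplit : ∀ φ : H → ENNReal, ∫⁻ z in Metric.thickening τ A₀, φ z ∂ν =
      ∫⁻ z in A₀, φ z ∂ν + ∫⁻ z in Metric.thickening τ A₀ \ A₀, φ z ∂ν := fun φ => by
    rw [← lintegral_inter_add_sdiff φ (Metric.thickening τ A₀) hA₀,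
      Set.inter_eq_self_of_subset_right hsub]
  have hJτ : ∀ w : EuclideanSpace ℝ (Fin d), ‖w‖ < σ → ‖J w‖ < τ := fun w hw => by
    refine (hJc w).trans_lt ?_
    rw [hσ, lt_div_iff₀ (by positivity)] at hw
    nlinarith [norm_nonneg w]
  have htm : Measurable fun w : EuclideanSpace ℝ (Fin d) => ENNReal.ofReal (σ - ‖w‖) := by
    fun_prop
  have hcut : ∀ {φ φ' : EuclideanSpace ℝ (Fin d) → ENNReal}, (∀ w, ‖w‖ < σ → φ w ≤ φ' w) →
      ∫⁻ w, ENNReal.ofReal (σ - ‖w‖) * φ w ≤ ∫⁻ w, ENNReal.ofReal (σ - ‖w‖) * φ' w :=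
    fun hφ => lintegral_mono fun w => by
      rcases lt_or_ge ‖w‖ σ with hw | hw
      · exact mul_le_mul_right (hφ w hw) _
      · rw [ENNReal.ofReal_of_nonpos (by linarith)]; simp
  constructor
  · rw [← lintegral_tent_mul_localAvg ν A₀ hk, ← lintegral_tent_mul_localAvg ν _ hk,
      ← lintegral_mul_const _ htm]
    have hmeas : ∀ S : Set H, Measurable fun w : EuclideanSpace ℝ (Fin d) =>
        ∫⁻ z in S, kern k δ (A (z - x) + w) ∂ν := fun S =>
      Measurable.lintegral_prod_right' (f := fun p : EuclideanSpace ℝ (Fin d) × H =>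
        kern k δ (A (p.2 - x) + p.1)) (hm.comp (by fun_prop))
    rw [← lintegral_add_left (by have := hmeas A₀; fun_prop), ← lintegral_const_mul _
      (by have := hmeas A₀; have := hmeas (Metric.thickening τ A₀ \ A₀); fun_prop)]
    refine (hcut (φ' := fun w => ENNReal.ofReal (Real.exp (L * τ)) *
      (∫⁻ z in A₀, kern k δ (A (z - x) + w) ∂ν + ∫⁻ z in Metric.thickening τ A₀ \ A₀,
        kern k δ (A (z - x) + w) ∂ν)) fun w hw => ?_).trans
      (le_of_eq (lintegral_congr fun w => by ring))
    rw [← hsplit]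
    have := TameOn.lintegral_translate_le hL hτ h (v := -J w)
      (fun j hj => by rw [inner_neg_right, hJ w j hj, neg_zero]) (by rw [norm_neg]; exact hJτ w hw)
      (φ := fun z => kern k δ (A (z - x) + w)) (hm.comp (by fun_prop))
    refine le_trans (le_of_eq ?_) this
    refine lintegral_congr fun z => ?_
    rw [show z + -J w - x = (z - x) - J w by abel, map_sub A (z - x) (J w), hAJ, sub_add_cancel]
  · rw [← lintegral_tent_mul_localAvg ν A₀ hk]
    refine (hcut (φ' := fun w => ENNReal.ofReal (Real.exp (L * τ)) *
      (localAvg ν A₀ k δ A x + localAvg ν (Metric.thickening τ A₀ \ A₀) k δ A x))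
      fun w hw => ?_).trans (le_of_eq ?_)
    · simp only [localAvg]
      rw [← hsplit]
      have := TameOn.lintegral_translate_le hL hτ h (v := J w) (hJ w) (hJτ w hw)
        (φ := fun z => kern k δ (A (z - x))) (hm.comp (by fun_prop))
      refine le_trans (le_of_eq ?_) this
      refine lintegral_congr fun z => ?_
      rw [show z + J w - x = (z - x) + J w by abel, map_add, hAJ]
    · rw [lintegral_mul_const _ htm]; ring

/-- Kernel averages depend continuously on the projection, in `L¹` of a tame measure, uniformly in
the bandwidth. -/
theorem exists_localAvg_le_add {ν ν' : Measure H} [IsFiniteMeasure ν] [IsFiniteMeasure ν']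
    {ξ ξ' : HilbertBasis ℕ ℝ H} {A₀ B₀ : Set H} (hA₀ : IsCompact A₀) (hA₀t : A₀ ⊆ tamePts ν ξ)
    (hB₀ : IsCompact B₀) (hB₀t : B₀ ⊆ tamePts ν' ξ')
    {A : H →L[ℝ] EuclideanSpace ℝ (Fin d)} (hA : Function.Surjective A)
    {k : ℝ → ENNReal} (hk : Measurable k) {B : ENNReal} (hBtop : B ≠ ⊤) {c : ℝ} (hc0 : 0 ≤ c)
    (hB : ∀ u, k u ≤ B) (hc : ∀ u, c < u → k u = 0) {ε : ENNReal} (hε : ε ≠ 0) :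
    ∃ η > 0, ∀ A' A'' : H →L[ℝ] EuclideanSpace ℝ (Fin d), ‖A' - A‖ ≤ η → ‖A'' - A‖ ≤ η →
      ∀ δ > 0, ∃ R : H → ENNReal, Measurable R ∧
        (∀ x ∈ B₀, localAvg ν A₀ k δ A' x ≤ localAvg ν A₀ k δ A'' x + R x) ∧
        ∫⁻ x in B₀, R x ∂ν' ≤ ε := by
  obtain ⟨ε₁, hε₁, m, cJ, hcJ, hJ⟩ := exists_uniform_rightInverse ξ A hA
  obtain ⟨ε₂, hε₂, C', hC', hb'⟩ := exists_lintegral_kern_le hB₀ hB₀t hA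
  obtain ⟨ε₃, hε₃, C, hC, hb⟩ := exists_lintegral_kern_le hA₀ hA₀t hA
  obtain ⟨r, hr, ht⟩ := exists_tameOn_thickening hA₀ hA₀t
  obtain ⟨L, hL, hLt⟩ := ht m
  set CA := B * (C * ENNReal.ofReal (c ^ d)) with hCA
  set CB := B * (C' * ENNReal.ofReal (c ^ d)) with hCB
  have hCAt : CA ≠ ⊤ := ENNReal.mul_ne_top hBtop (ENNReal.mul_ne_top hC ENNReal.ofReal_ne_top)
  have hCBt : CB ≠ ⊤ := ENNReal.mul_ne_top hBtop (ENNReal.mul_ne_top hC' ENNReal.ofReal_ne_top)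
  set θ : ℝ → ENNReal := fun τ => ENNReal.ofReal (Real.exp (L * τ)) with hθ
  set β : ℝ → ENNReal := fun τ => ν (Metric.thickening τ A₀ \ A₀) with hβ
  have hε2 : 0 < ε / 2 := ENNReal.half_pos hε
  -- the choice of the smoothing radius
  obtain ⟨τ, ⟨hτ0, hτr⟩, hτε⟩ : ∃ τ, (0 < τ ∧ τ ≤ r) ∧
      (θ τ ^ 2 - 1) * CA * ν' B₀ + θ τ ^ 2 * (CB * β τ) + θ τ * (CB * β τ) < ε / 2 := by
    have h1 : Tendsto θ (𝓝[>] 0) (𝓝 1) := by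
      have : Tendsto θ (𝓝 0) (𝓝 (θ 0)) := by
        refine Continuous.tendsto ?_ 0
        exact ENNReal.continuous_ofReal.comp (by fun_prop)
      simpa [hθ] using this.mono_left nhdsWithin_le_nhds
    have h2 : Tendsto β (𝓝[>] 0) (𝓝 0) := by
      have h3 := tendsto_measure_thickening_of_isClosed (μ := ν)
        ⟨1, one_pos, measure_ne_top _ _⟩ hA₀.isClosed
      have h4 : ∀ᶠ τ in 𝓝[>] (0 : ℝ), β τ = ν (Metric.thickening τ A₀) - ν A₀ := by
        filter_upwards [self_mem_nhdsWithin] with τ hτ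
        exact measure_sdiff (Metric.self_subset_thickening hτ A₀)
          hA₀.measurableSet.nullMeasurableSet (measure_ne_top _ _)
      refine Tendsto.congr' (EventuallyEq.symm h4) ?_
      have := ENNReal.Tendsto.sub h3 (tendsto_const_nhds (x := ν A₀))
        (Or.inl (measure_ne_top _ _))
      simpa using this
    have h5 : Tendsto (fun τ => (θ τ ^ 2 - 1) * CA * ν' B₀ + θ τ ^ 2 * (CB * β τ) +
        θ τ * (CB * β τ)) (𝓝[>] 0) (𝓝 0) := by
      have hθ2 : Tendsto (fun τ => θ τ ^ 2) (𝓝[>] 0) (𝓝 1) := by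
        simpa using ENNReal.Tendsto.pow (n := 2) h1
      have a1 : Tendsto (fun τ => θ τ ^ 2 - 1) (𝓝[>] 0) (𝓝 0) := by
        simpa using ENNReal.Tendsto.sub hθ2 (tendsto_const_nhds (x := (1 : ENNReal)))
          (Or.inl ENNReal.one_ne_top)
      have a2 : Tendsto (fun τ => (θ τ ^ 2 - 1) * CA * ν' B₀) (𝓝[>] 0) (𝓝 0) := by
        have := ENNReal.Tendsto.mul_const a1 (b := CA * ν' B₀)
          (Or.inr (ENNReal.mul_ne_top hCAt (measure_ne_top _ _)))
        simpa [mul_assoc] using this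
      have a3 : Tendsto (fun τ => CB * β τ) (𝓝[>] 0) (𝓝 0) := by
        simpa using ENNReal.Tendsto.const_mul h2 (Or.inr hCBt)
      have a4 := ENNReal.Tendsto.mul hθ2 (Or.inl one_ne_zero) a3 (Or.inr ENNReal.one_ne_top)
      have a5 := ENNReal.Tendsto.mul h1 (Or.inl one_ne_zero) a3 (Or.inr ENNReal.one_ne_top)
      simpa using (a2.add a4).add a5
    have h6 := h5.eventually (Iio_mem_nhds hε2)
    obtain ⟨τ, h7, h8⟩ := (h6.and (Ioc_mem_nhdsGT hr)).exists
    exact ⟨τ, h8, h7⟩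
  set σ := τ / (cJ + 1) with hσ
  have hσ0 : 0 < σ := by positivity
  set M : ENNReal := ∫⁻ w : EuclideanSpace ℝ (Fin d), ENNReal.ofReal (σ - ‖w‖) with hM
  have hM0 : M ≠ 0 := lintegral_tent_ne_zero hσ0
  have hMt : M ≠ ⊤ := lintegral_tent_ne_top σ
  set κ : ENNReal := B *
    (ENNReal.ofReal (c ^ d) * volume (Metric.ball (0 : EuclideanSpace ℝ (Fin d)) 1)) with hκ
  have hκt : κ ≠ ⊤ := ENNReal.mul_ne_top hBtop
    (ENNReal.mul_ne_top ENNReal.ofReal_ne_top measure_ball_lt_top.ne)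
  obtain ⟨D, hD⟩ := (hA₀.isBounded.union hB₀.isBounded).exists_norm_le
  set W : ENNReal := M⁻¹ * θ τ * (κ * ν A₀) * ν' B₀ with hW
  have hWt : W ≠ ⊤ := by
    refine ENNReal.mul_ne_top (ENNReal.mul_ne_top (ENNReal.mul_ne_top
      (ENNReal.inv_ne_top.2 hM0) ENNReal.ofReal_ne_top) (ENNReal.mul_ne_top hκt ?_)) ?_ <;>
    exact measure_ne_top _ _
  -- The radius `τ` is fixed first: the cost `W` of comparing two projections through the smoothed
  -- kernel depends on `τ`, but not on `δ`. The projections differ by at most `2 * η`, and the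
  -- points by at most `2 * |D|`.
  obtain ⟨η, hη0, hηε⟩ : ∃ η > 0, W * ENNReal.ofReal (2 * η * (2 * |D|)) ≤ ε / 2 := by
    have h1 : Tendsto (fun η : ℝ => W * ENNReal.ofReal (2 * η * (2 * |D|))) (𝓝[>] 0) (𝓝 0) := by
      have : Tendsto (fun η : ℝ => ENNReal.ofReal (2 * η * (2 * |D|))) (𝓝 0) (𝓝 0) := by
        have h : Continuous fun η : ℝ => ENNReal.ofReal (2 * η * (2 * |D|)) :=
          ENNReal.continuous_ofReal.comp (by fun_prop)
        simpa using h.tendsto 0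
      simpa using ENNReal.Tendsto.const_mul (this.mono_left nhdsWithin_le_nhds) (Or.inr hWt)
    obtain ⟨η, h2, h3⟩ := ((h1.eventually (Iio_mem_nhds hε2)).and self_mem_nhdsWithin).exists
    exact ⟨η, h3, le_of_lt h2⟩
  refine ⟨min η (min ε₁ (min ε₂ ε₃)), by positivity, fun A' A'' hA' hA'' δ hδ => ?_⟩
  have hle : ∀ {A' : H →L[ℝ] EuclideanSpace ℝ (Fin d)},
      ‖A' - A‖ ≤ min η (min ε₁ (min ε₂ ε₃)) →
      ‖A' - A‖ ≤ η ∧ ‖A' - A‖ ≤ ε₁ ∧ ‖A' - A‖ ≤ ε₂ ∧ ‖A' - A‖ ≤ ε₃ := fun h => by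
    simpa only [le_min_iff] using h
  obtain ⟨hA1, hA2, hA3, hA4⟩ := hle hA'
  obtain ⟨hA1', hA2', hA3', hA4'⟩ := hle hA''
  obtain ⟨J', hJ1, hJ2, hJ3⟩ := hJ A' hA2
  obtain ⟨J'', hJ1', hJ2', hJ3'⟩ := hJ A'' hA2'
  have hm := measurable_kern (d := d) hk δ
  have hms := measurable_smoothKern (d := d) hk δ σ
  set T := Metric.thickening τ A₀ \ A₀ with hT
  have hbx : ∀ {A' : H →L[ℝ] EuclideanSpace ℝ (Fin d)}, ‖A' - A‖ ≤ ε₂ → ∀ u,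
      ∫⁻ x in B₀, kern k δ (u - A' x) ∂ν' ≤ CB := fun hA' u =>
    hb' _ hA' k B c hc0 hB hc δ hδ u
  set S' : H → ENNReal := fun x => ∫⁻ z in T, smoothKern k δ σ (A' (z - x)) ∂ν with hS'
  have hS'm : Measurable S' :=
    Measurable.lintegral_prod_right' (f := fun p : H × H => smoothKern k δ σ (A' (p.2 - p.1)))
      (hms.comp (by fun_prop))
  -- Integrating over `x` first, anti-concentration of `ν'` bounds the inner integral uniformly in
  -- `δ`, and the layer has small `ν` measure.
  have hbd1 : ∫⁻ x in B₀, localAvg ν T k δ A'' x ∂ν' ≤ CB * β τ := by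
    simp only [localAvg]
    rw [lintegral_lintegral_swap (f := fun x z => kern k δ (A'' (z - x)))
      (Measurable.aemeasurable (by unfold Function.uncurry; fun_prop))]
    calc ∫⁻ z in T, ∫⁻ x in B₀, kern k δ (A'' (z - x)) ∂ν' ∂ν ≤ ∫⁻ _ in T, CB ∂ν :=
          lintegral_mono fun z => by simpa only [map_sub] using hbx hA3' (A'' z)
      _ = CB * β τ := by rw [setLIntegral_const]
  have hbd2 : ∫⁻ x in B₀, S' x ∂ν' ≤ M * (CB * β τ) := by
    simp only [hS']
    rw [lintegral_lintegral_swap (f := fun x z => smoothKern k δ σ (A' (z - x)))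
      (Measurable.aemeasurable (by unfold Function.uncurry; fun_prop))]
    calc ∫⁻ z in T, ∫⁻ x in B₀, smoothKern k δ σ (A' (z - x)) ∂ν' ∂ν
        ≤ ∫⁻ _ in T, M * CB ∂ν := by
          refine lintegral_mono fun z => ?_
          simp only [smoothKern]
          rw [lintegral_lintegral_swap
            (f := fun x w => ENNReal.ofReal (σ - ‖w‖) * kern k δ (A' (z - x) + w))
            (Measurable.aemeasurable (by unfold Function.uncurry; fun_prop)), hM,
            ← lintegral_mul_const _ (by fun_prop)]
          refine lintegral_mono fun w => ?_
          rw [lintegral_const_mul _ (by fun_prop)]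
          refine mul_le_mul_right ?_ _
          have := hbx hA3 (A' z + w)
          simpa only [map_sub, add_sub_right_comm] using this
      _ = M * (CB * β τ) := by rw [setLIntegral_const]; ring
  -- The four errors: the distortion factor of two translations, the layer met when leaving `A''`,
  -- the change of projection under the smoothed kernel, and the layer met when returning to `A'`.
  refine ⟨fun x => (θ τ ^ 2 - 1) * CA + θ τ ^ 2 * localAvg ν T k δ A'' x +
      M⁻¹ * θ τ * (κ * ν A₀) * ENNReal.ofReal (2 * η * (2 * |D|)) + M⁻¹ * θ τ * S' x,
    ?_, fun x hx => ?_, ?_⟩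
  · have := measurable_localAvg ν T hk δ A''
    fun_prop
  · have h1 := (localAvg_le_smooth hA₀.measurableSet hL hcJ hτ0 hτr hLt hJ1 hJ2 hJ3 hk δ x).1
    have h2 := (localAvg_le_smooth hA₀.measurableSet hL hcJ hτ0 hτr hLt hJ1' hJ2' hJ3' hk δ x).2
    rw [← hσ, ← hM] at h1 h2
    have h3 : ∫⁻ z in A₀, smoothKern k δ σ (A' (z - x)) ∂ν ≤
        ∫⁻ z in A₀, smoothKern k δ σ (A'' (z - x)) ∂ν +
          κ * ν A₀ * ENNReal.ofReal (2 * η * (2 * |D|)) := by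
      calc ∫⁻ z in A₀, smoothKern k δ σ (A' (z - x)) ∂ν
          ≤ ∫⁻ z in A₀, (smoothKern k δ σ (A'' (z - x)) +
              ENNReal.ofReal (2 * η * (2 * |D|)) * κ) ∂ν := by
            refine setLIntegral_mono' hA₀.measurableSet fun z hz => ?_
            refine (smoothKern_le_add hk hB hc0 hc hδ σ _ (A'' (z - x))).trans ?_
            gcongr
            rw [← sub_apply]
            refine ((A' - A'').le_opNorm _).trans (mul_le_mul ?_ ?_ (norm_nonneg _) (by positivity))
            · have := norm_sub_le_norm_sub_add_norm_sub A' A A''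
              rw [norm_sub_rev A A''] at this
              linarith
            · have hz' := (hD z (Or.inl hz)).trans (le_abs_self D)
              have hx' := (hD x (Or.inr hx)).trans (le_abs_self D)
              have := norm_sub_le z x
              linarith
        _ = _ := by
            rw [lintegral_add_left (by fun_prop), setLIntegral_const]
            ring
    have h4 : localAvg ν A₀ k δ A'' x ≤ CA := by
      have h5 : ∀ z, kern k δ (A'' (z - x)) = kern k δ (A'' x - A'' z) := fun z => by
        rw [map_sub, kern, kern, norm_sub_rev]
      simp only [localAvg, h5]
      exact hb _ hA4' k B c hc0 hB hc δ hδ _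
    have h6 : localAvg ν A₀ k δ A' x = M⁻¹ * (M * localAvg ν A₀ k δ A' x) := by
      rw [← mul_assoc, ENNReal.inv_mul_cancel hM0 hMt, one_mul]
    have h7 : θ τ ^ 2 * localAvg ν A₀ k δ A'' x ≤
        localAvg ν A₀ k δ A'' x + (θ τ ^ 2 - 1) * CA := by
      calc θ τ ^ 2 * localAvg ν A₀ k δ A'' x
          ≤ (1 + (θ τ ^ 2 - 1)) * localAvg ν A₀ k δ A'' x := by gcongr; exact le_add_tsub
        _ = localAvg ν A₀ k δ A'' x + (θ τ ^ 2 - 1) * localAvg ν A₀ k δ A'' x := by ring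
        _ ≤ _ := by gcongr
    calc localAvg ν A₀ k δ A' x
        ≤ M⁻¹ * (θ τ * ((θ τ * M * (localAvg ν A₀ k δ A'' x + localAvg ν T k δ A'' x) +
            κ * ν A₀ * ENNReal.ofReal (2 * η * (2 * |D|))) + S' x)) := by
          rw [h6]
          refine mul_le_mul_right (h1.trans (mul_le_mul_right ?_ _)) _
          exact add_le_add (h3.trans (add_le_add h2 le_rfl)) le_rfl
      _ = (M⁻¹ * M) * (θ τ ^ 2 * localAvg ν A₀ k δ A'' x) +
          ((M⁻¹ * M) * (θ τ ^ 2 * localAvg ν T k δ A'' x) +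
          M⁻¹ * θ τ * (κ * ν A₀) * ENNReal.ofReal (2 * η * (2 * |D|)) + M⁻¹ * θ τ * S' x) := by
          ring
      _ ≤ (localAvg ν A₀ k δ A'' x + (θ τ ^ 2 - 1) * CA) + (θ τ ^ 2 * localAvg ν T k δ A'' x +
          M⁻¹ * θ τ * (κ * ν A₀) * ENNReal.ofReal (2 * η * (2 * |D|)) + M⁻¹ * θ τ * S' x) := by
          rw [ENNReal.inv_mul_cancel hM0 hMt, one_mul, one_mul]
          gcongr
      _ = _ := by ring
  · have hlm := measurable_localAvg ν T hk δ A''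
    rw [lintegral_add_left (by fun_prop), lintegral_add_left (by fun_prop),
      lintegral_add_left (by fun_prop), lintegral_const_mul _ hlm, lintegral_const_mul _ hS'm,
      setLIntegral_const, setLIntegral_const]
    calc (θ τ ^ 2 - 1) * CA * ν' B₀ + θ τ ^ 2 * ∫⁻ x in B₀, localAvg ν T k δ A'' x ∂ν' +
          M⁻¹ * θ τ * (κ * ν A₀) * ENNReal.ofReal (2 * η * (2 * |D|)) * ν' B₀ +
          M⁻¹ * θ τ * ∫⁻ x in B₀, S' x ∂ν'
        ≤ (θ τ ^ 2 - 1) * CA * ν' B₀ + θ τ ^ 2 * (CB * β τ) +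
          M⁻¹ * θ τ * (κ * ν A₀) * ENNReal.ofReal (2 * η * (2 * |D|)) * ν' B₀ +
          M⁻¹ * θ τ * (M * (CB * β τ)) := by gcongr
      _ = ((θ τ ^ 2 - 1) * CA * ν' B₀ + θ τ ^ 2 * (CB * β τ) + (M⁻¹ * M) * (θ τ * (CB * β τ))) +
          W * ENNReal.ofReal (2 * η * (2 * |D|)) := by rw [hW]; ring
      _ ≤ ε / 2 + ε / 2 := by
          rw [ENNReal.inv_mul_cancel hM0 hMt, one_mul]
          exact add_le_add hτε.le hηε
      _ = ε := ENNReal.add_halves ε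

end Local

/-! ### Removing one observation from a sample -/

/-- The form in which independence is used: the deleted observation is integrated while the
remaining sample, and hence its projection, is frozen. -/
lemma lintegral_removeNth {Z : Type*} [MeasurableSpace Z] {μ : Measure Z} [SigmaFinite μ] {N : ℕ}
    (i : Fin (N + 1)) {F : (Fin N → Z) → Z → ENNReal} (hF : Measurable (Function.uncurry F)) :
    ∫⁻ s, F (i.removeNth s) (s i) ∂(Measure.pi fun _ : Fin (N + 1) => μ) =
      ∫⁻ s, ∫⁻ z, F s z ∂μ ∂(Measure.pi fun _ : Fin N => μ) := by
  have h := measurePreserving_piFinSuccAbove (fun _ : Fin (N + 1) => μ) i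
  have h1 : Measurable fun p : Z × (Fin N → Z) => F p.2 p.1 := hF.comp measurable_swap
  have h2 := h.lintegral_comp h1
  rw [lintegral_prod_symm' _ h1] at h2
  exact h2

lemma lintegral_removeNth_removeNth {Z : Type*} [MeasurableSpace Z] {μ : Measure Z} [SigmaFinite μ]
    {N : ℕ} (i : Fin (N + 2)) (j : Fin (N + 1)) {F : (Fin N → Z) → Z → Z → ENNReal}
    (hF : Measurable fun p : (Fin N → Z) × Z × Z => F p.1 p.2.1 p.2.2) :
    ∫⁻ s, F (j.removeNth (i.removeNth s)) (s i) (s (i.succAbove j))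
        ∂(Measure.pi fun _ : Fin (N + 2) => μ) =
      ∫⁻ s, ∫⁻ z', ∫⁻ z, F s z z' ∂μ ∂μ ∂(Measure.pi fun _ : Fin N => μ) := by
  have h1 := lintegral_removeNth (μ := μ) i
    (F := fun s z => F (j.removeNth s) z (s j)) (by
      refine hF.comp (f := fun p : (Fin (N + 1) → Z) × Z =>
        ((j.removeNth p.1 : Fin N → Z), p.2, p.1 j)) ?_
      have : Measurable fun p : (Fin (N + 1) → Z) × Z => (j.removeNth p.1 : Fin N → Z) :=
        measurable_pi_lambda _ fun k => (measurable_pi_apply _).comp measurable_fst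
      fun_prop)
  have h2 := lintegral_removeNth (μ := μ) j (F := fun s z' => ∫⁻ z, F s z z' ∂μ) (by
    refine Measurable.lintegral_prod_right' (f := fun q : ((Fin N → Z) × Z) × Z =>
      F q.1.1 q.2 q.1.2) ?_
    exact hF.comp (f := fun q : ((Fin N → Z) × Z) × Z => (q.1.1, q.2, q.1.2)) (by fun_prop))
  exact h1.trans h2

lemma continuous_feature {G : ℕ} (g : Fin G) : Continuous (feature (H := H) g) := by
  have h1 : feature (H := H) g = fun z =>
      (if z.2 = g then (1 : ℝ) else 0) • ((1 : ℝ), z.1, tensorL z.1 z.1) := by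
    funext z
    rw [feature]; split_ifs <;> simp
  have h2 : Continuous fun y : Fin G => if y = g then (1 : ℝ) else 0 :=
    continuous_of_discreteTopology
  rw [h1]
  exact (h2.comp continuous_snd).smul (by fun_prop)

lemma continuous_featureMean {G n : ℕ} (g : Fin G) :
    Continuous (featureMean (H := H) (n := n) g) := by
  have := continuous_feature (H := H) g
  unfold featureMean
  fun_prop

/-- The mean moves by the difference between one observation and the mean, divided by the sample
size. Writing this with either the full or the reduced mean allows the ball to be assumed for
whichever of them is known to lie in it. -/
lemma norm_featureMean_removeNth_sub_le {G N : ℕ} {g : Fin G} {T : ℝ × H × (H →L[ℝ] H)} {r c : ℝ}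
    (hN : 0 < N) (i : Fin (N + 1)) (s : Fin (N + 1) → H × Fin G) (hc : ‖feature g (s i)‖ ≤ c)
    (h : featureMean g s ∈ Metric.ball T r ∨ featureMean g (i.removeNth s) ∈ Metric.ball T r) :
    ‖featureMean g s - featureMean g (i.removeNth s)‖ ≤ (c + (‖T‖ + r)) / N := by
  have hN' : (0 : ℝ) < N := by exact_mod_cast hN
  have h1 : ((N : ℝ) + 1) • featureMean g s =
      feature g (s i) + (N : ℝ) • featureMean g (i.removeNth s) := by
    rw [featureMean, featureMean, Nat.cast_succ, smul_inv_smul₀ (by positivity),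
      smul_inv_smul₀ hN'.ne', Fin.sum_univ_succAbove _ i]
    rfl
  have hb : ∀ S : ℝ × H × (H →L[ℝ] H), S ∈ Metric.ball T r → ‖S‖ ≤ ‖T‖ + r := fun S hS => by
    have h2 := norm_le_norm_add_norm_sub' S T
    rw [mem_ball_iff_norm] at hS
    linarith
  set S := featureMean g s
  set S' := featureMean g (i.removeNth s)
  rw [le_div_iff₀ hN', mul_comm]
  rcases h with h | h
  · have e : (N : ℝ) • (S - S') = feature g (s i) - S := by
      rw [smul_sub, eq_sub_iff_add_eq, sub_add_eq_add_sub, sub_eq_iff_eq_add, ← h1, add_smul,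
        one_smul]
    calc (N : ℝ) * ‖S - S'‖ = ‖(N : ℝ) • (S - S')‖ := by
          rw [norm_smul, Real.norm_of_nonneg hN'.le]
      _ ≤ ‖feature g (s i)‖ + ‖S‖ := by rw [e]; exact norm_sub_le _ _
      _ ≤ _ := add_le_add hc (hb _ h)
  · have e : ((N : ℝ) + 1) • (S - S') = feature g (s i) - S' := by
      rw [smul_sub, h1, add_smul, one_smul]; abel
    calc (N : ℝ) * ‖S - S'‖ ≤ ((N : ℝ) + 1) * ‖S - S'‖ := by nlinarith [norm_nonneg (S - S')]
      _ = ‖((N : ℝ) + 1) • (S - S')‖ := by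
          rw [norm_smul, Real.norm_of_nonneg (by positivity)]
      _ ≤ ‖feature g (s i)‖ + ‖S'‖ := by rw [e]; exact norm_sub_le _ _
      _ ≤ _ := add_le_add hc (hb _ h)

/-! ### Comparison of kernels -/

/-- The kernel `K` on the half-line with values in `[0, ∞]`. -/
def ennKernel (K : ℝ → ℝ) (u : ℝ) : ENNReal := ENNReal.ofReal (K |u|)

lemma IsKernel.exists_bounds {K : ℝ → ℝ} (hK : IsKernel K) :
    ∃ L : ℝ, 0 ≤ L ∧ (∀ u v, 0 ≤ u → 0 ≤ v → K u ≤ K v + L * |u - v|) ∧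
      (∀ u, ennKernel K u ≤ ENNReal.ofReal L) ∧ (∀ u, 1 < u → ennKernel K u = 0) ∧
      Measurable (ennKernel K) := by
  obtain ⟨L, hL⟩ := hK.lipschitz
  have h1 : ∀ u v, 0 ≤ u → 0 ≤ v → K u ≤ K v + L * |u - v| := fun u v hu hv => by
    have := hL.dist_le_mul u hu v hv
    rw [Real.dist_eq, Real.dist_eq] at this
    have := (le_abs_self _).trans this
    linarith
  -- One constant is used both as Lipschitz constant and as bound: `K` vanishes at `2`, and the
  -- points of `[0, 1]` are at distance at most `2` from it.
  refine ⟨2 * L, by positivity, fun u v hu hv => (h1 u v hu hv).trans ?_, fun u => ?_,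
    fun u hu => ?_, ?_⟩
  · have : 0 ≤ L * |u - v| := by positivity
    linarith
  · refine ENNReal.ofReal_le_ofReal ?_
    by_cases hu : 1 < |u|
    · rw [hK.support _ hu]; positivity
    · have := h1 |u| 2 (abs_nonneg u) (by norm_num)
      rw [hK.support 2 (by norm_num), zero_add] at this
      refine this.trans ?_
      rw [mul_comm]
      refine mul_le_mul_of_nonneg_right ?_ L.2
      rw [abs_le]
      constructor <;> linarith [abs_nonneg u]
  · rw [ennKernel, hK.support _ (hu.trans_le (le_abs_self u)), ENNReal.ofReal_zero]
  · refine ENNReal.measurable_ofReal.comp (Continuous.measurable ?_)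
    exact hL.continuousOn.comp_continuous continuous_abs fun u => abs_nonneg u

/-- The indicator kernel of `[0, 2]`. -/
def boxKernel (u : ℝ) : ENNReal := (Set.Iic 2).indicator 1 u

lemma boxKernel_le (u : ℝ) : boxKernel u ≤ 1 := Set.indicator_le_self' (by simp) u

lemma boxKernel_eq_zero {u : ℝ} (hu : 2 < u) : boxKernel u = 0 :=
  Set.indicator_of_notMem (by simpa using hu) _

lemma measurable_boxKernel : Measurable boxKernel := measurable_one.indicator measurableSet_Iic

/-- If one argument is at most `1`, then both are at most `2` because `ε ≤ 1`, so the box over `[0,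
2]` covers the error. In both inequalities the box is taken at `b`, the argument that will involve
only the remaining sample. -/
lemma ennKernel_le_add {K : ℝ → ℝ} {L : ℝ} (hL0 : 0 ≤ L)
    (hL : ∀ u v, 0 ≤ u → 0 ≤ v → K u ≤ K v + L * |u - v|) (hs : ∀ u, 1 < u → ennKernel K u = 0)
    {a b ε : ℝ} (ha : 0 ≤ a) (hb : 0 ≤ b) (hε : ε ≤ 1) (h : a ≤ 1 ∨ b ≤ 1 → |a - b| ≤ ε) :
    ennKernel K a ≤ ennKernel K b + ENNReal.ofReal (L * ε) * boxKernel b ∧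
      ennKernel K b ≤ ennKernel K a + ENNReal.ofReal (L * ε) * boxKernel b := by
  have key : ∀ a b : ℝ, 0 ≤ a → 0 ≤ b → |a - b| ≤ ε →
      ennKernel K a ≤ ennKernel K b + ENNReal.ofReal (L * ε) := fun a b ha hb hab => by
    rw [ennKernel, ennKernel, abs_of_nonneg ha, abs_of_nonneg hb]
    refine (ENNReal.ofReal_le_ofReal ((hL a b ha hb).trans
      (add_le_add_right (mul_le_mul_of_nonneg_left hab hL0) _))).trans ENNReal.ofReal_add_le
  have hbox : ∀ {u : ℝ}, u ≤ 2 → boxKernel u = 1 := fun hu =>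
    Set.indicator_of_mem (show _ ∈ Set.Iic (2 : ℝ) from hu) 1
  constructor
  · rcases lt_or_ge 1 a with h1 | h1
    · rw [hs a h1]; exact zero_le
    · have h2 := h (Or.inl h1)
      have h3 := abs_le.1 h2
      rw [hbox (by linarith), mul_one]
      exact key a b ha hb h2
  · rcases lt_or_ge 1 b with h1 | h1
    · rw [hs b h1]; exact zero_le
    · have h2 := h (Or.inr h1)
      rw [hbox (by linarith), mul_one]
      exact key b a hb ha (by rwa [abs_sub_comm])

/-- Comparison of the kernel at an estimated projection `e` with the kernel at the image in
`span a` of a nearby projection `e'`. -/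
lemma kern_coordMap_le_add {d : ℕ} {K : ℝ → ℝ} {L : ℝ} (hL0 : 0 ≤ L)
    (hL : ∀ u v, 0 ≤ u → 0 ≤ v → K u ≤ K v + L * |u - v|) (hs : ∀ u, 1 < u → ennKernel K u = 0)
    {e e' a : Fin d → H} (he : Orthonormal ℝ e) (he' : Orthonormal ℝ e') (ha : Orthonormal ℝ a)
    {δ ε : ℝ} (hδ : 0 < δ) (hε : ε ≤ 1) {v : H} (h1 : ‖projL e - projL e'‖ * ‖v‖ ≤ ε / 2 * δ)
    (h2 : ‖projL e' - projL a‖ ≤ ε / 4) :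
    kern (ennKernel K) δ (coordMap e v) ≤ kern (ennKernel K) δ (coordMap a (projL e' v)) +
        ENNReal.ofReal (L * ε) * kern boxKernel δ (coordMap a (projL e' v)) ∧
      kern (ennKernel K) δ (coordMap a (projL e' v)) ≤ kern (ennKernel K) δ (coordMap e v) +
        ENNReal.ofReal (L * ε) * kern boxKernel δ (coordMap a (projL e' v)) := by
  set q := ‖projL e' v‖ with hq
  have hE : ‖coordMap e v‖ = ‖projL e v‖ := (norm_projL he v).symm
  have hA : ‖coordMap a (projL e' v)‖ = ‖projL a (projL e' v)‖ := (norm_projL ha _).symm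
  have hb : ‖coordMap a (projL e' v)‖ ≤ q := norm_coordMap_le ha _
  have hqb : q - ‖coordMap a (projL e' v)‖ ≤ ε / 4 * q := by
    rw [hA]
    refine (norm_sub_norm_le _ _).trans ?_
    have h3 : projL e' v - projL a (projL e' v) = (projL e' - projL a) (projL e' v) := by
      rw [sub_apply, projL_projL he']
    rw [h3]
    exact ((projL e' - projL a).le_opNorm _).trans
      (mul_le_mul_of_nonneg_right h2 (norm_nonneg _))
  have haq : |‖coordMap e v‖ - q| ≤ ε / 2 * δ := by
    rw [hE]
    refine (abs_norm_sub_norm_le _ _).trans ?_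
    rw [← sub_apply]
    exact ((projL e - projL e').le_opNorm _).trans h1
  set x := ‖coordMap e v‖
  set y := ‖coordMap a (projL e' v)‖
  have hy0 : 0 ≤ y := norm_nonneg _
  have hq0 : 0 ≤ q := norm_nonneg _
  have hε0 : 0 ≤ ε := by linarith [norm_nonneg (projL e' - projL a)]
  -- The error from `e'` to `a` is only relative, at most `ε / 4 * q`. Where one of the kernels can
  -- be nonzero, `q ≤ 2 * δ`, so it is at most `ε / 2 * δ`, like the absolute error from `e` to
  -- `e'`.
  have hmain : x / δ ≤ 1 ∨ y / δ ≤ 1 → |x / δ - y / δ| ≤ ε := fun h => by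
    rw [← sub_div, abs_div, abs_of_pos hδ, div_le_iff₀ hδ]
    rw [div_le_one hδ, div_le_one hδ] at h
    have h4 := abs_le.1 haq
    have h5 : q ≤ 2 * δ := by
      rcases h with h | h <;> nlinarith
    rw [abs_le]
    constructor <;> nlinarith
  have := ennKernel_le_add hL0 hL hs (div_nonneg (norm_nonneg (coordMap e v)) hδ.le)
    (div_nonneg hy0 hδ.le) hε hmain
  simp only [kern]
  constructor
  · refine (mul_le_mul_right this.1 _).trans (le_of_eq ?_)
    ring
  · refine (mul_le_mul_right this.2 _).trans (le_of_eq ?_)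
    ring

/-! ### Measurability in the sample -/

/-- The estimated projections are Lipschitz functions of the mean feature near its limit. -/
structure StableProjections {G d : ℕ} (g : Fin G)
    (e : (n : ℕ) → (Fin n → H × Fin G) → Fin d → H) (a : Fin d → H)
    (T : ℝ × H × (H →L[ℝ] H)) (η C : ℝ) : Prop where
  pos : 0 < η
  nonneg : 0 ≤ C
  orthonormal : ∀ n s, Orthonormal ℝ (e n s)
  orthonormal_limit : Orthonormal ℝ a
  near : ∀ n s, featureMean g s ∈ Metric.ball T η →
    ‖projL (e n s) - projL a‖ ≤ C * ‖featureMean g s - T‖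
  lipschitz : ∀ n (s : Fin n → H × Fin G) m (s' : Fin m → H × Fin G),
    featureMean g s ∈ Metric.ball T η → featureMean g s' ∈ Metric.ball T η →
      ‖projL (e n s) - projL (e m s')‖ ≤ C * ‖featureMean g s - featureMean g s'‖

/-- The samples whose mean feature is within `r` of its limit. -/
def goodSet {G n : ℕ} (g : Fin G) (T : ℝ × H × (H →L[ℝ] H)) (r : ℝ) : Set (Fin n → H × Fin G) :=
  {s | featureMean g s ∈ Metric.ball T r}

lemma isOpen_goodSet {G n : ℕ} (g : Fin G) (T : ℝ × H × (H →L[ℝ] H)) (r : ℝ) :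
    IsOpen (goodSet (n := n) g T r) :=
  Metric.isOpen_ball.preimage (continuous_featureMean g)

section Measurability

variable [MeasurableSpace H] [BorelSpace H] [SecondCountableTopology H] {G d n : ℕ} {g : Fin G}
  {e : (n : ℕ) → (Fin n → H × Fin G) → Fin d → H} {a : Fin d → H} {T : ℝ × H × (H →L[ℝ] H)}
  {η C : ℝ}

lemma measurableSet_goodSet (g : Fin G) (T : ℝ × H × (H →L[ℝ] H)) (r : ℝ) :
    MeasurableSet (goodSet (n := n) g T r) :=
  (isOpen_goodSet g T r).measurableSet

/-- The choice of the eigenvectors need not be measurable. Their projection is continuous in the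
sample on the open set of good samples, and this is enough after cutting off by the indicator. -/
lemma StableProjections.measurable_indicator_projL (h : StableProjections g e a T η C) {r : ℝ}
    (hr : r ≤ η) : Measurable fun p : (Fin n → H × Fin G) × H =>
      (goodSet g T r).indicator (fun s => projL (e n s) p.2) p.1 := by
  have hU : IsOpen (Prod.fst ⁻¹' goodSet g T r : Set ((Fin n → H × Fin G) × H)) :=
    (isOpen_goodSet g T r).preimage continuous_fst
  have hc : ContinuousOn (fun p : (Fin n → H × Fin G) × H => projL (e n p.1) p.2)
      (Prod.fst ⁻¹' goodSet g T r) := by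
    have h1 : ContinuousOn (fun p : (Fin n → H × Fin G) × H => projL (e n p.1))
        (Prod.fst ⁻¹' goodSet g T r) := by
      intro p hp
      refine ContinuousAt.continuousWithinAt (tendsto_iff_norm_sub_tendsto_zero.2 ?_)
      have h2 : Tendsto (fun q : (Fin n → H × Fin G) × H =>
          C * ‖featureMean g q.1 - featureMean g p.1‖) (𝓝 p) (𝓝 0) := by
        have h3 : Continuous fun q : (Fin n → H × Fin G) × H =>
            C * ‖featureMean g q.1 - featureMean g p.1‖ := by
          have := continuous_featureMean (H := H) (n := n) g
          fun_prop
        simpa using h3.tendsto p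
      refine tendsto_of_tendsto_of_tendsto_of_le_of_le' tendsto_const_nhds h2
        (Eventually.of_forall fun _ => norm_nonneg _) ?_
      filter_upwards [hU.mem_nhds hp] with q hq
      exact h.lipschitz n q.1 n p.1 (Metric.ball_subset_ball hr hq) (Metric.ball_subset_ball hr hp)
    exact h1.clm_apply continuousOn_snd
  classical
  have := hc.measurable_piecewise (g := fun _ => (0 : H)) continuousOn_const hU.measurableSet
  have heq : (fun p : (Fin n → H × Fin G) × H =>
      (goodSet g T r).indicator (fun s => projL (e n s) p.2) p.1) =
      (Prod.fst ⁻¹' goodSet g T r).piecewise (fun p => projL (e n p.1) p.2) fun _ => 0 := by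
    funext p
    by_cases hp : p.1 ∈ goodSet g T r
    · have hp' : p ∈ (Prod.fst ⁻¹' goodSet g T r : Set ((Fin n → H × Fin G) × H)) := hp
      rw [Set.indicator_of_mem hp, Set.piecewise_eq_of_mem _ _ _ hp']
    · have hp' : p ∉ (Prod.fst ⁻¹' goodSet g T r : Set ((Fin n → H × Fin G) × H)) := hp
      rw [Set.indicator_of_notMem hp, Set.piecewise_eq_of_notMem _ _ _ hp']
  rw [heq]
  exact this

lemma StableProjections.measurable_indicator_mul (h : StableProjections g e a T η C) {r : ℝ}
    (hr : r ≤ η) {φ : H → ENNReal} (hφ : Measurable φ) {α : Type*} [MeasurableSpace α]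
    {σ : α → Fin n → H × Fin G} (hσ : Measurable σ) {v : α → H} (hv : Measurable v) :
    Measurable fun p => (goodSet g T r).indicator 1 (σ p) * φ (projL (e n (σ p)) (v p)) := by
  have h1 : ∀ p, (goodSet g T r).indicator 1 (σ p) * φ (projL (e n (σ p)) (v p)) =
      (goodSet g T r).indicator (1 : (Fin n → H × Fin G) → ENNReal) (σ p) *
        φ ((goodSet g T r).indicator (fun s => projL (e n s) (v p)) (σ p)) := fun p => by
    by_cases hp : σ p ∈ goodSet g T r
    · rw [Set.indicator_of_mem hp (fun s => projL (e n s) (v p))]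
    · rw [Set.indicator_of_notMem hp, zero_mul, zero_mul]
  simp_rw [h1]
  have h2 : Measurable fun p => (goodSet g T r).indicator (1 : (Fin n → H × Fin G) → ENNReal) (σ p) :=
    (measurable_one.indicator (measurableSet_goodSet g T r)).comp hσ
  have h3 : Measurable fun p => (goodSet g T r).indicator (fun s => projL (e n s) (v p)) (σ p) :=
    Measurable.comp (f := fun p => (σ p, v p)) (h.measurable_indicator_projL hr) (hσ.prodMk hv)
  exact h2.mul (hφ.comp h3)

end Measurability

/-! ### Moments of the local averages of a sample -/

/-- The indicator of an observation of group `g` in the set `S`. -/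
def obs {G : ℕ} (g : Fin G) (S : Set H) (z : H × Fin G) : ENNReal :=
  {z : H × Fin G | z.2 = g ∧ z.1 ∈ S}.indicator 1 z

lemma obs_le_one {G : ℕ} (g : Fin G) (S : Set H) (z : H × Fin G) : obs g S z ≤ 1 :=
  Set.indicator_le_self' (by simp) z

lemma obs_of_notMem {G : ℕ} {g : Fin G} {S : Set H} {z : H × Fin G} (h : ¬ (z.2 = g ∧ z.1 ∈ S)) :
    obs g S z = 0 :=
  Set.indicator_of_notMem (s := {z : H × Fin G | z.2 = g ∧ z.1 ∈ S}) h _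

lemma kern_add {d : ℕ} (k k' : ℝ → ENNReal) (c : ENNReal) (δ : ℝ) (w : EuclideanSpace ℝ (Fin d)) :
    kern (fun u => k u + c * k' u) δ w = kern k δ w + c * kern k' δ w := by
  simp only [kern]; ring

lemma norm_coordMap_comp_projL_sub_le {d : ℕ} {e a : Fin d → H} (ha : Orthonormal ℝ a) :
    ‖coordMap a ∘L projL e - coordMap a‖ ≤ ‖projL e - projL a‖ := by
  refine ContinuousLinearMap.opNorm_le_bound _ (norm_nonneg _) fun v => ?_
  have h1 : (coordMap a ∘L projL e - coordMap a) v = coordMap a ((projL e - projL a) v) := by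
    rw [sub_apply, sub_apply, map_sub, coordMap_projL ha]; rfl
  rw [h1]
  exact (norm_coordMap_le ha _).trans ((projL e - projL a).le_opNorm v)

/-- The contribution of the observation `i` to the local average of a good sample at `x`. -/
def term {G d : ℕ} (g : Fin G) (e : (n : ℕ) → (Fin n → H × Fin G) → Fin d → H)
    (T : ℝ × H × (H →L[ℝ] H)) (r : ℝ) (k : ℝ → ENNReal) (δ : ℝ) (S : Set H) {n : ℕ}
    (s : Fin n → H × Fin G) (i : Fin n) (x : H) : ENNReal :=
  (goodSet g T r).indicator 1 s * (obs g S (s i) * kern k δ (coordMap (e n s) ((s i).1 - x)))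

section Moments

variable [MeasurableSpace H] [BorelSpace H] [SecondCountableTopology H] {G d : ℕ} {g : Fin G}
  {e : (n : ℕ) → (Fin n → H × Fin G) → Fin d → H} {a : Fin d → H} {T : ℝ × H × (H →L[ℝ] H)}
  {η C : ℝ}

lemma measurable_obs (g : Fin G) {S : Set H} (hS : MeasurableSet S) : Measurable (obs g S) := by
  refine measurable_one.indicator ?_
  exact ((measurableSet_singleton g).preimage measurable_snd).inter (hS.preimage measurable_fst)

lemma StableProjections.measurable_kern_comp (h : StableProjections g e a T η C) {r : ℝ}
    (hr : r ≤ η) {k : ℝ → ENNReal} (hk : Measurable k) (δ : ℝ) {α : Type*} [MeasurableSpace α]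
    {n : ℕ} {σ : α → Fin n → H × Fin G} (hσ : Measurable σ) {v : α → H} (hv : Measurable v) :
    Measurable (fun p => (goodSet g T r).indicator 1 (σ p) *
      kern k δ (coordMap (e n (σ p)) (v p))) ∧
    Measurable (fun p => (goodSet g T r).indicator 1 (σ p) *
      kern k δ (coordMap a (projL (e n (σ p)) (v p)))) := by
  constructor
  · have := h.measurable_indicator_mul hr
      (φ := fun w => ENNReal.ofReal (δ ^ d)⁻¹ * k (‖w‖ / δ))
      ((hk.comp (by fun_prop)).const_mul _) hσ hv
    refine (congrArg Measurable (funext fun p => ?_)).mp this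
    rw [kern, norm_projL (h.orthonormal _ _)]
  · exact h.measurable_indicator_mul hr (φ := fun w => kern k δ (coordMap a w))
      ((measurable_kern hk δ).comp (coordMap a).measurable) hσ hv

lemma StableProjections.measurable_term (h : StableProjections g e a T η C) {r : ℝ}
    (hr : r ≤ η) {k : ℝ → ENNReal} (hk : Measurable k) (δ : ℝ) {S : Set H} (hS : MeasurableSet S)
    {n : ℕ} (i : Fin n) :
    Measurable fun p : (Fin n → H × Fin G) × H => term g e T r k δ S p.1 i p.2 := by
  have h1 := (h.measurable_kern_comp hr hk δ (α := (Fin n → H × Fin G) × H) (σ := fun p => p.1)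
    measurable_fst (v := fun p => (p.1 i).1 - p.2) (by fun_prop)).1
  have h2 := measurable_obs g hS
  have h3 : Measurable fun p : (Fin n → H × Fin G) × H => obs g S (p.1 i) := by fun_prop
  refine (congrArg Measurable (funext fun p => ?_)).mp (h3.mul h1)
  simp only [term, Pi.mul_apply]
  ring

/-- `μ` restricted to group `g` is `p` times the law `ν`. -/
def IsGroupPart (μ : Measure (H × Fin G)) (g : Fin G) (p : ENNReal) (ν : Measure H) : Prop :=
  ∀ φ : H → ENNReal, Measurable φ →
    ∫⁻ z, {z : H × Fin G | z.2 = g}.indicator (fun z => φ z.1) z ∂μ = p * ∫⁻ x, φ x ∂ν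

lemma IsGroupPart.lintegral_obs {μ : Measure (H × Fin G)} {p : ENNReal} {ν : Measure H}
    (h : IsGroupPart μ g p ν) {S : Set H} (hS : MeasurableSet S) {φ : H → ENNReal}
    (hφ : Measurable φ) : ∫⁻ z, obs g S z * φ z.1 ∂μ = p * ∫⁻ x in S, φ x ∂ν := by
  rw [← lintegral_indicator hS, ← h _ (hφ.indicator hS)]
  refine lintegral_congr fun z => ?_
  by_cases h1 : z.2 = g <;> by_cases h2 : z.1 ∈ S <;> simp [obs, h1, h2]

variable {μ : Measure (H × Fin G)} [IsProbabilityMeasure μ] {p : ENNReal} {ν ν' : Measure H}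
  [IsFiniteMeasure ν] [IsFiniteMeasure ν'] {K : ℝ → ℝ} {L : ℝ} {A₀ B₀ : Set H}

/-- The kernel dominating `K` after a relative perturbation of the argument. -/
def enlargedKernel (K : ℝ → ℝ) (L ε : ℝ) (u : ℝ) : ENNReal :=
  ennKernel K u + ENNReal.ofReal (L * ε) * boxKernel u

lemma exists_norm_feature_le (g : Fin G) (hA₀ : Bornology.IsBounded A₀) :
    ∃ c, ∀ z : H × Fin G, z.1 ∈ A₀ → ‖feature g z‖ ≤ c := by
  obtain ⟨D, hD⟩ := hA₀.exists_norm_le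
  refine ⟨max 1 (max |D| (|D| * |D|)), fun z hz => ?_⟩
  have h1 := (hD _ hz).trans (le_abs_self D)
  rw [feature]
  split_ifs
  · rw [Prod.norm_mk, Prod.norm_mk, norm_one, norm_tensorL]
    gcongr
  · simp

/-- An upper bound for mixed moments of two observations. -/
lemma StableProjections.lintegral_term_mul_term_le (h : StableProjections g e a T η C)
    (hμ : IsGroupPart μ g p ν) (hA₀ : MeasurableSet A₀) (hB₀ : MeasurableSet B₀) (hL0 : 0 ≤ L)
    (hL : ∀ u v, 0 ≤ u → 0 ≤ v → K u ≤ K v + L * |u - v|) (hs : ∀ u, 1 < u → ennKernel K u = 0)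
    (hKm : Measurable (ennKernel K)) {c D : ℝ}
    (hc : ∀ z : H × Fin G, z.1 ∈ A₀ → ‖feature g z‖ ≤ c)
    (hD : ∀ z ∈ A₀, ∀ x ∈ B₀, ‖z - x‖ ≤ D) {r δ ε : ℝ} (hr : 2 * r ≤ η) (hδ : 0 < δ)
    (hr0 : 0 < r)
    (hε : ε ≤ 1) (hCr : C * (2 * r) ≤ ε / 4) {N : ℕ} (hN : 0 < N)
    (hN1 : (c + (‖T‖ + 2 * r)) / N ≤ r / 2)
    (hN2 : C * (2 * ((c + (‖T‖ + 2 * r)) / N)) * D ≤ ε / 2 * δ) {U : ENNReal}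
    (hU : ∀ A' : H →L[ℝ] EuclideanSpace ℝ (Fin d), ‖A' - coordMap a‖ ≤ C * (2 * r) →
      ∫⁻ x in B₀, (p * localAvg ν A₀ (enlargedKernel K L ε) δ A' x) ^ 2 ∂ν' ≤ U)
    {i j : Fin (N + 2)} (hij : j ≠ i) :
    ∫⁻ x in B₀, ∫⁻ s, term g e T r (ennKernel K) δ A₀ s i x * term g e T r (ennKernel K) δ A₀ s j x
      ∂(Measure.pi fun _ => μ) ∂ν' ≤ U := by
  obtain ⟨j, rfl⟩ := Fin.exists_succAbove_eq hij
  have hkm : Measurable (enlargedKernel K L ε) :=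
    hKm.add (measurable_boxKernel.const_mul _)
  -- The projection of the sample without the observations `i` and `j`, read in the fixed frame `a`
  -- to have values in a fixed Euclidean space.
  set A : (Fin N → H × Fin G) → H →L[ℝ] EuclideanSpace ℝ (Fin d) :=
    fun s => coordMap a ∘L projL (e N s) with hA
  set Fx : H → (Fin N → H × Fin G) → H × Fin G → H × Fin G → ENNReal := fun x s z z' =>
    ((goodSet g T (2 * r)).indicator 1 s * (obs g A₀ z * kern (enlargedKernel K L ε) δ
      (A s (z.1 - x)))) * (obs g A₀ z' * kern (enlargedKernel K L ε) δ (A s (z'.1 - x))) with hFx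
  have hind : ∀ s : Fin N → H × Fin G, ((goodSet g T (2 * r)).indicator (1 : (Fin N → H × Fin G) → ENNReal) s) =
      (goodSet g T (2 * r)).indicator 1 s * (goodSet g T (2 * r)).indicator 1 s := fun s => by
    by_cases hs : s ∈ goodSet g T (2 * r) <;> simp [hs]
  have hmo := measurable_obs g hA₀
  have hFm : ∀ x, Measurable fun q : (Fin N → H × Fin G) × (H × Fin G) × (H × Fin G) =>
      Fx x q.1 q.2.1 q.2.2 := fun x => by
    have h1 := (h.measurable_kern_comp hr hkm δ
      (α := (Fin N → H × Fin G) × (H × Fin G) × (H × Fin G)) (σ := fun q => q.1) measurable_fst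
      (v := fun q => q.2.1.1 - x) (by fun_prop)).2
    have h2 := (h.measurable_kern_comp hr hkm δ
      (α := (Fin N → H × Fin G) × (H × Fin G) × (H × Fin G)) (σ := fun q => q.1) measurable_fst
      (v := fun q => q.2.2.1 - x) (by fun_prop)).2
    have h3 : Measurable fun q : (Fin N → H × Fin G) × (H × Fin G) × (H × Fin G) =>
      obs g A₀ q.2.1 * obs g A₀ q.2.2 := by fun_prop
    refine (congrArg Measurable (funext fun q => ?_)).mp (h3.mul (h1.mul h2))
    simp only [hFx, Pi.mul_apply]
    conv_rhs => rw [hind q.1]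
    simp only [hA, ContinuousLinearMap.comp_apply]
    ring
  -- Two deletions move the projection by `O(1 / N)`, which `hN2` makes small relative to `δ`; the
  -- enlarged kernel absorbs the change.
  have hpt : ∀ x ∈ B₀, ∀ s : Fin (N + 2) → H × Fin G,
      term g e T r (ennKernel K) δ A₀ s i x *
        term g e T r (ennKernel K) δ A₀ s (i.succAbove j) x ≤
      Fx x (j.removeNth (i.removeNth s)) (s i) (s (i.succAbove j)) := fun x hx s => by
    by_cases hsr : s ∈ goodSet g T r
    swap
    · simp [term, hsr]
    by_cases hzi : (s i).2 = g ∧ (s i).1 ∈ A₀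
    swap
    · simp [term, obs_of_notMem hzi]
    by_cases hzj : (s (i.succAbove j)).2 = g ∧ (s (i.succAbove j)).1 ∈ A₀
    swap
    · simp [term, obs_of_notMem hzj]
    have hN' : (0 : ℝ) < N := by exact_mod_cast hN
    have hc0 : 0 ≤ c := (norm_nonneg _).trans (hc _ hzi.2)
    set s1 := i.removeNth s with hs1
    set s2 := j.removeNth s1 with hs2
    have d1 : ‖featureMean g s - featureMean g s1‖ ≤ (c + (‖T‖ + 2 * r)) / N := by
      refine (norm_featureMean_removeNth_sub_le (by omega) i s (hc _ hzi.2) (Or.inl hsr)).trans ?_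
      gcongr
      · linarith
      · simp
    have g1 : featureMean g s1 ∈ Metric.ball T (2 * r) := by
      have h1 : ‖featureMean g s - T‖ < r := mem_ball_iff_norm.1 hsr
      have h2 := norm_sub_le_norm_sub_add_norm_sub (featureMean g s1) (featureMean g s) T
      rw [norm_sub_rev (featureMean g s1) (featureMean g s)] at h2
      rw [mem_ball_iff_norm]
      linarith
    have d2 : ‖featureMean g s1 - featureMean g s2‖ ≤ (c + (‖T‖ + 2 * r)) / N :=
      norm_featureMean_removeNth_sub_le hN j s1 (hc _ hzj.2) (Or.inl g1)
    have d3 : ‖featureMean g s - featureMean g s2‖ ≤ 2 * ((c + (‖T‖ + 2 * r)) / N) := by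
      have := norm_sub_le_norm_sub_add_norm_sub (featureMean g s) (featureMean g s1)
        (featureMean g s2)
      linarith
    -- Each deletion moves the mean by at most `r / 2`, so a sample good at radius `r` remains good
    -- at radius `2 * r`.
    have g2 : featureMean g s2 ∈ Metric.ball T (2 * r) := by
      have h1 : ‖featureMean g s - T‖ < r := mem_ball_iff_norm.1 hsr
      have h2 := norm_sub_le_norm_sub_add_norm_sub (featureMean g s2) (featureMean g s) T
      rw [norm_sub_rev (featureMean g s2) (featureMean g s)] at h2
      rw [mem_ball_iff_norm]
      linarith
    have q1 : ‖projL (e _ s) - projL (e _ s2)‖ ≤ C * (2 * ((c + (‖T‖ + 2 * r)) / N)) :=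
      (h.lipschitz _ s _ s2 (Metric.ball_subset_ball (by linarith) hsr)
        (Metric.ball_subset_ball hr g2)).trans (mul_le_mul_of_nonneg_left d3 h.nonneg)
    have q2 : ‖projL (e _ s2) - projL a‖ ≤ ε / 4 := by
      refine (h.near _ s2 (Metric.ball_subset_ball hr g2)).trans (le_trans ?_ hCr)
      exact mul_le_mul_of_nonneg_left (le_of_lt (mem_ball_iff_norm.1 g2)) h.nonneg
    have hker : ∀ z ∈ A₀, kern (ennKernel K) δ (coordMap (e _ s) (z - x)) ≤
        kern (enlargedKernel K L ε) δ (A s2 (z - x)) := fun z hz => by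
      refine (kern_coordMap_le_add hL0 hL hs (h.orthonormal _ _) (h.orthonormal _ _)
        h.orthonormal_limit hδ hε ?_ q2).1.trans
        (kern_add (ennKernel K) boxKernel (ENNReal.ofReal (L * ε)) δ _).symm.le
      refine le_trans (mul_le_mul q1 (hD z hz x hx) (norm_nonneg _) ?_) hN2
      have := h.nonneg
      positivity
    have hs2' : s2 ∈ goodSet g T (2 * r) := g2
    simp only [term, hFx, Set.indicator_of_mem hsr, Set.indicator_of_mem hs2', Pi.one_apply,
      one_mul]
    exact mul_le_mul' (mul_le_mul_right (hker _ hzi.2) _) (mul_le_mul_right (hker _ hzj.2) _)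
  -- For a frozen remaining sample the two deleted observations are independent with the same law,
  -- so their integral is a square.
  have hloc : ∀ x s, ∫⁻ z', ∫⁻ z, Fx x s z z' ∂μ ∂μ = (goodSet g T (2 * r)).indicator 1 s *
      (p * localAvg ν A₀ (enlargedKernel K L ε) δ (A s) x) ^ 2 := fun x s => by
    have hmk : Measurable fun z : H => kern (enlargedKernel K L ε) δ (A s (z - x)) :=
      (measurable_kern hkm δ).comp (by fun_prop)
    have hmz : Measurable fun z : H × Fin G => obs g A₀ z *
        kern (enlargedKernel K L ε) δ (A s (z.1 - x)) := hmo.mul (hmk.comp measurable_fst)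
    simp only [hFx]
    have h1 : ∀ z' : H × Fin G, ∫⁻ z, ((goodSet g T (2 * r)).indicator 1 s * (obs g A₀ z *
        kern (enlargedKernel K L ε) δ (A s (z.1 - x)))) * (obs g A₀ z' *
        kern (enlargedKernel K L ε) δ (A s (z'.1 - x))) ∂μ = ((goodSet g T (2 * r)).indicator 1 s *
        (p * localAvg ν A₀ (enlargedKernel K L ε) δ (A s) x)) * (obs g A₀ z' *
        kern (enlargedKernel K L ε) δ (A s (z'.1 - x))) := fun z' => by
      rw [lintegral_mul_const _ (hmz.const_mul _), lintegral_const_mul _ hmz,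
        hμ.lintegral_obs hA₀ hmk]
      rfl
    simp_rw [h1]
    rw [lintegral_const_mul _ hmz, hμ.lintegral_obs hA₀ hmk]
    simp only [localAvg]
    ring
  calc ∫⁻ x in B₀, ∫⁻ s, term g e T r (ennKernel K) δ A₀ s i x *
        term g e T r (ennKernel K) δ A₀ s (i.succAbove j) x ∂(Measure.pi fun _ => μ) ∂ν'
      ≤ ∫⁻ x in B₀, ∫⁻ s : Fin N → H × Fin G, (goodSet g T (2 * r)).indicator 1 s *
          (p * localAvg ν A₀ (enlargedKernel K L ε) δ (A s) x) ^ 2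
            ∂(Measure.pi fun _ => μ) ∂ν' := by
        refine setLIntegral_mono' hB₀ fun x hx => ?_
        refine (lintegral_mono fun s => hpt x hx s).trans (le_of_eq ?_)
        rw [lintegral_removeNth_removeNth i j (hFm x)]
        exact lintegral_congr fun s => hloc x s
    _ = ∫⁻ s : Fin N → H × Fin G, (goodSet g T (2 * r)).indicator 1 s * ∫⁻ x in B₀,
          (p * localAvg ν A₀ (enlargedKernel K L ε) δ (A s) x) ^ 2 ∂ν'
            ∂(Measure.pi fun _ => μ) := by
        rw [lintegral_lintegral_swap]
        · refine lintegral_congr fun s => ?_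
          have := measurable_localAvg ν A₀ hkm δ (A s)
          rw [lintegral_const_mul _ (by fun_prop)]
        · refine Measurable.aemeasurable ?_
          have h1 := (h.measurable_kern_comp hr hkm δ
            (α := (H × (Fin N → H × Fin G)) × H) (σ := fun q => q.1.2) (by fun_prop)
            (v := fun q => q.2 - q.1.1) (by fun_prop)).2
          have h2 := (Measurable.lintegral_prod_right' (ν := ν.restrict A₀) h1)
          have h3 := (h2.const_mul p).pow_const 2
          refine (congrArg Measurable (funext fun q => ?_)).mp h3
          by_cases hq : q.2 ∈ goodSet g T (2 * r)
          · simp [hq, localAvg, hA, Function.uncurry]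
          · simp [hq, Function.uncurry]
    _ ≤ ∫⁻ _ : Fin N → H × Fin G, U ∂(Measure.pi fun _ => μ) := by
        refine lintegral_mono fun s => ?_
        by_cases hs2 : s ∈ goodSet g T (2 * r)
        · rw [Set.indicator_of_mem hs2, Pi.one_apply, one_mul]
          refine hU _ ((norm_coordMap_comp_projL_sub_le h.orthonormal_limit).trans
            ((h.near _ s (Metric.ball_subset_ball hr hs2)).trans ?_))
          exact mul_le_mul_of_nonneg_left (le_of_lt (mem_ball_iff_norm.1 hs2)) h.nonneg
        · rw [Set.indicator_of_notMem hs2, zero_mul]; exact zero_le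
    _ = U := by simp

end Moments

/-! ### Lower bounds for the moment of one observation -/

section Moments

variable [MeasurableSpace H] [BorelSpace H] [SecondCountableTopology H] {G d : ℕ} {g : Fin G}
  {e : (n : ℕ) → (Fin n → H × Fin G) → Fin d → H} {a : Fin d → H} {T : ℝ × H × (H →L[ℝ] H)}
  {η C : ℝ} {μ : Measure (H × Fin G)} [IsProbabilityMeasure μ] {p : ENNReal} {ν ν' : Measure H}
  [IsFiniteMeasure ν] [IsFiniteMeasure ν'] {K : ℝ → ℝ} {L : ℝ} {A₀ B₀ : Set H}

/-- Integrating a kernel of the estimated projection of the remaining sample. -/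
lemma StableProjections.lintegral_single (h : StableProjections g e a T η C)
    (hμ : IsGroupPart μ g p ν) (hA₀ : MeasurableSet A₀) {r δ : ℝ} (hr : r ≤ η) {k : ℝ → ENNReal}
    (hk : Measurable k) {N : ℕ} (i : Fin (N + 1)) {I : H → ENNReal} (hI : Measurable I) :
    ∫⁻ x in B₀, ∫⁻ s : Fin (N + 1) → H × Fin G, (goodSet g T r).indicator 1 (i.removeNth s) *
      (obs g A₀ (s i) * kern k δ (coordMap a (projL (e N (i.removeNth s)) ((s i).1 - x)))) * I x
        ∂(Measure.pi fun _ => μ) ∂ν' =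
    ∫⁻ s : Fin N → H × Fin G, (goodSet g T r).indicator 1 s * ∫⁻ x in B₀,
      p * localAvg ν A₀ k δ (coordMap a ∘L projL (e N s)) x * I x ∂ν' ∂(Measure.pi fun _ => μ) := by
  have hmo := measurable_obs g hA₀
  have h0 : ∀ x, ∫⁻ s : Fin (N + 1) → H × Fin G,
      (goodSet g T r).indicator 1 (i.removeNth s) *
      (obs g A₀ (s i) * kern k δ (coordMap a (projL (e N (i.removeNth s)) ((s i).1 - x)))) * I x
        ∂(Measure.pi fun _ => μ) = ∫⁻ s : Fin N → H × Fin G, (goodSet g T r).indicator 1 s *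
      (p * localAvg ν A₀ k δ (coordMap a ∘L projL (e N s)) x * I x)
        ∂(Measure.pi fun _ => μ) := fun x => by
    have h1 := (h.measurable_kern_comp hr hk δ (α := (Fin N → H × Fin G) × (H × Fin G))
      (σ := fun q => q.1) measurable_fst (v := fun q => q.2.1 - x) (by fun_prop)).2
    have hF : Measurable (Function.uncurry fun (s : Fin N → H × Fin G) (z : H × Fin G) =>
        (goodSet g T r).indicator 1 s *
          (obs g A₀ z * kern k δ (coordMap a (projL (e N s) (z.1 - x)))) * I x) := by
      have h3 : Measurable fun q : (Fin N → H × Fin G) × (H × Fin G) => obs g A₀ q.2 := by fun_prop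
      refine (congrArg Measurable (funext fun q => ?_)).mp ((h3.mul h1).mul_const (I x))
      simp only [Pi.mul_apply, Function.uncurry]
      ring
    rw [lintegral_removeNth i hF]
    refine lintegral_congr fun s => ?_
    have hmk : Measurable fun z : H => kern k δ (coordMap a (projL (e N s) (z - x))) :=
      (measurable_kern hk δ).comp (by fun_prop)
    have hmz : Measurable fun z : H × Fin G => obs g A₀ z *
        kern k δ (coordMap a (projL (e N s) (z.1 - x))) := hmo.mul (hmk.comp measurable_fst)
    rw [lintegral_mul_const _ (hmz.const_mul _), lintegral_const_mul _ hmz,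
      hμ.lintegral_obs hA₀ hmk]
    simp only [localAvg, ContinuousLinearMap.comp_apply]
    ring
  simp_rw [h0]
  rw [lintegral_lintegral_swap]
  · refine lintegral_congr fun s => ?_
    have := measurable_localAvg ν A₀ hk δ (coordMap a ∘L projL (e N s))
    rw [lintegral_const_mul _ (by fun_prop)]
  · refine Measurable.aemeasurable ?_
    have h1 := (h.measurable_kern_comp hr hk δ
      (α := (H × (Fin N → H × Fin G)) × H) (σ := fun q => q.1.2) (by fun_prop)
      (v := fun q => q.2 - q.1.1) (by fun_prop)).2
    have h2 := (Measurable.lintegral_prod_right' (ν := ν.restrict A₀) h1)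
    have h3 := (h2.const_mul p).mul (hI.comp measurable_fst)
    refine (congrArg Measurable (funext fun q => ?_)).mp h3
    by_cases hq : q.2 ∈ goodSet g T r
    · simp [hq, localAvg, Function.uncurry]
    · simp [hq, Function.uncurry]

/-- A kernel of the projection of the remaining sample is close to that of the sample. -/
lemma StableProjections.removeNth_le_term (h : StableProjections g e a T η C) (hL0 : 0 ≤ L)
    (hL : ∀ u v, 0 ≤ u → 0 ≤ v → K u ≤ K v + L * |u - v|) (hs : ∀ u, 1 < u → ennKernel K u = 0)
    {c D : ℝ} (hc : ∀ z : H × Fin G, z.1 ∈ A₀ → ‖feature g z‖ ≤ c)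
    (hD : ∀ z ∈ A₀, ∀ x ∈ B₀, ‖z - x‖ ≤ D) {r δ ε : ℝ} (hr : 2 * r ≤ η) (hδ : 0 < δ)
    (hr0 : 0 < r) (hε : ε ≤ 1) (hCr : C * (2 * r) ≤ ε / 4) {N : ℕ} (hN : 0 < N)
    (hN1 : (c + (‖T‖ + 2 * r)) / N ≤ r / 2)
    (hN2 : C * (2 * ((c + (‖T‖ + 2 * r)) / N)) * D ≤ ε / 2 * δ) {x : H} (hx : x ∈ B₀)
    (i : Fin (N + 1)) (s : Fin (N + 1) → H × Fin G) :
    (goodSet g T (r / 2)).indicator 1 (i.removeNth s) * (obs g A₀ (s i) * kern (ennKernel K) δ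
        (coordMap a (projL (e N (i.removeNth s)) ((s i).1 - x)))) ≤
      term g e T r (ennKernel K) δ A₀ s i x + ENNReal.ofReal (L * ε) *
        ((goodSet g T (r / 2)).indicator 1 (i.removeNth s) * (obs g A₀ (s i) * kern boxKernel δ
        (coordMap a (projL (e N (i.removeNth s)) ((s i).1 - x))))) := by
  have hr2 : r / 2 ≤ η := by linarith
  by_cases hzi : (s i).2 = g ∧ (s i).1 ∈ A₀
  swap
  · simp [obs_of_notMem hzi]
  by_cases hsr : i.removeNth s ∈ goodSet g T (r / 2)
  swap
  · simp [hsr]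
  have hN' : (0 : ℝ) < N := by exact_mod_cast hN
  have hc0 : 0 ≤ c := (norm_nonneg _).trans (hc _ hzi.2)
  have d1 : ‖featureMean g s - featureMean g (i.removeNth s)‖ ≤ (c + (‖T‖ + 2 * r)) / N := by
    refine (norm_featureMean_removeNth_sub_le hN i s (hc _ hzi.2) (Or.inr hsr)).trans ?_
    gcongr
    linarith
  have h1 : ‖featureMean g (i.removeNth s) - T‖ < r / 2 := mem_ball_iff_norm.1 hsr
  -- In the lower bound the implication goes from the remaining sample to the full one, hence the
  -- smaller radius `r / 2` for the former.
  have g1 : featureMean g s ∈ Metric.ball T r := by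
    have h2 := norm_sub_le_norm_sub_add_norm_sub (featureMean g s)
      (featureMean g (i.removeNth s)) T
    rw [mem_ball_iff_norm]
    linarith
  have g1' : s ∈ goodSet g T r := g1
  have q1 : ‖projL (e _ s) - projL (e _ (i.removeNth s))‖ ≤
      C * (2 * ((c + (‖T‖ + 2 * r)) / N)) :=
    (h.lipschitz _ s _ _ (Metric.ball_subset_ball (by linarith) g1)
      (Metric.ball_subset_ball hr2 hsr)).trans (mul_le_mul_of_nonneg_left
        (by linarith [show 0 ≤ (c + (‖T‖ + 2 * r)) / N by positivity]) h.nonneg)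
  have q2 : ‖projL (e _ (i.removeNth s)) - projL a‖ ≤ ε / 4 := by
    refine (h.near _ _ (Metric.ball_subset_ball hr2 hsr)).trans (le_trans ?_ hCr)
    exact mul_le_mul_of_nonneg_left (by linarith) h.nonneg
  have hker := (kern_coordMap_le_add hL0 hL hs (h.orthonormal _ s) (h.orthonormal _ (i.removeNth s))
    h.orthonormal_limit hδ hε (v := (s i).1 - x) (by
      refine le_trans (mul_le_mul q1 (hD _ hzi.2 x hx) (norm_nonneg _) ?_) hN2
      have := h.nonneg
      positivity) q2).2
  simp only [term, Set.indicator_of_mem hsr, Set.indicator_of_mem g1', Pi.one_apply, one_mul]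
  refine (mul_le_mul_right hker _).trans (le_of_eq ?_)
  ring

/-- A lower bound for the moment of one observation. -/
lemma StableProjections.le_lintegral_term (h : StableProjections g e a T η C)
    (hμ : IsGroupPart μ g p ν) (hA₀ : MeasurableSet A₀) (hB₀ : MeasurableSet B₀) (hL0 : 0 ≤ L)
    (hL : ∀ u v, 0 ≤ u → 0 ≤ v → K u ≤ K v + L * |u - v|) (hs : ∀ u, 1 < u → ennKernel K u = 0)
    (hKm : Measurable (ennKernel K)) {c D : ℝ}
    (hc : ∀ z : H × Fin G, z.1 ∈ A₀ → ‖feature g z‖ ≤ c)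
    (hD : ∀ z ∈ A₀, ∀ x ∈ B₀, ‖z - x‖ ≤ D) {r δ ε : ℝ} (hr : 2 * r ≤ η) (hδ : 0 < δ)
    (hr0 : 0 < r)
    (hε : ε ≤ 1) (hCr : C * (2 * r) ≤ ε / 4) {N : ℕ} (hN : 0 < N)
    (hN1 : (c + (‖T‖ + 2 * r)) / N ≤ r / 2)
    (hN2 : C * (2 * ((c + (‖T‖ + 2 * r)) / N)) * D ≤ ε / 2 * δ) {I : H → ENNReal}
    (hI : Measurable I) {V W : ENNReal}
    (hV : ∀ A' : H →L[ℝ] EuclideanSpace ℝ (Fin d), ‖A' - coordMap a‖ ≤ C * (2 * r) →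
      V ≤ ∫⁻ x in B₀, p * localAvg ν A₀ (ennKernel K) δ A' x * I x ∂ν')
    (hW : ∀ A' : H →L[ℝ] EuclideanSpace ℝ (Fin d), ‖A' - coordMap a‖ ≤ C * (2 * r) →
      ∫⁻ x in B₀, p * localAvg ν A₀ boxKernel δ A' x * I x ∂ν' ≤ W)
    (i : Fin (N + 1)) :
    (Measure.pi fun _ : Fin N => μ) (goodSet g T (r / 2)) * V ≤
      ∫⁻ x in B₀, ∫⁻ s, term g e T r (ennKernel K) δ A₀ s i x * I x
        ∂(Measure.pi fun _ => μ) ∂ν' + ENNReal.ofReal (L * ε) * W := by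
  have hr2 : r / 2 ≤ η := by linarith
  -- The kernel of the remaining sample exceeds that of the full sample by at most a small multiple
  -- of the box kernel, itself taken at the remaining sample and so integrable by independence.
  have hpt : ∀ x ∈ B₀, ∀ s : Fin (N + 1) → H × Fin G,
      (goodSet g T (r / 2)).indicator 1 (i.removeNth s) * (obs g A₀ (s i) * kern (ennKernel K) δ
        (coordMap a (projL (e N (i.removeNth s)) ((s i).1 - x)))) * I x ≤
      term g e T r (ennKernel K) δ A₀ s i x * I x + ENNReal.ofReal (L * ε) *
        ((goodSet g T (r / 2)).indicator 1 (i.removeNth s) * (obs g A₀ (s i) * kern boxKernel δ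
        (coordMap a (projL (e N (i.removeNth s)) ((s i).1 - x)))) * I x) := fun x hx s => by
    refine (mul_le_mul_left (h.removeNth_le_term hL0 hL hs hc hD hr hδ hr0 hε hCr hN hN1 hN2 hx i s)
      (I x)).trans (le_of_eq ?_)
    rw [add_mul, mul_assoc]
  have hnear : ∀ s : Fin N → H × Fin G, s ∈ goodSet g T (r / 2) →
      ‖coordMap a ∘L projL (e N s) - coordMap a‖ ≤ C * (2 * r) := fun s hs => by
    refine (norm_coordMap_comp_projL_sub_le h.orthonormal_limit).trans
      ((h.near _ s (Metric.ball_subset_ball hr2 hs)).trans ?_)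
    exact mul_le_mul_of_nonneg_left (by linarith [mem_ball_iff_norm.1 hs]) h.nonneg
  have hbm : Measurable boxKernel := measurable_boxKernel
  calc (Measure.pi fun _ : Fin N => μ) (goodSet g T (r / 2)) * V
      = ∫⁻ s : Fin N → H × Fin G, (goodSet g T (r / 2)).indicator 1 s * V
          ∂(Measure.pi fun _ => μ) := by
        rw [lintegral_mul_const _ (measurable_one.indicator (measurableSet_goodSet _ _ _)),
          lintegral_indicator_one (measurableSet_goodSet _ _ _)]
    _ ≤ ∫⁻ s : Fin N → H × Fin G, (goodSet g T (r / 2)).indicator 1 s * ∫⁻ x in B₀,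
          p * localAvg ν A₀ (ennKernel K) δ (coordMap a ∘L projL (e N s)) x * I x ∂ν'
            ∂(Measure.pi fun _ => μ) := by
        refine lintegral_mono fun s => ?_
        by_cases hs : s ∈ goodSet g T (r / 2)
        · exact mul_le_mul_right (hV _ (hnear s hs)) _
        · simp [hs]
    _ ≤ ∫⁻ x in B₀, ∫⁻ s, (term g e T r (ennKernel K) δ A₀ s i x * I x + ENNReal.ofReal (L * ε) *
        ((goodSet g T (r / 2)).indicator 1 (i.removeNth s) * (obs g A₀ (s i) * kern boxKernel δ
        (coordMap a (projL (e N (i.removeNth s)) ((s i).1 - x)))) * I x))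
          ∂(Measure.pi fun _ => μ) ∂ν' := by
        rw [← h.lintegral_single hμ hA₀ hr2 hKm i hI]
        exact setLIntegral_mono' hB₀ fun x hx => lintegral_mono fun s => hpt x hx s
    _ = ∫⁻ x in B₀, ∫⁻ s, term g e T r (ennKernel K) δ A₀ s i x * I x
          ∂(Measure.pi fun _ => μ) ∂ν' + ENNReal.ofReal (L * ε) *
        ∫⁻ s : Fin N → H × Fin G, (goodSet g T (r / 2)).indicator 1 s * ∫⁻ x in B₀,
          p * localAvg ν A₀ boxKernel δ (coordMap a ∘L projL (e N s)) x * I x ∂ν'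
            ∂(Measure.pi fun _ => μ) := by
        have ht := h.measurable_term (r := r) (by linarith) hKm δ hA₀ i
        have ht2 : Measurable fun q : H × (Fin (N + 1) → H × Fin G) =>
            term g e T r (ennKernel K) δ A₀ q.2 i q.1 * I q.1 :=
          (ht.comp measurable_swap).mul (hI.comp measurable_fst)
        have hm1 : Measurable fun x => ∫⁻ s : Fin (N + 1) → H × Fin G,
            term g e T r (ennKernel K) δ A₀ s i x * I x ∂(Measure.pi fun _ => μ) :=
          Measurable.lintegral_prod_right (f := fun x (s : Fin (N + 1) → H × Fin G) =>
            term g e T r (ennKernel K) δ A₀ s i x * I x) ht2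
        have ht3 : ∀ x, Measurable fun s : Fin (N + 1) → H × Fin G =>
          term g e T r (ennKernel K) δ A₀ s i x * I x := fun x =>
          Measurable.of_uncurry_left (f := fun x (s : Fin (N + 1) → H × Fin G) =>
            term g e T r (ennKernel K) δ A₀ s i x * I x) (x := x) ht2
        rw [← h.lintegral_single hμ hA₀ hr2 hbm i hI, ← lintegral_const_mul' _ _
          ENNReal.ofReal_ne_top, ← lintegral_add_left hm1]
        refine lintegral_congr fun x => ?_
        rw [lintegral_add_left (ht3 x), lintegral_const_mul' _ _ ENNReal.ofReal_ne_top]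
    _ ≤ _ := by
        gcongr
        calc ∫⁻ s : Fin N → H × Fin G, (goodSet g T (r / 2)).indicator 1 s * ∫⁻ x in B₀,
              p * localAvg ν A₀ boxKernel δ (coordMap a ∘L projL (e N s)) x * I x ∂ν'
                ∂(Measure.pi fun _ => μ)
            ≤ ∫⁻ _ : Fin N → H × Fin G, W ∂(Measure.pi fun _ => μ) := by
              refine lintegral_mono fun s => ?_
              by_cases hs : s ∈ goodSet g T (r / 2)
              · rw [Set.indicator_of_mem hs, Pi.one_apply, one_mul]
                exact hW _ (hnear s hs)
              · rw [Set.indicator_of_notMem hs, zero_mul]; exact zero_le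
          _ = W := by simp

/-- A good sample: kernel averages over `B₀` of one observation are bounded. -/
lemma StableProjections.setLIntegral_term_le (h : StableProjections g e a T η C)
    (hL0 : 0 ≤ L)
    (hL : ∀ u v, 0 ≤ u → 0 ≤ v → K u ≤ K v + L * |u - v|) (hs : ∀ u, 1 < u → ennKernel K u = 0)
    {r δ ε : ℝ} (hr : r ≤ η) (hδ : 0 < δ)
    (hε0 : 0 ≤ ε) (hε : ε ≤ 1) (hCr : C * r ≤ ε / 4) {W : ENNReal}
    (hW : ∀ A' : H →L[ℝ] EuclideanSpace ℝ (Fin d), ‖A' - coordMap a‖ ≤ C * r →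
      ∀ u, ∫⁻ x in B₀, kern (enlargedKernel K L ε) δ (u - A' x) ∂ν' ≤ W) (S : Set H)
    {n : ℕ} (s : Fin n → H × Fin G) (i : Fin n) :
    ∫⁻ x in B₀, term g e T r (ennKernel K) δ S s i x ∂ν' ≤ obs g S (s i) * W := by
  by_cases hsr : s ∈ goodSet g T r
  swap
  · simp [term, hsr]
  have hn : ‖projL (e _ s) - projL a‖ ≤ C * r :=
    (h.near _ s (Metric.ball_subset_ball hr hsr)).trans
      (mul_le_mul_of_nonneg_left (mem_ball_iff_norm.1 hsr).le h.nonneg)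
  simp only [term, Set.indicator_of_mem hsr, Pi.one_apply, one_mul]
  rw [lintegral_const_mul' _ _ (ne_top_of_le_ne_top ENNReal.one_ne_top (obs_le_one _ _ _))]
  refine mul_le_mul_right (le_trans (lintegral_mono fun x => ?_)
    (hW (coordMap a ∘L projL (e n s))
    ((norm_coordMap_comp_projL_sub_le h.orthonormal_limit).trans hn)
    ((coordMap a ∘L projL (e n s)) (s i).1))) _
  rw [← map_sub]
  refine (kern_coordMap_le_add hL0 hL hs (h.orthonormal _ s) (h.orthonormal _ s)
    h.orthonormal_limit hδ hε (v := (s i).1 - x) (by rw [sub_self, norm_zero, zero_mul]; positivity)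
    (hn.trans hCr)).1.trans (kern_add (ennKernel K) boxKernel (ENNReal.ofReal (L * ε)) δ _).symm.le

end Moments

/-! ### Mean square error through mixed moments -/

/-- The expansion of the square with the cross term kept on the left, so that no truncated
subtraction occurs; the later moment bounds retain this additive form. -/
lemma ofReal_sq_sub_add {w i : ENNReal} (hw : w ≠ ⊤) (hi : i ≠ ⊤) :
    ENNReal.ofReal ((w.toReal - i.toReal) ^ 2) + 2 * (w * i) = w ^ 2 + i ^ 2 := by
  lift w to NNReal using hw
  lift i to NNReal using hi
  have h1 : (2 : ENNReal) * ((w : ENNReal) * i) = ENNReal.ofReal (2 * (w * i)) := by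
    rw [ENNReal.ofReal_mul (by norm_num), ENNReal.ofReal_mul (NNReal.coe_nonneg w)]
    simp
  have h2 : (w : ENNReal) ^ 2 + (i : ENNReal) ^ 2 = ENNReal.ofReal ((w : ℝ) ^ 2 + (i : ℝ) ^ 2) := by
    rw [ENNReal.ofReal_add (by positivity) (by positivity), ENNReal.ofReal_pow (NNReal.coe_nonneg w),
      ENNReal.ofReal_pow (NNReal.coe_nonneg i)]
    simp
  rw [h1, h2, ← ENNReal.ofReal_add (sq_nonneg _) (by positivity)]
  congr 1
  simp only [ENNReal.coe_toReal]
  ring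

/-- The mean square distance of an average of `n` random functions from a fixed function, bounded
through their mixed moments. -/
lemma lintegral_sq_average_sub_add_le {S α : Type*} [MeasurableSpace S] [MeasurableSpace α]
    {Q : Measure S} [IsProbabilityMeasure Q] {m : Measure α} [SFinite m] {n : ℕ} (hn : n ≠ 0)
    {t : Fin n → S → α → ENNReal} (htm : ∀ i, Measurable fun q : α × S => t i q.2 q.1)
    (htt : ∀ i s x, t i s x ≠ ⊤) {I : α → ENNReal} (hI : Measurable I) (hIt : ∀ x, I x ≠ ⊤)
    {D U V c : ENNReal} (hdiag : ∀ i, ∫⁻ x, ∫⁻ s, t i s x * t i s x ∂Q ∂m ≤ D)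
    (hoff : ∀ i j, j ≠ i → ∫⁻ x, ∫⁻ s, t i s x * t j s x ∂Q ∂m ≤ U)
    (hcross : ∀ i, V ≤ ∫⁻ x, ∫⁻ s, t i s x * I x ∂Q ∂m + c) :
    ∫⁻ x, ∫⁻ s, ENNReal.ofReal
        ((((n : ENNReal)⁻¹ * ∑ i, t i s x).toReal - (I x).toReal) ^ 2) ∂Q ∂m + 2 * V ≤
      (n : ENNReal)⁻¹ * D + U + ∫⁻ x, I x ^ 2 ∂m + 2 * c := by
  have hn0 : (n : ENNReal) ≠ 0 := by exact_mod_cast hn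
  have hnt : (n : ENNReal) ≠ ⊤ := ENNReal.natCast_ne_top _
  have hnn : (n : ENNReal)⁻¹ * n = 1 := ENNReal.inv_mul_cancel hn0 hnt
  have hit : (n : ENNReal)⁻¹ ≠ ⊤ := ENNReal.inv_ne_top.2 hn0
  have hslice : ∀ (φ : S → α → ENNReal), (Measurable fun q : α × S => φ q.2 q.1) →
      (∀ x, Measurable fun s => φ s x) ∧ Measurable fun x => ∫⁻ s, φ s x ∂Q := fun φ hφ =>
    ⟨fun x => Measurable.of_uncurry_left (f := fun x s => φ s x) (x := x) hφ,
      Measurable.lintegral_prod_right (f := fun x s => φ s x) hφ⟩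
  have hsq : ∫⁻ x, ∫⁻ s, ((n : ENNReal)⁻¹ * ∑ i, t i s x) ^ 2 ∂Q ∂m ≤ (n : ENNReal)⁻¹ * D + U := by
    -- In the double sum the `n` diagonal terms receive the weight `1 / n`, while the off-diagonal
    -- ones contribute at most `U`.
    have h1 : ∀ s x, ((n : ENNReal)⁻¹ * ∑ i, t i s x) ^ 2 =
        (n : ENNReal)⁻¹ * (n : ENNReal)⁻¹ * ∑ i, ∑ j, t i s x * t j s x := fun s x => by
      rw [← Finset.sum_mul_sum]; ring
    have hc : (n : ENNReal)⁻¹ * (n : ENNReal)⁻¹ ≠ ⊤ := ENNReal.mul_ne_top hit hit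
    have hij := fun i j => hslice (fun s x => t i s x * t j s x) ((htm i).mul (htm j))
    have h2 : ∫⁻ x, ∫⁻ s, ((n : ENNReal)⁻¹ * ∑ i, t i s x) ^ 2 ∂Q ∂m =
        (n : ENNReal)⁻¹ * (n : ENNReal)⁻¹ * ∑ i, ∑ j, ∫⁻ x, ∫⁻ s, t i s x * t j s x ∂Q ∂m := by
      simp_rw [h1, lintegral_const_mul' _ _ hc]
      congr 1
      have h3 : ∀ x, ∫⁻ s, ∑ i, ∑ j, t i s x * t j s x ∂Q =
          ∑ i, ∑ j, ∫⁻ s, t i s x * t j s x ∂Q := fun x => by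
        rw [lintegral_finsetSum _ fun i _ =>
          Finset.measurable_fun_sum _ fun j _ => (hij i j).1 x]
        exact Finset.sum_congr rfl fun i _ => lintegral_finsetSum _ fun j _ => (hij i j).1 x
      simp_rw [h3]
      rw [lintegral_finsetSum _ fun i _ => Finset.measurable_fun_sum _ fun j _ => (hij i j).2]
      exact Finset.sum_congr rfl fun i _ => lintegral_finsetSum _ fun j _ => (hij i j).2
    rw [h2]
    calc (n : ENNReal)⁻¹ * (n : ENNReal)⁻¹ * ∑ i, ∑ j, ∫⁻ x, ∫⁻ s, t i s x * t j s x ∂Q ∂m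
        ≤ (n : ENNReal)⁻¹ * (n : ENNReal)⁻¹ *
            ∑ i : Fin n, ∑ j, ((if j = i then D else 0) + U) := by
          refine mul_le_mul_right
            (Finset.sum_le_sum fun i _ => Finset.sum_le_sum fun j _ => ?_) _
          split_ifs with hji
          · rw [hji]; exact (hdiag i).trans le_self_add
          · rw [zero_add]; exact hoff i j hji
      _ = (n : ENNReal)⁻¹ * (n : ENNReal)⁻¹ * (n * D + n * n * U) := by
          simp only [Finset.sum_add_distrib, Finset.sum_ite_eq', Finset.mem_univ, if_true,
            Finset.sum_const, Finset.card_univ, Fintype.card_fin, nsmul_eq_mul]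
          ring
      _ = (n : ENNReal)⁻¹ * ((n : ENNReal)⁻¹ * n) * D +
          ((n : ENNReal)⁻¹ * n) * ((n : ENNReal)⁻¹ * n) * U := by ring
      _ = _ := by rw [hnn, mul_one, one_mul, one_mul]
  have hcr : V ≤ ∫⁻ x, ∫⁻ s, ((n : ENNReal)⁻¹ * ∑ i, t i s x) * I x ∂Q ∂m + c := by
    have hi := fun i => hslice (fun s x => t i s x * I x) ((htm i).mul (hI.comp measurable_fst))
    have h1 : ∫⁻ x, ∫⁻ s, ((n : ENNReal)⁻¹ * ∑ i, t i s x) * I x ∂Q ∂m =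
        (n : ENNReal)⁻¹ * ∑ i, ∫⁻ x, ∫⁻ s, t i s x * I x ∂Q ∂m := by
      simp_rw [mul_assoc, lintegral_const_mul' _ _ hit, Finset.sum_mul]
      congr 1
      have h3 : ∀ x, ∫⁻ s, ∑ i, t i s x * I x ∂Q = ∑ i, ∫⁻ s, t i s x * I x ∂Q := fun x =>
        lintegral_finsetSum _ fun i _ => (hi i).1 x
      simp_rw [h3]
      exact lintegral_finsetSum _ fun i _ => (hi i).2
    have h3 := Finset.sum_le_sum fun (i : Fin n) (_ : i ∈ Finset.univ) => hcross i
    rw [Finset.sum_add_distrib, Finset.sum_const, Finset.sum_const, Finset.card_univ,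
      Fintype.card_fin, nsmul_eq_mul, nsmul_eq_mul] at h3
    have h4 := mul_le_mul_right h3 (n : ENNReal)⁻¹
    rw [mul_add, ← mul_assoc, ← mul_assoc, hnn, one_mul, one_mul] at h4
    rwa [h1]
  have hwm : Measurable fun q : α × S => (n : ENNReal)⁻¹ * ∑ i, t i q.2 q.1 :=
    (Finset.measurable_fun_sum _ fun i _ => htm i).const_mul _
  have hwI := hslice (fun s x => ((n : ENNReal)⁻¹ * ∑ i, t i s x) * I x)
    (hwm.mul (hI.comp measurable_fst))
  have hw2 := hslice (fun s x => ((n : ENNReal)⁻¹ * ∑ i, t i s x) ^ 2) (hwm.pow_const 2)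
  have hid : ∫⁻ x, ∫⁻ s, ENNReal.ofReal
        ((((n : ENNReal)⁻¹ * ∑ i, t i s x).toReal - (I x).toReal) ^ 2) ∂Q ∂m +
      2 * ∫⁻ x, ∫⁻ s, ((n : ENNReal)⁻¹ * ∑ i, t i s x) * I x ∂Q ∂m =
      ∫⁻ x, ∫⁻ s, ((n : ENNReal)⁻¹ * ∑ i, t i s x) ^ 2 ∂Q ∂m + ∫⁻ x, I x ^ 2 ∂m := by
    have h2t : (2 : ENNReal) ≠ ⊤ := by norm_num
    rw [← lintegral_const_mul' _ _ h2t, ← lintegral_add_right _ (hwI.2.const_mul 2),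
      ← lintegral_add_left hw2.2]
    refine lintegral_congr fun x => ?_
    have h5 : ∫⁻ _, I x ^ 2 ∂Q = I x ^ 2 := by simp
    rw [← lintegral_const_mul' _ _ h2t, ← lintegral_add_right _ ((hwI.1 x).const_mul 2)]
    conv_rhs => rw [← h5]
    rw [← lintegral_add_left (hw2.1 x)]
    exact lintegral_congr fun s => ofReal_sq_sub_add
      (ENNReal.mul_ne_top hit (ENNReal.sum_ne_top.2 fun i _ => htt i s x)) (hIt x)
  calc _ ≤ ∫⁻ x, ∫⁻ s, ENNReal.ofReal
          ((((n : ENNReal)⁻¹ * ∑ i, t i s x).toReal - (I x).toReal) ^ 2) ∂Q ∂m +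
        2 * (∫⁻ x, ∫⁻ s, ((n : ENNReal)⁻¹ * ∑ i, t i s x) * I x ∂Q ∂m + c) :=
        add_le_add le_rfl (mul_le_mul_right hcr 2)
    _ = ∫⁻ x, ∫⁻ s, ((n : ENNReal)⁻¹ * ∑ i, t i s x) ^ 2 ∂Q ∂m + ∫⁻ x, I x ^ 2 ∂m + 2 * c := by
        rw [mul_add, ← add_assoc, hid]
    _ ≤ _ := by gcongr

section Moments

variable [MeasurableSpace H] [BorelSpace H] [SecondCountableTopology H] {G d : ℕ} {g : Fin G}
  {e : (n : ℕ) → (Fin n → H × Fin G) → Fin d → H} {a : Fin d → H} {T : ℝ × H × (H →L[ℝ] H)}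
  {η C : ℝ} {μ : Measure (H × Fin G)} [IsProbabilityMeasure μ] {p : ENNReal} {ν ν' : Measure H}
  [IsFiniteMeasure ν] [IsFiniteMeasure ν'] {K : ℝ → ℝ} {L : ℝ} {A₀ B₀ : Set H}

lemma term_le (hKL : ∀ u, ennKernel K u ≤ ENNReal.ofReal L) (r δ : ℝ) (S : Set H)
    {n : ℕ} (s : Fin n → H × Fin G) (i : Fin n) (x : H) :
    term g e T r (ennKernel K) δ S s i x ≤ ENNReal.ofReal (δ ^ d)⁻¹ * ENNReal.ofReal L := by
  calc term g e T r (ennKernel K) δ S s i x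
      ≤ 1 * (1 * (ENNReal.ofReal (δ ^ d)⁻¹ * ENNReal.ofReal L)) := by
        refine mul_le_mul' (Set.indicator_le_self' (by simp) s) (mul_le_mul' (obs_le_one _ _ _) ?_)
        exact mul_le_mul_right (hKL _) _
    _ = _ := by rw [one_mul, one_mul]

/-- The local average of a good sample at `x`, over the observations in `S`. -/
def sampleAvg (g : Fin G) (e : (n : ℕ) → (Fin n → H × Fin G) → Fin d → H)
    (T : ℝ × H × (H →L[ℝ] H)) (r : ℝ) (k : ℝ → ENNReal) (δ : ℝ) (S : Set H) {n : ℕ}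
    (s : Fin n → H × Fin G) (x : H) : ENNReal :=
  (n : ENNReal)⁻¹ * ∑ i, term g e T r k δ S s i x

lemma StableProjections.measurable_sampleAvg (h : StableProjections g e a T η C) {r : ℝ}
    (hr : r ≤ η) {k : ℝ → ENNReal} (hk : Measurable k) (δ : ℝ) {S : Set H} (hS : MeasurableSet S)
    {n : ℕ} :
    Measurable fun p : (Fin n → H × Fin G) × H => sampleAvg g e T r k δ S p.1 p.2 :=
  (Finset.measurable_fun_sum _ fun i _ => h.measurable_term hr hk δ hS i).const_mul _

lemma term_ne_top (hKL : ∀ u, ennKernel K u ≤ ENNReal.ofReal L) (r δ : ℝ) (S : Set H)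
    {n : ℕ} (s : Fin n → H × Fin G) (i : Fin n) (x : H) :
    term g e T r (ennKernel K) δ S s i x ≠ ⊤ :=
  ne_top_of_le_ne_top (ENNReal.mul_ne_top ENNReal.ofReal_ne_top ENNReal.ofReal_ne_top)
    (term_le hKL r δ S s i x)

lemma sampleAvg_ne_top (hKL : ∀ u, ennKernel K u ≤ ENNReal.ofReal L) (r δ : ℝ) (S : Set H)
    {n : ℕ} (s : Fin n → H × Fin G) (x : H) :
    sampleAvg g e T r (ennKernel K) δ S s x ≠ ⊤ := by
  rcases Nat.eq_zero_or_pos n with rfl | hn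
  · simp [sampleAvg]
  exact ENNReal.mul_ne_top (ENNReal.inv_ne_top.2 (by exact_mod_cast hn.ne'))
    (ENNReal.sum_ne_top.2 fun i _ => term_ne_top hKL r δ S s i x)

/-- The mean square distance of the local average of a sample from its limit `I`. -/
lemma StableProjections.lintegral_sq_sub_add_le (h : StableProjections g e a T η C)
    (hμ : IsGroupPart μ g p ν) (hA₀ : MeasurableSet A₀) (hB₀ : MeasurableSet B₀) (hL0 : 0 ≤ L)
    (hL : ∀ u v, 0 ≤ u → 0 ≤ v → K u ≤ K v + L * |u - v|) (hs : ∀ u, 1 < u → ennKernel K u = 0)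
    (hKm : Measurable (ennKernel K)) (hKL : ∀ u, ennKernel K u ≤ ENNReal.ofReal L) {c D : ℝ}
    (hc0 : 0 ≤ c) (hD0 : 0 ≤ D)
    (hc : ∀ z : H × Fin G, z.1 ∈ A₀ → ‖feature g z‖ ≤ c)
    (hD : ∀ z ∈ A₀, ∀ x ∈ B₀, ‖z - x‖ ≤ D) {r δ ε : ℝ} (hr : 2 * r ≤ η) (hδ : 0 < δ)
    (hr0 : 0 < r) (hε0 : 0 ≤ ε)
    (hε : ε ≤ 1) (hCr : C * (2 * r) ≤ ε / 4) {N : ℕ} (hN : 0 < N)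
    (hN1 : (c + (‖T‖ + 2 * r)) / N ≤ r / 2)
    (hN2 : C * (2 * ((c + (‖T‖ + 2 * r)) / N)) * D ≤ ε / 2 * δ) {I : H → ENNReal}
    (hI : Measurable I) (hIt : ∀ x, I x ≠ ⊤) {U V W W' : ENNReal}
    (hU : ∀ A' : H →L[ℝ] EuclideanSpace ℝ (Fin d), ‖A' - coordMap a‖ ≤ C * (2 * r) →
      ∫⁻ x in B₀, (p * localAvg ν A₀ (enlargedKernel K L ε) δ A' x) ^ 2 ∂ν' ≤ U)
    (hV : ∀ A' : H →L[ℝ] EuclideanSpace ℝ (Fin d), ‖A' - coordMap a‖ ≤ C * (2 * r) →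
      V ≤ ∫⁻ x in B₀, p * localAvg ν A₀ (ennKernel K) δ A' x * I x ∂ν')
    (hW : ∀ A' : H →L[ℝ] EuclideanSpace ℝ (Fin d), ‖A' - coordMap a‖ ≤ C * (2 * r) →
      ∫⁻ x in B₀, p * localAvg ν A₀ boxKernel δ A' x * I x ∂ν' ≤ W)
    (hW' : ∀ A' : H →L[ℝ] EuclideanSpace ℝ (Fin d), ‖A' - coordMap a‖ ≤ C * (2 * r) →
      ∀ u, ∫⁻ x in B₀, kern (enlargedKernel K L ε) δ (u - A' x) ∂ν' ≤ W') :
    ∫⁻ x in B₀, ∫⁻ s : Fin (N + 2) → H × Fin G,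
        ENNReal.ofReal (((sampleAvg g e T r (ennKernel K) δ A₀ s x).toReal - (I x).toReal) ^ 2)
          ∂(Measure.pi fun _ => μ) ∂ν' +
      2 * ((Measure.pi fun _ : Fin (N + 1) => μ) (goodSet g T (r / 2)) * V) ≤
    ((N + 2 : ℕ) : ENNReal)⁻¹ * (ENNReal.ofReal (δ ^ d)⁻¹ * ENNReal.ofReal L * W') + U +
      ∫⁻ x in B₀, I x ^ 2 ∂ν' + 2 * (ENNReal.ofReal (L * ε) * W) := by
  have hrη : r ≤ η := by linarith
  have hN' : (0 : ℝ) < N := by exact_mod_cast hN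
  have hnum : 0 ≤ c + (‖T‖ + 2 * r) := by positivity
  have hNle : (c + (‖T‖ + 2 * r)) / ((N + 1 : ℕ) : ℝ) ≤ (c + (‖T‖ + 2 * r)) / N := by
    gcongr; simp
  have hrr : C * r ≤ C * (2 * r) := mul_le_mul_of_nonneg_left (by linarith) h.nonneg
  have htm : ∀ i, Measurable fun q : H × (Fin (N + 2) → H × Fin G) =>
      term g e T r (ennKernel K) δ A₀ q.2 i q.1 := fun i =>
    Measurable.comp (g := fun q : (Fin (N + 2) → H × Fin G) × H =>
      term g e T r (ennKernel K) δ A₀ q.1 i q.2) (f := Prod.swap)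
      (h.measurable_term hrη hKm δ hA₀ i) measurable_swap
  refine lintegral_sq_average_sub_add_le (Nat.succ_ne_zero (N + 1)) htm
    (fun i s x => term_ne_top hKL r δ A₀ s i x) hI hIt (fun i => ?_)
    (fun i j hji => h.lintegral_term_mul_term_le hμ hA₀ hB₀ hL0 hL hs hKm hc hD hr hδ hr0 hε hCr
      hN hN1 hN2 hU hji) fun i => ?_
  -- On the diagonal one factor is bounded by the supremum of the kernel, of order `δ⁻ᵈ`, and the
  -- other integrates over `x` to a constant by anti-concentration. After division by `n` the
  -- contribution is of order `1 / (n δᵈ)`.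
  · refine (lintegral_mono fun x => lintegral_mono fun s =>
      mul_le_mul_left (term_le hKL r δ A₀ s i x) _).trans ?_
    rw [lintegral_lintegral_swap ((htm i).const_mul _).aemeasurable]
    calc _ ≤ ∫⁻ s : Fin (N + 2) → H × Fin G, ENNReal.ofReal (δ ^ d)⁻¹ * ENNReal.ofReal L * W'
          ∂(Measure.pi fun _ => μ) := by
          refine lintegral_mono fun s => ?_
          rw [lintegral_const_mul' _ _ (ENNReal.mul_ne_top ENNReal.ofReal_ne_top
            ENNReal.ofReal_ne_top)]
          refine mul_le_mul_right ?_ _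
          refine (h.setLIntegral_term_le hL0 hL hs hrη hδ hε0 hε (hrr.trans hCr)
            (fun A' hA' => hW' A' (hA'.trans hrr)) A₀ s i).trans ?_
          calc obs g A₀ (s i) * W' ≤ 1 * W' := mul_le_mul_left (obs_le_one _ _ _) _
            _ = W' := one_mul _
      _ = _ := by simp
  -- The cross moment deletes a single observation from `N + 2`, so the remaining sample has size `N
  -- + 1`, for which the smallness conditions are weaker than for `N`.
  · exact h.le_lintegral_term hμ hA₀ hB₀ hL0 hL hs hKm hc hD hr hδ hr0 hε hCr (Nat.succ_pos N)
      (hNle.trans hN1) (le_trans (by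
        have := h.nonneg
        gcongr) hN2) hI hV hW i

end Moments

lemma add_sq_le_sq_add {X I ρ b q : ENNReal} (hX : X ≤ I + ρ) (hXq : X ≤ q) (hIq : I ≤ q)
    (hb : b ≤ q) : (X + b) ^ 2 ≤ I ^ 2 + 3 * q * (b + ρ) := by
  have h1 : X * X ≤ I ^ 2 + 2 * (q * ρ) := by
    calc X * X ≤ X * (I + ρ) := mul_le_mul_right hX _
      _ = X * I + X * ρ := mul_add _ _ _
      _ ≤ (I + ρ) * I + q * ρ := add_le_add (mul_le_mul_left hX _) (mul_le_mul_left hXq _)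
      _ = I ^ 2 + (ρ * I + q * ρ) := by ring
      _ ≤ I ^ 2 + (ρ * q + q * ρ) := by gcongr
      _ = _ := by ring
  calc (X + b) ^ 2 = X * X + (2 * (X * b) + b * b) := by ring
    _ ≤ I ^ 2 + 2 * (q * ρ) + (2 * (q * b) + q * b) := by gcongr
    _ ≤ I ^ 2 + 2 * (q * ρ) + (2 * (q * b) + q * b) + q * ρ := le_self_add
    _ = _ := by ring

/-- If the cross moment is nearly `M`, with `P` near `1` and `V` near `M`, the two copies of `M`
cancel up to the stated errors. -/
lemma le_of_add_two_mul_le {Q P V M U a c : ENNReal} (hP : P ≤ 1) (hM : M ≠ ⊤) (hVM : V ≤ M)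
    (hMV : M ≤ V + a) (h : Q + 2 * (P * V) ≤ U + M + M + c) :
    Q ≤ U + c + 2 * ((1 - P) * M) + 2 * a := by
  have h1 : V ≤ P * V + (1 - P) * M := by
    calc V = (P + (1 - P)) * V := by rw [add_tsub_cancel_of_le hP, one_mul]
      _ = P * V + (1 - P) * V := add_mul _ _ _
      _ ≤ _ := by gcongr
  have h2 : M + M ≤ 2 * (P * V) + 2 * ((1 - P) * M) + 2 * a := by
    calc M + M ≤ (P * V + (1 - P) * M + a) + (P * V + (1 - P) * M + a) :=
          add_le_add (hMV.trans (add_le_add_left h1 a)) (hMV.trans (add_le_add_left h1 a))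
      _ = _ := by ring
  refine ENNReal.le_of_add_le_add_right (a := M + M) (ENNReal.add_ne_top.2 ⟨hM, hM⟩) ?_
  calc Q + (M + M) ≤ Q + (2 * (P * V) + 2 * ((1 - P) * M) + 2 * a) := by gcongr
    _ = (Q + 2 * (P * V)) + (2 * ((1 - P) * M) + 2 * a) := by ring
    _ ≤ (U + M + M + c) + (2 * ((1 - P) * M) + 2 * a) := by gcongr
    _ = _ := by ring

lemma surjective_coordMap {d : ℕ} {a : Fin d → H} (ha : Orthonormal ℝ a) :
    Function.Surjective (coordMap a) := fun w => ⟨synth a w, coordMap_synth ha w⟩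

/-! ### Mean square convergence of the local averages -/

section Asymptotics

variable [MeasurableSpace H] [BorelSpace H] [SecondCountableTopology H] {G d : ℕ} {g : Fin G}
  {e : (n : ℕ) → (Fin n → H × Fin G) → Fin d → H} {a : Fin d → H} {T : ℝ × H × (H →L[ℝ] H)}
  {η C : ℝ} {μ : Measure (H × Fin G)} [IsProbabilityMeasure μ] {p : ENNReal} {ν ν' : Measure H}
  [IsFiniteMeasure ν] [IsFiniteMeasure ν'] {K : ℝ → ℝ} {L : ℝ} {A₀ B₀ : Set H}

lemma localAvg_enlargedKernel (hKm : Measurable (ennKernel K)) (S : Set H) (ε δ : ℝ)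
    (A : H →L[ℝ] EuclideanSpace ℝ (Fin d)) (x : H) :
    localAvg ν S (enlargedKernel K L ε) δ A x =
      localAvg ν S (ennKernel K) δ A x + ENNReal.ofReal (L * ε) * localAvg ν S boxKernel δ A x := by
  have h1 : Measurable fun z => kern (ennKernel K) δ (A (z - x)) :=
    (measurable_kern hKm δ).comp (by fun_prop)
  simp only [localAvg]
  rw [← lintegral_const_mul' _ _ ENNReal.ofReal_ne_top, ← lintegral_add_left h1]
  exact lintegral_congr fun z => kern_add _ _ _ _ _

lemma localAvg_le {k : ℝ → ENNReal} {δ : ℝ} {A : H →L[ℝ] EuclideanSpace ℝ (Fin d)} {M : ENNReal}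
    (h : ∀ u, ∫⁻ z in A₀, kern k δ (u - A z) ∂ν ≤ M) (x : H) : localAvg ν A₀ k δ A x ≤ M := by
  refine le_trans (le_of_eq ?_) (h (A x))
  simp only [localAvg, map_sub, kern, norm_sub_rev]

lemma enlargedKernel_le (hL0 : 0 ≤ L) (hKL : ∀ u, ennKernel K u ≤ ENNReal.ofReal L)
    {ε : ℝ} (hε : ε ≤ 1) (u : ℝ) : enlargedKernel K L ε u ≤ 2 * ENNReal.ofReal L := by
  rw [enlargedKernel, two_mul]
  refine add_le_add (hKL u) ?_
  calc ENNReal.ofReal (L * ε) * boxKernel u ≤ ENNReal.ofReal L * 1 :=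
        mul_le_mul' (ENNReal.ofReal_le_ofReal (by nlinarith)) (boxKernel_le u)
    _ = _ := mul_one _

lemma enlargedKernel_eq_zero (hs : ∀ u, 1 < u → ennKernel K u = 0) (ε : ℝ) {u : ℝ} (hu : 2 < u) :
    enlargedKernel K L ε u = 0 := by
  rw [enlargedKernel, hs u (by linarith), boxKernel_eq_zero hu, mul_zero, add_zero]

/-- The mean square distance between the local averages of a sample, over a compact set of tame
points, and their expectation for the limiting projection tends to zero. -/
theorem StableProjections.eventually_lintegral_sq_le (h : StableProjections g e a T η C)
    (hμ : IsGroupPart μ g p ν) (hp : p ≠ ⊤) {ξ ξ' : HilbertBasis ℕ ℝ H}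
    (hA₀ : IsCompact A₀) (hA₀t : A₀ ⊆ tamePts ν ξ) (hB₀ : IsCompact B₀)
    (hB₀t : B₀ ⊆ tamePts ν' ξ') (hK : IsKernel K) {δ : ℕ → ℝ} (hδ : ∀ n, 0 < δ n)
    (hδ1 : Tendsto (fun n : ℕ => n * δ n) atTop atTop)
    (hδd : Tendsto (fun n : ℕ => n * δ n ^ d) atTop atTop)
    (hgood : ∀ r > 0, Tendsto (fun n => (Measure.pi fun _ : Fin n => μ) (goodSet g T r)) atTop (𝓝 1))
    {ε₀ : ENNReal} (hε₀ : ε₀ ≠ 0) :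
    ∃ r₀ > 0, ∀ r > 0, r ≤ r₀ → ∀ᶠ n : ℕ in atTop,
      ∫⁻ x in B₀, ∫⁻ s : Fin n → H × Fin G,
        ENNReal.ofReal (((sampleAvg g e T r (ennKernel K) (δ n) A₀ s x).toReal -
          (p * localAvg ν A₀ (ennKernel K) (δ n) (coordMap a) x).toReal) ^ 2)
            ∂(Measure.pi fun _ => μ) ∂ν' ≤ ε₀ := by
  obtain ⟨L, hL0, hL, hKL, hs, hKm⟩ := hK.exists_bounds
  have ha := h.orthonormal_limit
  have hsurj := surjective_coordMap ha
  obtain ⟨ε_b, hε_b, C_b, hC_b, hb⟩ := exists_lintegral_kern_le hB₀ hB₀t hsurj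
  obtain ⟨ε_a, hε_a, C_a, hC_a, hca⟩ := exists_lintegral_kern_le hA₀ hA₀t hsurj
  obtain ⟨c, hc⟩ := exists_norm_feature_le (G := G) g hA₀.isBounded
  obtain ⟨D, hD⟩ := (hA₀.isBounded.union hB₀.isBounded).exists_norm_le
  set C1 : ENNReal := ENNReal.ofReal L * (C_a * ENNReal.ofReal (1 ^ d)) with hC1
  set C2 : ENNReal := 1 * (C_a * ENNReal.ofReal (2 ^ d)) with hC2
  have hC1t : C1 ≠ ⊤ := ENNReal.mul_ne_top ENNReal.ofReal_ne_top
    (ENNReal.mul_ne_top hC_a ENNReal.ofReal_ne_top)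
  have hC2t : C2 ≠ ⊤ := ENNReal.mul_ne_top ENNReal.one_ne_top
    (ENNReal.mul_ne_top hC_a ENNReal.ofReal_ne_top)
  set q : ENNReal := p * (C1 + ENNReal.ofReal L * C2) with hq
  have hqt : q ≠ ⊤ := ENNReal.mul_ne_top hp
    (ENNReal.add_ne_top.2 ⟨hC1t, ENNReal.mul_ne_top ENNReal.ofReal_ne_top hC2t⟩)
  have hβt : ν' B₀ ≠ ⊤ := measure_ne_top _ _
  have hε4 : 0 < ε₀ / 4 := ENNReal.div_pos hε₀ (by norm_num)
  -- `ε` is the relative enlargement of the kernel. It enters the upper bound of the second moment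
  -- with coefficient `3 * q` and the cross moment with `2 * q`, hence the factor `5`.
  obtain ⟨ε, ⟨hε0, hε1⟩, hεb⟩ : ∃ ε : ℝ, (0 < ε ∧ ε ≤ 1) ∧
      5 * q * (p * (ENNReal.ofReal (L * ε) * C2) * ν' B₀) ≤ ε₀ / 4 := by
    have h1 : Tendsto (fun ε : ℝ => 5 * q * (p * C2 * ν' B₀) * ENNReal.ofReal (L * ε))
        (𝓝[>] 0) (𝓝 0) := by
      have : Tendsto (fun ε : ℝ => ENNReal.ofReal (L * ε)) (𝓝 0) (𝓝 0) := by
        have h : Continuous fun ε : ℝ => ENNReal.ofReal (L * ε) :=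
          ENNReal.continuous_ofReal.comp (by fun_prop)
        simpa using h.tendsto 0
      have hfin : 5 * q * (p * C2 * ν' B₀) ≠ ⊤ := ENNReal.mul_ne_top
        (ENNReal.mul_ne_top (by norm_num) hqt)
        (ENNReal.mul_ne_top (ENNReal.mul_ne_top hp hC2t) hβt)
      simpa using ENNReal.Tendsto.const_mul (this.mono_left nhdsWithin_le_nhds) (Or.inr hfin)
    obtain ⟨ε, h2, h3⟩ := ((h1.eventually (Iio_mem_nhds hε4)).and (Ioc_mem_nhdsGT one_pos)).exists
    refine ⟨ε, h3, le_trans (le_of_eq ?_) (le_of_lt h2)⟩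
    ring
  -- `ε₁` is the change of the local averages when the projection varies; the factor `5` arises as
  -- for `ε`.
  obtain ⟨ε₁, hε₁, hεq⟩ : ∃ ε₁ : ENNReal, ε₁ ≠ 0 ∧ 5 * q * (p * ε₁) ≤ ε₀ / 4 := by
    have hfin : 5 * q * p ≠ ⊤ := ENNReal.mul_ne_top (ENNReal.mul_ne_top (by norm_num) hqt) hp
    have h1 : Tendsto (fun ε : ENNReal => 5 * q * p * ε) (𝓝[>] 0) (𝓝 0) := by
      simpa using ENNReal.Tendsto.const_mul
        (tendsto_id.mono_left (nhdsWithin_le_nhds (a := (0 : ENNReal)) (s := Set.Ioi 0))) (Or.inr hfin)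
    obtain ⟨ε, h2, h3⟩ := ((h1.eventually (Iio_mem_nhds hε4)).and self_mem_nhdsWithin).exists
    refine ⟨ε, ne_of_gt h3, le_trans (le_of_eq ?_) (le_of_lt h2)⟩
    ring
  obtain ⟨η₁, hη₁, hη⟩ := exists_localAvg_le_add hA₀ hA₀t hB₀ hB₀t hsurj hKm ENNReal.ofReal_ne_top
    zero_le_one hKL hs hε₁
  -- One neighbourhood of the limiting projection for the kernel comparison, the two
  -- anti-concentration bounds and the continuity of local averages; `r` is then chosen so that good
  -- samples have projections in it.
  set ρ := min (ε / 4) (min ε_a (min ε_b η₁)) with hρ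
  have hρ0 : 0 < ρ := by positivity
  have hC0 := h.nonneg
  refine ⟨min (η / 2) (ρ / (2 * (C + 1))), lt_min (by linarith [h.pos]) (by positivity),
    fun r hr0 hr => ?_⟩
  have hrη : 2 * r ≤ η := by linarith [hr.trans (min_le_left _ _)]
  have hrC : C * (2 * r) ≤ ρ := by
    have := hr.trans (min_le_right _ _)
    rw [le_div_iff₀ (by positivity)] at this
    nlinarith
  have hρs : ρ ≤ ε / 4 ∧ ρ ≤ ε_a ∧ ρ ≤ ε_b ∧ ρ ≤ η₁ := by
    have := le_refl ρ
    rw [hρ] at this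
    simpa only [le_min_iff] using this
  set W' : ENNReal := 2 * ENNReal.ofReal L * (C_b * ENNReal.ofReal (2 ^ d)) with hW'
  have hW't : W' ≠ ⊤ := ENNReal.mul_ne_top
    (ENNReal.mul_ne_top (by norm_num) ENNReal.ofReal_ne_top)
    (ENNReal.mul_ne_top hC_b ENNReal.ofReal_ne_top)
  set c' : ℝ := max c 0 with hc'
  set D' : ℝ := 2 * max D 0 with hD'
  have hcc : 0 ≤ c' + (‖T‖ + 2 * r) := by positivity
  -- the bound for one sample size
  have key : ∀ N : ℕ, 0 < N → (c' + (‖T‖ + 2 * r)) / N ≤ r / 2 →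
      C * (2 * ((c' + (‖T‖ + 2 * r)) / N)) * D' ≤ ε / 2 * δ (N + 2) →
      ∫⁻ x in B₀, ∫⁻ s : Fin (N + 2) → H × Fin G,
        ENNReal.ofReal (((sampleAvg g e T r (ennKernel K) (δ (N + 2)) A₀ s x).toReal -
          (p * localAvg ν A₀ (ennKernel K) (δ (N + 2)) (coordMap a) x).toReal) ^ 2)
            ∂(Measure.pi fun _ => μ) ∂ν' ≤
      ((N + 2 : ℕ) : ENNReal)⁻¹ * (ENNReal.ofReal (δ (N + 2) ^ d)⁻¹ * ENNReal.ofReal L * W') +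
      2 * ((1 - (Measure.pi fun _ : Fin (N + 1) => μ) (goodSet g T (r / 2))) * (q ^ 2 * ν' B₀)) +
        (ε₀ / 4 + ε₀ / 4) := fun N hN hN1 hN2 => by
    set δ' := δ (N + 2) with hδ'
    have hδ0 : 0 < δ' := hδ _
    set I : H → ENNReal := fun x => p * localAvg ν A₀ (ennKernel K) δ' (coordMap a) x with hI
    have hIm : Measurable I := (measurable_localAvg ν A₀ hKm δ' _).const_mul p
    set b : ENNReal := p * (ENNReal.ofReal (L * ε) * C2) with hbdef
    have hbq : b ≤ q := by
      refine mul_le_mul_right (le_trans (mul_le_mul_left (ENNReal.ofReal_le_ofReal ?_) _)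
        le_add_self) p
      nlinarith
    have hloc : ∀ A' : H →L[ℝ] EuclideanSpace ℝ (Fin d), ‖A' - coordMap a‖ ≤ ρ → ∀ x,
        p * localAvg ν A₀ (ennKernel K) δ' A' x ≤ q ∧ localAvg ν A₀ boxKernel δ' A' x ≤ C2 :=
      fun A' hA' x => by
        have hA2 := hA'.trans hρs.2.1
        constructor
        · refine mul_le_mul_right (le_trans (localAvg_le (fun u =>
            hca A' hA2 _ _ 1 zero_le_one hKL hs δ' hδ0 u) x) le_self_add) p
        · exact localAvg_le (fun u => hca A' hA2 _ 1 2 (by norm_num) boxKernel_le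
            (fun _ => boxKernel_eq_zero) δ' hδ0 u) x
    have hloc0 := hloc (coordMap a) (by rw [sub_self, norm_zero]; exact hρ0.le)
    have hIq : ∀ x, I x ≤ q := fun x => (hloc0 x).1
    have hIt : ∀ x, I x ≠ ⊤ := fun x => ne_top_of_le_ne_top hqt (hIq x)
    set M := ∫⁻ x in B₀, I x ^ 2 ∂ν' with hM
    have hMq : M ≤ q ^ 2 * ν' B₀ := by
      rw [← setLIntegral_const]
      exact lintegral_mono fun x => by gcongr; exact hIq x
    have hMt : M ≠ ⊤ := ne_top_of_le_ne_top (ENNReal.mul_ne_top (ENNReal.pow_ne_top hqt) hβt) hMq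
    have hclose : ∀ A' : H →L[ℝ] EuclideanSpace ℝ (Fin d), ‖A' - coordMap a‖ ≤ C * (2 * r) →
        ‖A' - coordMap a‖ ≤ ρ := fun A' hA' => hA'.trans hrC
    have main := h.lintegral_sq_sub_add_le (B₀ := B₀) (ν' := ν') hμ hA₀.measurableSet
      hB₀.measurableSet hL0 hL hs hKm hKL (c := c') (D := D') (by positivity) (by positivity)
      (fun z hz => (hc z hz).trans (le_max_left _ _))
      (fun z hz x hx => (norm_sub_le z x).trans (by
        have h1 := (hD z (Or.inl hz)).trans (le_max_left D 0)
        have h2 := (hD x (Or.inr hx)).trans (le_max_left D 0)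
        linarith)) hrη hδ0 hr0 hε0.le hε1 (hrC.trans hρs.1) hN hN1 hN2 hIm hIt
      -- Both the second moment and the cross moment are compared with `M = ∫ I ^ 2`: from above
      -- with the enlarged kernel, from below with the kernel itself.
      (U := M + 3 * q * (b * ν' B₀ + p * ε₁)) (V := M - p * ε₁ * q)
      (W := p * C2 * q * ν' B₀) (W' := W') ?_ ?_ ?_ ?_
    · rw [← hM] at main
      have h1 := le_of_add_two_mul_le prob_le_one hMt tsub_le_self le_tsub_add
        (U := ((N + 2 : ℕ) : ENNReal)⁻¹ * (ENNReal.ofReal (δ' ^ d)⁻¹ * ENNReal.ofReal L * W') +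
          3 * q * (b * ν' B₀ + p * ε₁))
        (c := 2 * (ENNReal.ofReal (L * ε) * (p * C2 * q * ν' B₀))) (main.trans (le_of_eq (by ring)))
      refine h1.trans ?_
      calc ((N + 2 : ℕ) : ENNReal)⁻¹ * (ENNReal.ofReal (δ' ^ d)⁻¹ * ENNReal.ofReal L * W') +
            3 * q * (b * ν' B₀ + p * ε₁) + 2 * (ENNReal.ofReal (L * ε) * (p * C2 * q * ν' B₀)) +
            2 * ((1 - (Measure.pi fun _ : Fin (N + 1) => μ) (goodSet g T (r / 2))) * M) +
            2 * (p * ε₁ * q)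
          = ((N + 2 : ℕ) : ENNReal)⁻¹ * (ENNReal.ofReal (δ' ^ d)⁻¹ * ENNReal.ofReal L * W') +
            2 * ((1 - (Measure.pi fun _ : Fin (N + 1) => μ) (goodSet g T (r / 2))) * M) +
            (5 * q * (b * ν' B₀) + 5 * q * (p * ε₁)) := by rw [hbdef]; ring
        _ ≤ _ := by gcongr
    · intro A' hA'
      have hA'ρ := hclose A' hA'
      obtain ⟨R, hRm, hR, hRε⟩ := hη A' (coordMap a) (hA'ρ.trans hρs.2.2.2)
        (by rw [sub_self, norm_zero]; exact hη₁.le) δ' hδ0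
      calc ∫⁻ x in B₀, (p * localAvg ν A₀ (enlargedKernel K L ε) δ' A' x) ^ 2 ∂ν'
          ≤ ∫⁻ x in B₀, (I x ^ 2 + 3 * q * (b + p * R x)) ∂ν' := by
            refine setLIntegral_mono' hB₀.measurableSet fun x hx => ?_
            rw [localAvg_enlargedKernel hKm]
            refine le_trans ?_ (add_sq_le_sq_add (X := p * localAvg ν A₀ (ennKernel K) δ' A' x)
              ?_ (hloc A' hA'ρ x).1 (hIq x) hbq)
            · rw [mul_add]
              gcongr
              exact mul_le_mul_right (mul_le_mul_right (hloc A' hA'ρ x).2 _) p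
            · rw [hI, ← mul_add]
              exact mul_le_mul_right (hR x hx) p
        _ = M + 3 * q * (b * ν' B₀ + p * ∫⁻ x in B₀, R x ∂ν') := by
            rw [lintegral_add_left (hIm.pow_const 2), lintegral_const_mul _ (by fun_prop),
              lintegral_add_left measurable_const, lintegral_const_mul _ hRm, setLIntegral_const]
        _ ≤ _ := by gcongr
    · intro A' hA'
      have hA'ρ := hclose A' hA'
      obtain ⟨R, hRm, hR, hRε⟩ := hη (coordMap a) A' (by rw [sub_self, norm_zero]; exact hη₁.le)
        (hA'ρ.trans hρs.2.2.2) δ' hδ0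
      rw [tsub_le_iff_right]
      calc M ≤ ∫⁻ x in B₀, (p * localAvg ν A₀ (ennKernel K) δ' A' x * I x + p * q * R x) ∂ν' := by
            refine setLIntegral_mono' hB₀.measurableSet fun x hx => ?_
            calc I x ^ 2 = p * localAvg ν A₀ (ennKernel K) δ' (coordMap a) x * I x := by
                  rw [pow_two]
              _ ≤ p * (localAvg ν A₀ (ennKernel K) δ' A' x + R x) * I x := by
                  gcongr
                  exact hR x hx
              _ = p * localAvg ν A₀ (ennKernel K) δ' A' x * I x + p * I x * R x := by ring
              _ ≤ _ := by gcongr; exact hIq x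
        _ = ∫⁻ x in B₀, p * localAvg ν A₀ (ennKernel K) δ' A' x * I x ∂ν' +
              p * q * ∫⁻ x in B₀, R x ∂ν' := by
            rw [lintegral_add_right _ (hRm.const_mul _), lintegral_const_mul _ hRm]
        _ ≤ ∫⁻ x in B₀, p * localAvg ν A₀ (ennKernel K) δ' A' x * I x ∂ν' + p * q * ε₁ := by
            gcongr
        _ = _ := by ring
    · intro A' hA'
      rw [← setLIntegral_const]
      refine lintegral_mono fun x => ?_
      gcongr
      · exact (hloc A' (hclose A' hA') x).2
      · exact hIq x
    · intro A' hA' u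
      exact hb A' ((hclose A' hA').trans hρs.2.2.1) _ _ 2 (by norm_num)
        (enlargedKernel_le hL0 hKL hε1) (fun _ => enlargedKernel_eq_zero hs ε) δ' hδ0 u
  have hcast : Tendsto (fun N : ℕ => (N : ℝ)) atTop atTop := tendsto_natCast_atTop_atTop
  have e1 : ∀ᶠ N : ℕ in atTop, (c' + (‖T‖ + 2 * r)) / N ≤ r / 2 :=
    (hcast.const_div_atTop (c' + (‖T‖ + 2 * r))).eventually (ge_mem_nhds (by positivity))
  have e2 : ∀ᶠ N : ℕ in atTop,
      C * (2 * ((c' + (‖T‖ + 2 * r)) / N)) * D' ≤ ε / 2 * δ (N + 2) := by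
    have h1 := ((tendsto_add_atTop_iff_nat 2).2 hδ1).eventually_ge_atTop
      (3 * (C * (2 * (c' + (‖T‖ + 2 * r))) * D') / (ε / 2))
    filter_upwards [h1, eventually_ge_atTop 1] with N h2 h3
    have hN : (1 : ℝ) ≤ N := by exact_mod_cast h3
    have hδN := hδ (N + 2)
    rw [div_le_iff₀ (by positivity)] at h2
    push_cast at h2
    rw [show C * (2 * ((c' + (‖T‖ + 2 * r)) / N)) * D' =
      (C * (2 * (c' + (‖T‖ + 2 * r))) * D') / N by ring, div_le_iff₀ (by positivity)]
    -- The factor `3` in `h1` pays for `N + 2 ≤ 3 * N`, since the growth condition is stated for the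
    -- full sample size.
    have h4 : (N + 2 : ℝ) * δ (N + 2) * (ε / 2) ≤ 3 * N * δ (N + 2) * (ε / 2) := by
      gcongr; linarith
    linarith
  have e3 : ∀ᶠ N : ℕ in atTop, ((N + 2 : ℕ) : ENNReal)⁻¹ *
      (ENNReal.ofReal (δ (N + 2) ^ d)⁻¹ * ENNReal.ofReal L * W') ≤ ε₀ / 4 := by
    have h1 : Tendsto (fun n : ℕ => ENNReal.ofReal (n * δ n ^ d)⁻¹ * (ENNReal.ofReal L * W'))
        atTop (𝓝 0) := by
      have h2 := (ENNReal.continuous_ofReal.tendsto 0).comp hδd.inv_tendsto_atTop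
      rw [ENNReal.ofReal_zero] at h2
      simpa using ENNReal.Tendsto.mul_const h2
        (Or.inr (ENNReal.mul_ne_top ENNReal.ofReal_ne_top hW't))
    filter_upwards [((tendsto_add_atTop_iff_nat 2).2 h1).eventually (Iio_mem_nhds hε4)] with N hN
    refine le_trans (le_of_eq ?_) (le_of_lt hN)
    have hN2 : (0 : ℝ) < ((N + 2 : ℕ) : ℝ) := by positivity
    rw [mul_inv, ENNReal.ofReal_mul (by positivity), ENNReal.ofReal_inv_of_pos hN2,
      ENNReal.ofReal_natCast]
    ring
  have e4 : ∀ᶠ N : ℕ in atTop, 2 * ((1 - (Measure.pi fun _ : Fin (N + 1) => μ)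
      (goodSet g T (r / 2))) * (q ^ 2 * ν' B₀)) ≤ ε₀ / 4 := by
    have h1 := ENNReal.Tendsto.sub (tendsto_const_nhds (x := (1 : ENNReal)))
      ((tendsto_add_atTop_iff_nat 1).2 (hgood (r / 2) (by positivity)))
      (Or.inl ENNReal.one_ne_top)
    rw [tsub_self] at h1
    have h2 := ENNReal.Tendsto.const_mul (ENNReal.Tendsto.mul_const h1
      (b := q ^ 2 * ν' B₀) (Or.inr (ENNReal.mul_ne_top (ENNReal.pow_ne_top hqt) hβt)))
      (a := 2) (Or.inr (by norm_num))
    rw [zero_mul, mul_zero] at h2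
    exact (h2.eventually (Iio_mem_nhds hε4)).mono fun N hN => le_of_lt hN
  obtain ⟨N₀, hN₀⟩ := eventually_atTop.1 (e1.and (e2.and (e3.and (e4.and (eventually_gt_atTop 0)))))
  refine eventually_atTop.2 ⟨N₀ + 2, fun n hn => ?_⟩
  obtain ⟨N, rfl⟩ := Nat.exists_eq_add_of_le' (show 2 ≤ n by omega)
  obtain ⟨f1, f2, f3, f4, f5⟩ := hN₀ N (by omega)
  refine (key N f5 f1 f2).trans ((add_le_add_left (add_le_add f3 f4) _).trans (le_of_eq ?_))
  have h4 : ε₀ / 4 + ε₀ / 4 = ε₀ / 2 := by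
    have h5 : ε₀ / 2 / 2 = ε₀ / 4 := by
      rw [div_eq_mul_inv, div_eq_mul_inv, div_eq_mul_inv, mul_assoc,
        ← ENNReal.mul_inv (by norm_num) (by norm_num)]
      norm_num
    rw [← ENNReal.add_halves (ε₀ / 2), h5]
  rw [h4, ENNReal.add_halves]

end Asymptotics

/-! ### The limit of the scores -/

/-- The integral of the radial kernel `k` over `ℝ^d`. -/
def kernelMass (d : ℕ) (k : ℝ → ENNReal) : ENNReal :=
  ∫⁻ u : EuclideanSpace ℝ (Fin d), k ‖u‖

lemma lintegral_kern_sub {d : ℕ} {k : ℝ → ENNReal} (hk : Measurable k) {δ : ℝ} (hδ : 0 < δ)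
    (c : EuclideanSpace ℝ (Fin d)) : ∫⁻ y, kern k δ (y - c) = kernelMass d k := by
  rw [lintegral_sub_right_eq_self (fun y => kern k δ y) c]
  have h1 : ∀ w : EuclideanSpace ℝ (Fin d), kern k δ w =
      ENNReal.ofReal (δ ^ d)⁻¹ * k ‖δ⁻¹ • w‖ := fun w => by
    rw [kern, norm_smul, Real.norm_of_nonneg (inv_nonneg.2 hδ.le), div_eq_inv_mul]
  have hm : Measurable fun w : EuclideanSpace ℝ (Fin d) => k ‖w‖ := by fun_prop
  simp_rw [h1]
  rw [lintegral_const_mul' _ _ ENNReal.ofReal_ne_top,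
    ← lintegral_map (f := fun w : EuclideanSpace ℝ (Fin d) => k ‖w‖) hm (by fun_prop),
    Measure.map_addHaar_smul volume (inv_ne_zero hδ.ne'), lintegral_smul_measure, smul_eq_mul,
    ← mul_assoc, ← ENNReal.ofReal_mul (by positivity), finrank_euclideanSpace_fin,
    abs_of_nonneg (by positivity)]
  rw [show (δ ^ d)⁻¹ * (δ⁻¹ ^ d)⁻¹ = 1 by
    rw [inv_pow, inv_inv]; exact inv_mul_cancel₀ (pow_ne_zero d hδ.ne')]
  rw [ENNReal.ofReal_one, one_mul, kernelMass]

lemma kernelMass_ne_top {d : ℕ} {k : ℝ → ENNReal} {B : ENNReal} (hB : B ≠ ⊤) (hk : ∀ u, k u ≤ B)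
    (hs : ∀ u, 1 < u → k u = 0) : kernelMass d k ≠ ⊤ := by
  have h1 : kernelMass d k ≤ ∫⁻ u : EuclideanSpace ℝ (Fin d),
      (Metric.closedBall 0 1).indicator (fun _ => B) u := lintegral_mono fun u => by
    by_cases hu : ‖u‖ ≤ 1
    · rw [Set.indicator_of_mem (mem_closedBall_zero_iff.2 hu)]; exact hk _
    · rw [hs _ (not_le.1 hu)]; exact zero_le
  refine ne_top_of_le_ne_top ?_ h1
  rw [lintegral_indicator Metric.isClosed_closedBall.measurableSet, setLIntegral_const]
  exact ENNReal.mul_ne_top hB measure_closedBall_lt_top.ne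

/-- A vanishing integral forces the continuous function `u ↦ K ‖u‖` to vanish identically. In
positive dimension every radius in `[0, 1]` is attained, so `K` would vanish on `[0, 1]`. -/
lemma IsKernel.kernelMass_ne_zero {K : ℝ → ℝ} (hK : IsKernel K) {d : ℕ} (hd : 0 < d) :
    kernelMass d (ennKernel K) ≠ 0 := by
  obtain ⟨L, hL⟩ := hK.lipschitz
  have hcont : Continuous fun u : EuclideanSpace ℝ (Fin d) => ennKernel K ‖u‖ := by
    refine ENNReal.continuous_ofReal.comp ?_
    have h1 : ContinuousOn K (Set.Ici 0) := hL.continuousOn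
    exact h1.comp_continuous (by fun_prop) fun u => Set.mem_Ici.2 (abs_nonneg _)
  intro h0
  rw [kernelMass, lintegral_eq_zero_iff hcont.measurable] at h0
  replace h0 := (Continuous.ae_eq_iff_eq volume hcont continuous_zero).1 h0
  have hz : ∀ u ∈ Set.Icc (0 : ℝ) 1, K u = 0 := fun u hu => by
    have h1 := congrFun h0 (EuclideanSpace.single (⟨0, hd⟩ : Fin d) u)
    simp only [ennKernel, PiLp.norm_single, Real.norm_eq_abs,
      abs_of_nonneg hu.1, Pi.zero_apply, ENNReal.ofReal_eq_zero] at h1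
    exact le_antisymm h1 (hK.nonneg u)
  have := hK.pos
  rw [setIntegral_congr_fun measurableSet_Icc hz] at this
  simp at this

/-! ### The bias for small bandwidth -/

section Bias

variable [MeasurableSpace H] [BorelSpace H] {d : ℕ}

/-- Kernel averages with small bandwidth approximate a multiple of the density, uniformly over a
compact set. -/
lemma exists_localAvg_univ_le {ν : Measure H} {A : H →L[ℝ] EuclideanSpace ℝ (Fin d)}
    {F : EuclideanSpace ℝ (Fin d) → ℝ} (hF : Continuous F)
    (hν : ν.map A = volume.withDensity fun y => ENNReal.ofReal (F y)) {B₀ : Set H}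
    (hB₀ : IsCompact B₀) {k : ℝ → ENNReal} (hk : Measurable k) (hs : ∀ u, 1 < u → k u = 0)
    {τ : ℝ} (hτ : 0 < τ) :
    ∃ δ₀ > 0, ∀ δ > 0, δ ≤ δ₀ → ∀ x ∈ B₀,
      localAvg ν Set.univ k δ A x ≤
        kernelMass d k * ENNReal.ofReal (F (A x)) + kernelMass d k * ENNReal.ofReal τ ∧
      kernelMass d k * ENNReal.ofReal (F (A x)) ≤
        localAvg ν Set.univ k δ A x + kernelMass d k * ENNReal.ofReal τ := by
  -- Uniform continuity near a compact set: only the point `A x` has to lie in the compact image,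
  -- while the neighbour `y` is arbitrary.
  have hu := (hB₀.image A.continuous).uniformContinuousAt_of_continuousAt F
    (fun y _ => hF.continuousAt) (Metric.dist_mem_uniformity hτ)
  obtain ⟨δ₁, hδ₁, h1⟩ := Metric.mem_uniformity_dist.1 hu
  refine ⟨δ₁ / 2, by positivity, fun δ hδ hδ₀ x hx => ?_⟩
  set c := A x with hc
  have hloc : localAvg ν Set.univ k δ A x = ∫⁻ y, ENNReal.ofReal (F y) * kern k δ (y - c) := by
    have hm : Measurable fun y => kern k δ (y - c) := (measurable_kern hk δ).comp (by fun_prop)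
    have h2 : ∀ z, kern k δ (A (z - x)) = kern k δ (A z - c) := fun z => by rw [map_sub]
    simp only [localAvg, Measure.restrict_univ, h2]
    rw [← lintegral_map (f := fun y => kern k δ (y - c)) hm A.continuous.measurable, hν,
      lintegral_withDensity_eq_lintegral_mul _ (by fun_prop) hm]
    rfl
  have hnear : ∀ y, kern k δ (y - c) = 0 ∨ |F c - F y| < τ := fun y => by
    rcases lt_or_ge 1 (‖y - c‖ / δ) with h2 | h2
    · left; rw [kern, hs _ h2, mul_zero]
    · right
      rw [div_le_one hδ] at h2
      have h3 : dist c y < δ₁ := by rw [dist_comm, dist_eq_norm]; linarith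
      have := h1 h3 (Set.mem_image_of_mem A hx)
      simpa [Real.dist_eq] using this
  have hm : Measurable fun y => kern k δ (y - c) := (measurable_kern hk δ).comp (by fun_prop)
  have hle : ∀ y, ENNReal.ofReal (F y) * kern k δ (y - c) ≤
        ENNReal.ofReal (F c) * kern k δ (y - c) + ENNReal.ofReal τ * kern k δ (y - c) ∧
      ENNReal.ofReal (F c) * kern k δ (y - c) ≤
        ENNReal.ofReal (F y) * kern k δ (y - c) + ENNReal.ofReal τ * kern k δ (y - c) := fun y => by
    rcases hnear y with h2 | h2
    · simp [h2]
    · rw [abs_lt] at h2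
      rw [← add_mul, ← add_mul]
      constructor <;> refine mul_le_mul_left (le_trans (ENNReal.ofReal_le_ofReal ?_)
        ENNReal.ofReal_add_le) _ <;> linarith
  have hmass : ∀ C : ENNReal, C ≠ ⊤ → ∫⁻ y, C * kern k δ (y - c) = kernelMass d k * C :=
    fun C hC => by rw [lintegral_const_mul' _ _ hC, lintegral_kern_sub hk hδ, mul_comm]
  rw [hloc, ← hmass _ ENNReal.ofReal_ne_top, ← hmass _ ENNReal.ofReal_ne_top,
    ← lintegral_add_right _ (hm.const_mul _), ← lintegral_add_right _ (hm.const_mul _)]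
  exact ⟨lintegral_mono fun y => (hle y).1, lintegral_mono fun y => (hle y).2⟩

end Bias

lemma ofReal_abs_toReal_sub_le {a b c : ENNReal} (ha : a ≠ ⊤) (hb : b ≠ ⊤) (hab : a ≤ b + c)
    (hba : b ≤ a + c) : ENNReal.ofReal |a.toReal - b.toReal| ≤ c := by
  rcases eq_or_ne c ⊤ with rfl | hc
  · exact le_top
  rw [ENNReal.ofReal_le_iff_le_toReal hc, abs_le]
  have h1 := ENNReal.toReal_mono (ENNReal.add_ne_top.2 ⟨hb, hc⟩) hab
  have h2 := ENNReal.toReal_mono (ENNReal.add_ne_top.2 ⟨ha, hc⟩) hba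
  rw [ENNReal.toReal_add hb hc] at h1
  rw [ENNReal.toReal_add ha hc] at h2
  constructor <;> linarith

lemma le_add_ofReal_abs {a b : ENNReal} (ha : a ≠ ⊤) (hb : b ≠ ⊤) :
    a ≤ b + ENNReal.ofReal |a.toReal - b.toReal| := by
  rw [← ENNReal.ofReal_toReal ha, ← ENNReal.ofReal_toReal hb,
    ← ENNReal.ofReal_add ENNReal.toReal_nonneg (abs_nonneg _)]
  refine ENNReal.ofReal_le_ofReal ?_
  rw [ENNReal.toReal_ofReal ENNReal.toReal_nonneg, ENNReal.toReal_ofReal ENNReal.toReal_nonneg]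
  linarith [le_abs_self (a.toReal - b.toReal)]

/-- The passage from mean square to mean error, with a free weight `c`. -/
lemma ofReal_abs_le_add {c : ENNReal} (hc0 : c ≠ 0) (hc : c ≠ ⊤) (u : ℝ) :
    ENNReal.ofReal |u| ≤ c + c⁻¹ * ENNReal.ofReal (u ^ 2) := by
  have hc' : 0 < c.toReal := ENNReal.toReal_pos hc0 hc
  rw [← ENNReal.ofReal_toReal hc, ← ENNReal.ofReal_inv_of_pos hc',
    ← ENNReal.ofReal_mul (by positivity), ← ENNReal.ofReal_add hc'.le (by positivity)]
  refine ENNReal.ofReal_le_ofReal ?_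
  rw [← sq_abs u]
  rcases le_or_gt |u| c.toReal with h | h
  · have : 0 ≤ c.toReal⁻¹ * |u| ^ 2 := by positivity
    linarith
  · have h1 : |u| ≤ c.toReal⁻¹ * |u| ^ 2 := by
      rw [inv_mul_eq_div, le_div_iff₀ hc', pow_two]
      exact mul_le_mul_of_nonneg_left h.le (abs_nonneg u)
    linarith

lemma exists_ne_zero_mul_le {c ε : ENNReal} (hc : c ≠ ⊤) (hε : ε ≠ 0) :
    ∃ x : ENNReal, x ≠ 0 ∧ x ≠ ⊤ ∧ c * x ≤ ε := by
  have hc1 : c + 1 ≠ ⊤ := ENNReal.add_ne_top.2 ⟨hc, ENNReal.one_ne_top⟩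
  refine ⟨min 1 (ε / (c + 1)), ?_, ne_top_of_le_ne_top ENNReal.one_ne_top (min_le_left _ _), ?_⟩
  · exact (lt_min one_pos (ENNReal.div_pos hε hc1)).ne'
  · calc c * min 1 (ε / (c + 1)) ≤ (c + 1) * (ε / (c + 1)) :=
          mul_le_mul' le_self_add (min_le_right _ _)
      _ ≤ ε := ENNReal.mul_div_le

/-! ### Convergence in mean of the scores -/

section Limit

variable [MeasurableSpace H] [BorelSpace H] [SecondCountableTopology H] {G d : ℕ} {g : Fin G}
  {e : (n : ℕ) → (Fin n → H × Fin G) → Fin d → H} {a : Fin d → H} {T : ℝ × H × (H →L[ℝ] H)}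
  {η C : ℝ} {μ : Measure (H × Fin G)} [IsProbabilityMeasure μ] {p : ENNReal} {ν ν' : Measure H}
  [IsFiniteMeasure ν] [IsFiniteMeasure ν'] {K : ℝ → ℝ} {L : ℝ} {A₀ B₀ : Set H}

lemma sampleAvg_univ (r : ℝ) (k : ℝ → ENNReal) (δ : ℝ) (S : Set H) {n : ℕ}
    (s : Fin n → H × Fin G) (x : H) :
    sampleAvg g e T r k δ Set.univ s x =
      sampleAvg g e T r k δ S s x + sampleAvg g e T r k δ Sᶜ s x := by
  have h1 : ∀ z : H × Fin G, obs g Set.univ z = obs g S z + obs g Sᶜ z := fun z => by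
    by_cases h1 : z.2 = g <;> by_cases h2 : z.1 ∈ S <;> simp [obs, h1, h2]
  simp only [sampleAvg, term, h1, add_mul, mul_add, Finset.sum_add_distrib]

lemma localAvg_univ {S : Set H} (hS : MeasurableSet S) (k : ℝ → ENNReal) (δ : ℝ)
    (A : H →L[ℝ] EuclideanSpace ℝ (Fin d)) (x : H) :
    localAvg ν Set.univ k δ A x = localAvg ν S k δ A x + localAvg ν Sᶜ k δ A x := by
  simp only [localAvg, Measure.restrict_univ]
  exact (lintegral_add_compl _ hS).symm

lemma localAvg_ne_top (hKL : ∀ u, ennKernel K u ≤ ENNReal.ofReal L) (S : Set H) (δ : ℝ)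
    (A : H →L[ℝ] EuclideanSpace ℝ (Fin d)) (x : H) : localAvg ν S (ennKernel K) δ A x ≠ ⊤ := by
  refine ne_top_of_le_ne_top ?_ (lintegral_mono (μ := ν.restrict S)
    (g := fun _ => ENNReal.ofReal (δ ^ d)⁻¹ * ENNReal.ofReal L)
    fun z => mul_le_mul_right (hKL _) _)
  rw [setLIntegral_const]
  exact ENNReal.mul_ne_top (ENNReal.mul_ne_top ENNReal.ofReal_ne_top ENNReal.ofReal_ne_top)
    (measure_ne_top _ _)

/-- The mean contribution of the observations outside a set is controlled by its measure. -/
lemma StableProjections.lintegral_sampleAvg_le (h : StableProjections g e a T η C)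
    (hμ : IsGroupPart μ g p ν) (hL0 : 0 ≤ L)
    (hL : ∀ u v, 0 ≤ u → 0 ≤ v → K u ≤ K v + L * |u - v|) (hs : ∀ u, 1 < u → ennKernel K u = 0)
    (hKm : Measurable (ennKernel K)) {r δ : ℝ} (hr : r ≤ η) (hδ : 0 < δ) (hCr : C * r ≤ 1 / 4)
    {W : ENNReal} (hW : ∀ A' : H →L[ℝ] EuclideanSpace ℝ (Fin d), ‖A' - coordMap a‖ ≤ C * r →
      ∀ u, ∫⁻ x in B₀, kern (enlargedKernel K L 1) δ (u - A' x) ∂ν' ≤ W) {S : Set H}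
    (hS : MeasurableSet S) {n : ℕ} (hn : n ≠ 0) :
    ∫⁻ x in B₀, ∫⁻ s : Fin n → H × Fin G, sampleAvg g e T r (ennKernel K) δ S s x
      ∂(Measure.pi fun _ => μ) ∂ν' ≤ p * ν S * W := by
  have hn0 : (n : ENNReal) ≠ 0 := by exact_mod_cast hn
  have hnn : (n : ENNReal)⁻¹ * n = 1 := ENNReal.inv_mul_cancel hn0 (ENNReal.natCast_ne_top _)
  have hit : (n : ENNReal)⁻¹ ≠ ⊤ := ENNReal.inv_ne_top.2 hn0
  have hm := h.measurable_sampleAvg hr hKm δ hS (n := n)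
  have hsw : Measurable (Function.uncurry fun x (s : Fin n → H × Fin G) =>
      sampleAvg g e T r (ennKernel K) δ S s x) :=
    Measurable.comp (g := fun q : (Fin n → H × Fin G) × H =>
      sampleAvg g e T r (ennKernel K) δ S q.1 q.2) (f := Prod.swap) hm measurable_swap
  rw [lintegral_lintegral_swap hsw.aemeasurable]
  have hobs : ∀ i : Fin n, ∫⁻ s : Fin n → H × Fin G, obs g S (s i) ∂(Measure.pi fun _ => μ) =
      p * ν S := fun i => by
    have h1 := (measurePreserving_eval (fun _ : Fin n => μ) i).lintegral_comp
      (f := obs g S) (measurable_obs g hS)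
    have h2 := hμ.lintegral_obs hS (φ := fun _ => 1) measurable_const
    simp only [mul_one, setLIntegral_one] at h2
    rw [← h2, ← h1]
  calc ∫⁻ s : Fin n → H × Fin G, ∫⁻ x in B₀, sampleAvg g e T r (ennKernel K) δ S s x ∂ν'
        ∂(Measure.pi fun _ => μ)
      ≤ ∫⁻ s : Fin n → H × Fin G, (n : ENNReal)⁻¹ * (∑ i, obs g S (s i)) * W
        ∂(Measure.pi fun _ => μ) := by
        refine lintegral_mono fun s => ?_
        simp only [sampleAvg]
        rw [lintegral_const_mul' _ _ hit, lintegral_finsetSum _ fun i _ =>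
          Measurable.of_uncurry_left (f := fun (s : Fin n → H × Fin G) x =>
            term g e T r (ennKernel K) δ S s i x) (x := s) (h.measurable_term hr hKm δ hS i),
          mul_assoc, Finset.sum_mul]
        exact mul_le_mul_right (Finset.sum_le_sum fun i _ =>
          h.setLIntegral_term_le hL0 hL hs hr hδ zero_le_one le_rfl hCr hW S s i) _
    _ = (n : ENNReal)⁻¹ * (∑ _i : Fin n, p * ν S) * W := by
        have hmo : ∀ i : Fin n, Measurable fun s : Fin n → H × Fin G => obs g S (s i) :=
          fun i => (measurable_obs g hS).comp (measurable_pi_apply i)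
        rw [lintegral_mul_const _ ((Finset.measurable_fun_sum _ fun i _ => hmo i).const_mul _),
          lintegral_const_mul' _ _ hit, lintegral_finsetSum _ fun i _ => hmo i]
        simp_rw [hobs]
    _ = p * ν S * W := by
        rw [Finset.sum_const, Finset.card_univ, Fintype.card_fin, nsmul_eq_mul, ← mul_assoc, hnn,
          one_mul]

/-- The expectation of the contribution of the observations outside a set. -/
lemma lintegral_localAvg_le {A : H →L[ℝ] EuclideanSpace ℝ (Fin d)} {k : ℝ → ENNReal}
    (hk : Measurable k) {δ : ℝ} {W : ENNReal}
    (hW : ∀ u, ∫⁻ x in B₀, kern k δ (u - A x) ∂ν' ≤ W) (S : Set H) :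
    ∫⁻ x in B₀, localAvg ν S k δ A x ∂ν' ≤ ν S * W := by
  simp only [localAvg]
  have hm := measurable_kern (d := d) hk δ
  rw [lintegral_lintegral_swap (f := fun x z => kern k δ (A (z - x)))
    (Measurable.aemeasurable (by unfold Function.uncurry; fun_prop))]
  calc ∫⁻ z in S, ∫⁻ x in B₀, kern k δ (A (z - x)) ∂ν' ∂ν ≤ ∫⁻ _ in S, W ∂ν :=
        lintegral_mono fun z => by simpa only [map_sub] using hW (A z)
    _ = ν S * W := by rw [setLIntegral_const, mul_comm]

/-- The scores converge in mean, over a compact set of tame points, to a multiple of the density of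
the leading coordinates. -/
theorem StableProjections.eventually_lintegral_abs_le [CompleteSpace H]
    (h : StableProjections g e a T η C)
    (hμ : IsGroupPart μ g p ν) (hp : p ≠ ⊤) {ξ ξ' : HilbertBasis ℕ ℝ H}
    (hνt : ∀ᵐ x ∂ν, x ∈ tamePts ν ξ) (hB₀ : IsCompact B₀)
    (hB₀t : B₀ ⊆ tamePts ν' ξ') (hK : IsKernel K) {δ : ℕ → ℝ} (hδ : ∀ n, 0 < δ n)
    (hδ0 : Tendsto δ atTop (𝓝 0))
    (hδ1 : Tendsto (fun n : ℕ => n * δ n) atTop atTop)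
    (hδd : Tendsto (fun n : ℕ => n * δ n ^ d) atTop atTop)
    (hgood : ∀ r > 0, Tendsto (fun n => (Measure.pi fun _ : Fin n => μ) (goodSet g T r)) atTop (𝓝 1))
    {F : EuclideanSpace ℝ (Fin d) → ℝ} (hF : Continuous F)
    (hν : ν.map (coordMap a) = volume.withDensity fun y => ENNReal.ofReal (F y))
    {ε₀ : ENNReal} (hε₀ : ε₀ ≠ 0) :
    ∃ r₀ > 0, ∀ r > 0, r ≤ r₀ → ∀ᶠ n : ℕ in atTop,
      ∫⁻ x in B₀, ∫⁻ s : Fin n → H × Fin G,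
        ENNReal.ofReal |(sampleAvg g e T r (ennKernel K) (δ n) Set.univ s x).toReal -
          (p * (kernelMass d (ennKernel K) * ENNReal.ofReal (F (coordMap a x)))).toReal|
            ∂(Measure.pi fun _ => μ) ∂ν' ≤ ε₀ := by
  obtain ⟨L, hL0, hL, hKL, hs, hKm⟩ := hK.exists_bounds
  have hsurj := surjective_coordMap h.orthonormal_limit
  obtain ⟨ε_b, hε_b, C_b, hC_b, hb⟩ := exists_lintegral_kern_le hB₀ hB₀t hsurj
  set W : ENNReal := 2 * ENNReal.ofReal L * (C_b * ENNReal.ofReal (2 ^ d)) with hW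
  have hWt : W ≠ ⊤ := ENNReal.mul_ne_top
    (ENNReal.mul_ne_top (by norm_num) ENNReal.ofReal_ne_top)
    (ENNReal.mul_ne_top hC_b ENNReal.ofReal_ne_top)
  set κ := kernelMass d (ennKernel K) with hκ
  have hκt : κ ≠ ⊤ := kernelMass_ne_top ENNReal.ofReal_ne_top hKL hs
  have hβt : ν' B₀ ≠ ⊤ := measure_ne_top _ _
  have hε4 : ε₀ / 4 ≠ 0 := (ENNReal.div_pos hε₀ (by norm_num)).ne'
  have hε8 : ε₀ / 8 ≠ 0 := (ENNReal.div_pos hε₀ (by norm_num)).ne'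
  -- Tolerances: `x₁` for the mass outside a compact set of tame points, `x₂` for the weight in the
  -- passage from mean square to mean, `x₃` for the bias.
  obtain ⟨x₁, hx₁, hx₁t, hx₁ε⟩ := exists_ne_zero_mul_le (ENNReal.mul_ne_top hp hWt) hε4
  obtain ⟨x₂, hx₂, hx₂t, hx₂ε⟩ := exists_ne_zero_mul_le hβt hε8
  obtain ⟨x₃, hx₃, hx₃t, hx₃ε⟩ := exists_ne_zero_mul_le
    (ENNReal.mul_ne_top (ENNReal.mul_ne_top hp hκt) hβt) hε4
  -- The mean square argument needs observations in a compact set of tame points. The bias concerns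
  -- the uncut law, whose projection has the given density, so the cut is undone before comparing
  -- with it.
  obtain ⟨A₀, hA₀t, hA₀, hA₀ν⟩ : ∃ A₀ ⊆ tamePts ν ξ, IsCompact A₀ ∧ ν A₀ᶜ ≤ x₁ := by
    obtain ⟨A₀, h1, h2, h3⟩ := (isOpen_tamePts ν ξ).measurableSet.exists_isCompact_sdiff_lt
      (measure_ne_top ν _) hx₁
    refine ⟨A₀, h1, h2, le_trans ?_ h3.le⟩
    refine measure_mono_ae ?_
    filter_upwards [hνt] with x hx hxA using ⟨hx, hxA⟩
  have hA₀m := hA₀.measurableSet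
  obtain ⟨r₁, hr₁, hsq⟩ := h.eventually_lintegral_sq_le hμ hp hA₀ hA₀t hB₀ hB₀t hK hδ hδ1 hδd hgood
    (ε₀ := x₂ * (ε₀ / 8)) (mul_ne_zero hx₂ hε8)
  obtain ⟨δ₀, hδ₀, hbias⟩ := exists_localAvg_univ_le hF hν hB₀ hKm hs (ENNReal.toReal_pos hx₃ hx₃t)
  have hC0 := h.nonneg
  set ρ := min (1 / 4) ε_b with hρ
  have hρ0 : 0 < ρ := by positivity
  refine ⟨min r₁ (min η (ρ / (C + 1))), lt_min hr₁ (lt_min h.pos (by positivity)),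
    fun r hr0 hr => ?_⟩
  obtain ⟨hr1, hrη, hrρ⟩ : r ≤ r₁ ∧ r ≤ η ∧ r ≤ ρ / (C + 1) := by simpa only [le_min_iff] using hr
  have hCr : C * r ≤ ρ := by
    rw [le_div_iff₀ (by positivity)] at hrρ
    nlinarith
  filter_upwards [hsq r hr0 hr1, hδ0.eventually (ge_mem_nhds hδ₀), eventually_ne_atTop 0]
    with n hn hδn hn0
  have hδ' := hδ n
  set Q := (Measure.pi fun _ : Fin n => μ) with hQ
  set w : Set H → (Fin n → H × Fin G) → H → ENNReal :=
    fun S s x => sampleAvg g e T r (ennKernel K) (δ n) S s x with hw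
  set J : Set H → H → ENNReal := fun S x => localAvg ν S (ennKernel K) (δ n) (coordMap a) x with hJ
  set ℓ : H → ENNReal := fun x => p * (κ * ENNReal.ofReal (F (coordMap a x))) with hℓ
  have hwt : ∀ S s x, w S s x ≠ ⊤ := fun S s x => sampleAvg_ne_top hKL r (δ n) S s x
  have hJt : ∀ S x, p * J S x ≠ ⊤ := fun S x =>
    ENNReal.mul_ne_top hp (localAvg_ne_top hKL S (δ n) _ x)
  have hℓt : ∀ x, ℓ x ≠ ⊤ := fun x =>
    ENNReal.mul_ne_top hp (ENNReal.mul_ne_top hκt ENNReal.ofReal_ne_top)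
  have hJm : Measurable (J A₀ᶜ) := measurable_localAvg ν _ hKm _ _
  have hwm : Measurable (Function.uncurry fun x (s : Fin n → H × Fin G) => w A₀ᶜ s x) :=
    Measurable.comp (g := fun q : (Fin n → H × Fin G) × H => w A₀ᶜ q.1 q.2) (f := Prod.swap)
      (h.measurable_sampleAvg hrη hKm (δ n) hA₀m.compl) measurable_swap
  have hwx : ∀ x, Measurable fun s => w A₀ᶜ s x := fun x =>
    Measurable.of_uncurry_left (f := fun x s => w A₀ᶜ s x) (x := x) hwm
  -- The error splits into the fluctuation over `A₀`, the observations outside `A₀`, their expected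
  -- contribution and the bias.
  have hpt : ∀ x ∈ B₀, ∀ s, ENNReal.ofReal |(w Set.univ s x).toReal - (ℓ x).toReal| ≤
      ENNReal.ofReal |(w A₀ s x).toReal - (p * J A₀ x).toReal| +
        (w A₀ᶜ s x + (p * J A₀ᶜ x + p * (κ * x₃))) := fun x hx s => by
    obtain ⟨b1, b2⟩ := hbias (δ n) hδ' hδn x hx
    rw [ENNReal.ofReal_toReal hx₃t, localAvg_univ hA₀m] at b1 b2
    have e1 := mul_le_mul_right b1 p
    have e2 := mul_le_mul_right b2 p
    rw [mul_add, mul_add] at e1 e2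
    have d1 := le_add_ofReal_abs (hwt A₀ s x) (hJt A₀ x)
    have d2 := le_add_ofReal_abs (hJt A₀ x) (hwt A₀ s x)
    rw [abs_sub_comm] at d2
    set D := ENNReal.ofReal |(w A₀ s x).toReal - (p * J A₀ x).toReal|
    have hsum : w Set.univ s x = w A₀ s x + w A₀ᶜ s x := sampleAvg_univ _ _ _ _ _ _
    refine ofReal_abs_toReal_sub_le (hwt _ s x) (hℓt x) ?_ ?_
    · calc w Set.univ s x = w A₀ s x + w A₀ᶜ s x := hsum
        _ ≤ (p * J A₀ x + D) + w A₀ᶜ s x := by gcongr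
        _ ≤ (p * J A₀ x + D) + w A₀ᶜ s x + p * J A₀ᶜ x := le_self_add
        _ = (p * J A₀ x + p * J A₀ᶜ x) + (D + w A₀ᶜ s x) := by ring
        _ ≤ (ℓ x + p * (κ * x₃)) + (D + w A₀ᶜ s x) := by gcongr
        _ ≤ (ℓ x + p * (κ * x₃)) + (D + w A₀ᶜ s x) + p * J A₀ᶜ x := le_self_add
        _ = _ := by ring
    · calc ℓ x ≤ (p * J A₀ x + p * J A₀ᶜ x) + p * (κ * x₃) := e2
        _ ≤ ((w A₀ s x + D) + p * J A₀ᶜ x) + p * (κ * x₃) := by gcongr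
        _ ≤ ((w A₀ s x + D) + p * J A₀ᶜ x) + p * (κ * x₃) + (w A₀ᶜ s x + w A₀ᶜ s x) := le_self_add
        _ = _ := by rw [hsum]; ring
  have hclose : ∀ A' : H →L[ℝ] EuclideanSpace ℝ (Fin d), ‖A' - coordMap a‖ ≤ C * r →
      ∀ u, ∫⁻ x in B₀, kern (enlargedKernel K L 1) (δ n) (u - A' x) ∂ν' ≤ W := fun A' hA' u =>
    hb A' (hA'.trans (hCr.trans (min_le_right _ _))) _ _ 2 (by norm_num)
      (enlargedKernel_le hL0 hKL le_rfl) (fun _ => enlargedKernel_eq_zero hs 1) (δ n) hδ' u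
  have t1 : ∫⁻ x in B₀, ∫⁻ s, ENNReal.ofReal |(w A₀ s x).toReal - (p * J A₀ x).toReal| ∂Q ∂ν' ≤
      ε₀ / 4 := by
    calc _ ≤ ∫⁻ x in B₀, ∫⁻ s, (x₂ + x₂⁻¹ *
          ENNReal.ofReal (((w A₀ s x).toReal - (p * J A₀ x).toReal) ^ 2)) ∂Q ∂ν' :=
          lintegral_mono fun x => lintegral_mono fun s => ofReal_abs_le_add hx₂ hx₂t _
      _ = ν' B₀ * x₂ + x₂⁻¹ * ∫⁻ x in B₀, ∫⁻ s,
          ENNReal.ofReal (((w A₀ s x).toReal - (p * J A₀ x).toReal) ^ 2) ∂Q ∂ν' := by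
          have hx₂i : x₂⁻¹ ≠ ⊤ := ENNReal.inv_ne_top.2 hx₂
          simp_rw [lintegral_add_left (measurable_const (a := x₂)), lintegral_const_mul' _ _ hx₂i,
            lintegral_const, measure_univ, mul_one]
          rw [lintegral_add_left measurable_const, lintegral_const_mul' _ _ hx₂i,
            setLIntegral_const, mul_comm x₂]
      _ ≤ ε₀ / 8 + x₂⁻¹ * (x₂ * (ε₀ / 8)) := by gcongr
      _ = ε₀ / 4 := by
          rw [← mul_assoc, ENNReal.inv_mul_cancel hx₂ hx₂t, one_mul, ← two_mul,
            show (8 : ENNReal) = 2 * 4 by norm_num, div_eq_mul_inv, div_eq_mul_inv,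
            ENNReal.mul_inv (by norm_num) (by norm_num), mul_left_comm, ← mul_assoc 2,
            ENNReal.mul_inv_cancel (by norm_num) (by norm_num), one_mul]
  have t2 : ∫⁻ x in B₀, ∫⁻ s, w A₀ᶜ s x ∂Q ∂ν' ≤ ε₀ / 4 := by
    refine (h.lintegral_sampleAvg_le hμ hL0 hL hs hKm hrη hδ' (hCr.trans (min_le_left _ _)) hclose
      hA₀m.compl hn0).trans (le_trans ?_ hx₁ε)
    calc p * ν A₀ᶜ * W ≤ p * x₁ * W := by gcongr
      _ = p * W * x₁ := by ring
  have t3 : ∫⁻ x in B₀, p * J A₀ᶜ x ∂ν' ≤ ε₀ / 4 := by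
    rw [lintegral_const_mul _ hJm]
    refine le_trans ?_ hx₁ε
    calc p * ∫⁻ x in B₀, J A₀ᶜ x ∂ν' ≤ p * (ν A₀ᶜ * W) := by
          refine mul_le_mul_right (lintegral_localAvg_le hKm (fun u => ?_) _) p
          refine le_trans (lintegral_mono fun x => ?_) (hclose (coordMap a) (by
            rw [sub_self, norm_zero]; positivity) u)
          exact mul_le_mul_right (le_self_add) _
      _ ≤ p * (x₁ * W) := by gcongr
      _ = p * W * x₁ := by ring
  have t4 : p * (κ * x₃) * ν' B₀ ≤ ε₀ / 4 := le_trans (le_of_eq (by ring)) hx₃ε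
  calc ∫⁻ x in B₀, ∫⁻ s, ENNReal.ofReal |(w Set.univ s x).toReal - (ℓ x).toReal| ∂Q ∂ν'
      ≤ ∫⁻ x in B₀, ∫⁻ s, (ENNReal.ofReal |(w A₀ s x).toReal - (p * J A₀ x).toReal| +
        (w A₀ᶜ s x + (p * J A₀ᶜ x + p * (κ * x₃)))) ∂Q ∂ν' :=
        setLIntegral_mono' hB₀.measurableSet fun x hx => lintegral_mono fun s => hpt x hx s
    _ = ∫⁻ x in B₀, ∫⁻ s, ENNReal.ofReal |(w A₀ s x).toReal - (p * J A₀ x).toReal| ∂Q ∂ν' +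
        (∫⁻ x in B₀, ∫⁻ s, w A₀ᶜ s x ∂Q ∂ν' + (∫⁻ x in B₀, p * J A₀ᶜ x ∂ν' +
          p * (κ * x₃) * ν' B₀)) := by
        have hm1 : Measurable fun x => ∫⁻ s, w A₀ᶜ s x ∂Q :=
          Measurable.lintegral_prod_right (f := fun x s => w A₀ᶜ s x) hwm
        have e1 : ∀ x, ∫⁻ s, (ENNReal.ofReal |(w A₀ s x).toReal - (p * J A₀ x).toReal| +
            (w A₀ᶜ s x + (p * J A₀ᶜ x + p * (κ * x₃)))) ∂Q =
            ∫⁻ s, ENNReal.ofReal |(w A₀ s x).toReal - (p * J A₀ x).toReal| ∂Q +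
              (∫⁻ s, w A₀ᶜ s x ∂Q + (p * J A₀ᶜ x + p * (κ * x₃))) := fun x => by
          have hm : Measurable fun s => w A₀ᶜ s x + (p * J A₀ᶜ x + p * (κ * x₃)) :=
            (hwx x).add_const _
          rw [lintegral_add_right _ hm, lintegral_add_left (hwx x),
            lintegral_const, measure_univ, mul_one]
        have hm2 : Measurable fun x => p * J A₀ᶜ x := hJm.const_mul p
        have hm3 : Measurable fun x => ∫⁻ s, w A₀ᶜ s x ∂Q + (p * J A₀ᶜ x + p * (κ * x₃)) :=
          hm1.add (hm2.add_const _)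
        simp_rw [e1]
        rw [lintegral_add_right _ hm3, lintegral_add_left hm1, lintegral_add_left hm2,
          setLIntegral_const]
    _ ≤ ε₀ / 4 + (ε₀ / 4 + (ε₀ / 4 + ε₀ / 4)) := by gcongr
    _ = ε₀ := by
        have : ε₀ / 4 + (ε₀ / 4 + (ε₀ / 4 + ε₀ / 4)) = 4 * (ε₀ / 4) := by ring
        rw [this, ENNReal.mul_div_cancel (by norm_num) (by norm_num)]

end Limit

/-! ### The law of large numbers for the features -/

section Sampling

variable {Ω S : Type*} [MeasurableSpace Ω] [MeasurableSpace S] {P : Measure Ω}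
  [IsProbabilityMeasure P] {Z : ℕ → Ω → S} {μ : Measure S}

lemma map_sample (hZ : iIndepFun Z P) (hZm : ∀ i, AEMeasurable (Z i) P)
    (hlaw : ∀ i, P.map (Z i) = μ) (n : ℕ) :
    P.map (fun ω (i : Fin n) => Z i ω) = Measure.pi fun _ => μ := by
  have h1 := (iIndepFun_iff_map_fun_eq_pi_map (fun i : Fin n => hZm i)).1
    (hZ.precomp (g := fun i : Fin n => (i : ℕ)) Fin.val_injective)
  rw [h1]
  simp_rw [hlaw]

/-- The strong law along the given sequence yields convergence in probability, which depends only on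
the law of each finite sample and so passes to product measures. -/
lemma tendsto_measure_mean_mem_ball {E : Type*} [NormedAddCommGroup E] [NormedSpace ℝ E]
    [CompleteSpace E] [MeasurableSpace E] [BorelSpace E] (hZ : iIndepFun Z P)
    (hZm : ∀ i, AEMeasurable (Z i) P) (hlaw : ∀ i, P.map (Z i) = μ) {τ : S → E}
    (hτ : Measurable τ) (hint : Integrable τ μ) {r : ℝ} (hr : 0 < r)
    (hms : ∀ n : ℕ, MeasurableSet
      {s : Fin n → S | (n : ℝ)⁻¹ • ∑ i, τ (s i) ∈ Metric.ball (∫ z, τ z ∂μ) r}) :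
    Tendsto (fun n : ℕ => (Measure.pi fun _ : Fin n => μ)
      {s | (n : ℝ)⁻¹ • ∑ i, τ (s i) ∈ Metric.ball (∫ z, τ z ∂μ) r}) atTop (𝓝 1) := by
  have hint' : ∀ i, Integrable (fun ω => τ (Z i ω)) P := fun i => by
    rw [← hlaw i] at hint
    exact hint.comp_aemeasurable (hZm i)
  have hmean : ∫ ω, τ (Z 0 ω) ∂P = ∫ z, τ z ∂μ := by
    rw [← hlaw 0, integral_map (hZm 0)]
    rw [hlaw 0]; exact hint.aestronglyMeasurable
  have hll := strong_law_ae (μ := P) (fun i ω => τ (Z i ω)) (hint' 0)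
    (fun i j hij => (hZ.indepFun hij).comp hτ hτ)
    (fun i => (IdentDistrib.mk (hZm i) (hZm 0) ((hlaw i).trans (hlaw 0).symm)).comp hτ)
  rw [hmean] at hll
  have hM := tendstoInMeasure_of_tendsto_ae (μ := P) (fun n => AEStronglyMeasurable.const_smul
    (Finset.aestronglyMeasurable_fun_sum (Finset.range n) fun i _ => (hint' i).aestronglyMeasurable)
    ((n : ℝ)⁻¹)) hll
  have h2 := tendstoInMeasure_iff_norm.1 hM r hr
  have h3 := ENNReal.Tendsto.sub (tendsto_const_nhds (x := (1 : ENNReal))) h2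
    (Or.inl ENNReal.one_ne_top)
  rw [tsub_zero] at h3
  refine h3.congr fun n => ?_
  rw [← map_sample hZ hZm hlaw n, Measure.map_apply_of_aemeasurable
    (aemeasurable_pi_lambda (fun ω (i : Fin n) => Z i ω) fun i => hZm i) (hms n)]
  have h4 : {ω | r ≤ ‖(n : ℝ)⁻¹ • ∑ i ∈ Finset.range n, τ (Z i ω) - ∫ z, τ z ∂μ‖} =
      ((fun ω (i : Fin n) => Z i ω) ⁻¹'
        {s | (n : ℝ)⁻¹ • ∑ i, τ (s i) ∈ Metric.ball (∫ z, τ z ∂μ) r})ᶜ := by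
    ext ω
    simp only [Set.mem_ofPred_eq, Set.mem_compl_iff, Set.mem_preimage, mem_ball_iff_norm, not_lt,
      Finset.sum_range (fun i => τ (Z i ω))]
  have h5 : NullMeasurableSet ((fun ω (i : Fin n) => Z i ω) ⁻¹'
        {s | (n : ℝ)⁻¹ • ∑ i, τ (s i) ∈ Metric.ball (∫ z, τ z ∂μ) r}) P :=
    (aemeasurable_pi_lambda (fun ω (i : Fin n) => Z i ω) fun i => hZm i).nullMeasurable (hms n)
  change 1 - P {ω | r ≤ ‖(n : ℝ)⁻¹ • ∑ i ∈ Finset.range n, τ (Z i ω) - ∫ z, τ z ∂μ‖} = _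
  rw [h4, prob_compl_eq_one_sub₀ h5, ENNReal.sub_sub_cancel ENNReal.one_ne_top prob_le_one]

end Sampling

/-! ### Second moments of a law -/

section Covariance

variable [MeasurableSpace H] [BorelSpace H] [SecondCountableTopology H] [CompleteSpace H]

lemma inner_covOp_left {ν : Measure H} [IsFiniteMeasure ν] (h2 : MemLp (fun x : H => x) 2 ν)
    (v w : H) : inner ℝ (covOp ν v) w =
      ∫ x, inner ℝ (x - meanVec ν) v * inner ℝ (x - meanVec ν) w ∂ν := by
  rw [real_inner_comm, covOp, ← integral_inner (integrable_inner_smul h2 _ v)]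
  simp only [inner_smul_right, real_inner_comm]

lemma inner_covOp_comm {ν : Measure H} [IsFiniteMeasure ν] (h2 : MemLp (fun x : H => x) 2 ν)
    (v w : H) : inner ℝ (covOp ν v) w = (inner ℝ v (covOp ν w) : ℝ) := by
  rw [← real_inner_comm v, inner_covOp_left h2, inner_covOp_left h2]
  exact integral_congr_ae (Eventually.of_forall fun x => mul_comm _ _)

lemma covOp_eq {ν : Measure H} [IsProbabilityMeasure ν] (h2 : MemLp (fun x : H => x) 2 ν) (v : H) :
    covOp ν v = ∫ x, (inner ℝ x v : ℝ) • x ∂ν - (inner ℝ (meanVec ν) v : ℝ) • meanVec ν := by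
  set m := meanVec ν with hm
  have h1 : Integrable (fun x : H => x) ν := h2.integrable (by norm_num)
  have hS : Integrable (fun x : H => (inner ℝ x v : ℝ) • x) ν := by
    simpa using integrable_inner_smul h2 0 v
  have hi : Integrable (fun x : H => (inner ℝ x v : ℝ)) ν := h1.inner_const v
  have he : ∀ x, (inner ℝ (x - m) v : ℝ) • (x - m) = (inner ℝ x v : ℝ) • x -
      (inner ℝ m v : ℝ) • x - ((inner ℝ x v : ℝ) • m - (inner ℝ m v : ℝ) • m) := fun x => by
    rw [inner_sub_left, sub_smul, smul_sub, smul_sub]; abel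
  rw [covOp, ← hm]
  simp_rw [he]
  have hiv : ∫ x, (inner ℝ x v : ℝ) ∂ν = inner ℝ m v := by
    simp_rw [real_inner_comm v]
    rw [integral_inner h1]
    rfl
  have i1 : Integrable (fun x : H => (inner ℝ m v : ℝ) • x) ν := h1.smul _
  have i2 : Integrable (fun x : H => (inner ℝ x v : ℝ) • x - (inner ℝ m v : ℝ) • x) ν := hS.sub i1
  have i3 : Integrable (fun _ : H => (inner ℝ m v : ℝ) • m) ν := integrable_const _
  have i4 : Integrable (fun x : H => (inner ℝ x v : ℝ) • m) ν := hi.smul_const m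
  have i5 : Integrable (fun x : H => (inner ℝ x v : ℝ) • m - (inner ℝ m v : ℝ) • m) ν := i4.sub i3
  rw [integral_sub i2 i5, integral_sub hS i1, integral_sub i4 i3, integral_smul,
    integral_smul_const, integral_const, hiv]
  simp [hm, meanVec]

end Covariance

/-! ### Expectation of the features and stability of the projections -/

section Feature

variable {Ω : Type*} [MeasurableSpace Ω] [MeasurableSpace H] [BorelSpace H]
  [SecondCountableTopology H] {G : ℕ} {P : Measure Ω} [IsProbabilityMeasure P] {X : Ω → H}
  {Y : Ω → Fin G}

lemma isGroupPart_groupLaw (hX : Measurable X) (hY : Measurable Y) {g : Fin G}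
    (hg : 0 < P.real (Y ⁻¹' {g})) :
    IsGroupPart (P.map fun ω => (X ω, Y ω)) g (ENNReal.ofReal (P.real (Y ⁻¹' {g})))
      (groupLaw P X Y g) := fun φ hφ => by
  have hm : MeasurableSet (Y ⁻¹' {g}) := hY (measurableSet_singleton g)
  have h0 : P (Y ⁻¹' {g}) ≠ 0 := fun h0 => by simp [measureReal_def, h0] at hg
  have hind : Measurable ({z : H × Fin G | z.2 = g}.indicator fun z => φ z.1) :=
    (hφ.comp measurable_fst).indicator ((measurableSet_singleton g).preimage measurable_snd)
  rw [lintegral_map hind (hX.prodMk hY),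
    groupLaw, lintegral_map hφ hX, ProbabilityTheory.cond, lintegral_smul_measure, smul_eq_mul,
    ← mul_assoc, ofReal_measureReal, ENNReal.mul_inv_cancel h0 (measure_ne_top _ _), one_mul,
    ← lintegral_indicator hm]
  rfl

/-- The space of operators need not be separable; separability of the source makes a continuous map
strongly measurable. -/
lemma aestronglyMeasurable_feature (g : Fin G) (μ : Measure (H × Fin G)) :
    AEStronglyMeasurable (feature g) μ :=
  have := secondCountableTopologyEither_of_left (H × Fin G) (ℝ × H × (H →L[ℝ] H))
  (continuous_feature g).aestronglyMeasurable

lemma integrable_feature (hX : Measurable X) (hY : Measurable Y) (hX2 : MemLp X 2 P) (g : Fin G) :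
    Integrable (feature g) (P.map fun ω => (X ω, Y ω)) := by
  refine (integrable_map_measure (aestronglyMeasurable_feature g _)
    (hX.prodMk hY).aemeasurable).2 ?_
  have hb : Integrable (fun ω => 1 + ‖X ω‖ + ‖X ω‖ ^ 2) P :=
    ((integrable_const 1).add (hX2.integrable (by norm_num)).norm).add hX2.norm.integrable_sq
  refine hb.mono' ((aestronglyMeasurable_feature g _).comp_measurable (hX.prodMk hY))
    (Eventually.of_forall fun ω => ?_)
  have h1 := norm_nonneg (X ω)
  simp only [Function.comp_apply, feature]
  split_ifs
  · rw [Prod.norm_mk, Prod.norm_mk, norm_one, norm_tensorL]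
    refine max_le ?_ (max_le ?_ ?_) <;> nlinarith
  · rw [norm_zero]; positivity

variable [CompleteSpace H]

/-- Continuous linear maps commute with the integral, so the frequency, the mean and the second
moment at a vector are all read off in the same way. -/
lemma map_integral_feature (hX : Measurable X) (hY : Measurable Y) (hX2 : MemLp X 2 P) {g : Fin G}
    (hg : 0 < P.real (Y ⁻¹' {g})) {E : Type*} [NormedAddCommGroup E] [NormedSpace ℝ E]
    [CompleteSpace E] (Λ : ℝ × H × (H →L[ℝ] H) →L[ℝ] E) {ψ : H → E} (hψ : Continuous ψ)
    (hΛ : ∀ x, Λ (1, x, tensorL x x) = ψ x) :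
    Λ (∫ z, feature g z ∂(P.map fun ω => (X ω, Y ω))) =
      P.real (Y ⁻¹' {g}) • ∫ x, ψ x ∂(groupLaw P X Y g) := by
  have hm : MeasurableSet (Y ⁻¹' {g}) := hY (measurableSet_singleton g)
  rw [← Λ.integral_comp_comm (integrable_feature hX hY hX2 g),
    integral_map (f := fun z => Λ (feature g z)) (hX.prodMk hY).aemeasurable
      (Λ.continuous.comp_aestronglyMeasurable (aestronglyMeasurable_feature g _)), groupLaw,
    integral_map hX.aemeasurable hψ.aestronglyMeasurable, ProbabilityTheory.cond,
    integral_smul_measure, smul_smul, ENNReal.toReal_inv, ← measureReal_def,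
    mul_inv_cancel₀ hg.ne', one_smul, ← integral_indicator hm]
  refine integral_congr_ae (Eventually.of_forall fun ω => ?_)
  by_cases hω : Y ω = g
  · simp [feature, hω, hΛ]
  · simp [feature, hω]

lemma integral_feature (hX : Measurable X) (hY : Measurable Y) (hX2 : MemLp X 2 P) {g : Fin G}
    (hg : 0 < P.real (Y ⁻¹' {g})) :
    (∫ z, feature g z ∂(P.map fun ω => (X ω, Y ω))).1 = P.real (Y ⁻¹' {g}) ∧
    (∫ z, feature g z ∂(P.map fun ω => (X ω, Y ω))).2.1 =
      P.real (Y ⁻¹' {g}) • meanVec (groupLaw P X Y g) ∧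
    ∀ v, (∫ z, feature g z ∂(P.map fun ω => (X ω, Y ω))).2.2 v =
      P.real (Y ⁻¹' {g}) • ∫ x, (inner ℝ x v : ℝ) • x ∂(groupLaw P X Y g) := by
  have := isProbabilityMeasure_groupLaw hX hg
  refine ⟨?_, ?_, fun v => ?_⟩
  · have := map_integral_feature hX hY hX2 hg (ContinuousLinearMap.fst ℝ ℝ (H × (H →L[ℝ] H)))
      (ψ := fun _ => (1 : ℝ)) continuous_const fun x => rfl
    simpa using this
  · exact map_integral_feature hX hY hX2 hg (ContinuousLinearMap.fst ℝ H (H →L[ℝ] H) ∘L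
      ContinuousLinearMap.snd ℝ ℝ (H × (H →L[ℝ] H))) (ψ := fun x => x) continuous_id fun x => rfl
  · exact map_integral_feature hX hY hX2 hg (ContinuousLinearMap.apply ℝ H v ∘L
      ContinuousLinearMap.snd ℝ H (H →L[ℝ] H) ∘L ContinuousLinearMap.snd ℝ ℝ (H × (H →L[ℝ] H)))
      (ψ := fun x => (inner ℝ x v : ℝ) • x) (by fun_prop) fun x => rfl

lemma featureCov_integral_feature (hX : Measurable X) (hY : Measurable Y) (hX2 : MemLp X 2 P)
    {g : Fin G} (hg : 0 < P.real (Y ⁻¹' {g})) (v : H) :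
    featureCov (∫ z, feature g z ∂(P.map fun ω => (X ω, Y ω))) v = covOp (groupLaw P X Y g) v := by
  obtain ⟨h1, h2, h3⟩ := integral_feature hX hY hX2 hg
  have := isProbabilityMeasure_groupLaw hX hg
  rw [covOp_eq (memLp_groupLaw hX hX2 g), featureCov, sub_apply, smul_apply, smul_apply,
    tensorL_apply, h1, h2, h3, inv_smul_smul₀ hg.ne', inner_smul_left, smul_smul, smul_smul]
  congr 2
  simp only [conj_trivial]
  field_simp

/-- The estimated projections are Lipschitz in the mean feature near its expectation. -/
lemma exists_stableProjections (hX : Measurable X) (hY : Measurable Y) (hX2 : MemLp X 2 P)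
    {g : Fin G} (hg : 0 < P.real (Y ⁻¹' {g})) {ξ : HilbertBasis ℕ ℝ H} {lam : ℕ → ℝ}
    (hξ : IsKLBasis (groupLaw P X Y g) ξ lam) {d : ℕ} (hd : 0 < d)
    (hgap : ∀ j < d, lam d < lam j) {e : (n : ℕ) → (Fin n → H × Fin G) → Fin d → H}
    (he : ∀ n s, IsLeadingEigensystem (groupCov s g) (e n s)) :
    ∃ η C, StableProjections g e (initSeg ξ d) (∫ z, feature g z ∂(P.map fun ω => (X ω, Y ω)))
      η C := by
  set T := ∫ z, feature g z ∂(P.map fun ω => (X ω, Y ω)) with hT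
  have hcov := featureCov_integral_feature hX hY hX2 hg
  rw [← hT] at hcov
  have hT0 : T.1 ≠ 0 := by rw [hT, (integral_feature hX hY hX2 hg).1]; exact hg.ne'
  have := isProbabilityMeasure_groupLaw hX hg
  -- Eigenvalues are numbered from `0`: `lam (d - 1)` is the smallest of the leading `d` and `lam d`
  -- the largest of the others; this is where `0 < d` matters.
  have hsplit : SpectralSplit (featureCov T) (initSeg ξ d) (lam (d - 1)) (lam d) :=
    spectralSplit_initSeg hξ.antitone
      (fun x y => by rw [hcov, hcov]; exact inner_covOp_comm (memLp_groupLaw hX hX2 g) x y)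
      (fun j => by rw [hcov]; exact hξ.eigen j) (fun j hj => hξ.antitone (by omega))
  obtain ⟨η, hη, C, hC, h⟩ := exists_projL_lipschitz hT0 (hgap (d - 1) (by omega)) hsplit
  exact ⟨η, C, hη, hC, fun n s => (he n s).1, orthonormal_initSeg ξ d,
    fun n s hs => (h n s _ hs (he n s)).1,
    fun n s m s' hs hs' => (h n s _ hs (he n s)).2 m s' _ hs' (he m s')⟩

/-- The mean feature of a large sample is close to its expectation. -/
lemma tendsto_measure_goodSet (hX : Measurable X) (hY : Measurable Y) (hX2 : MemLp X 2 P)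
    {Z : ℕ → Ω → H × Fin G} (hZ : iIndepFun Z P)
    (hZlaw : ∀ i, IdentDistrib (Z i) (fun ω => (X ω, Y ω)) P P) (g : Fin G) {r : ℝ} (hr : 0 < r) :
    Tendsto (fun n => (Measure.pi fun _ : Fin n => P.map fun ω => (X ω, Y ω))
      (goodSet g (∫ z, feature g z ∂(P.map fun ω => (X ω, Y ω))) r)) atTop (𝓝 1) :=
  tendsto_measure_mean_mem_ball hZ (fun i => (hZlaw i).aemeasurable_fst)
    (fun i => (hZlaw i).map_eq) (continuous_feature g).measurable
    (integrable_feature hX hY hX2 g) hr fun _ => measurableSet_goodSet g _ r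

end Feature

/-! ### Consistency -/

lemma sqrt_pow_eq {h : ℝ} (hh : 0 ≤ h) (d : ℕ) : √(h ^ d) = √h ^ d := by
  rw [Real.sqrt_eq_iff_mul_self_eq (by positivity) (by positivity), ← mul_pow,
    Real.mul_self_sqrt hh]

/-- If every score is within `t` of its limit, the limit at the selected index is less than `2 * t`
below any other. It is then maximal unless some pair has a positive gap below `2 * t`; exact ties
are harmless. -/
lemma gap_or_le_of_mem_argmaxSet {G : ℕ} {S ℓ : Fin G → ℝ} {c : Fin G} (hc : c ∈ argmaxSet S)
    (hcl : c ∉ argmaxSet ℓ) (t : ℝ) :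
    (∃ g g', ℓ g < ℓ g' ∧ ℓ g' < ℓ g + 2 * t) ∨ ∃ g, t ≤ |S g - ℓ g| := by
  by_contra hcon
  push Not at hcon
  obtain ⟨h1, h2⟩ := hcon
  obtain ⟨g', hg'⟩ : ∃ g', ℓ c < ℓ g' := by
    by_contra hall
    push Not at hall
    exact hcl hall
  have h3 := h1 c g' hg'
  have h4 := abs_lt.1 (h2 c)
  have h5 := abs_lt.1 (h2 g')
  have h6 : S g' ≤ S c := hc g'
  linarith [h4.1, h4.2, h5.1, h5.2]

/-- The set of points where two distinct scores nearly tie has small measure. -/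
lemma exists_measure_gap_le {α : Type*} [MeasurableSpace α] {ν : Measure α} [IsFiniteMeasure ν]
    {G : ℕ} {ℓ : Fin G → α → ℝ} (hℓ : ∀ g, Measurable (ℓ g)) {ε : ENNReal} (hε : ε ≠ 0) :
    ∃ t > 0, ν {x | ∃ g g', ℓ g x < ℓ g' x ∧ ℓ g' x < ℓ g x + 2 * t} ≤ ε := by
  set E : ℕ → Set α := fun n => {x | ∃ g g', ℓ g x < ℓ g' x ∧ ℓ g' x < ℓ g x + 2 * (1 / ((n : ℝ) + 1))}
    with hE
  have hEm : ∀ n, MeasurableSet (E n) := fun n => by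
    have : E n = ⋃ g, ⋃ g', {x | ℓ g x < ℓ g' x ∧ ℓ g' x < ℓ g x + 2 * (1 / ((n : ℝ) + 1))} := by
      ext x; simp [hE]
    rw [this]
    refine MeasurableSet.iUnion fun g => MeasurableSet.iUnion fun g' => ?_
    exact (measurableSet_lt (hℓ g) (hℓ g')).inter
      (measurableSet_lt (hℓ g') ((hℓ g).add_const _))
  have hanti : Antitone E := fun m n hmn x ⟨g, g', h1, h2⟩ => ⟨g, g', h1, h2.trans_le (by
    gcongr)⟩
  have hempty : ⋂ n, E n = ∅ := by
    rw [Set.eq_empty_iff_forall_notMem]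
    intro x hx
    -- At a fixed point there are finitely many strict gaps, so all of them eventually exceed the
    -- threshold.
    have h1 : ∀ᶠ n : ℕ in atTop, ∀ g g', ℓ g x < ℓ g' x → ℓ g x + 2 * (1 / ((n : ℝ) + 1)) ≤ ℓ g' x := by
      rw [eventually_all]; intro g
      rw [eventually_all]; intro g'
      by_cases h : ℓ g x < ℓ g' x
      · have h2 := (tendsto_one_div_add_atTop_nhds_zero_nat (𝕜 := ℝ)).eventually
          (ge_mem_nhds (show 0 < (ℓ g' x - ℓ g x) / 2 by linarith))
        filter_upwards [h2] with n hn _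
        linarith
      · exact Eventually.of_forall fun n h' => absurd h' h
    obtain ⟨n, hn⟩ := h1.exists
    obtain ⟨g, g', h2, h3⟩ := Set.mem_iInter.1 hx n
    exact absurd h3 (not_lt.2 (hn g g' h2))
  have hlim := tendsto_measure_iInter_atTop (μ := ν) (fun n => (hEm n).nullMeasurableSet) hanti
    ⟨0, measure_ne_top _ _⟩
  rw [hempty, measure_empty] at hlim
  obtain ⟨n, hn⟩ := (hlim.eventually (Iio_mem_nhds (pos_iff_ne_zero.2 hε))).exists
  exact ⟨1 / ((n : ℝ) + 1), by positivity, le_of_lt hn⟩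

/-! ### The scores as local averages -/

section Score

variable [MeasurableSpace H] [BorelSpace H] [SecondCountableTopology H] {G d : ℕ} {g : Fin G}
  {e : (n : ℕ) → (Fin n → H × Fin G) → Fin d → H} {a : Fin d → H} {T : ℝ × H × (H →L[ℝ] H)}
  {η C : ℝ} {μ : Measure (H × Fin G)} [IsProbabilityMeasure μ] {p : ENNReal} {ν ν' : Measure H}
  [IsFiniteMeasure ν] [IsFiniteMeasure ν'] {K : ℝ → ℝ} {B₀ : Set H}

/-- The estimated prior divided by the group size is `1 / n`, so the score is an average over the
whole sample. The kernel is radial, so the norm of the projection may be read in coordinates. -/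
lemma groupScore_eq (hK : ∀ u, 0 ≤ K u) {h : ℝ} (hh : 0 ≤ h) {r : ℝ} {n : ℕ}
    {s : Fin n → H × Fin G} (he : Orthonormal ℝ (e n s)) (hs : s ∈ goodSet g T r) (x : H) :
    groupScore K h (e n s) s g x =
      (sampleAvg g e T r (ennKernel K) √h Set.univ s x).toReal := by
  have hterm : ∀ i, (term g e T r (ennKernel K) √h Set.univ s i x).toReal =
      (if (s i).2 = g then 1 else 0) * scaledKernel K d h ‖proj (e n s) ((s i).1 - x)‖ := fun i => by
    by_cases hi : (s i).2 = g
    · simp only [term, Set.indicator_of_mem hs, Pi.one_apply, one_mul, obs, hi, Set.mem_univ,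
        and_self, Set.mem_ofPred_eq, Set.indicator_of_mem, if_true, kern, ennKernel,
        ENNReal.toReal_mul]
      rw [ENNReal.toReal_ofReal (by positivity), ENNReal.toReal_ofReal (hK _), scaledKernel,
        sqrt_pow_eq hh, norm_proj he, abs_of_nonneg (by positivity)]
    · simp [term, obs, hi]
  have hsum : ∀ i, term g e T r (ennKernel K) √h Set.univ s i x ≠ ⊤ := fun i => by
    refine ENNReal.mul_ne_top ?_ (ENNReal.mul_ne_top
      (ne_top_of_le_ne_top ENNReal.one_ne_top (obs_le_one _ _ _))
      (ENNReal.mul_ne_top ENNReal.ofReal_ne_top ENNReal.ofReal_ne_top))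
    exact ne_top_of_le_ne_top ENNReal.one_ne_top (Set.indicator_le_self' (by simp) s)
  rw [sampleAvg, ENNReal.toReal_mul, ENNReal.toReal_sum fun i _ => hsum i, groupScore]
  simp_rw [hterm]
  rw [ENNReal.toReal_inv, ENNReal.toReal_natCast]
  -- For an empty group the quotient is `0` by convention, and so is every term on the other side.
  by_cases hc : groupCount s g = 0
  · have h0 : ∀ i, (if (s i).2 = g then (1 : ℝ) else 0) = 0 := fun i =>
      (Finset.sum_eq_zero_iff_of_nonneg fun i _ => by split_ifs <;> norm_num).1 hc i
        (Finset.mem_univ i)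
    simp [h0]
  · congr 1
    field_simp

/-- The scores of a group converge in measure on a compact set of tame points. -/
theorem StableProjections.eventually_measure_score_le [CompleteSpace H]
    (h : StableProjections g e a T η C)
    (hμ : IsGroupPart μ g p ν) (hp : p ≠ ⊤) {ξ ξ' : HilbertBasis ℕ ℝ H}
    (hνt : ∀ᵐ x ∂ν, x ∈ tamePts ν ξ) (hB₀ : IsCompact B₀)
    (hB₀t : B₀ ⊆ tamePts ν' ξ') (hK : IsKernel K) (hd : 0 < d) {b : ℕ → ℝ} (hb : ∀ n, 0 < b n)
    (hb0 : Tendsto b atTop (𝓝 0))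
    (hbd : Tendsto (fun n : ℕ => n * √(b n ^ d)) atTop atTop)
    (hgood : ∀ r > 0, Tendsto (fun n => (Measure.pi fun _ : Fin n => μ) (goodSet g T r)) atTop (𝓝 1))
    {F : EuclideanSpace ℝ (Fin d) → ℝ} (hF : Continuous F)
    (hν : ν.map (coordMap a) = volume.withDensity fun y => ENNReal.ofReal (F y)) {t : ℝ} (ht : 0 < t)
    {ε₀ : ENNReal} (hε₀ : ε₀ ≠ 0) :
    ∀ᶠ n : ℕ in atTop, ∃ φ : (Fin n → H × Fin G) → ENNReal, Measurable φ ∧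
      (∀ s, ν' (B₀ ∩ {x | t ≤ |groupScore K (b n) (e n s) s g x -
        (p * (kernelMass d (ennKernel K) * ENNReal.ofReal (F (coordMap a x)))).toReal|}) ≤ φ s) ∧
      ∫⁻ s, φ s ∂(Measure.pi fun _ => μ) ≤ ε₀ := by
  have hδ : ∀ n, 0 < √(b n) := fun n => Real.sqrt_pos.2 (hb n)
  have hδ0 : Tendsto (fun n => √(b n)) atTop (𝓝 0) := by
    have := (Real.continuous_sqrt.tendsto 0).comp hb0
    rwa [Real.sqrt_zero] at this
  have hδd : Tendsto (fun n : ℕ => n * √(b n) ^ d) atTop atTop :=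
    hbd.congr fun n => by rw [sqrt_pow_eq (hb n).le]
  -- Once `√(b n) ≤ 1`, its power of order `d ≥ 1` is at most itself. This makes the `O(1 / n)`
  -- motion of the projections negligible at the scale of the kernel.
  have hδ1 : Tendsto (fun n : ℕ => n * √(b n)) atTop atTop := by
    refine tendsto_atTop_mono' _ ?_ hδd
    filter_upwards [hδ0.eventually (ge_mem_nhds one_pos)] with n hn
    exact mul_le_mul_of_nonneg_left (pow_le_of_le_one (hδ n).le hn hd.ne') n.cast_nonneg
  have ht0 : ENNReal.ofReal t ≠ 0 := by simpa using ht
  have hε2 : ε₀ / 2 ≠ 0 := (ENNReal.half_pos hε₀).ne'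
  obtain ⟨r₀, hr₀, hr⟩ := h.eventually_lintegral_abs_le hμ hp hνt hB₀ hB₀t hK hδ hδ0 hδ1 hδd hgood
    hF hν (ε₀ := ENNReal.ofReal t * (ε₀ / 2)) (mul_ne_zero ht0 hε2)
  set r := min r₀ η with hrdef
  have hr0 : 0 < r := lt_min hr₀ h.pos
  obtain ⟨L, hL0, hL, hKL, hs, hKm⟩ := hK.exists_bounds
  have hbad : ∀ᶠ n : ℕ in atTop,
      (1 - (Measure.pi fun _ : Fin n => μ) (goodSet g T r)) * ν' Set.univ ≤ ε₀ / 2 := by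
    have h1 := ENNReal.Tendsto.sub (tendsto_const_nhds (x := (1 : ENNReal))) (hgood r hr0)
      (Or.inl ENNReal.one_ne_top)
    rw [tsub_self] at h1
    have h2 := ENNReal.Tendsto.mul_const h1 (b := ν' Set.univ) (Or.inr (measure_ne_top _ _))
    rw [zero_mul] at h2
    exact (h2.eventually (Iio_mem_nhds (ENNReal.half_pos hε₀))).mono fun n hn => le_of_lt hn
  filter_upwards [hr r hr0 (min_le_left _ _), hbad] with n hn1 hn2
  set D : (Fin n → H × Fin G) → H → ENNReal := fun s x =>
    ENNReal.ofReal |(sampleAvg g e T r (ennKernel K) √(b n) Set.univ s x).toReal -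
      (p * (kernelMass d (ennKernel K) * ENNReal.ofReal (F (coordMap a x)))).toReal| with hD
  have hDm : Measurable fun q : (Fin n → H × Fin G) × H => D q.1 q.2 := by
    have h1 := (h.measurable_sampleAvg (min_le_right r₀ η) hKm √(b n) MeasurableSet.univ
      (n := n)).ennreal_toReal
    have h2 : Measurable fun q : (Fin n → H × Fin G) × H =>
        (p * (kernelMass d (ennKernel K) * ENNReal.ofReal (F (coordMap a q.2)))).toReal := by
      fun_prop
    have h3 : Measurable fun q : (Fin n → H × Fin G) × H =>
      |(sampleAvg g e T r (ennKernel K) √(b n) Set.univ q.1 q.2).toReal -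
      (p * (kernelMass d (ennKernel K) * ENNReal.ofReal (F (coordMap a q.2)))).toReal| :=
      continuous_abs.measurable.comp (h1.sub h2)
    exact h3.ennreal_ofReal
  have hDs : Measurable fun s => ∫⁻ x in B₀, D s x ∂ν' :=
    Measurable.lintegral_prod_right (f := fun s x => D s x) hDm
  have hgm : MeasurableSet (goodSet (n := n) g T r)ᶜ := (measurableSet_goodSet g T r).compl
  have him : Measurable ((goodSet (n := n) g T r)ᶜ.indicator fun _ => ν' Set.univ) :=
    measurable_const.indicator hgm
  -- The score need not be measurable in the sample, so its deviation set is dominated: full mass on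
  -- bad samples, Markov's inequality on good ones.
  refine ⟨fun s => (goodSet g T r)ᶜ.indicator (fun _ => ν' Set.univ) s +
    (ENNReal.ofReal t)⁻¹ * ∫⁻ x in B₀, D s x ∂ν', him.add (hDs.const_mul _), fun s => ?_, ?_⟩
  · by_cases hsg : s ∈ goodSet g T r
    · refine le_trans ?_ le_add_self
      rw [← ENNReal.mul_le_iff_le_inv ht0 ENNReal.ofReal_ne_top]
      have hDx : Measurable fun x => D s x := 
        Measurable.of_uncurry_left (f := fun s x => D s x) (x := s) hDm
      have hsub : B₀ ∩ {x | t ≤ |groupScore K (b n) (e n s) s g x -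
          (p * (kernelMass d (ennKernel K) * ENNReal.ofReal (F (coordMap a x)))).toReal|} ⊆
          {x | ENNReal.ofReal t ≤ D s x} ∩ B₀ := fun x hx => by
        refine ⟨?_, hx.1⟩
        have h1 := hx.2
        rw [Set.mem_ofPred_eq, groupScore_eq hK.nonneg (hb n).le (h.orthonormal n s) hsg] at h1
        exact ENNReal.ofReal_le_ofReal h1
      calc ENNReal.ofReal t * _ ≤ ENNReal.ofReal t * ν' ({x | ENNReal.ofReal t ≤ D s x} ∩ B₀) := by
            gcongr
        _ = ENNReal.ofReal t * (ν'.restrict B₀) {x | ENNReal.ofReal t ≤ D s x} := by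
            rw [Measure.restrict_apply (measurableSet_le measurable_const hDx)]
        _ ≤ _ := mul_meas_ge_le_lintegral hDx _
    · beta_reduce
      rw [Set.indicator_of_mem (show s ∈ (goodSet g T r)ᶜ from hsg)]
      exact (measure_mono (Set.subset_univ _)).trans le_self_add
  · rw [lintegral_add_left him, lintegral_indicator hgm, setLIntegral_const,
      prob_compl_eq_one_sub (measurableSet_goodSet g T r), lintegral_const_mul _ hDs,
      lintegral_lintegral_swap (f := fun s x => D s x) hDm.aemeasurable, mul_comm (ν' Set.univ)]
    calc _ ≤ ε₀ / 2 + (ENNReal.ofReal t)⁻¹ * (ENNReal.ofReal t * (ε₀ / 2)) := by gcongr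
      _ = ε₀ := by
        rw [← mul_assoc, ENNReal.inv_mul_cancel ht0 ENNReal.ofReal_ne_top, one_mul,
          ENNReal.add_halves]

end Score

/-! ### The plug-in rule and the surrogate Bayes set -/

section Consistency

variable [MeasurableSpace H]

lemma argmaxSet_const_mul {G : ℕ} {c : ℝ} (hc : 0 < c) (s : Fin G → ℝ) :
    argmaxSet (fun g => c * s g) = argmaxSet s := by
  ext g
  simp only [argmaxSet, Set.mem_ofPred_eq, mul_le_mul_iff_right₀ hc]

lemma measure_map_le_sum_groupLaw {Ω : Type*} [MeasurableSpace Ω] {G : ℕ} {P : Measure Ω}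
    [IsProbabilityMeasure P] {X : Ω → H} {Y : Ω → Fin G} (hX : Measurable X) (hY : Measurable Y)
    (hYpos : ∀ g, 0 < P.real (Y ⁻¹' {g})) {S : Set H} (hS : MeasurableSet S) :
    P.map X S ≤ ∑ g, groupLaw P X Y g S := by
  have h1 : X ⁻¹' S = ⋃ g, (Y ⁻¹' {g} ∩ X ⁻¹' S) := by ext ω; simp
  rw [Measure.map_apply hX hS, h1]
  refine (measure_iUnion_fintype_le _ _).trans (Finset.sum_le_sum fun g _ => ?_)
  rw [← ofReal_mul_groupLaw hX hY (hYpos g) hS]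
  calc ENNReal.ofReal (P.real (Y ⁻¹' {g})) * groupLaw P X Y g S ≤ 1 * groupLaw P X Y g S := by
        gcongr
        exact ENNReal.ofReal_le_one.2 measureReal_le_one
    _ = _ := one_mul _

variable [BorelSpace H] [SecondCountableTopology H] [CompleteSpace H] {Ω : Type*}
  [MeasurableSpace Ω] {G : ℕ} {P : Measure Ω} [IsProbabilityMeasure P] {X : Ω → H} {Y : Ω → Fin G}
  {ξ : Fin G → HilbertBasis ℕ ℝ H} {lam : Fin G → ℕ → ℝ}
  {f : Fin G → (d : ℕ) → (Fin d → ℝ) → ℝ} {d : ℕ} {K : ℝ → ℝ}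

/-- The probability that the plug-in rule leaves the surrogate Bayes set tends to zero. -/
theorem eventually_lintegral_measure_notMem_le (hX : Measurable X) (hY : Measurable Y)
    (hX2 : MemLp X 2 P) (hYpos : ∀ g, 0 < P.real (Y ⁻¹' {g}))
    {Z : ℕ → Ω → H × Fin G} (hZ : iIndepFun Z P)
    (hZlaw : ∀ i, IdentDistrib (Z i) (fun ω => (X ω, Y ω)) P P)
    (hξ : ∀ g, IsKLBasis (groupLaw P X Y g) (ξ g) (lam g))
    (hreg : ∀ g, IsRegularLaw (groupLaw P X Y g) (ξ g) (lam g) (f g)) (hd : 0 < d)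
    (hgap : ∀ g, ∀ j < d, lam g d < lam g j) (hK : IsKernel K) {h : Fin G → ℕ → ℝ}
    (hpos : ∀ g n, 0 < h g n) (hzero : ∀ g, Tendsto (h g) atTop (𝓝 0))
    (hinf : ∀ g, Tendsto (fun n : ℕ => (n : ℝ) * √(h g n ^ d)) atTop atTop)
    {e : (n : ℕ) → (Fin n → H × Fin G) → Fin G → Fin d → H}
    (he : ∀ n s g, IsLeadingEigensystem (groupCov s g) (e n s g))
    {c : (n : ℕ) → (Fin n → H × Fin G) → H → Fin G}
    (hc : ∀ n s x, c n s x ∈ argmaxSet (fun g => groupScore K (h g n) (e n s g) s g x))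
    (g' : Fin G) {ε : ENNReal} (hε : ε ≠ 0) :
    ∀ᶠ n : ℕ in atTop, ∫⁻ s : Fin n → H × Fin G, groupLaw P X Y g'
      {x | c n s x ∉ surrogateBayes (fun g => P.real (Y ⁻¹' {g})) (groupLaw P X Y) ξ f d x}
        ∂(Measure.pi fun _ => P.map fun ω => (X ω, Y ω)) ≤ ε := by
  have hprob := fun g => isProbabilityMeasure_groupLaw hX (hYpos g)
  have hμp : IsProbabilityMeasure (P.map fun ω => (X ω, Y ω)) :=
    Measure.isProbabilityMeasure_map (hX.prodMk hY).aemeasurable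
  set μ := P.map fun ω => (X ω, Y ω) with hμ
  set ν := groupLaw P X Y with hν
  set π : Fin G → ℝ := fun g => P.real (Y ⁻¹' {g}) with hπ
  have htame : ∀ g, ∀ᵐ x ∂(ν g), x ∈ tamePts (ν g) (ξ g) := fun g =>
    (hreg g).ae_mem_tamePts (hξ g) (memLp_groupLaw hX hX2 g)
  set κ := kernelMass d (ennKernel K) with hκ
  obtain ⟨L, hL0, hL, hKL, hs, hKm⟩ := hK.exists_bounds
  have hκ0 : 0 < κ.toReal :=
    ENNReal.toReal_pos (hK.kernelMass_ne_zero hd) (kernelMass_ne_top ENNReal.ofReal_ne_top hKL hs)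
  set F := fun g => coordDensity (ν g) (ξ g) (f g) d with hF
  have hFc : ∀ g, Continuous (F g) := fun g => (hreg g).continuous_coordDensity d
  set ℓ : Fin G → H → ℝ := fun g x =>
    (ENNReal.ofReal (π g) * (κ * ENNReal.ofReal (F g (coordMap (initSeg (ξ g) d) x)))).toReal with hℓ
  have hℓm : ∀ g, Measurable (ℓ g) := fun g => by
    have := (hFc g).measurable
    fun_prop
  -- The limits carry the common factor `κ > 0`, which does not affect the maximizers.
  have hsur : ∀ x, surrogateBayes π ν ξ f d x = argmaxSet fun g => ℓ g x := fun x => by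
    rw [surrogateBayes, ← argmaxSet_const_mul hκ0]
    congr 1
    funext g
    simp only [hℓ, hF, coordDensity_coordMap]
    rw [ENNReal.toReal_mul, ENNReal.toReal_mul, ENNReal.toReal_ofReal (hYpos g).le,
      ENNReal.toReal_ofReal ((hreg g).pos _ _).le]
    ring
  -- One third each for the mass outside a compact set of tame points, for the near ties, and for
  -- the deviations of all the scores.
  have hε3 : ε / 3 ≠ 0 := (ENNReal.div_pos hε (by norm_num)).ne'
  obtain ⟨B₀, hB₀t, hB₀, hB₀ν⟩ : ∃ B₀ ⊆ tamePts (ν g') (ξ g'), IsCompact B₀ ∧ ν g' B₀ᶜ ≤ ε / 3 := by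
    obtain ⟨B₀, h1, h2, h3⟩ := (isOpen_tamePts (ν g') (ξ g')).measurableSet.exists_isCompact_sdiff_lt
      (measure_ne_top (ν g') _) hε3
    refine ⟨B₀, h1, h2, le_trans ?_ h3.le⟩
    refine measure_mono_ae ?_
    filter_upwards [htame g'] with x hx hxB using ⟨hx, hxB⟩
  obtain ⟨t, ht, htν⟩ := exists_measure_gap_le (ν := ν g') hℓm hε3
  obtain ⟨ε₁, hε₁, -, hε₁G⟩ := exists_ne_zero_mul_le (c := (G : ENNReal)) (ENNReal.natCast_ne_top G)
    hε3
  have hall : ∀ᶠ n : ℕ in atTop, ∀ g, ∃ φ : (Fin n → H × Fin G) → ENNReal, Measurable φ ∧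
      (∀ s, ν g' (B₀ ∩ {x | t ≤ |groupScore K (h g n) (e n s g) s g x - ℓ g x|}) ≤ φ s) ∧
      ∫⁻ s, φ s ∂(Measure.pi fun _ => μ) ≤ ε₁ := by
    rw [eventually_all]
    intro g
    obtain ⟨η, C, hstab⟩ := exists_stableProjections hX hY hX2 (hYpos g) (hξ g) hd (hgap g)
      (e := fun n s => e n s g) fun n s => he n s g
    exact hstab.eventually_measure_score_le (isGroupPart_groupLaw hX hY (hYpos g))
      ENNReal.ofReal_ne_top (htame g) hB₀ hB₀t hK hd (hpos g) (hzero g) (hinf g)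
      (fun r hr => tendsto_measure_goodSet hX hY hX2 hZ hZlaw g hr) (hFc g)
      ((hreg g).map_coordMap d) ht hε₁
  filter_upwards [hall] with n hn
  choose φ hφm hφ hφε using hn
  have hpt : ∀ s : Fin n → H × Fin G, ν g' {x | c n s x ∉ surrogateBayes π ν ξ f d x} ≤
      (ε / 3 + ε / 3) + ∑ g, φ g s := fun s => by
    have hsub : {x | c n s x ∉ surrogateBayes π ν ξ f d x} ⊆
        (B₀ᶜ ∪ {x | ∃ g g', ℓ g x < ℓ g' x ∧ ℓ g' x < ℓ g x + 2 * t}) ∪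
          ⋃ g, (B₀ ∩ {x | t ≤ |groupScore K (h g n) (e n s g) s g x - ℓ g x|}) := fun x hx => by
      by_cases hxB : x ∈ B₀
      · rw [Set.mem_ofPred_eq, hsur] at hx
        rcases gap_or_le_of_mem_argmaxSet (hc n s x) hx t with h1 | ⟨g, h1⟩
        · exact Or.inl (Or.inr h1)
        · exact Or.inr (Set.mem_iUnion.2 ⟨g, hxB, h1⟩)
      · exact Or.inl (Or.inl hxB)
    refine (measure_mono hsub).trans ((measure_union_le _ _).trans (add_le_add
      ((measure_union_le _ _).trans (add_le_add hB₀ν htν)) ?_))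
    exact (measure_iUnion_fintype_le _ _).trans (Finset.sum_le_sum fun g _ => hφ g s)
  calc _ ≤ ∫⁻ s : Fin n → H × Fin G, ((ε / 3 + ε / 3) + ∑ g, φ g s) ∂(Measure.pi fun _ => μ) :=
        lintegral_mono hpt
    _ = (ε / 3 + ε / 3) + ∑ g, ∫⁻ s, φ g s ∂(Measure.pi fun _ => μ) := by
        rw [lintegral_add_left measurable_const, lintegral_const, measure_univ, mul_one,
          lintegral_finsetSum _ fun g _ => hφm g]
    _ ≤ (ε / 3 + ε / 3) + ε / 3 := by
        gcongr
        refine (Finset.sum_le_sum fun g _ => hφε g).trans (le_trans (le_of_eq ?_) hε₁G)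
        rw [Finset.sum_const, Finset.card_univ, Fintype.card_fin, nsmul_eq_mul]
    _ = ε := ENNReal.add_thirds ε

end Consistency

/-! ### Joint measurability and transfer to convergence in probability -/

section JointMeasurability

variable {S E : Type*} [MeasurableSpace S] [MeasurableSpace E] {G : ℕ}

lemma measurableSet_notMem_prod {c : S → E → Fin G}
    (hc : Measurable fun p : S × E => c p.1 p.2) {A : E → Set (Fin G)}
    (hA : ∀ g, MeasurableSet {x | g ∈ A x}) :
    MeasurableSet {p : S × E | c p.1 p.2 ∉ A p.2} := by
  have he : {p : S × E | c p.1 p.2 ∉ A p.2} =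
      ⋃ g, ((fun p : S × E => c p.1 p.2) ⁻¹' {g} ∩ Prod.snd ⁻¹' {x | g ∈ A x}ᶜ) := by
    ext p; simp
  rw [he]
  exact MeasurableSet.iUnion fun g => (hc (measurableSet_singleton g)).inter
    (measurable_snd (hA g).compl)

end JointMeasurability

/-- A sequence of sample statistics whose distance to a constant is at most `W n` of the sample,
where `W n` has vanishing mean, converges in probability. -/
lemma tendstoInMeasure_of_lintegral_sample {E Ω : Type*} [MeasurableSpace E] [MeasurableSpace Ω]
    {P : Measure Ω} [IsProbabilityMeasure P] {μ : Measure E} [IsProbabilityMeasure μ]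
    {Z : ℕ → Ω → E} (hZ : iIndepFun Z P) (hZm : ∀ i, AEMeasurable (Z i) P)
    (hlaw : ∀ i, P.map (Z i) = μ) {T : (n : ℕ) → (Fin n → E) → ℝ} {b : ℝ}
    {W : (n : ℕ) → (Fin n → E) → ENNReal} (hW : ∀ n, Measurable (W n))
    (hT : ∀ n s, ENNReal.ofReal ‖T n s - b‖ ≤ W n s)
    (hlim : ∀ ε : ENNReal, ε ≠ 0 → ∀ᶠ n in atTop, ∫⁻ s, W n s ∂(Measure.pi fun _ => μ) ≤ ε) :
    TendstoInMeasure P (fun (n : ℕ) ω => T n (fun i : Fin n => Z i ω)) atTop (fun _ => b) := by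
  rw [tendstoInMeasure_iff_norm]
  intro ε hε
  rw [ENNReal.tendsto_nhds_zero]
  intro δ hδ
  have hε0 : ENNReal.ofReal ε ≠ 0 := by simpa using hε
  filter_upwards [hlim (ENNReal.ofReal ε * δ) (mul_ne_zero hε0 hδ.ne')] with n hn
  have hsub : {ω | ε ≤ ‖T n (fun i : Fin n => Z i ω) - b‖} ⊆
      (fun ω (i : Fin n) => Z i ω) ⁻¹' {s | ENNReal.ofReal ε ≤ W n s} := fun ω hω =>
    (ENNReal.ofReal_le_ofReal hω).trans (hT n _)
  have hms : MeasurableSet {s | ENNReal.ofReal ε ≤ W n s} :=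
    measurableSet_le measurable_const (hW n)
  refine (measure_mono hsub).trans ?_
  rw [← Measure.map_apply_of_aemeasurable
    (aemeasurable_pi_lambda (fun ω (i : Fin n) => Z i ω) fun i => hZm i) hms,
    map_sample hZ hZm hlaw n]
  exact (ENNReal.mul_le_mul_iff_right hε0 ENNReal.ofReal_ne_top).1
    ((mul_meas_ge_le_lintegral (hW n) _).trans hn)

end KernelClassifier

end

/-! ### The consistency theorem -/

theorem proposition3
    {Ω H : Type*} [MeasurableSpace Ω]
    [NormedAddCommGroup H] [InnerProductSpace ℝ H] [CompleteSpace H]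
    [SecondCountableTopology H] [MeasurableSpace H] [BorelSpace H]
    {G : ℕ} (P : Measure Ω) [IsProbabilityMeasure P]
    -- the pair (X, Y) and an i.i.d. sequence Z i = (X_i, Y_i) with the same law
    (X : Ω → H) (Y : Ω → Fin G) (hX : Measurable X) (hY : Measurable Y)
    (hX2 : MemLp X 2 P) (hYpos : ∀ g, 0 < P.real (Y ⁻¹' {g}))
    (Z : ℕ → Ω → H × Fin G) (hZ : iIndepFun Z P)
    (hZlaw : ∀ i, IdentDistrib (Z i) (fun ω => (X ω, Y ω)) P P)
    -- Karhunen-Loève bases, eigenvalues and surrogate densities of the groups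
    (ξ : Fin G → HilbertBasis ℕ ℝ H) (lam : Fin G → ℕ → ℝ)
    (f : Fin G → (d : ℕ) → (Fin d → ℝ) → ℝ)
    (hξ : ∀ g, KernelClassifier.IsKLBasis (KernelClassifier.groupLaw P X Y g) (ξ g) (lam g))
    (hreg : ∀ g, KernelClassifier.IsRegularLaw (KernelClassifier.groupLaw P X Y g)
      (ξ g) (lam g) (f g))
    -- the surrogate Bayes rule is constant from dimension dstar on
    (dstar : ℕ) (hdstar : 1 ≤ dstar)
    (hstab : ∀ᵐ x ∂(P.map X), ∀ d' ≥ dstar,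
      KernelClassifier.surrogateBayes (fun g => P.real (Y ⁻¹' {g}))
          (KernelClassifier.groupLaw P X Y) ξ f d' x =
        KernelClassifier.surrogateBayes (fun g => P.real (Y ⁻¹' {g}))
          (KernelClassifier.groupLaw P X Y) ξ f dstar x)
    -- the dimension used by the classifier; its principal subspaces are well defined
    (d : ℕ) (hd : dstar ≤ d) (hgap : ∀ g, ∀ j < d, lam g d < lam g j)
    -- kernel and bandwidth matrices h g n • I
    (K : ℝ → ℝ) (hK : KernelClassifier.IsKernel K)
    (h : Fin G → ℕ → ℝ) (hpos : ∀ g n, 0 < h g n)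
    (hzero : ∀ g, Tendsto (h g) atTop (𝓝 0))
    (hinf : ∀ g, Tendsto (fun n : ℕ => (n : ℝ) * √(h g n ^ d)) atTop atTop)
    -- estimated eigenfunctions and the plug-in classifier
    (ξhat : (n : ℕ) → (Fin n → H × Fin G) → Fin G → Fin d → H)
    (hξhat : ∀ n s g, KernelClassifier.IsLeadingEigensystem
      (KernelClassifier.groupCov s g) (ξhat n s g))
    (γhat : (n : ℕ) → (Fin n → H × Fin G) → H → Fin G)
    (hγmeas : ∀ n, Measurable (fun p : (Fin n → H × Fin G) × H => γhat n p.1 p.2))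
    (hγhat : ∀ n s x, γhat n s x ∈ KernelClassifier.argmaxSet
      (fun g => KernelClassifier.groupScore K (h g n) (ξhat n s g) s g x)) :
    TendstoInMeasure P
      (fun (n : ℕ) ω => KernelClassifier.errorProb P X Y (γhat n (fun i : Fin n => Z i ω)))
      atTop (fun _ => KernelClassifier.bayesError P X Y) := by
  classical
  have hμ : IsProbabilityMeasure (P.map fun ω => (X ω, Y ω)) :=
    Measure.isProbabilityMeasure_map (hX.prodMk hY).aemeasurable
  have hμX : IsProbabilityMeasure (P.map X) := Measure.isProbabilityMeasure_map hX.aemeasurable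
  have hprob := fun g => KernelClassifier.isProbabilityMeasure_groupLaw hX (hYpos g)
  set A := KernelClassifier.surrogateBayes (fun g => P.real (Y ⁻¹' {g}))
    (KernelClassifier.groupLaw P X Y) ξ f d with hA
  have hAm : ∀ g, MeasurableSet {x | g ∈ A x} :=
    KernelClassifier.measurableSet_mem_surrogateBayes hreg d
  -- Stability is rebased from `dstar` to the dimension in use, the reference set being the one the
  -- estimated rule approximates.
  have hstab' : ∀ᵐ x ∂(P.map X), ∀ d' ≥ d,
      KernelClassifier.surrogateBayes (fun g => P.real (Y ⁻¹' {g}))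
        (KernelClassifier.groupLaw P X Y) ξ f d' x = A x := by
    filter_upwards [hstab] with x hx d' hd'
    rw [hA, hx d' (hd.trans hd'), hx d hd]
  have hjoint := fun n => KernelClassifier.measurableSet_notMem_prod (hγmeas n) hAm
  have hγn : ∀ n s, Measurable (γhat n s) := fun n s =>
    Measurable.of_uncurry_left (f := fun s x => γhat n s x) (x := s) (hγmeas n)
  have hsec : ∀ n s, MeasurableSet {x | γhat n s x ∉ A x} := fun n s =>
    measurable_prodMk_left (x := s) (hjoint n)
  -- The excess risk is dominated by the probability of leaving the surrogate set, a measurable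
  -- function of the sample because the rule is jointly measurable; only its mean has to vanish.
  refine KernelClassifier.tendstoInMeasure_of_lintegral_sample hZ
    (fun i => (hZlaw i).aemeasurable_fst) (fun i => (hZlaw i).map_eq)
    (T := fun n s => KernelClassifier.errorProb P X Y (γhat n s))
    (W := fun n s => P.map X {x | γhat n s x ∉ A x})
    (fun n => measurable_measure_prodMk_left (hjoint n)) (fun n s => ?_) (fun ε hε => ?_)
  · have h1 := KernelClassifier.errorProb_le_bayesError_add hX hY hX2 hYpos hξ hreg hstab'
      (hγn n s)
    have h2 := KernelClassifier.bayesError_le (P := P) (X := X) (Y := Y) (hγn n s)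
    refine ENNReal.ofReal_le_of_le_toReal ?_
    rw [Real.norm_of_nonneg (sub_nonneg.2 h2)]
    exact sub_le_iff_le_add'.2 h1
  -- The law of `X` is at most the sum of the `G` group laws, so each of them is allowed a share `δ`
  -- with `G * δ ≤ ε`.
  · obtain ⟨δ, hδ, -, hδε⟩ := KernelClassifier.exists_ne_zero_mul_le
      (ENNReal.natCast_ne_top G) hε
    have hev := eventually_all.2 fun g' => KernelClassifier.eventually_lintegral_measure_notMem_le
      hX hY hX2 hYpos hZ hZlaw hξ hreg (hdstar.trans hd) hgap hK hpos hzero hinf hξhat hγhat g' hδ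
    filter_upwards [hev] with n hn
    calc ∫⁻ s, P.map X {x | γhat n s x ∉ A x} ∂(Measure.pi fun _ => P.map fun ω => (X ω, Y ω))
        ≤ ∫⁻ s, ∑ g', KernelClassifier.groupLaw P X Y g' {x | γhat n s x ∉ A x}
            ∂(Measure.pi fun _ => P.map fun ω => (X ω, Y ω)) :=
          lintegral_mono fun s =>
            KernelClassifier.measure_map_le_sum_groupLaw hX hY hYpos (hsec n s)
      _ = ∑ g', ∫⁻ s, KernelClassifier.groupLaw P X Y g' {x | γhat n s x ∉ A x}
            ∂(Measure.pi fun _ => P.map fun ω => (X ω, Y ω)) :=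
          lintegral_finsetSum _ fun g' _ => measurable_measure_prodMk_left (hjoint n)
      _ ≤ ∑ _g' : Fin G, δ := Finset.sum_le_sum fun g' _ => hn g'
      _ = G * δ := by simp
      _ ≤ ε := hδε
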